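/- Fix a real number $\alpha_2>0$ and, for $\alpha_3\in[\tfrac12,1]$, let $Q(x)=x_1^2+\alpha_2x_2^2-\alpha_3x_3^2$. Write $|x|$ for the Euclidean norm of $x\in\mathbb Z^3$. For functions $A,\delta$ of the real variable $N$ with $A(N)\to\infty$, and $\delta(N)>0$ for all large $N$ and $\delta(N)\to0$, as $N\to\infty$, consider the property $$\sup_{|\xi|<A(N)}\ \min_{x\in\mathbb Z^3,\ 0<|x|<N}|Q(x)-\xi|<\delta(N)\quad\text{for all sufficiently large } N,\tag{1.1}$$ where $\xi$ ranges over real numbers. Then for (Lebesgue) almost every $\alpha_3\in[\tfrac12,1]$ the following two statements hold. (i) Assume the Lindelöf hypothesis for the Riemann zeta function, i.e. for every $\varepsilon>0$ one has $|\zeta(\tfrac12+it)|\ll_\varepsilon(1+|t|)^{\varepsilon}$ for all $t\in\mathbb R$. Then for every $\varepsilon>0$ there is a constant $C$ such that $$\min_{x\in\mathbb Z^3,\ 0<|x|<N}|Q(x)|\le C N^{-1+\varepsilon}\quad\text{for all real } N>1.$$ Moreover, (1.1) holds for all $A,\delta$ as above such that, for some $\varepsilon>0$, $A(N)\,\delta(N)^{-2}\ll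 N^{1-\varepsilon}$ as $N\to\infty$. (ii) Unconditionally, for every $\varepsilon>0$ there is a constant $C$ such that $$\min_{x\in\mathbb Z^3,\ 0<|x|<N}|Q(x)|\le C N^{-2/5+\varepsilon}\quad\text{for all real } N>1.$$ Moreover, (1.1) holds for all $A,\delta$ as above such that, for some $\varepsilon>0$, $A(N)^3\,\delta(N)^{-11/2}\ll N^{1-\varepsilon}$ as $N\to\infty$. Here the constants $C$ may depend on $\alpha_2,\alpha_3,\varepsilon$, and the threshold for $N$ in (1.1) may depend on $\alpha_2,\alpha_3,\varepsilon,A,\delta$; the exceptional null set of $\alpha_3$ depends only on $\alpha_2$. -/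

import Mathlib

open Filter Topology Asymptotics MeasureTheory

noncomputable section

/-- The diagonal ternary form `Q(x) = x₁² + α₂ x₂² - α₃ x₃²`, evaluated at integer vectors. -/
def diagForm (α₂ α₃ : ℝ) (x : Fin 3 → ℤ) : ℝ :=
  (x 0 : ℝ) ^ 2 + α₂ * (x 1 : ℝ) ^ 2 - α₃ * (x 2 : ℝ) ^ 2

/-- The integer vectors `x` with `0 < |x| < N`, where `|x|` is the Euclidean norm. -/
def puncturedBall (N : ℝ) : Set (Fin 3 → ℤ) :=
  {x | x ≠ 0 ∧ ‖!₂[(x 0 : ℝ), (x 1 : ℝ), (x 2 : ℝ)]‖ < N}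

/-- The Lindelöf hypothesis for the Riemann zeta function:
`ζ(1/2 + it) ≪ (1 + |t|)^ε` for every `ε > 0`. -/
def LindelofHypothesis : Prop :=
  ∀ ε : ℝ, 0 < ε → ∃ C : ℝ, ∀ t : ℝ,
    ‖riemannZeta (1 / 2 + (t : ℂ) * Complex.I)‖ ≤ C * (1 + |t|) ^ ε

/-- `min_{0 < |x| < N} |Q(x)| ≪ N^e` with an implied constant independent of `N`. For `N > 1` the
set of admissible `x` is finite and non-empty, so the minimum is at most `b` if and only if some
admissible `x` has `|Q(x)| ≤ b`; for `N ≤ 1` there is no admissible `x`. -/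
def MinValueBound (α₂ α₃ e : ℝ) : Prop :=
  ∃ C : ℝ, ∀ N : ℝ, 1 < N → ∃ x ∈ puncturedBall N, |diagForm α₂ α₃ x| ≤ C * N ^ e

/-- `max_{|ξ| < A} min_{0 < |x| < N} |Q(x) - ξ| < δ`, the maximum being read as a supremum:
some `η < δ` is an upper bound of the inner minima over all real `ξ` with `|ξ| < A`. -/
def OppenheimBound (α₂ α₃ N A δ : ℝ) : Prop :=
  ∃ η : ℝ, η < δ ∧ ∀ ξ : ℝ, |ξ| < A →
    ∃ x ∈ puncturedBall N, |diagForm α₂ α₃ x - ξ| ≤ η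

end

/-! Put `u = log α₃`. A point `x` of size `M` solves `Q(x) = ξ` exactly when `u` equals `λ = log(x₁²
+ α₂x₂² - ξ) - 2 log x₃`, and `|u - λ| < 1/T` with `T = M²/δ` forces `|Q(x) - ξ| ≪ δ`. So one asks
for which `u` none of the roughly `M³` numbers `λ` falls within `δ/M²` of `u`, and shows that the
set of such bad `u` is small.

This is a variance argument. The smooth count at the coarse resolution `T₀ = M^(1-η)` is of the
expected size for every `u` (`gsum_ge`). On the bad set the fine count vanishes, so there the two
normalized counts differ by `≫ M³`. By Chebyshev and Plancherel (`volume_badSet_mul_le`), `M⁶` times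
the measure of the bad set is at most the integral of `|B(τ)|²|Z(2τ)|²` against a kernel
concentrated on `T₀ < |τ| < T`. Here `B` (`bsum`) is an exponential sum over the binary form `x₁² +
α₂x₂²` and `Z` (`zsum`) is a smooth piece of `ζ` on a vertical line; they separate because `λ` is a
sum of a function of `(x₁, x₂)` and a function of `x₃`. Frequencies below `T₀` are handled by
Kuzmin–Landau, those well above `T` by the decay of the kernel (`exists_energy_le`).

For the middle range, the mean square of `B` over `[-T, T]` is `≪ T M^(2+ε)`, by counting pairs of
close values of the binary form with the divisor bound (`exists_integral_norm_sq_bsum_le`). Under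
the Lindelöf hypothesis `Z ≪ M^(1/2+ε)` there, and the bad set has measure `≪ M^(-1+ε) δ^(-1)`.

Unconditionally the range is split at `|Z| = V = M T^(-1/12)`. Where `Z` is small the mean square of
`B` suffices. Where `Z` is large two inputs are combined: a large values estimate for `Z` by duality
(`exists_integral_norm_zsum_sq_large_le`), and the pointwise bound `B² ≪ M^(2+ε) T^(2/3)`
(`exists_norm_sq_bsum_midRange_le`). For the latter, the box is cut into blocks on which the phase
`log|z + ω|²` is quadratic up to a harmless error. Weyl differencing turns each block into geometric
sums whose frequencies are the real and imaginary parts of `κ/z²`, and averaging over the blocks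
uses the spacing of the points `1/z²`. The result is measure `≪ M^(-1/3+ε) δ^(-5/6)`.

In both cases the measure is `≪ M^(-e+ε) δ^(-r)`, with `(e, r) = (1, 1)` or `(1/3, 5/6)`.
Borel–Cantelli is applied at `M = 2^k`, `δ = M^(-j/n)`, and all `ξ` in `δℤ` up to a height `A`.
About `A/δ` bad sets are united, so summability needs `A δ^(-1-r) ≪ M^(e-ε)`; for `(1/3, 5/6)` this
is the cube root of the condition with exponents `3` and `11/2`. With `ξ = 0` alone one may take `δ`
down to `M^(-e/r+ε)`, and `e/r` is `1` or `2/5`. -/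

/-! ### The divisor bound -/

/-- By multiplicativity it suffices to compare `a + 1` with `p^(aε)` prime by prime. For `p ≥
2^(1/ε)` one has `p^(aε) ≥ 2^a ≥ a + 1`; each of the fewer than `B` smaller primes costs at most the
factor `C0`. -/
theorem card_divisors_le_rpow {ε : ℝ} (hε : 0 < ε) :
    ∃ C : ℝ, 0 < C ∧ ∀ n : ℕ, n ≠ 0 → (n.divisors.card : ℝ) ≤ C * (n : ℝ) ^ ε := by
  have hl : 0 < Real.log 2 := Real.log_pos one_lt_two
  set C0 : ℝ := 1 + 1 / (ε * Real.log 2) with hC0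
  have hC1 : 1 ≤ C0 := by rw [hC0]; have : 0 < 1 / (ε * Real.log 2) := by positivity
                          linarith
  obtain ⟨B, hB⟩ := exists_nat_ge ((2 : ℝ) ^ (1 / ε))
  refine ⟨C0 ^ B, by positivity, fun n hn => ?_⟩
  have key : ∀ p ∈ n.primeFactors, ((n.factorization p + 1 : ℕ) : ℝ) ≤
      (if p < B then C0 else 1) * (((p : ℝ) ^ (n.factorization p)) ^ ε) := by
    intro p hp
    have hp2 : (2 : ℝ) ≤ p := by exact_mod_cast (Nat.prime_of_mem_primeFactors hp).two_le
    set a := n.factorization p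
    have e1 : ((p : ℝ) ^ a) ^ ε = Real.exp (a * ε * Real.log p) := by
      rw [Real.rpow_def_of_pos (by positivity), Real.log_pow]; ring_nf
    push_cast
    split_ifs with h
    · have h2 : 1 + a * ε * Real.log 2 ≤ ((p : ℝ) ^ a) ^ ε := by
        rw [e1]
        have h3 : a * ε * Real.log 2 ≤ a * ε * Real.log p := by gcongr
        have := Real.add_one_le_exp (a * ε * Real.log p)
        linarith
      calc (a : ℝ) + 1 ≤ C0 * (1 + a * ε * Real.log 2) := by
            have : C0 * (1 + a * ε * Real.log 2) = 1 + a + a * ε * Real.log 2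
              + 1 / (ε * Real.log 2) := by rw [hC0]; field_simp; ring
            rw [this]
            have : 0 ≤ a * ε * Real.log 2 + 1 / (ε * Real.log 2) := by positivity
            linarith
        _ ≤ _ := by gcongr
    · rw [one_mul]
      have h3 : (2 : ℝ) ^ (1 / ε) ≤ p := hB.trans (by exact_mod_cast not_lt.mp h)
      have h4 : (2 : ℝ) ≤ (p : ℝ) ^ ε := by
        calc (2 : ℝ) = ((2 : ℝ) ^ (1 / ε)) ^ ε := by
              rw [← Real.rpow_mul (by norm_num)]; field_simp; simp
          _ ≤ _ := by gcongr
      have h5 : ((p : ℝ) ^ a) ^ ε = ((p : ℝ) ^ ε) ^ a := by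
        rw [← Real.rpow_natCast, ← Real.rpow_natCast, ← Real.rpow_mul (by positivity),
          ← Real.rpow_mul (by positivity), mul_comm]
      rw [h5]
      calc (a : ℝ) + 1 ≤ (2 : ℝ) ^ a := by exact_mod_cast Nat.lt_two_pow_self
        _ ≤ _ := by gcongr
  have h1 : (n : ℝ) ^ ε = ∏ p ∈ n.primeFactors, (((p : ℝ) ^ (n.factorization p)) ^ ε) := by
    rw [Real.finsetProd_rpow _ _ (fun i _ => by positivity)]
    congr 1
    conv_lhs => rw [← Nat.prod_factorization_pow_eq_self hn]
    rw [Finsupp.prod]; push_cast; rfl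
  rw [Nat.card_divisors hn]
  push_cast at key ⊢
  calc _ ≤ ∏ p ∈ n.primeFactors, ((if p < B then C0 else 1) *
        (((p : ℝ) ^ (n.factorization p)) ^ ε)) :=
        Finset.prod_le_prod (fun i _ => by positivity) key
    _ = (∏ p ∈ n.primeFactors, (if p < B then C0 else 1)) * (n : ℝ) ^ ε := by
        rw [Finset.prod_mul_distrib, h1]
    _ ≤ _ := by
        gcongr
        rw [Finset.prod_ite, Finset.prod_const, Finset.prod_const_one, mul_one]
        apply pow_le_pow_right₀ hC1
        calc _ ≤ (Finset.range B).card := Finset.card_le_card (fun p hp => by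
              simp only [Finset.mem_filter] at hp; simpa using hp.2)
          _ = B := Finset.card_range B

/-! ### The additive character and the Kuzmin–Landau inequality -/

/-- The additive character `x ↦ e^{2πix}`. -/
noncomputable def ex (x : ℝ) : ℂ := Complex.exp (2 * Real.pi * x * Complex.I)

theorem ex_add (x y : ℝ) : ex (x + y) = ex x * ex y := by
  rw [ex, ex, ex, ← Complex.exp_add]; push_cast; ring_nf

@[simp] theorem norm_ex (x : ℝ) : ‖ex x‖ = 1 := by
  rw [ex, show (2 * Real.pi * x * Complex.I : ℂ) = ((2 * Real.pi * x : ℝ) : ℂ) * Complex.I by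
    push_cast; ring]
  exact Complex.norm_exp_ofReal_mul_I _

@[simp] theorem ex_zero : ex 0 = 1 := by simp [ex]

theorem ex_neg (x : ℝ) : ex (-x) = (starRingEnd ℂ) (ex x) := by
  rw [ex, ex, ← Complex.exp_conj]; simp [Complex.conj_ofNat]

theorem ex_int (n : ℤ) : ex n = 1 := by
  rw [ex, Complex.exp_eq_one_iff]; exact ⟨n, by push_cast; ring⟩

theorem ex_sub_int (x : ℝ) (n : ℤ) : ex (x - n) = ex x := by
  have := ex_add (x - n) n
  rw [sub_add_cancel, ex_int, mul_one] at this; exact this.symm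

theorem ex_eq_cos_add_sin (x : ℝ) :
    ex x = (Real.cos (2 * (Real.pi * x)) : ℝ) + (Real.sin (2 * (Real.pi * x)) : ℝ) * Complex.I := by
  rw [ex, Complex.exp_mul_I]; push_cast; ring_nf

theorem ex_eq_sin_cos (x : ℝ) :
    ex x = ((1 - 2 * Real.sin (Real.pi * x) ^ 2 : ℝ) : ℂ) +
      ((2 * Real.sin (Real.pi * x) * Real.cos (Real.pi * x) : ℝ) : ℂ) * Complex.I := by
  rw [ex_eq_cos_add_sin, Real.cos_two_mul, Real.sin_two_mul, Real.cos_sq']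
  push_cast; ring

theorem continuous_ex : Continuous ex := by unfold ex; fun_prop

theorem sin_pi_mul_ge {Δ x : ℝ} (h0 : 0 < Δ) (h1 : Δ ≤ x) (h2 : x ≤ 1 - Δ) :
    2 * Δ ≤ Real.sin (Real.pi * x) := by
  have hpi := Real.pi_pos
  rcases le_total x (1 / 2) with h | h
  · have := Real.mul_le_sin (x := Real.pi * x) (by nlinarith) (by nlinarith)
    have e : 2 / Real.pi * (Real.pi * x) = 2 * x := by field_simp
    linarith
  · have := Real.mul_le_sin (x := Real.pi * (1 - x)) (by nlinarith) (by nlinarith)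
    have e : 2 / Real.pi * (Real.pi * (1 - x)) = 2 * (1 - x) := by field_simp
    have e2 : Real.sin (Real.pi * (1 - x)) = Real.sin (Real.pi * x) := by
      rw [mul_sub, mul_one, Real.sin_pi_sub]
    linarith

/-- `1 / (1 - e(x))`, for `x` not an integer. -/
noncomputable def invOneSubEx (x : ℝ) : ℂ :=
  1 / 2 + (Real.cos (Real.pi * x) / Real.sin (Real.pi * x) / 2 : ℝ) * Complex.I

theorem invOneSubEx_mul {x : ℝ} (h : Real.sin (Real.pi * x) ≠ 0) :
    invOneSubEx x * (1 - ex x) = 1 := by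
  rw [ex_eq_sin_cos, invOneSubEx]
  have hs := Real.sin_sq_add_cos_sq (Real.pi * x)
  set s := Real.sin (Real.pi * x)
  set c := Real.cos (Real.pi * x)
  have hc : c ^ 2 = 1 - s ^ 2 := by linarith
  apply Complex.ext
  · simp [-Complex.ofReal_sub, -Complex.ofReal_pow, -Complex.ofReal_mul, -Complex.ofReal_div]
    field_simp; nlinarith
  · simp [-Complex.ofReal_sub, -Complex.ofReal_pow, -Complex.ofReal_mul, -Complex.ofReal_div]
    field_simp; nlinarith

theorem norm_invOneSubEx_le {Δ x : ℝ} (h0 : 0 < Δ) (h1 : Δ ≤ x) (h2 : x ≤ 1 - Δ) :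
    ‖invOneSubEx x‖ ≤ 1 / (4 * Δ) := by
  have hs := sin_pi_mul_ge h0 h1 h2
  have hs0 : 0 < Real.sin (Real.pi * x) := by linarith
  have h := invOneSubEx_mul hs0.ne'
  have hn : ‖1 - ex x‖ = 2 * Real.sin (Real.pi * x) := by
    rw [ex_eq_sin_cos]
    have hsc := Real.sin_sq_add_cos_sq (Real.pi * x)
    set s := Real.sin (Real.pi * x)
    set c := Real.cos (Real.pi * x)
    have hc : c ^ 2 = 1 - s ^ 2 := by linarith
    rw [← sq_eq_sq₀ (norm_nonneg _) (by positivity), Complex.sq_norm, Complex.normSq_apply]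
    simp [-Complex.ofReal_sub, -Complex.ofReal_pow, -Complex.ofReal_mul]
    nlinarith
  have h' := congrArg norm h
  rw [norm_mul, hn, norm_one] at h'
  rw [le_div_iff₀ (by positivity)]
  nlinarith [norm_nonneg (invOneSubEx x)]

/-- After clearing denominators the claim is `sin (y - x) ≥ 0`. -/
theorem cot_antitone {x y : ℝ} (hx : 0 < Real.sin x) (hy : 0 < Real.sin y) (hxy : x ≤ y)
    (hd : y - x ≤ Real.pi) :
    Real.cos y / Real.sin y ≤ Real.cos x / Real.sin x := by
  rw [div_le_div_iff₀ hy hx]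
  have := Real.sin_nonneg_of_nonneg_of_le_pi (sub_nonneg.mpr hxy) hd
  rw [Real.sin_sub] at this
  linarith

/-- The Kuzmin–Landau inequality. -/
theorem kuzmin_landau (f : ℕ → ℝ) (N : ℕ) (ν : ℤ) {Δ : ℝ} (hΔ : 0 < Δ)
    (hd : ∀ n < N, ν + Δ ≤ f (n + 1) - f n ∧ f (n + 1) - f n ≤ ν + 1 - Δ)
    (hanti : ∀ n, n + 1 < N → f (n + 2) - f (n + 1) ≤ f (n + 1) - f n) :
    ‖∑ n ∈ Finset.range N, ex (f n)‖ ≤ 1 / Δ := by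
  -- Subtracting `ν n` from the phase changes no term of the sum and lowers every difference by `ν`.
  wlog hν : ν = 0 generalizing f ν with H
  · have := H (fun n => f n - ν * n) 0 (fun n hn => by
      have := hd n hn; push_cast; constructor <;> linarith [this.1, this.2]) (fun n hn => by
      have := hanti n hn; push_cast; linarith) rfl
    refine le_of_eq_of_le ?_ this
    congr 1
    refine Finset.sum_congr rfl fun n _ => ?_
    have := ex_sub_int (f n) (ν * n)
    push_cast at this
    exact this.symm
  subst hν
  simp only [Int.cast_zero, zero_add] at hd
  set d : ℕ → ℝ := fun n => f (n + 1) - f n with hdd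
  have hs : ∀ n < N, 0 < Real.sin (Real.pi * d n) := fun n hn => by
    have := sin_pi_mul_ge hΔ (hd n hn).1 (hd n hn).2; linarith
  have hpi := Real.pi_pos
  have hΔ2 : ∀ n < N, Δ ≤ 1 / 2 := fun n hn => by linarith [(hd n hn).1, (hd n hn).2]
  set ct : ℕ → ℝ := fun n => Real.cos (Real.pi * d n) / Real.sin (Real.pi * d n) with hct
  have hmono : ∀ n, n + 1 < N → ct n ≤ ct (n + 1) := fun n hn => by
    refine cot_antitone (hs (n + 1) hn) (hs n (by lia)) ?_ ?_
    · exact mul_le_mul_of_nonneg_left (hanti n hn) hpi.le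
    · have a1 := (hd n (by lia)).2
      have a2 := (hd (n + 1) hn).1
      have : d n - d (n + 1) ≤ 1 := by simp only [hdd]; linarith
      calc _ = Real.pi * (d n - d (n + 1)) := by ring
        _ ≤ Real.pi * 1 := by gcongr
        _ = _ := by ring
  -- Each term is `invOneSubEx (d n)` times `ex (f n) - ex (f (n + 1))`. Summation by parts leaves
  -- the increments of `invOneSubEx (d n)`; its real part is constant and its imaginary part is
  -- monotone in `n`, so the norms of the increments telescope.
  have main : ∀ k, k < N → ‖∑ n ∈ Finset.range (k + 1), ex (f n)
      + invOneSubEx (d k) * ex (f (k + 1))‖ ≤ ‖invOneSubEx (d 0)‖ + (ct k - ct 0) / 2 := by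
    intro k
    have step : ∀ k < N, ex (f k) + invOneSubEx (d k) * ex (f (k + 1)) =
        invOneSubEx (d k) * ex (f k) := fun k hk => by
      have h1 := invOneSubEx_mul (hs k hk).ne'
      have h2 : ex (f (k + 1)) = ex (d k) * ex (f k) := by rw [← ex_add]; simp [hdd]
      rw [h2]
      linear_combination (-ex (f k)) * h1
    induction k with
    | zero =>
      intro h0
      simp only [zero_add, Finset.sum_range_one]
      rw [show f 1 = f (0 + 1) by rfl, step 0 h0]; simp
    | succ k ih =>
      intro hk
      rw [Finset.sum_range_succ, add_assoc, step (k + 1) hk]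
      have e : invOneSubEx (d (k + 1)) - invOneSubEx (d k) =
          (((ct (k + 1) - ct k) / 2 : ℝ) : ℂ) * Complex.I := by
        simp only [invOneSubEx, hct]; push_cast; ring
      have e2 : ‖invOneSubEx (d (k + 1)) - invOneSubEx (d k)‖ = (ct (k + 1) - ct k) / 2 := by
        rw [e, norm_mul, Complex.norm_I, mul_one, Complex.norm_real, Real.norm_eq_abs,
          abs_of_nonneg]
        linarith [hmono k hk]
      calc _ = ‖(∑ n ∈ Finset.range (k + 1), ex (f n) + invOneSubEx (d k) * ex (f (k + 1)))
            + (invOneSubEx (d (k + 1)) - invOneSubEx (d k)) * ex (f (k + 1))‖ := by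
            congr 1; ring
        _ ≤ _ := norm_add_le _ _
        _ ≤ (‖invOneSubEx (d 0)‖ + (ct k - ct 0) / 2) + (ct (k + 1) - ct k) / 2 := by
            gcongr
            · exact ih (by lia)
            · rw [norm_mul, norm_ex, mul_one, e2]
        _ = _ := by ring
  rcases Nat.eq_zero_or_pos N with h0 | h0
  · subst h0; simp; positivity
  have hm := main (N - 1) (by lia)
  rw [Nat.sub_add_cancel h0] at hm
  have hctb : ∀ n < N, |ct n| ≤ 1 / (2 * Δ) := fun n hn => by
    simp only [hct]
    rw [abs_div, abs_of_pos (hs n hn)]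
    exact div_le_div₀ (by norm_num) (Real.abs_cos_le_one _) (by positivity)
      (sin_pi_mul_ge hΔ (hd n hn).1 (hd n hn).2)
  have b1 := norm_invOneSubEx_le hΔ (hd 0 h0).1 (hd 0 h0).2
  have b2 := norm_invOneSubEx_le hΔ (hd (N - 1) (by lia)).1 (hd (N - 1) (by lia)).2
  have b3 := abs_le.mp (hctb 0 h0)
  have b4 := abs_le.mp (hctb (N - 1) (by lia))
  have tri : ‖∑ n ∈ Finset.range N, ex (f n)‖ ≤ ‖∑ n ∈ Finset.range N, ex (f n)
      + invOneSubEx (d (N - 1)) * ex (f N)‖ + ‖invOneSubEx (d (N - 1)) * ex (f N)‖ := by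
    have := norm_sub_le (∑ n ∈ Finset.range N, ex (f n)
      + invOneSubEx (d (N - 1)) * ex (f N)) (invOneSubEx (d (N - 1)) * ex (f N))
    rwa [add_sub_cancel_right] at this
  rw [norm_mul, norm_ex, mul_one] at tri
  -- Two boundary terms of size `1/(4Δ)`, and half the total variation of the cotangent, which stays
  -- in `[-1/(2Δ), 1/(2Δ)]`.
  have e : 1 / Δ = 1 / (4 * Δ) + 1 / (4 * Δ) + (1 / (2 * Δ) + 1 / (2 * Δ)) / 2 := by
    field_simp; norm_num
  rw [e]
  simp only [hdd] at *
  linarith [b3.1, b3.2, b4.1, b4.2]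

/-! ### Partial summation and the second derivative test -/

/-- Abel's inequality. -/
theorem norm_sum_mul_le_of_partial_sums (a v : ℕ → ℂ) (N : ℕ) {B : ℝ}
    (hB : ∀ n ≤ N, ‖∑ i ∈ Finset.range n, v i‖ ≤ B) :
    ‖∑ i ∈ Finset.range N, a i * v i‖ ≤
      (‖a (N - 1)‖ + ∑ i ∈ Finset.range (N - 1), ‖a (i + 1) - a i‖) * B := by
  have h := Finset.sum_range_by_parts a v N
  simp only [smul_eq_mul] at h
  rw [h, add_mul, Finset.sum_mul]
  refine (norm_sub_le _ _).trans (add_le_add ?_ ((norm_sum_le _ _).trans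
    (Finset.sum_le_sum fun i hi => ?_)))
  · rw [norm_mul]; exact mul_le_mul_of_nonneg_left (hB N le_rfl) (norm_nonneg _)
  · rw [norm_mul]
    refine mul_le_mul_of_nonneg_left (hB (i + 1) ?_) (norm_nonneg _)
    have := Finset.mem_range.mp hi; lia

theorem eq_Ico_of_ordConnected (s : Finset ℕ)
    (hs : ∀ a ∈ s, ∀ b ∈ s, ∀ c, a ≤ c → c ≤ b → c ∈ s) : ∃ a b, s = Finset.Ico a b := by
  rcases s.eq_empty_or_nonempty with h | h
  · exact ⟨0, 0, by simp [h]⟩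
  · refine ⟨s.min' h, s.max' h + 1, ?_⟩
    ext c
    rw [Finset.mem_Ico]
    refine ⟨fun hc => ⟨s.min'_le c hc, by have := s.le_max' c hc; lia⟩, fun hc => ?_⟩
    exact hs _ (s.min'_mem h) _ (s.max'_mem h) c hc.1 (by lia)

/-- Between the smallest and the largest index of `s` the sequence falls by at least `l` per step,
and by at most `Δ` in total. -/
theorem card_le_of_separated (d : ℕ → ℝ) (N : ℕ) {l : ℝ} (hl : 0 < l)
    (hd : ∀ n, n + 1 < N → l ≤ d n - d (n + 1)) (s : Finset ℕ) (hs : ∀ n ∈ s, n < N) {u Δ : ℝ}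
    (hΔ : 0 ≤ Δ) (hu : ∀ n ∈ s, u ≤ d n ∧ d n ≤ u + Δ) : (s.card : ℝ) ≤ Δ / l + 1 := by
  have hsep : ∀ k n, n + k < N → l * k ≤ d n - d (n + k) := by
    intro k
    induction k with
    | zero => intro n _; simp
    | succ k ih =>
      intro n hn
      have h1 := ih n (by lia)
      have h2 := hd (n + k) (by lia)
      push_cast
      rw [show n + (k + 1) = n + k + 1 by ring]
      linarith
  rcases s.eq_empty_or_nonempty with h | h
  · subst h; simp; positivity
  · set a := s.min' h
    set b := s.max' h
    have hab : a ≤ b := s.min'_le _ (s.max'_mem h)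
    have hsub : s ⊆ Finset.Icc a b := fun x hx =>
      Finset.mem_Icc.mpr ⟨s.min'_le x hx, s.le_max' x hx⟩
    have hcard := Finset.card_le_card hsub
    rw [Nat.card_Icc] at hcard
    have hb : b < N := hs b (s.max'_mem h)
    have h1 := hsep (b - a) a (by lia)
    rw [Nat.add_sub_cancel' hab] at h1
    have h2 := (hu a (s.min'_mem h)).2
    have h3 := (hu b (s.max'_mem h)).1
    have h4 : ((b - a : ℕ) : ℝ) ≤ Δ / l := by
      rw [le_div_iff₀ hl]; nlinarith
    have h5 : s.card ≤ (b - a) + 1 := by lia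
    have h6 : (s.card : ℝ) ≤ ((b - a : ℕ) : ℝ) + 1 := by exact_mod_cast h5
    linarith

/-- Van der Corput's second derivative test, for sequences with decreasing differences. -/
theorem second_derivative_test (f : ℕ → ℝ) (N : ℕ) {l D : ℝ} (hD : 0 ≤ D) (hl : 0 < l) (hl4 : l ≤ 1 / 4)
    (hd : ∀ n < N, 0 ≤ f (n + 1) - f n ∧ f (n + 1) - f n ≤ D)
    (hdd : ∀ n, n + 1 < N → l ≤ (f (n + 1) - f n) - (f (n + 2) - f (n + 1))) :
    ‖∑ n ∈ Finset.range N, ex (f n)‖ ≤ (D + 2) * (5 / √l) := by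
  classical
  set d : ℕ → ℝ := fun n => f (n + 1) - f n with hdef
  -- This choice balances the bound `1/Δ` of Kuzmin–Landau against the roughly `Δ/l` indices whose
  -- difference is within `Δ` of an integer.
  set Δ := √l with hΔ
  have hΔ0 : 0 < Δ := Real.sqrt_pos.mpr hl
  have hΔl : Δ * Δ = l := Real.mul_self_sqrt hl.le
  have hΔ2 : Δ ≤ 1 / 2 := by nlinarith
  have hanti : ∀ k n, n + k < N → d (n + k) ≤ d n := by
    intro k
    induction k with
    | zero => intro n _; simp
    | succ k ih =>
      intro n hn
      have h1 := ih n (by lia)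
      have h2 := hdd (n + k) (by lia)
      rw [show n + (k + 1) = n + k + 1 by ring]
      simp only [hdef] at *
      linarith
  have hanti' : ∀ a b, a ≤ b → b < N → d b ≤ d a := fun a b hab hb => by
    have := hanti (b - a) a (by lia)
    rwa [Nat.add_sub_cancel' hab] at this
  have hmaps : ∀ n ∈ Finset.range N, ⌊d n⌋₊ ∈ Finset.range (⌊D⌋₊ + 1) := fun n hn => by
    rw [Finset.mem_range] at hn ⊢
    exact Nat.lt_succ_of_le (Nat.floor_le_floor (hd n hn).2)
  -- Indices are grouped by the integer part of the difference `d n`. Since `d` decreases, the part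
  -- of a class that stays away from integers is an interval, to which Kuzmin–Landau applies; the
  -- rest of the class is counted trivially.
  rw [← Finset.sum_fiberwise_of_maps_to hmaps]
  have fib : ∀ ν ∈ Finset.range (⌊D⌋₊ + 1),
      ‖∑ n ∈ (Finset.range N).filter (fun n => ⌊d n⌋₊ = ν), ex (f n)‖ ≤ 5 / Δ := by
    intro ν _
    set s := (Finset.range N).filter (fun n => ⌊d n⌋₊ = ν) with hs
    have hsm : ∀ n ∈ s, n < N ∧ (ν : ℝ) ≤ d n ∧ d n < ν + 1 := fun n hn => by
      rw [hs, Finset.mem_filter, Finset.mem_range] at hn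
      refine ⟨hn.1, ?_, ?_⟩
      · rw [← hn.2]; exact Nat.floor_le (hd n hn.1).1
      · rw [← hn.2]; exact Nat.lt_floor_add_one _
    have hmid : ‖∑ n ∈ s.filter (fun n => ν + Δ ≤ d n ∧ d n ≤ ν + 1 - Δ), ex (f n)‖ ≤ 1 / Δ := by
      obtain ⟨a, b, hab⟩ := eq_Ico_of_ordConnected
        (s.filter (fun n => ν + Δ ≤ d n ∧ d n ≤ ν + 1 - Δ)) (fun a ha b hb c hac hcb => by
          rw [Finset.mem_filter] at ha hb
          have hbN := (hsm b hb.1).1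
          have h1 := hanti' a c hac (by lia)
          have h2 := hanti' c b hcb hbN
          have h3 := (hsm a ha.1).2
          have h4 := (hsm b hb.1).2
          rw [Finset.mem_filter, hs, Finset.mem_filter, Finset.mem_range]
          refine ⟨⟨by lia, ?_⟩, by linarith, by linarith⟩
          rw [Nat.floor_eq_iff (by linarith [(Nat.cast_nonneg ν : (0 : ℝ) ≤ ν)])]
          exact ⟨by linarith, by linarith⟩)
      have hin : ∀ n, a + n < b → a + n < N ∧ ν + Δ ≤ d (a + n) ∧ d (a + n) ≤ ν + 1 - Δ :=
        fun n hn => by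
          have : a + n ∈ Finset.Ico a b := Finset.mem_Ico.mpr ⟨by lia, hn⟩
          rw [← hab, Finset.mem_filter] at this
          exact ⟨(hsm _ this.1).1, this.2⟩
      rw [hab, Finset.sum_Ico_eq_sum_range]
      refine kuzmin_landau (fun n => f (a + n)) (b - a) ν hΔ0 (fun n hn => ?_) (fun n hn => ?_)
      · exact_mod_cast (hin n (by lia)).2
      · have := (hdd (a + n) (hin (n + 1) (by lia)).1)
        simp only [← add_assoc]
        linarith
    have hfar : ((s.filter (fun n => ¬ (ν + Δ ≤ d n ∧ d n ≤ ν + 1 - Δ))).card : ℝ)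
        ≤ 2 * (Δ / l + 1) := by
      have hsub : s.filter (fun n => ¬ (ν + Δ ≤ d n ∧ d n ≤ ν + 1 - Δ)) ⊆
          s.filter (fun n => d n ≤ ν + Δ) ∪ s.filter (fun n => ν + 1 - Δ ≤ d n) := by
        intro n hn
        rw [Finset.mem_filter, not_and_or, not_le, not_le] at hn
        rw [Finset.mem_union]
        rcases hn.2 with h | h
        · exact Or.inl (Finset.mem_filter.mpr ⟨hn.1, h.le⟩)
        · exact Or.inr (Finset.mem_filter.mpr ⟨hn.1, h.le⟩)
      have c1 := card_le_of_separated d N hl hdd (s.filter (fun n => d n ≤ ν + Δ))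
        (fun n hn => (hsm n (Finset.mem_filter.mp hn).1).1) (u := ν) hΔ0.le
        (fun n hn => ⟨(hsm n (Finset.mem_filter.mp hn).1).2.1, (Finset.mem_filter.mp hn).2⟩)
      have c2 := card_le_of_separated d N hl hdd (s.filter (fun n => ν + 1 - Δ ≤ d n))
        (fun n hn => (hsm n (Finset.mem_filter.mp hn).1).1) (u := ν + 1 - Δ) hΔ0.le
        (fun n hn => ⟨(Finset.mem_filter.mp hn).2,
          by linarith [(hsm n (Finset.mem_filter.mp hn).1).2.2]⟩)
      have c3 : (((s.filter (fun n => ¬ (ν + Δ ≤ d n ∧ d n ≤ ν + 1 - Δ))).card : ℕ) : ℝ) ≤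
          (s.filter (fun n => d n ≤ ν + Δ)).card + (s.filter (fun n => ν + 1 - Δ ≤ d n)).card := by
        exact_mod_cast (Finset.card_le_card hsub).trans (Finset.card_union_le _ _)
      linarith
    rw [← Finset.sum_filter_add_sum_filter_not s (fun n => ν + Δ ≤ d n ∧ d n ≤ ν + 1 - Δ)]
    refine (norm_add_le _ _).trans ?_
    have hfar' : ‖∑ n ∈ s.filter (fun n => ¬ (ν + Δ ≤ d n ∧ d n ≤ ν + 1 - Δ)), ex (f n)‖ ≤
        2 * (Δ / l + 1) := by
      refine (norm_sum_le _ _).trans ?_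
      simpa using hfar
    have e : Δ / l = 1 / Δ := by rw [← hΔl]; field_simp
    rw [e] at hfar'
    have e2 : 1 ≤ 1 / Δ := by rw [le_div_iff₀ hΔ0]; linarith
    have e3 : 5 / Δ = 5 * (1 / Δ) := by ring
    rw [e3]; linarith
  refine (norm_sum_le _ _).trans ((Finset.sum_le_sum fib).trans ?_)
  rw [Finset.sum_const, Finset.card_range, nsmul_eq_mul]
  gcongr
  push_cast
  linarith [Nat.floor_le hD]

/-! ### Exponential sums with a logarithmic phase -/

theorem log_succ_sub_log_bounds {x : ℝ} (hx : 0 < x) :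
    1 / (x + 1) ≤ Real.log (x + 1) - Real.log x ∧ Real.log (x + 1) - Real.log x ≤ 1 / x := by
  rw [← Real.log_div (by positivity) hx.ne']
  constructor
  · have := Real.one_sub_inv_le_log_of_pos (x := (x + 1) / x) (by positivity)
    refine le_trans (le_of_eq ?_) this
    field_simp; ring
  · have := Real.log_le_sub_one_of_pos (x := (x + 1) / x) (by positivity)
    refine this.trans (le_of_eq ?_)
    field_simp; ring

/-- The second difference is the logarithm of `y = (x+1)²/(x(x+2))`, and `1 - 1/y` is exactly the
left side. -/
theorem log_second_difference_lower {x : ℝ} (hx : 0 < x) :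
    1 / (x + 1) ^ 2 ≤
      (Real.log (x + 1) - Real.log x) - (Real.log (x + 2) - Real.log (x + 1)) := by
  have e : (Real.log (x + 1) - Real.log x) - (Real.log (x + 2) - Real.log (x + 1)) =
      Real.log ((x + 1) * (x + 1) / (x * (x + 2))) := by
    rw [Real.log_div (by positivity) (by positivity), Real.log_mul (by positivity) (by positivity),
      Real.log_mul (by positivity) (by positivity)]; ring
  rw [e]
  have := Real.one_sub_inv_le_log_of_pos (x := (x + 1) * (x + 1) / (x * (x + 2))) (by positivity)
  refine le_trans (le_of_eq ?_) this
  field_simp; ring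

theorem norm_sum_ex_neg {ι : Type*} (s : Finset ι) (f : ι → ℝ) :
    ‖∑ n ∈ s, ex (-(f n))‖ = ‖∑ n ∈ s, ex (f n)‖ := by
  simp_rw [ex_neg]
  rw [← map_sum, RCLike.norm_conj]

theorem norm_sum_ex_abs_mul {ι : Type*} (s : Finset ι) (f : ι → ℝ) (t : ℝ) :
    ‖∑ n ∈ s, ex (|t| * f n)‖ = ‖∑ n ∈ s, ex (t * f n)‖ := by
  rcases abs_cases t with ⟨h, _⟩ | ⟨h, _⟩
  · rw [h]
  · rw [h]; simp_rw [neg_mul]; exact norm_sum_ex_neg s _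

/-- The increments of `|t| log n` lie between `|t|/(10L)` and `1/2`, so Kuzmin–Landau applies once,
next to the integer `0`. -/
theorem norm_sum_log_le_of_small {L a N : ℕ} (hL : 0 < L) (ha : L ≤ a) (hN : a + N ≤ 9 * L + 1)
    {t : ℝ} (ht0 : t ≠ 0) (ht : |t| ≤ L / 2) :
    ‖∑ n ∈ Finset.range N, ex (t * Real.log ((a + n : ℕ) : ℝ))‖ ≤ 10 * L / |t| := by
  rw [← norm_sum_ex_abs_mul]
  have ht' : 0 < |t| := abs_pos.mpr ht0
  set s := |t|
  have hL' : (1 : ℝ) ≤ L := by exact_mod_cast hL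
  have hx : ∀ n < N, (L : ℝ) ≤ ((a + n : ℕ) : ℝ) ∧ ((a + n : ℕ) : ℝ) ≤ 9 * L := fun n hn => by
    constructor
    · exact_mod_cast (by lia : L ≤ a + n)
    · exact_mod_cast (by lia : a + n ≤ 9 * L)
  have hk := kuzmin_landau (fun n => s * Real.log ((a + n : ℕ) : ℝ)) N 0
    (Δ := s / (10 * L)) (by positivity) (fun n hn => ?_) (fun n hn => ?_)
  · refine hk.trans (le_of_eq ?_); field_simp
  · obtain ⟨h1, h2⟩ := hx n hn
    have hb := log_succ_sub_log_bounds (x := ((a + n : ℕ) : ℝ)) (by linarith)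
    have e : ((a + (n + 1) : ℕ) : ℝ) = ((a + n : ℕ) : ℝ) + 1 := by push_cast; ring
    simp only [Int.cast_zero, zero_add, e]
    set x := ((a + n : ℕ) : ℝ)
    have h3 : s / (10 * L) ≤ s * (Real.log (x + 1) - Real.log x) := by
      calc s / (10 * L) ≤ s * (1 / (x + 1)) := by
            rw [mul_one_div]; gcongr; linarith
        _ ≤ _ := by gcongr; exact hb.1
    have h4 : s * (Real.log (x + 1) - Real.log x) ≤ 1 / 2 := by
      calc _ ≤ s * (1 / x) := by gcongr; exact hb.2
        _ ≤ s * (1 / L) := by gcongr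
        _ ≤ (L / 2) * (1 / L) := by gcongr
        _ = 1 / 2 := by field_simp
    have h5 : s / (10 * L) ≤ 1 / 20 := by
      calc _ ≤ ((L : ℝ) / 2) / (10 * L) := by gcongr
        _ = 1 / 20 := by field_simp; norm_num
    constructor <;> linarith
  · obtain ⟨h1, h2⟩ := hx n (by lia)
    have hb := log_second_difference_lower (x := ((a + n : ℕ) : ℝ)) (by linarith)
    have e : ((a + (n + 1) : ℕ) : ℝ) = ((a + n : ℕ) : ℝ) + 1 := by push_cast; ring
    have e2 : ((a + (n + 2) : ℕ) : ℝ) = ((a + n : ℕ) : ℝ) + 2 := by push_cast; ring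
    simp only [e, e2]
    set x := ((a + n : ℕ) : ℝ)
    have : 0 ≤ 1 / (x + 1) ^ 2 := by positivity
    nlinarith

/-- Second derivative test with second differences at least `|t|/(10L)²` and first differences at
most `|t|/L`. The lower bound on `|t|` absorbs the additive `2` of that test into `|t|/L`; the upper
bound keeps the second difference parameter below `1/4`. -/
theorem norm_sum_log_le_of_large {L a N : ℕ} (hL : 0 < L) (ha : L ≤ a) (hN : a + N ≤ 9 * L + 1)
    {t : ℝ} (ht0 : L / 2 ≤ |t|) (ht : |t| ≤ L ^ 2) :
    ‖∑ n ∈ Finset.range N, ex (t * Real.log ((a + n : ℕ) : ℝ))‖ ≤ 250 * √|t| := by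
  rw [← norm_sum_ex_abs_mul]
  set s := |t|
  have hL' : (1 : ℝ) ≤ L := by exact_mod_cast hL
  have hs : 0 < s := by linarith
  have hx : ∀ n < N, (L : ℝ) ≤ ((a + n : ℕ) : ℝ) ∧ ((a + n : ℕ) : ℝ) ≤ 9 * L := fun n hn => by
    constructor
    · exact_mod_cast (by lia : L ≤ a + n)
    · exact_mod_cast (by lia : a + n ≤ 9 * L)
  have hk := second_derivative_test (fun n => s * Real.log ((a + n : ℕ) : ℝ)) N
    (l := s / (10 * L) ^ 2) (D := s / L) (by positivity) (by positivity) ?_ (fun n hn => ?_) (fun n hn => ?_)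
  · refine hk.trans ?_
    have e : √(s / (10 * L) ^ 2) = √s / (10 * L) := by
      rw [Real.sqrt_div hs.le, Real.sqrt_sq (by positivity)]
    rw [e]
    have h2 : 2 ≤ 4 * (s / L) := by
      rw [← mul_div_assoc, le_div_iff₀ (by positivity)]; linarith
    have hss : 0 < √s := Real.sqrt_pos.mpr hs
    calc (s / L + 2) * (5 / (√s / (10 * L))) ≤ (5 * (s / L)) * (5 / (√s / (10 * L))) := by
          gcongr; linarith
      _ = 250 * (s / √s) := by field_simp; ring
      _ = _ := by rw [Real.div_sqrt]
  · rw [div_le_iff₀ (by positivity)]; nlinarith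
  · obtain ⟨h1, h2⟩ := hx n hn
    have hb := log_succ_sub_log_bounds (x := ((a + n : ℕ) : ℝ)) (by linarith)
    have e : ((a + (n + 1) : ℕ) : ℝ) = ((a + n : ℕ) : ℝ) + 1 := by push_cast; ring
    simp only [e]
    set x := ((a + n : ℕ) : ℝ)
    have h0 : 0 ≤ 1 / (x + 1) := by positivity
    constructor
    · nlinarith [hb.1]
    · calc _ = s * (Real.log (x + 1) - Real.log x) := by ring
        _ ≤ s * (1 / x) := by gcongr; exact hb.2
        _ ≤ s * (1 / L) := by gcongr
        _ = _ := by ring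
  · obtain ⟨h1, h2⟩ := hx n (by lia)
    have hb := log_second_difference_lower (x := ((a + n : ℕ) : ℝ)) (by linarith)
    have e : ((a + (n + 1) : ℕ) : ℝ) = ((a + n : ℕ) : ℝ) + 1 := by push_cast; ring
    have e2 : ((a + (n + 2) : ℕ) : ℝ) = ((a + n : ℕ) : ℝ) + 2 := by push_cast; ring
    simp only [e, e2]
    set x := ((a + n : ℕ) : ℝ)
    calc s / (10 * L) ^ 2 ≤ s * (1 / (x + 1) ^ 2) := by
          rw [mul_one_div]; gcongr; linarith
      _ ≤ s * ((Real.log (x + 1) - Real.log x) - (Real.log (x + 2) - Real.log (x + 1))) := by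
          gcongr
      _ = _ := by ring

/-! ### Partial sums of the zeta series on the critical line -/

/-- The increment of `(s - 1) ∑_{m ≤ n} m ^ (-s) + n ^ (1 - s)` from `n` to `n + 1`. -/
noncomputable def zetaIncrement (n : ℕ) (s : ℂ) : ℂ :=
  (s - 1) * ((n : ℂ) + 1) ^ (-s) + ((n : ℂ) + 1) ^ (1 - s) - (n : ℂ) ^ (1 - s)

/-- The increment is the change over `[n, n+1]` of `(s-1) x^(-s) (x-n) + x^(1-s)`. In the derivative
the terms of order `x^(-s)` cancel, leaving `-(s-1) s x^(-s-1) (x-n)`; the saved power of `x` makes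
the increments summable for `Re s > 0`. -/
theorem norm_zetaIncrement_le {n : ℕ} (hn : 0 < n) {s : ℂ} (hs : 0 < s.re) :
    ‖zetaIncrement n s‖ ≤ ‖s - 1‖ * ‖s‖ * (n : ℝ) ^ (-s.re - 1) := by
  set H : ℝ → ℂ := fun x => (s - 1) * ((x : ℂ) ^ (-s) * ((x : ℂ) - n)) + (x : ℂ) ^ (1 - s) with hH
  have hn0 : (0 : ℝ) < n := by exact_mod_cast hn
  have hder : ∀ x ∈ Set.Icc (n : ℝ) (n + 1), HasDerivWithinAt H
      (-((s - 1) * s * ((x : ℂ) ^ (-s - 1) * ((x : ℂ) - n)))) (Set.Icc (n : ℝ) (n + 1)) x := by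
    intro x hx
    have hx0 : 0 < x := lt_of_lt_of_le hn0 hx.1
    have hxs : (x : ℂ) ∈ Complex.slitPlane := Complex.ofReal_mem_slitPlane.mpr hx0
    have h0 : HasDerivAt (fun y : ℝ => (y : ℂ)) 1 x := Complex.ofRealCLM.hasDerivAt
    have h1 : HasDerivAt (fun y : ℝ => (y : ℂ) ^ (-s)) (-s * (x : ℂ) ^ (-s - 1) * 1) x :=
      (HasDerivAt.cpow_const (c := -s) (hasDerivAt_id (x : ℂ)) hxs).comp_ofReal
    have h2 : HasDerivAt (fun y : ℝ => (y : ℂ) ^ (1 - s)) ((1 - s) * (x : ℂ) ^ (1 - s - 1) * 1) x :=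
      (HasDerivAt.cpow_const (c := 1 - s) (hasDerivAt_id (x : ℂ)) hxs).comp_ofReal
    have h3 := ((h1.mul (h0.sub_const (n : ℂ))).const_mul (s - 1)).add h2
    refine HasDerivAt.hasDerivWithinAt (h3.congr_deriv ?_)
    have e1 : (x : ℂ) ^ (1 - s - 1) = (x : ℂ) ^ (-s) := by ring_nf
    rw [e1]
    ring
  have hb : ∀ x ∈ Set.Icc (n : ℝ) (n + 1),
      ‖-((s - 1) * s * ((x : ℂ) ^ (-s - 1) * ((x : ℂ) - n)))‖ ≤
        ‖s - 1‖ * ‖s‖ * (n : ℝ) ^ (-s.re - 1) := by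
    intro x hx
    have hx0 : 0 < x := lt_of_lt_of_le hn0 hx.1
    rw [norm_neg, norm_mul, norm_mul, norm_mul, Complex.norm_cpow_eq_rpow_re_of_pos hx0]
    have e : (-s - 1).re = -s.re - 1 := by simp
    rw [e]
    have h1 : x ^ (-s.re - 1) ≤ (n : ℝ) ^ (-s.re - 1) :=
      Real.rpow_le_rpow_of_nonpos hn0 hx.1 (by linarith)
    have h2 : ‖(x : ℂ) - n‖ ≤ 1 := by
      rw [← Complex.ofReal_natCast, ← Complex.ofReal_sub, Complex.norm_real, Real.norm_eq_abs,
        abs_of_nonneg (by linarith [hx.1])]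
      linarith [hx.2]
    have h3 : x ^ (-s.re - 1) * ‖(x : ℂ) - n‖ ≤ (n : ℝ) ^ (-s.re - 1) * 1 :=
      mul_le_mul h1 h2 (norm_nonneg _) (by positivity)
    rw [mul_one] at h3
    exact mul_le_mul_of_nonneg_left h3 (by positivity)
  have := Convex.norm_image_sub_le_of_norm_hasDerivWithin_le hder hb
    (convex_Icc (n : ℝ) (n + 1)) (x := (n : ℝ)) (y := (n : ℝ) + 1)
    ⟨le_rfl, by linarith⟩ ⟨by linarith, le_rfl⟩
  have e : H (n + 1) - H n = zetaIncrement n s := by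
    simp only [hH, zetaIncrement]; push_cast; ring
  rw [e] at this
  simpa using this

theorem differentiable_zetaIncrement {n : ℕ} (hn : 0 < n) : Differentiable ℂ (zetaIncrement n) := by
  unfold zetaIncrement
  have h1 : ((n : ℂ) + 1) ≠ 0 := by exact_mod_cast n.succ_ne_zero
  have h2 : (n : ℂ) ≠ 0 := by exact_mod_cast hn.ne'
  intro s
  have d1 : DifferentiableAt ℂ (fun s : ℂ => ((n : ℂ) + 1) ^ (-s)) s :=
    (differentiableAt_id.neg).const_cpow (Or.inl h1)
  have d2 : DifferentiableAt ℂ (fun s : ℂ => ((n : ℂ) + 1) ^ (1 - s)) s :=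
    (differentiableAt_id.const_sub 1).const_cpow (Or.inl h1)
  have d3 : DifferentiableAt ℂ (fun s : ℂ => (n : ℂ) ^ (1 - s)) s :=
    (differentiableAt_id.const_sub 1).const_cpow (Or.inl h2)
  exact (((differentiableAt_id.sub_const 1).mul d1).add d2).sub d3

theorem sum_zetaIncrement (N : ℕ) (s : ℂ) :
    s + ∑ n ∈ Finset.range N, zetaIncrement (n + 1) s =
      (s - 1) * ∑ m ∈ Finset.range (N + 1), ((m : ℂ) + 1) ^ (-s) + ((N : ℂ) + 1) ^ (1 - s) := by
  induction N with
  | zero => simp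
  | succ N ih =>
    rw [Finset.sum_range_succ, ← add_assoc, ih, Finset.sum_range_succ _ (N + 1), zetaIncrement]
    push_cast
    ring

theorem tendsto_zetaIncrement {s : ℂ} (hs : 1 < s.re) :
    Tendsto (fun N : ℕ => s + ∑ n ∈ Finset.range N, zetaIncrement (n + 1) s) atTop
      (𝓝 ((s - 1) * riemannZeta s)) := by
  simp_rw [sum_zetaIncrement]
  have h1 : Tendsto (fun N : ℕ => ∑ m ∈ Finset.range (N + 1), ((m : ℂ) + 1) ^ (-s)) atTop
      (𝓝 (riemannZeta s)) := by
    have hs' : Summable (fun n : ℕ => 1 / ((n : ℂ) + 1) ^ s) := by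
      have := (summable_nat_add_iff 1).mpr (Complex.summable_one_div_nat_cpow.mpr hs)
      simpa using this
    rw [zeta_eq_tsum_one_div_nat_add_one_cpow hs]
    have := (hs'.hasSum.tendsto_sum_nat).comp (tendsto_add_atTop_nat 1)
    refine this.congr fun N => ?_
    simp [Complex.cpow_neg]
  have h2 : Tendsto (fun N : ℕ => ((N : ℂ) + 1) ^ (1 - s)) atTop (𝓝 0) := by
    rw [tendsto_zero_iff_norm_tendsto_zero]
    have : ∀ N : ℕ, ‖((N : ℂ) + 1) ^ (1 - s)‖ = ((N : ℝ) + 1) ^ (-(s.re - 1)) := fun N => by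
      rw [show ((N : ℂ) + 1) = (((N : ℝ) + 1 : ℝ) : ℂ) by push_cast; ring,
        Complex.norm_cpow_eq_rpow_re_of_pos (by positivity)]
      simp
    simp_rw [this]
    exact (tendsto_rpow_neg_atTop (by linarith)).comp
      (tendsto_atTop_add_const_right _ _ tendsto_natCast_atTop_atTop)
  simpa using (h1.const_mul (s - 1)).add h2

/-- Both sides are analytic for `Re s > 1/4` and agree for `Re s > 1`, where the partial sums
converge to `ζ`; the identity theorem does the rest. The half plane is cut by a ball because the
increments are bounded uniformly only for bounded `s`, and the radius is chosen so that the ball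
contains both `s` and the point `2`. -/
theorem hasSum_zetaIncrement {s : ℂ} (hs : s.re = 1 / 2) :
    s + ∑' n, zetaIncrement (n + 1) s = (s - 1) * riemannZeta s := by
  set R := ‖s‖ + 3
  set U : Set ℂ := {z | 1 / 4 < z.re} ∩ Metric.ball 0 R with hU
  have hUo : IsOpen U := (isOpen_lt continuous_const Complex.continuous_re).inter Metric.isOpen_ball
  have hUc : Convex ℝ U := (convex_halfSpace_re_gt _).inter (convex_ball _ _)
  have hsum : Summable (fun n : ℕ => (R + 1) * R * ((n + 1 : ℕ) : ℝ) ^ (-(5 / 4) : ℝ)) :=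
    ((summable_nat_add_iff 1).mpr (Real.summable_nat_rpow.mpr (by norm_num))).mul_left _
  have hd : DifferentiableOn ℂ (fun z => ∑' n, zetaIncrement (n + 1) z) U := by
    refine Complex.differentiableOn_tsum_of_summable_norm hsum
      (fun n => (differentiable_zetaIncrement n.succ_pos).differentiableOn) hUo ?_
    intro n z hz
    have hz1 : 1 / 4 < z.re := hz.1
    have hz2 : ‖z‖ < R := by simpa using hz.2
    refine (norm_zetaIncrement_le n.succ_pos (by linarith)).trans ?_
    have h1 : ‖z - 1‖ ≤ R + 1 := (norm_sub_le _ _).trans (by simp; linarith)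
    have h2 : ((n + 1 : ℕ) : ℝ) ^ (-z.re - 1) ≤ ((n + 1 : ℕ) : ℝ) ^ (-(5 / 4) : ℝ) :=
      Real.rpow_le_rpow_of_exponent_le (by simp) (by linarith)
    gcongr
  have hloc : (fun z => z + ∑' n, zetaIncrement (n + 1) z) =ᶠ[𝓝 2] riemannZeta₁ := by
    have : {z : ℂ | 1 < z.re} ∈ 𝓝 (2 : ℂ) :=
      (isOpen_lt continuous_const Complex.continuous_re).mem_nhds (by simp)
    filter_upwards [this] with z hz
    have hz : 1 < z.re := hz
    have hz1 : z ≠ 1 := by rintro rfl; simp at hz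
    have h1 := tendsto_zetaIncrement hz
    have hs : Summable (fun n => zetaIncrement (n + 1) z) := by
      refine Summable.of_norm_bounded (g := fun n : ℕ => ‖z - 1‖ * ‖z‖ *
        ((n + 1 : ℕ) : ℝ) ^ (-z.re - 1)) ?_
        (fun n => norm_zetaIncrement_le n.succ_pos (by linarith))
      exact ((summable_nat_add_iff 1).mpr (Real.summable_nat_rpow.mpr (by linarith))).mul_left _
    have h2 := hs.hasSum.tendsto_sum_nat.const_add z
    rw [tendsto_nhds_unique h2 h1, riemannZeta_eq_inv_sub_mul hz1]
    have := sub_ne_zero.mpr hz1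
    field_simp
  have hd' : DifferentiableOn ℂ (fun z => z + ∑' n, zetaIncrement (n + 1) z) U :=
    differentiableOn_id.add hd
  have heq := (hd'.analyticOnNhd hUo).eqOn_of_preconnected_of_eventuallyEq
    (differentiable_riemannZeta₁.differentiableOn.analyticOnNhd hUo) hUc.isPreconnected
    (z₀ := 2) ⟨by simp; norm_num, by simp only [Metric.mem_ball, dist_zero_right, R]; norm_num; linarith [norm_nonneg s]⟩ hloc
  have hsU : s ∈ U := ⟨by simp [hs]; norm_num, by simp [R]⟩
  have hs1 : s ≠ 1 := by rintro rfl; norm_num at hs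
  have h3 := heq hsU
  simp only at h3
  rw [h3, riemannZeta_eq_inv_sub_mul hs1]
  have := sub_ne_zero.mpr hs1
  field_simp

/-- The approximate functional equation of `ζ` on the critical line, with only the main sum. -/
theorem exists_zeta_approx : ∃ η : ℕ → ℝ, Tendsto η atTop (𝓝 0) ∧ ∀ (s : ℂ), s.re = 1 / 2 →
    ∀ N : ℕ, ‖∑ m ∈ Finset.range (N + 1), ((m : ℂ) + 1) ^ (-s)
      - (riemannZeta s + ((N : ℂ) + 1) ^ (1 - s) / (1 - s))‖ ≤ ‖s‖ * η N := by
  have hsum : Summable (fun n : ℕ => ((n + 1 : ℕ) : ℝ) ^ (-(3 / 2) : ℝ)) :=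
    (summable_nat_add_iff 1).mpr (Real.summable_nat_rpow.mpr (by norm_num))
  -- The error is the tail of the increment series; on the critical line the increments have
  -- exponent `-1/2 - 1`. One factor `s - 1` of the increment bound is cancelled by the division by
  -- `s - 1`.
  refine ⟨fun N => ∑' n : ℕ, ((n + N + 1 : ℕ) : ℝ) ^ (-(3 / 2) : ℝ),
    tendsto_sum_nat_add (fun n : ℕ => ((n + 1 : ℕ) : ℝ) ^ (-(3 / 2) : ℝ)), fun s hs N => ?_⟩
  have hs1 : s ≠ 1 := by rintro rfl; norm_num at hs
  have hs1' := sub_ne_zero.mpr hs1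
  have hb : ∀ n : ℕ, ‖zetaIncrement (n + 1) s‖ ≤
      ‖s - 1‖ * ‖s‖ * ((n + 1 : ℕ) : ℝ) ^ (-(3 / 2) : ℝ) := fun n => by
    refine (norm_zetaIncrement_le n.succ_pos (by rw [hs]; norm_num)).trans (le_of_eq ?_)
    rw [hs]; norm_num
  have hsz : Summable (fun n => zetaIncrement (n + 1) s) :=
    Summable.of_norm_bounded (hsum.mul_left _) hb
  have h1 := hasSum_zetaIncrement hs
  rw [← hsz.sum_add_tsum_nat_add N, ← add_assoc, sum_zetaIncrement] at h1
  have hs1'' : (1 : ℂ) - s ≠ 0 := sub_ne_zero.mpr hs1.symm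
  have h2 : ∑ m ∈ Finset.range (N + 1), ((m : ℂ) + 1) ^ (-s)
      - (riemannZeta s + ((N : ℂ) + 1) ^ (1 - s) / (1 - s)) =
      -(∑' n, zetaIncrement (n + N + 1) s) / (s - 1) := by
    rw [eq_div_iff hs1']
    have e : ((N : ℂ) + 1) ^ (1 - s) / (1 - s) * (s - 1) = -((N : ℂ) + 1) ^ (1 - s) := by
      field_simp; ring
    linear_combination h1 - e
  rw [h2, norm_div, norm_neg, div_le_iff₀ (norm_pos_iff.mpr hs1')]
  have hsn := (summable_nat_add_iff N).mpr hsum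
  have h3 : ‖∑' n, zetaIncrement (n + N + 1) s‖ ≤
      ∑' n : ℕ, ‖s - 1‖ * ‖s‖ * ((n + N + 1 : ℕ) : ℝ) ^ (-(3 / 2) : ℝ) :=
    tsum_of_norm_bounded (hsn.mul_left _).hasSum (fun n => hb (n + N))
  rw [tsum_mul_left] at h3
  linarith

/-! ### The smooth weight and elementary bounds for weighted sums -/

/-- A smooth weight, equal to `1` on `[6/5, 27/10]` and supported in `[1, 29/10]`. -/
noncomputable def wt : ContDiffBump (39 / 20 : ℝ) := ⟨3 / 4, 19 / 20, by norm_num, by norm_num⟩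

theorem wt_one {x : ℝ} (h1 : 6 / 5 ≤ x) (h2 : x ≤ 27 / 10) : wt x = 1 :=
  wt.one_of_mem_closedBall (by
    rw [Metric.mem_closedBall, Real.dist_eq, abs_le]
    simp only [wt]; constructor <;> linarith)

theorem wt_zero {x : ℝ} (h : x ≤ 1 ∨ 29 / 10 ≤ x) : wt x = 0 :=
  wt.zero_of_le_dist (by
    rw [Real.dist_eq, le_abs]
    simp only [wt]; rcases h with h | h
    · right; linarith
    · left; linarith)

theorem contDiff_wt {n : ℕ∞} : ContDiff ℝ n wt := wt.contDiff

theorem exists_wt_deriv_bound : ∃ D : ℝ, 0 < D ∧ ∀ x, |deriv wt x| ≤ D := by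
  have h1 : HasCompactSupport (deriv wt) := wt.hasCompactSupport.deriv
  have h2 : Continuous (deriv wt) := (contDiff_wt (n := 1)).continuous_deriv le_rfl
  obtain ⟨C, hC⟩ := h1.exists_bound_of_continuous h2
  exact ⟨max C 1, by positivity, fun x => (hC x).trans (le_max_left _ _)⟩

/-- The smoothed sum `∑ w(n / M) n^{2πiθ}`. -/
noncomputable def zsum (M : ℕ) (θ : ℝ) : ℂ :=
  ∑ n ∈ Finset.Icc M (3 * M), (wt ((n : ℝ) / M) : ℂ) * ex (θ * Real.log n)

/-- Abel's inequality: the weight is `D`-Lipschitz, so its variation over `2M` steps of length `1/M`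
is at most `2D`, and all unweighted partial sums are `≤ 10M/|θ|` by Kuzmin–Landau. -/
theorem exists_norm_zsum_le_div : ∃ C : ℝ, 0 < C ∧ ∀ M : ℕ, 0 < M → ∀ θ : ℝ, θ ≠ 0 →
    |θ| ≤ M / 2 → ‖zsum M θ‖ ≤ C * (M / |θ|) := by
  obtain ⟨D, hD0, hD⟩ := exists_wt_deriv_bound
  refine ⟨(1 + 2 * D) * 10, by positivity, fun M hM θ h0 hθ => ?_⟩
  have hM' : (0 : ℝ) < M := by exact_mod_cast hM
  have e : zsum M θ = ∑ i ∈ Finset.range (2 * M + 1),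
      (wt (((M + i : ℕ) : ℝ) / M) : ℂ) * ex (θ * Real.log ((M + i : ℕ) : ℝ)) := by
    rw [zsum, ← Finset.Ico_add_one_right_eq_Icc, Finset.sum_Ico_eq_sum_range,
      show 3 * M + 1 - M = 2 * M + 1 by lia]
  rw [e]
  refine (norm_sum_mul_le_of_partial_sums (fun i => (wt (((M + i : ℕ) : ℝ) / M) : ℂ))
    (fun i => ex (θ * Real.log ((M + i : ℕ) : ℝ))) _ (B := 10 * M / |θ|) (fun n hn =>
      norm_sum_log_le_of_small hM le_rfl (by lia) h0 hθ)).trans ?_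
  have h1 : ‖(wt (((M + (2 * M + 1 - 1) : ℕ) : ℝ) / M) : ℂ)‖ ≤ 1 := by
    rw [Complex.norm_real, Real.norm_eq_abs, abs_of_nonneg wt.nonneg]; exact wt.le_one
  have h2 : ∀ i ∈ Finset.range (2 * M + 1 - 1), ‖(wt (((M + (i + 1) : ℕ) : ℝ) / M) : ℂ)
      - (wt (((M + i : ℕ) : ℝ) / M) : ℂ)‖ ≤ D / M := by
    intro i _
    rw [← Complex.ofReal_sub, Complex.norm_real]
    have := Convex.norm_image_sub_le_of_norm_deriv_le (f := wt) (s := Set.univ) (C := D)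
      (fun x _ => (contDiff_wt (n := 1)).differentiable (by norm_num) x) (fun x _ => hD x)
      convex_univ (Set.mem_univ (((M + i : ℕ) : ℝ) / M))
      (Set.mem_univ (((M + (i + 1) : ℕ) : ℝ) / M))
    refine this.trans (le_of_eq ?_)
    rw [← sub_div, norm_div]
    push_cast
    rw [show (M : ℝ) + (i + 1) - (M + i) = 1 by ring]
    simp [div_eq_mul_inv]
  have h3 := Finset.sum_le_sum h2
  rw [Finset.sum_const, Finset.card_range, nsmul_eq_mul] at h3
  have e3 : ((2 * M + 1 - 1 : ℕ) : ℝ) * (D / M) = 2 * D := by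
    rw [Nat.add_sub_cancel]; push_cast; field_simp
  rw [e3] at h3
  calc _ ≤ (1 + 2 * D) * (10 * M / |θ|) := by gcongr
    _ = _ := by ring

/-- One integration by parts against the primitive `v^(1+2πiθ)/(1+2πiθ)`. The weight vanishes at
both ends of `[M, 3M]`, so there is no boundary term, and the denominator is at least `2π|θ|`. -/
theorem exists_norm_integral_wt_le : ∃ C : ℝ, 0 < C ∧ ∀ M : ℝ, 0 < M → ∀ θ : ℝ, θ ≠ 0 →
    ∀ X : ℝ, 3 * M ≤ X →
    ‖∫ v in Set.Ioc 0 X, (wt (v / M) : ℂ) * ex (θ * Real.log v)‖ ≤ C * (M / |θ|) := by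
  obtain ⟨D, hD0, hD⟩ := exists_wt_deriv_bound
  refine ⟨D, by positivity, fun M hM θ h0 X hX => ?_⟩
  have e1 : ∫ v in Set.Ioc 0 X, (wt (v / M) : ℂ) * ex (θ * Real.log v) =
      ∫ v in M..(3 * M), (wt (v / M) : ℂ) * ex (θ * Real.log v) := by
    rw [intervalIntegral.integral_of_le (by linarith)]
    refine setIntegral_eq_of_subset_of_forall_sdiff_eq_zero measurableSet_Ioc
      (Set.Ioc_subset_Ioc hM.le hX) (fun v hv => ?_)
    rw [wt_zero, Complex.ofReal_zero, zero_mul]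
    rcases le_or_gt v M with h | h
    · left; rw [div_le_one hM]; exact h
    · right
      have : 3 * M < v := by
        by_contra hc; exact hv.2 ⟨h, not_lt.mp hc⟩
      rw [le_div_iff₀ hM]; linarith
  set c : ℂ := 1 + 2 * Real.pi * θ * Complex.I with hc
  have hcn : 2 * Real.pi * |θ| ≤ ‖c‖ := by
    have := Complex.abs_im_le_norm c
    simp only [hc] at this
    simpa [abs_mul, abs_of_pos Real.pi_pos] using this
  have hpi := Real.pi_gt_three
  have hθ : 0 < |θ| := abs_pos.mpr h0
  have hc0 : c ≠ 0 := by
    intro h; rw [h, norm_zero] at hcn; nlinarith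
  have hE : ∀ v ∈ Set.uIcc M (3 * M), HasDerivAt (fun v : ℝ => (v : ℂ) * ex (θ * Real.log v) / c)
      (ex (θ * Real.log v)) v := by
    intro v hv
    rw [Set.uIcc_of_le (by linarith)] at hv
    have hv0 : 0 < v := lt_of_lt_of_le hM hv.1
    have d1 : HasDerivAt (fun v : ℝ => θ * Real.log v) (θ * v⁻¹) v :=
      (Real.hasDerivAt_log hv0.ne').const_mul θ
    have d2 : HasDerivAt (fun v : ℝ => ((θ * Real.log v : ℝ) : ℂ)) ((θ * v⁻¹ : ℝ) : ℂ) v :=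
      d1.ofReal_comp
    have d3 : HasDerivAt (fun v : ℝ => ex (θ * Real.log v))
        (ex (θ * Real.log v) * (2 * Real.pi * ((θ * v⁻¹ : ℝ) : ℂ) * Complex.I)) v := by
      have := ((d2.const_mul (2 * Real.pi : ℂ)).mul_const Complex.I).cexp
      exact this
    have d0 : HasDerivAt (fun y : ℝ => (y : ℂ)) 1 v := Complex.ofRealCLM.hasDerivAt
    have d4 := (d0.mul d3).div_const c
    refine d4.congr_deriv ?_
    rw [div_eq_iff hc0, hc]
    have : (v : ℂ) ≠ 0 := by exact_mod_cast hv0.ne'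
    push_cast
    field_simp
  have hg : ∀ v ∈ Set.uIcc M (3 * M), HasDerivAt (fun v : ℝ => (wt (v / M) : ℂ))
      ((deriv wt (v / M) / M : ℝ) : ℂ) v := by
    intro v _
    have d1 : HasDerivAt wt (deriv wt (v / M)) (v / M) :=
      ((contDiff_wt (n := 1)).differentiable (by norm_num) _).hasDerivAt
    have d2 : HasDerivAt (fun v : ℝ => v / M) (1 / M) v := (hasDerivAt_id v).div_const M
    have := (HasDerivAt.comp v d1 d2).ofReal_comp
    refine this.congr_deriv ?_
    push_cast; ring
  have hcw : Continuous (deriv wt) := (contDiff_wt (n := 1)).continuous_deriv le_rfl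
  have hp := intervalIntegral.integral_mul_deriv_eq_deriv_mul hg hE
    (Continuous.intervalIntegrable (by fun_prop) _ _)
    (ContinuousOn.intervalIntegrable (continuous_ex.comp_continuousOn
      (continuousOn_const.mul (Real.continuousOn_log.mono (fun v hv => by
        rw [Set.uIcc_of_le (by linarith)] at hv
        exact (lt_of_lt_of_le hM hv.1).ne')))))
  rw [e1, hp]
  have z1 : wt (3 * M / M) = 0 := wt_zero (Or.inr (by rw [mul_div_cancel_right₀ _ hM.ne']; norm_num))
  have z2 : wt (M / M) = 0 := wt_zero (Or.inl (by rw [div_self hM.ne']))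
  rw [z1, z2]
  simp only [Complex.ofReal_zero, zero_mul, sub_zero, zero_sub, norm_neg]
  have hb := intervalIntegral.norm_integral_le_of_norm_le_const (a := M) (b := 3 * M)
    (f := fun v : ℝ => ((deriv wt (v / M) / M : ℝ) : ℂ) * ((v : ℂ) * ex (θ * Real.log v) / c))
    (C := (D / M) * (3 * M / (2 * Real.pi * |θ|))) (fun v hv => by
      rw [Set.uIoc_of_le (by linarith)] at hv
      have hv0 : 0 < v := hM.trans hv.1
      rw [norm_mul, norm_div, norm_mul, norm_ex, Complex.norm_real, Complex.norm_real,
        Real.norm_eq_abs, Real.norm_eq_abs, abs_div, abs_of_pos hM, abs_of_pos hv0, mul_one]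
      have := hD (v / M)
      have := hv.2
      gcongr)
  refine hb.trans ?_
  rw [show 3 * M - M = 2 * M by ring, abs_of_pos (show (0 : ℝ) < 2 * M by positivity)]
  have e5 : D / M * (3 * M / (2 * Real.pi * |θ|)) * (2 * M) = D * (M / |θ|) * (3 / Real.pi) := by
    field_simp
  rw [e5]
  have : 3 / Real.pi ≤ 1 := by rw [div_le_one Real.pi_pos]; exact hpi.le
  have h9 : 0 ≤ D * (M / |θ|) := by positivity
  nlinarith

/-! ### Mellin inversion and the Lindelöf bound for smooth sums -/

open scoped FourierTransform

/-- The weight in logarithmic coordinates, twisted to the critical line. -/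
noncomputable def wtLog (v : ℝ) : ℂ := ((wt (Real.exp v) * Real.exp (v / 2) : ℝ) : ℂ)

theorem hasCompactSupport_wtLog : HasCompactSupport wtLog := by
  refine HasCompactSupport.intro (isCompact_Icc (a := (0 : ℝ)) (b := 2)) (fun v hv => ?_)
  have : wt (Real.exp v) = 0 := by
    apply wt_zero
    rw [Set.mem_Icc, not_and_or, not_le, not_le] at hv
    rcases hv with h | h
    · left; rw [Real.exp_le_one_iff]; exact h.le
    · right
      have := Real.add_one_le_exp v
      linarith
  simp [wtLog, this]

theorem contDiff_wtLog : ContDiff ℝ (⊤ : ℕ∞) wtLog := by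
  unfold wtLog
  have h1 : ContDiff ℝ (⊤ : ℕ∞) (fun v : ℝ => wt (Real.exp v)) := contDiff_wt.comp Real.contDiff_exp
  have h2 : ContDiff ℝ (⊤ : ℕ∞) (fun v : ℝ => Real.exp (v / 2)) :=
    Real.contDiff_exp.comp (contDiff_id.div_const 2)
  exact Complex.ofRealCLM.contDiff.comp (h1.mul h2)

/-- The Fourier transform of `wtLog`. -/
noncomputable def wtHat : SchwartzMap ℝ ℂ :=
  𝓕 (hasCompactSupport_wtLog.toSchwartzMap contDiff_wtLog)

theorem wtLog_eq_integral (v : ℝ) : wtLog v = ∫ y : ℝ, ex (y * v) * wtHat y := by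
  have h : 𝓕⁻ wtHat = hasCompactSupport_wtLog.toSchwartzMap contDiff_wtLog := by
    rw [wtHat]; simp
  have h2 := congrArg (fun f : SchwartzMap ℝ ℂ => f v) h
  simp only [SchwartzMap.fourierInv_coe] at h2
  have h3 : (hasCompactSupport_wtLog.toSchwartzMap contDiff_wtLog) v = wtLog v := rfl
  rw [h3, Real.fourierInv_eq'] at h2
  rw [← h2]
  refine integral_congr_ae (Filter.Eventually.of_forall fun y => ?_)
  simp only [ex, smul_eq_mul]
  congr 2
  simp; ring

/-- The point on the critical line attached to the frequency `u`. -/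
noncomputable def critPt (u : ℝ) : ℂ := 1 / 2 - 2 * Real.pi * u * Complex.I

theorem critPt_re (u : ℝ) : (critPt u).re = 1 / 2 := by simp [critPt]

theorem norm_critPt_le (u : ℝ) : ‖critPt u‖ ≤ 1 / 2 + 2 * Real.pi * |u| := by
  refine (norm_sub_le _ _).trans ?_
  simp [abs_of_pos Real.pi_pos]

theorem cpow_neg_critPt {x : ℝ} (hx : 0 < x) (u : ℝ) :
    (x : ℂ) ^ (-critPt u) = ((x ^ (-(1 / 2) : ℝ) : ℝ) : ℂ) * ex (u * Real.log x) := by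
  have hx0 : (x : ℂ) ≠ 0 := by exact_mod_cast hx.ne'
  have e : -critPt u = ((-(1 / 2) : ℝ) : ℂ) + 2 * Real.pi * u * Complex.I := by
    simp [critPt]; ring
  rw [e, Complex.cpow_add _ _ hx0, ← Complex.ofReal_cpow hx.le]
  congr 1
  rw [Complex.cpow_def_of_ne_zero hx0, ex, ← Complex.ofReal_log hx.le]
  congr 1; push_cast; ring

/-- This is Mellin inversion on the line `Re s = 1/2`, written as Fourier inversion in `log x`. The
twist by `exp (v / 2)` in `wtLog` produces `x^(-1/2)`, so that summing over integers `x` gives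
partial sums of `ζ` at the points `critPt (y + θ)`. -/
theorem wt_mul_ex_eq_integral {M : ℝ} (hM : 0 < M) (θ : ℝ) {x : ℝ} (hx : 0 < x) :
    (wt (x / M) : ℂ) * ex (θ * Real.log x) = (√M : ℂ) * ∫ y : ℝ, wtHat y * ex (-(y * Real.log M)) *
      (((x ^ (-(1 / 2) : ℝ) : ℝ) : ℂ) * ex ((y + θ) * Real.log x)) := by
  have h := wtLog_eq_integral (Real.log x - Real.log M)
  have e1 : wtLog (Real.log x - Real.log M) = ((wt (x / M) * (√x / √M) : ℝ) : ℂ) := by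
    rw [wtLog, ← Real.log_div hx.ne' hM.ne', Real.exp_log (by positivity), Real.exp_half,
      Real.exp_log (by positivity), Real.sqrt_div hx.le]
  have hsx : (√x : ℂ) ≠ 0 := by exact_mod_cast (Real.sqrt_pos.mpr hx).ne'
  have hsM : (√M : ℂ) ≠ 0 := by exact_mod_cast (Real.sqrt_pos.mpr hM).ne'
  have e2 : ∫ y : ℝ, wtHat y * ex (-(y * Real.log M)) *
      (((x ^ (-(1 / 2) : ℝ) : ℝ) : ℂ) * ex ((y + θ) * Real.log x)) =
      (((x ^ (-(1 / 2) : ℝ) : ℝ) : ℂ) * ex (θ * Real.log x)) *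
        ∫ y : ℝ, ex (y * (Real.log x - Real.log M)) * wtHat y := by
    rw [← integral_const_mul]
    congr 1; ext y
    have : ex ((y + θ) * Real.log x) * ex (-(y * Real.log M)) =
        ex (θ * Real.log x) * ex (y * (Real.log x - Real.log M)) := by
      rw [← ex_add, ← ex_add]; ring_nf
    linear_combination (wtHat y * ((x ^ (-(1 / 2) : ℝ) : ℝ) : ℂ)) * this
  rw [e2, ← h, e1, Real.rpow_neg hx.le, ← Real.sqrt_eq_rpow]
  push_cast
  field_simp

theorem integrable_wtHat_mul {f : ℝ → ℂ} (hf : AEStronglyMeasurable f) {B : ℝ}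
    (hB : ∀ y, ‖f y‖ ≤ B) : Integrable (fun y => wtHat y * f y) :=
  (wtHat.integrable).mul_bdd (c := B) hf (Eventually.of_forall hB)

/-- The term coming from the pole of `ζ` is not estimated pointwise, as it grows with `X`. Writing
`X^(1-s)/(1-s)` as the integral of `v^(-s)` over `(0, X]` and exchanging integrals undoes the Mellin
inversion, and what remains is the integral of the weighted oscillation, independent of `X` in size.
-/
theorem norm_integral_main_le : ∃ C : ℝ, 0 < C ∧ ∀ M : ℝ, 0 < M → ∀ θ : ℝ, θ ≠ 0 →
    ∀ X : ℝ, 3 * M ≤ X → ‖(√M : ℂ) * ∫ y : ℝ, wtHat y * ex (-(y * Real.log M)) *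
      ((X : ℂ) ^ (1 - critPt (y + θ)) / (1 - critPt (y + θ)))‖ ≤ C * (M / |θ|) := by
  obtain ⟨C, hC0, hC⟩ := exists_norm_integral_wt_le
  refine ⟨C, hC0, fun M hM θ hθ X hX => ?_⟩
  refine le_of_eq_of_le ?_ (hC M hM θ hθ X hX)
  congr 1
  have hX0 : 0 < X := by linarith
  have e1 : ∫ v in Set.Ioc 0 X, (wt (v / M) : ℂ) * ex (θ * Real.log v) =
      ∫ v in Set.Ioc 0 X, (√M : ℂ) * ∫ y : ℝ, wtHat y * ex (-(y * Real.log M)) *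
      (((v ^ (-(1 / 2) : ℝ) : ℝ) : ℂ) * ex ((y + θ) * Real.log v)) :=
    setIntegral_congr_fun measurableSet_Ioc (fun v hv => wt_mul_ex_eq_integral hM θ hv.1)
  rw [e1, integral_const_mul]
  congr 1
  have hint : Integrable (Function.uncurry fun (v y : ℝ) => wtHat y * ex (-(y * Real.log M)) *
      (((v ^ (-(1 / 2) : ℝ) : ℝ) : ℂ) * ex ((y + θ) * Real.log v)))
      ((volume.restrict (Set.Ioc 0 X)).prod volume) := by
    have hv : Integrable (fun v : ℝ => v ^ (-(1 / 2) : ℝ)) (volume.restrict (Set.Ioc 0 X)) := by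
      have := intervalIntegral.intervalIntegrable_rpow' (a := 0) (b := X) (r := -(1 / 2))
        (by norm_num)
      rwa [intervalIntegrable_iff_integrableOn_Ioc_of_le hX0.le] at this
    have hp := hv.norm.mul_prod (wtHat.integrable (μ := volume)).norm
    refine hp.mono' ?_ (Eventually.of_forall fun p => ?_)
    · apply Measurable.aestronglyMeasurable
      have hm := continuous_ex.measurable
      have hm2 := wtHat.continuous.measurable
      rw [Function.uncurry_def]
      refine ((hm2.comp measurable_snd).mul (hm.comp ?_)).mul
        ((Complex.measurable_ofReal.comp ?_).mul (hm.comp ?_))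
      · fun_prop
      · fun_prop
      · fun_prop
    · simp only [Function.uncurry, norm_mul, norm_ex, mul_one, Complex.norm_real]
      rw [mul_comm]
  rw [integral_integral_swap hint]
  congr 1; ext y
  rw [integral_const_mul]
  congr 1
  have hre : (-1 : ℝ) < (-critPt (y + θ)).re := by rw [Complex.neg_re, critPt_re]; norm_num
  have h := integral_cpow (a := 0) (b := X) (r := -critPt (y + θ)) (Or.inl hre)
  have e3 : -critPt (y + θ) + 1 = 1 - critPt (y + θ) := by ring
  have hne : 1 - critPt (y + θ) ≠ 0 := fun h => by
    have := congrArg Complex.re h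
    rw [Complex.sub_re, critPt_re] at this; norm_num at this
  rw [e3, Complex.ofReal_zero, Complex.zero_cpow hne, sub_zero,
    intervalIntegral.integral_of_le hX0.le] at h
  rw [← h]
  exact (setIntegral_congr_fun measurableSet_Ioc (fun v hv => cpow_neg_critPt hv.1 _))

theorem zsum_eq_sum_range {M N : ℕ} (hM : 0 < M) (hN : 3 * M ≤ N) (θ : ℝ) :
    zsum M θ = ∑ m ∈ Finset.range (N + 1),
      (wt (((m : ℝ) + 1) / M) : ℂ) * ex (θ * Real.log ((m : ℝ) + 1)) := by
  have hM' : (0 : ℝ) < M := by exact_mod_cast hM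
  have e : ∑ m ∈ Finset.range (N + 1),
      (wt (((m : ℝ) + 1) / M) : ℂ) * ex (θ * Real.log ((m : ℝ) + 1)) =
      ∑ n ∈ Finset.Ico 1 (N + 2), (wt ((n : ℝ) / M) : ℂ) * ex (θ * Real.log n) := by
    rw [Finset.sum_Ico_eq_sum_range]
    refine Finset.sum_congr (by simp) (fun m _ => ?_)
    push_cast; rw [add_comm]
  rw [e, zsum]
  refine Finset.sum_subset (fun n hn => ?_) (fun n hn hn2 => ?_)
  · rw [Finset.mem_Icc] at hn; rw [Finset.mem_Ico]; lia
  · rw [Finset.mem_Icc, not_and_or, not_le, not_le] at hn2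
    rw [wt_zero, Complex.ofReal_zero, zero_mul]
    rcases hn2 with h | h
    · left; rw [div_le_one hM']; exact_mod_cast h.le
    · right
      have : (3 * M : ℝ) ≤ n := by exact_mod_cast h.le
      rw [le_div_iff₀ hM']; linarith

/-- Under the Lindelöf hypothesis, `∑ w(n/M) n^{2πiθ}` has square root cancellation. -/
theorem LindelofHypothesis.exists_norm_zsum_le (hLH : LindelofHypothesis) {ε : ℝ} (hε : 0 < ε)
    (hε1 : ε ≤ 1) : ∃ C : ℝ, 0 < C ∧ ∀ M : ℕ, 0 < M → ∀ θ : ℝ, θ ≠ 0 →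
      ‖zsum M θ‖ ≤ C * (√M * (1 + |θ|) ^ ε + M / |θ|) := by
  obtain ⟨C1, hC1⟩ := hLH ε hε
  obtain ⟨C2, hC20, hC2⟩ := norm_integral_main_le
  obtain ⟨η, hη, hzeta⟩ := exists_zeta_approx
  have hpi := Real.pi_pos
  set C1' := max C1 1 with hC1'
  have hI0 := wtHat.integrable (μ := volume)
  -- The factor `1 + 2π|y|` absorbs the `y`-dependence of both error sources: the Lindelöf bound,
  -- where `ε ≤ 1` makes a linear factor enough, and the norm of the point on the critical line.
  have hI1 : Integrable (fun y : ℝ => ‖wtHat y‖ * (1 + 2 * Real.pi * |y|)) := by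
    have h1 := (wtHat.integrable_pow_mul volume 1)
    have := hI0.norm.add (h1.const_mul (2 * Real.pi))
    refine this.congr (Eventually.of_forall fun y => ?_)
    simp only [Pi.add_apply, pow_one, Real.norm_eq_abs]; ring
  set I1 := ∫ y : ℝ, ‖wtHat y‖ * (1 + 2 * Real.pi * |y|) with hI1d
  have hI1n : 0 ≤ I1 := integral_nonneg fun y => by positivity
  set c := C1' * (2 * Real.pi) ^ ε * I1 with hc
  refine ⟨max c C2, by positivity, fun M hM θ hθ => ?_⟩
  have hM' : (0 : ℝ) < M := by exact_mod_cast hM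
  -- The truncation `N` is auxiliary: the smooth sum does not see it once `N ≥ 3M`. At the end `N`
  -- tends to infinity with `M` and `θ` fixed, which removes the last term.
  have hkey : ∀ N : ℕ, 3 * M ≤ N → ‖zsum M θ‖ ≤
      √M * (c * (1 + |θ|) ^ ε) + C2 * (M / |θ|) +
        √M * ((1 + 2 * Real.pi * |θ|) * I1) * |η N| := by
    intro N hN
    set X : ℝ := (N : ℝ) + 1 with hX
    have hX3 : 3 * (M : ℝ) ≤ X := by
      have : ((3 * M : ℕ) : ℝ) ≤ N := by exact_mod_cast hN
      push_cast at this; linarith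
    set P : ℝ → ℂ := fun y => ∑ m ∈ Finset.range (N + 1), ((m : ℂ) + 1) ^ (-critPt (y + θ)) with hP
    set J : ℝ → ℂ := fun y => (X : ℂ) ^ (1 - critPt (y + θ)) / (1 - critPt (y + θ)) with hJ
    have hcrit : Continuous critPt := by unfold critPt; fun_prop
    have hX0 : (X : ℂ) ≠ 0 := by
      have : X ≠ 0 := by positivity
      exact_mod_cast this
    have hPterm : ∀ m : ℕ, ∀ y, ((m : ℂ) + 1) ^ (-critPt (y + θ)) =
        ((((m : ℝ) + 1) ^ (-(1 / 2) : ℝ) : ℝ) : ℂ) * ex ((y + θ) * Real.log ((m : ℝ) + 1)) := by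
      intro m y
      rw [← cpow_neg_critPt (by positivity)]; push_cast; rfl
    have hne : ∀ y, 1 - critPt (y + θ) ≠ 0 := fun y h => by
      have := congrArg Complex.re h
      rw [Complex.sub_re, critPt_re] at this; norm_num at this
    have hJc : Continuous J := by
      refine Continuous.div ?_ ?_ hne
      · exact Continuous.const_cpow (by fun_prop) (Or.inl hX0)
      · fun_prop
    have hJb : ∀ y, ‖J y‖ ≤ √X * 2 := fun y => by
      simp only [hJ]
      rw [norm_div, Complex.norm_cpow_eq_rpow_re_of_pos (by positivity), Complex.sub_re, critPt_re,
        div_le_iff₀ (norm_pos_iff.mpr (hne y)), Complex.one_re, Real.sqrt_eq_rpow,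
        show (1 : ℝ) - 1 / 2 = 1 / 2 by norm_num]
      have h1 := Complex.abs_re_le_norm (1 - critPt (y + θ))
      rw [Complex.sub_re, critPt_re, Complex.one_re] at h1
      norm_num at h1
      have h2 : 0 ≤ X ^ (1 / 2 : ℝ) := by positivity
      nlinarith
    set E : ℝ → ℂ := fun y => ex (-(y * Real.log M)) with hE
    have hEc : Continuous E := continuous_ex.comp (by fun_prop)
    have hsum : zsum M θ = (√M : ℂ) * ∫ y, wtHat y * E y * P y := by
      rw [zsum_eq_sum_range hM hN]
      have : ∀ y, wtHat y * E y * P y = ∑ m ∈ Finset.range (N + 1), wtHat y * E y *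
          (((((m : ℝ) + 1) ^ (-(1 / 2) : ℝ) : ℝ) : ℂ) * ex ((y + θ) * Real.log ((m : ℝ) + 1))) := by
        intro y
        simp only [hP, Finset.mul_sum, hPterm]
      simp_rw [this]
      rw [integral_finsetSum, Finset.mul_sum]
      · exact Finset.sum_congr rfl fun m _ => wt_mul_ex_eq_integral hM' θ (by positivity)
      · intro m _
        simp_rw [mul_assoc]
        refine integrable_wtHat_mul (B := ((m : ℝ) + 1) ^ (-(1 / 2) : ℝ)) ?_ (fun y => ?_)
        · refine Continuous.aestronglyMeasurable (hEc.mul (continuous_const.mul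
            (continuous_ex.comp (by fun_prop))))
        · simp only [hE, norm_mul, norm_ex, Complex.norm_real, one_mul, mul_one, Real.norm_eq_abs]
          rw [abs_of_nonneg (by positivity)]
    have hPint : Integrable (fun y => wtHat y * E y * P y) := by
      simp_rw [mul_assoc]
      refine integrable_wtHat_mul
        (B := ∑ m ∈ Finset.range (N + 1), ((m : ℝ) + 1) ^ (-(1 / 2) : ℝ)) ?_ (fun y => ?_)
      · refine Continuous.aestronglyMeasurable (hEc.mul ?_)
        simp only [hP, hPterm]
        refine continuous_finsetSum _ fun m _ => continuous_const.mul
          (continuous_ex.comp (by fun_prop))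
      · rw [norm_mul, hE, norm_ex, one_mul]
        refine (norm_sum_le _ _).trans (Finset.sum_le_sum fun m _ => le_of_eq ?_)
        rw [hPterm, norm_mul, norm_ex, mul_one, Complex.norm_real, Real.norm_eq_abs,
          abs_of_nonneg (by positivity)]
    have hJint : Integrable (fun y => wtHat y * E y * J y) := by
      simp_rw [mul_assoc]
      refine integrable_wtHat_mul (B := √X * 2) (hEc.mul hJc).aestronglyMeasurable (fun y => ?_)
      rw [norm_mul, hE, norm_ex, one_mul]; exact hJb y
    have hdiff : ‖(∫ y, wtHat y * E y * P y) - ∫ y, wtHat y * E y * J y‖ ≤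
        c * (1 + |θ|) ^ ε + (1 + 2 * Real.pi * |θ|) * I1 * |η N| := by
      rw [← integral_sub hPint hJint]
      have hb : ∀ y, ‖wtHat y * E y * P y - wtHat y * E y * J y‖ ≤
          (C1' * (2 * Real.pi) ^ ε * (1 + |θ|) ^ ε + (1 + 2 * Real.pi * |θ|) * |η N|) *
            (‖wtHat y‖ * (1 + 2 * Real.pi * |y|)) := by
        intro y
        rw [← mul_sub, norm_mul, norm_mul, hE, norm_ex, mul_one]
        have hz := hzeta (critPt (y + θ)) (critPt_re _) N
        have htri : ‖P y - J y‖ ≤ ‖riemannZeta (critPt (y + θ))‖ + ‖critPt (y + θ)‖ * η N := by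
          have e : P y - J y = riemannZeta (critPt (y + θ)) + (∑ m ∈ Finset.range (N + 1),
              ((m : ℂ) + 1) ^ (-critPt (y + θ)) - (riemannZeta (critPt (y + θ))
                + ((N : ℂ) + 1) ^ (1 - critPt (y + θ)) / (1 - critPt (y + θ)))) := by
            simp only [hP, hJ, hX]; push_cast; ring
          rw [e]
          exact (norm_add_le _ _).trans (add_le_add le_rfl hz)
        have habs : |y + θ| ≤ |y| + |θ| := abs_add_le _ _
        have h1 : ‖riemannZeta (critPt (y + θ))‖ ≤
            C1' * (2 * Real.pi) ^ ε * (1 + |θ|) ^ ε * (1 + 2 * Real.pi * |y|) := by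
          have h2 := hC1 (-(2 * Real.pi * (y + θ)))
          have e : (1 / 2 + ((-(2 * Real.pi * (y + θ)) : ℝ) : ℂ) * Complex.I) = critPt (y + θ) := by
            simp only [critPt]; push_cast; ring
          rw [e, abs_neg, abs_mul, abs_of_pos (by positivity : 0 < 2 * Real.pi)] at h2
          have h3 : 1 + 2 * Real.pi * |y + θ| ≤
              (2 * Real.pi) * (1 + |θ|) * (1 + 2 * Real.pi * |y|) := by
            have hp3 := Real.pi_gt_three
            have a1 : 0 ≤ |y| := abs_nonneg _
            have a2 : 0 ≤ |θ| := abs_nonneg _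
            have a3 : 0 ≤ |θ| * |y| := by positivity
            have a4 : 2 * Real.pi * |y + θ| ≤ 2 * Real.pi * (|y| + |θ|) := by gcongr
            have a5 : 2 * Real.pi * |y| ≤ 2 * Real.pi * |y| * (2 * Real.pi) := by
              apply le_mul_of_one_le_right (by positivity); linarith
            have a6 : 0 ≤ Real.pi * Real.pi * (|θ| * |y|) := by positivity
            nlinarith
          have h4 : (1 + 2 * Real.pi * |y + θ|) ^ ε ≤
              (2 * Real.pi) ^ ε * (1 + |θ|) ^ ε * (1 + 2 * Real.pi * |y|) := by
            calc _ ≤ ((2 * Real.pi) * (1 + |θ|) * (1 + 2 * Real.pi * |y|)) ^ ε := by gcongr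
              _ = (2 * Real.pi) ^ ε * (1 + |θ|) ^ ε * (1 + 2 * Real.pi * |y|) ^ ε := by
                rw [Real.mul_rpow (by positivity) (by positivity),
                  Real.mul_rpow (by positivity) (by positivity)]
              _ ≤ _ := by
                gcongr
                calc (1 + 2 * Real.pi * |y|) ^ ε ≤ (1 + 2 * Real.pi * |y|) ^ (1 : ℝ) := by
                      apply Real.rpow_le_rpow_of_exponent_le _ hε1
                      have : 0 ≤ 2 * Real.pi * |y| := by positivity
                      linarith
                  _ = _ := Real.rpow_one _
          calc _ ≤ _ := h2
            _ ≤ C1' * (1 + 2 * Real.pi * |y + θ|) ^ ε := by gcongr; exact le_max_left _ _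
            _ ≤ C1' * ((2 * Real.pi) ^ ε * (1 + |θ|) ^ ε * (1 + 2 * Real.pi * |y|)) := by gcongr
            _ = _ := by ring
        have h5 : ‖critPt (y + θ)‖ * η N ≤
            (1 + 2 * Real.pi * |θ|) * |η N| * (1 + 2 * Real.pi * |y|) := by
          have a1 : 0 ≤ |y| := abs_nonneg _
          have a2 : 0 ≤ |θ| := abs_nonneg _
          have a4 : 2 * Real.pi * |y + θ| ≤ 2 * Real.pi * (|y| + |θ|) := by gcongr
          have a6 : 0 ≤ Real.pi * Real.pi * (|θ| * |y|) := by positivity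
          calc _ ≤ ‖critPt (y + θ)‖ * |η N| := by gcongr; exact le_abs_self _
            _ ≤ ((1 + 2 * Real.pi * |θ|) * (1 + 2 * Real.pi * |y|)) * |η N| := by
                gcongr
                refine (norm_critPt_le _).trans ?_
                nlinarith
            _ = _ := by ring
        calc ‖wtHat y‖ * ‖P y - J y‖ ≤ ‖wtHat y‖ *
              (C1' * (2 * Real.pi) ^ ε * (1 + |θ|) ^ ε * (1 + 2 * Real.pi * |y|) +
                (1 + 2 * Real.pi * |θ|) * |η N| * (1 + 2 * Real.pi * |y|)) := by
              gcongr; linarith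
          _ = _ := by ring
      refine (norm_integral_le_of_norm_le (hI1.const_mul _) (Eventually.of_forall hb)).trans ?_
      rw [integral_const_mul, ← hI1d, hc]
      apply le_of_eq; ring
    have hmain := hC2 M hM' θ hθ X hX3
    have htot : zsum M θ = (√M : ℂ) * ((∫ y, wtHat y * E y * P y) - ∫ y, wtHat y * E y * J y) +
        (√M : ℂ) * ∫ y, wtHat y * E y * J y := by rw [hsum]; ring
    rw [htot]
    refine (norm_add_le _ _).trans ?_
    have hs : ‖(√M : ℂ) * ((∫ y, wtHat y * E y * P y) - ∫ y, wtHat y * E y * J y)‖ ≤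
        √M * (c * (1 + |θ|) ^ ε + (1 + 2 * Real.pi * |θ|) * I1 * |η N|) := by
      rw [norm_mul, Complex.norm_real, Real.norm_eq_abs, abs_of_nonneg (Real.sqrt_nonneg _)]
      gcongr
    have : ‖(√M : ℂ) * ∫ y, wtHat y * E y * J y‖ ≤ C2 * (M / |θ|) := hmain
    linarith
  have hlim : Tendsto (fun N : ℕ => √M * (c * (1 + |θ|) ^ ε) + C2 * (M / |θ|) +
        √M * ((1 + 2 * Real.pi * |θ|) * I1) * |η N|) atTop
      (𝓝 (√M * (c * (1 + |θ|) ^ ε) + C2 * (M / |θ|) +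
        √M * ((1 + 2 * Real.pi * |θ|) * I1) * |0|)) :=
    tendsto_const_nhds.add (hη.abs.const_mul _)
  have hfin := ge_of_tendsto hlim (eventually_atTop.mpr ⟨3 * M, hkey⟩)
  rw [abs_zero, mul_zero, add_zero] at hfin
  refine hfin.trans ?_
  have p1 : 0 ≤ √M * (1 + |θ|) ^ ε := by positivity
  have p2 : 0 ≤ M / |θ| := by positivity
  calc _ = c * (√M * (1 + |θ|) ^ ε) + C2 * (M / |θ|) := by ring
    _ ≤ max c C2 * (√M * (1 + |θ|) ^ ε) + max c C2 * (M / |θ|) := by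
        gcongr
        · exact le_max_left _ _
        · exact le_max_right _ _
    _ = _ := by ring

/-! ### Plancherel for sums of translates and mean squares -/

open scoped FourierTransform

/-- The Fourier integral on the line, written with `ex`. -/
noncomputable def ft (ψ : ℝ → ℂ) (τ : ℝ) : ℂ := ∫ u : ℝ, ex (-(u * τ)) * ψ u

theorem fourier_eq_ft (ψ : ℝ → ℂ) (τ : ℝ) : 𝓕 ψ τ = ft ψ τ := by
  rw [Real.fourier_eq', ft]
  refine integral_congr_ae (Eventually.of_forall fun u => ?_)
  simp only [ex, smul_eq_mul]
  congr 2
  simp; ring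

theorem ft_translate (ψ : ℝ → ℂ) (l τ : ℝ) :
    ft (fun u => ψ (u - l)) τ = ex (-(τ * l)) * ft ψ τ := by
  rw [ft, ft, ← integral_const_mul,
    ← integral_sub_right_eq_self (fun u => ex (-(τ * l)) * (ex (-(u * τ)) * ψ u)) l]
  congr 1; ext u
  rw [← mul_assoc, ← ex_add]; ring_nf

theorem ft_scale (ψ : ℝ → ℂ) {T : ℝ} (hT : 0 < T) (τ : ℝ) :
    ft (fun u => (T : ℂ) * ψ (T * u)) τ = ft ψ (τ / T) := by
  have h := Measure.integral_comp_mul_left (fun u => ex (-(u * (τ / T))) * ψ u) T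
  rw [ft, ft]
  have e : ∀ u : ℝ, ex (-(u * τ)) * ((T : ℂ) * ψ (T * u)) =
      (T : ℂ) * (ex (-(T * u * (τ / T))) * ψ (T * u)) := fun u => by
    rw [show T * u * (τ / T) = u * τ by field_simp]; ring
  simp_rw [e]
  rw [integral_const_mul, h, abs_of_pos (inv_pos.mpr hT), Complex.real_smul, ← mul_assoc]
  have : (T : ℂ) ≠ 0 := by exact_mod_cast hT.ne'
  push_cast
  rw [mul_inv_cancel₀ this, one_mul]

/-- A combination of translates of one profile has as transform the transform of the profile times
an exponential polynomial. Smoothness and compact support make everything Schwartz, so Plancherel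
and integrability are immediate. -/
theorem plancherel_translates {ι : Type*} (s : Finset ι) (c : ι → ℂ) (l : ι → ℝ) {ψ : ℝ → ℂ}
    (hψ : HasCompactSupport ψ) (hψ' : ContDiff ℝ (⊤ : ℕ∞) ψ) :
    Integrable (fun τ => ‖ft ψ τ‖ ^ 2 * ‖∑ i ∈ s, c i * ex (-(τ * l i))‖ ^ 2) ∧
    ∫ τ, ‖ft ψ τ‖ ^ 2 * ‖∑ i ∈ s, c i * ex (-(τ * l i))‖ ^ 2 =
      ∫ u, ‖∑ i ∈ s, c i * ψ (u - l i)‖ ^ 2 := by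
  classical
  have hcs : ∀ a : ℝ, HasCompactSupport (fun u => ψ (u - a)) := fun a =>
    hψ.comp_homeomorph (Homeomorph.subRight a)
  have hG : HasCompactSupport (fun u => ∑ i ∈ s, c i * ψ (u - l i)) := by
    induction s using Finset.induction_on with
    | empty => simp only [Finset.sum_empty]; exact HasCompactSupport.zero
    | insert a s ha ih =>
      simp_rw [Finset.sum_insert ha]
      exact ((hcs (l a)).mul_left (f := fun _ => c a)).add ih
  have hG' : ContDiff ℝ (⊤ : ℕ∞) (fun u => ∑ i ∈ s, c i * ψ (u - l i)) :=
    ContDiff.sum fun i _ => contDiff_const.mul (hψ'.comp (contDiff_id.sub contDiff_const))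
  set G := hG.toSchwartzMap hG' with hGd
  have hft : ∀ τ, (𝓕 G) τ = ft ψ τ * ∑ i ∈ s, c i * ex (-(τ * l i)) := by
    intro τ
    rw [SchwartzMap.fourier_coe, fourier_eq_ft]
    have e1 : ft (⇑G) τ = ∑ i ∈ s, c i * ft (fun u => ψ (u - l i)) τ := by
      rw [ft]
      have : ∀ u, ex (-(u * τ)) * G u = ∑ i ∈ s, c i * (ex (-(u * τ)) * ψ (u - l i)) := fun u => by
        change ex (-(u * τ)) * (∑ i ∈ s, c i * ψ (u - l i)) = _
        rw [Finset.mul_sum]; exact Finset.sum_congr rfl fun i _ => by ring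
      simp_rw [this]
      rw [integral_finsetSum]
      · exact Finset.sum_congr rfl fun i _ => by rw [integral_const_mul, ft]
      · intro i _
        refine Integrable.const_mul ?_ _
        refine Continuous.integrable_of_hasCompactSupport ?_ ?_
        · exact (continuous_ex.comp (by fun_prop)).mul
            (hψ'.continuous.comp (by fun_prop))
        · exact (hcs (l i)).mul_left
    rw [e1, Finset.mul_sum]
    exact Finset.sum_congr rfl fun i _ => by rw [ft_translate]; ring
  have hn : ∀ τ, ‖ft ψ τ‖ ^ 2 * ‖∑ i ∈ s, c i * ex (-(τ * l i))‖ ^ 2 = ‖(𝓕 G) τ‖ ^ 2 := fun τ => by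
    rw [hft, norm_mul, mul_pow]
  simp_rw [hn]
  refine ⟨?_, SchwartzMap.integral_norm_sq_fourier G⟩
  have := (𝓕 G).memLp 2 volume
  exact (memLp_two_iff_integrable_sq_norm (𝓕 G).continuous.aestronglyMeasurable).mp this

/-- A smooth bump equal to `1` on `[-1/2, 1/2]` and supported in `[-1, 1]`. -/
noncomputable def bump : ContDiffBump (0 : ℝ) := ⟨1 / 2, 1, by norm_num, by norm_num⟩

theorem bump_one {x : ℝ} (h : |x| ≤ 1 / 2) : bump x = 1 :=
  bump.one_of_mem_closedBall (by rw [Metric.mem_closedBall, Real.dist_eq, sub_zero]; exact h)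

theorem bump_zero {x : ℝ} (h : 1 ≤ |x|) : bump x = 0 :=
  bump.zero_of_le_dist (by rw [Real.dist_eq, sub_zero]; exact h)

/-- The bump, as a complex valued function. -/
noncomputable def bumpC (x : ℝ) : ℂ := (bump x : ℂ)

theorem hasCompactSupport_bumpC : HasCompactSupport bumpC :=
  bump.hasCompactSupport.comp_left (g := fun x : ℝ => (x : ℂ)) Complex.ofReal_zero

theorem contDiff_bumpC : ContDiff ℝ (⊤ : ℕ∞) bumpC :=
  Complex.ofRealCLM.contDiff.comp (bump.contDiff (n := (⊤ : ℕ∞)))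

theorem integral_bump_le : ∫ u, bump u ≤ 2 := by
  have h : ∫ u, bump u ≤ ∫ u, (Set.Icc (-1 : ℝ) 1).indicator (fun _ => (1 : ℝ)) u := by
    refine integral_mono bump.integrable ?_ (fun u => ?_)
    · exact (integrable_indicator_iff measurableSet_Icc).mpr (by simp)
    · by_cases hu : u ∈ Set.Icc (-1 : ℝ) 1
      · rw [Set.indicator_of_mem hu]; exact bump.le_one
      · rw [Set.indicator_of_notMem hu, bump_zero]
        by_contra hc; exact hu (abs_le.mp (not_le.mp hc).le)
  refine h.trans (le_of_eq ?_)
  rw [integral_indicator measurableSet_Icc]; simp; norm_num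

theorem one_le_integral_bump : 1 ≤ ∫ u, bump u := by
  have h : ∫ u, (Set.Icc (-(1 / 2) : ℝ) (1 / 2)).indicator (fun _ => (1 : ℝ)) u ≤ ∫ u, bump u := by
    refine integral_mono ?_ bump.integrable (fun u => ?_)
    · exact (integrable_indicator_iff measurableSet_Icc).mpr (by simp)
    · by_cases hu : u ∈ Set.Icc (-(1 / 2) : ℝ) (1 / 2)
      · rw [Set.indicator_of_mem hu, bump_one (abs_le.mpr hu)]
      · rw [Set.indicator_of_notMem hu]; exact bump.nonneg
  refine le_trans (le_of_eq ?_) h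
  rw [integral_indicator measurableSet_Icc]; simp; norm_num

theorem norm_ex_sub_ex_le (x y : ℝ) : ‖ex x - ex y‖ ≤ 2 * Real.pi * |x - y| := by
  have h : ex x - ex y = ex y * (ex (x - y) - 1) := by
    rw [mul_sub, ← ex_add, mul_one]; ring_nf
  rw [h, norm_mul, norm_ex, one_mul]
  have := Real.norm_exp_I_mul_ofReal_sub_one_le (x := 2 * Real.pi * (x - y))
  rw [ex]
  rw [show (2 * Real.pi * ((x - y : ℝ) : ℂ) * Complex.I) =
    Complex.I * ((2 * Real.pi * (x - y) : ℝ) : ℂ) by push_cast; ring]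
  refine this.trans (le_of_eq ?_)
  rw [Real.norm_eq_abs, abs_mul, abs_of_pos (by positivity)]

theorem integrable_ex_mul_bumpC (τ : ℝ) : Integrable (fun u : ℝ => ex (-(u * τ)) * bumpC u) :=
  Continuous.integrable_of_hasCompactSupport
    ((continuous_ex.comp (by fun_prop)).mul contDiff_bumpC.continuous)
    hasCompactSupport_bumpC.mul_left

theorem norm_ft_bumpC_sub_le (a b : ℝ) :
    ‖ft bumpC a - ft bumpC b‖ ≤ 4 * Real.pi * |a - b| := by
  rw [ft, ft, ← integral_sub (integrable_ex_mul_bumpC a) (integrable_ex_mul_bumpC b)]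
  have hb : ∀ u : ℝ, ‖ex (-(u * a)) * bumpC u - ex (-(u * b)) * bumpC u‖ ≤
      (2 * Real.pi * |a - b|) * bump u := fun u => by
    rw [← sub_mul, norm_mul, bumpC, Complex.norm_real, Real.norm_eq_abs, abs_of_nonneg bump.nonneg]
    rcases le_or_gt 1 |u| with h | h
    · rw [bump_zero h]; simp
    · refine mul_le_mul_of_nonneg_right ?_ bump.nonneg
      refine (norm_ex_sub_ex_le _ _).trans ?_
      have h2 : |-(u * a) - -(u * b)| ≤ |a - b| := by
        rw [show -(u * a) - -(u * b) = -(u * (a - b)) by ring, abs_neg, abs_mul]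
        nlinarith [abs_nonneg (a - b)]
      gcongr
  refine (norm_integral_le_of_norm_le (bump.integrable.const_mul _)
    (Eventually.of_forall hb)).trans ?_
  rw [integral_const_mul]
  have := integral_bump_le
  have hp := Real.pi_pos
  calc _ ≤ 2 * Real.pi * |a - b| * 2 := by gcongr
    _ = _ := by ring

theorem norm_ft_bumpC_le (a : ℝ) : ‖ft bumpC a‖ ≤ 2 := by
  have hb : ∀ u : ℝ, ‖ex (-(u * a)) * bumpC u‖ ≤ bump u := fun u => by
    rw [norm_mul, norm_ex, one_mul, bumpC, Complex.norm_real, Real.norm_eq_abs,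
      abs_of_nonneg bump.nonneg]
  exact (norm_integral_le_of_norm_le bump.integrable (Eventually.of_forall hb)).trans
    integral_bump_le

/-- The transform at `0` is the integral of the bump, at least `1`, and over a distance `1/32` the
Lipschitz constant `4π < 16` costs at most `1/2`. -/
theorem half_le_norm_ft_bumpC {a : ℝ} (ha : |a| ≤ 1 / 32) : 1 / 2 ≤ ‖ft bumpC a‖ := by
  have h0 : 1 ≤ ‖ft bumpC 0‖ := by
    have : ft bumpC 0 = ((∫ u, bump u : ℝ) : ℂ) := by
      rw [ft, ← integral_complex_ofReal]; simp [bumpC]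
    rw [this, Complex.norm_real, Real.norm_eq_abs]
    exact one_le_integral_bump.trans (le_abs_self _)
  have h1 := norm_ft_bumpC_sub_le a 0
  rw [sub_zero] at h1
  have h2 := norm_sub_norm_le (ft bumpC 0) (ft bumpC a)
  rw [norm_sub_rev] at h2
  have := Real.pi_lt_four
  nlinarith [abs_nonneg a]

theorem exists_norm_ft_bumpC_decay (k : ℕ) : ∃ C : ℝ, 0 < C ∧ ∀ a : ℝ,
    |a| ^ k * ‖ft bumpC a‖ ≤ C := by
  set S := hasCompactSupport_bumpC.toSchwartzMap contDiff_bumpC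
  obtain ⟨C, hC0, hC⟩ := (𝓕 S).decay k 0
  refine ⟨C, hC0, fun a => ?_⟩
  have := hC a
  rw [norm_iteratedFDeriv_zero, SchwartzMap.fourier_coe, fourier_eq_ft, Real.norm_eq_abs] at this
  exact this

theorem hasCompactSupport_scale (T : ℝ) (hT : 0 < T) :
    HasCompactSupport (fun u : ℝ => (T : ℂ) * bumpC (T * u)) :=
  (hasCompactSupport_bumpC.comp_homeomorph (Homeomorph.mulLeft₀ T hT.ne')).mul_left

theorem contDiff_scale (T : ℝ) : ContDiff ℝ (⊤ : ℕ∞) (fun u : ℝ => (T : ℂ) * bumpC (T * u)) :=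
  contDiff_const.mul (contDiff_bumpC.comp (contDiff_const.mul contDiff_id))

/-- Mean square of an exponential sum, in terms of the number of close pairs of frequencies. -/
theorem integral_norm_sq_le_card {ι : Type*} (s : Finset ι) (l : ι → ℝ) {T : ℝ} (hT : 0 < T) :
    ∫ τ in Set.Icc (-T) T, ‖∑ i ∈ s, ex (-(τ * l i))‖ ^ 2 ≤
      256 * T * (((s ×ˢ s).filter (fun p => |l p.1 - l p.2| ≤ 1 / T)).card : ℝ) := by
  classical
  -- With the bump at scale `1/S`, its transform is at least `1/2` on all of `[-T, T]`. Two
  -- translates then overlap only if their centres are within `2/S`, which is well below `1/T`.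
  set S := 32 * T with hS
  have hS0 : 0 < S := by positivity
  obtain ⟨hint, heq⟩ := plancherel_translates s (fun _ => 1) l (hasCompactSupport_scale S hS0)
    (contDiff_scale S)
  simp only [one_mul, ft_scale _ hS0] at hint heq
  have hcont : Continuous fun τ : ℝ => ∑ i ∈ s, ex (-(τ * l i)) :=
    continuous_finsetSum _ fun i _ => continuous_ex.comp (by fun_prop)
  have h1 : ∫ τ in Set.Icc (-T) T, ‖∑ i ∈ s, ex (-(τ * l i))‖ ^ 2 ≤
      4 * ∫ τ, ‖ft bumpC (τ / S)‖ ^ 2 * ‖∑ i ∈ s, ex (-(τ * l i))‖ ^ 2 := by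
    rw [← integral_const_mul]
    calc _ ≤ ∫ τ in Set.Icc (-T) T,
          4 * (‖ft bumpC (τ / S)‖ ^ 2 * ‖∑ i ∈ s, ex (-(τ * l i))‖ ^ 2) := by
          refine setIntegral_mono_on ?_ (hint.const_mul 4).integrableOn measurableSet_Icc
            (fun τ hτ => ?_)
          · exact (hcont.norm.pow 2).integrableOn_Icc
          · have : |τ / S| ≤ 1 / 32 := by
              rw [abs_div, abs_of_pos hS0, div_le_iff₀ hS0, hS]
              have := abs_le.mpr hτ
              linarith
            have h2 := half_le_norm_ft_bumpC this
            have h3 : 1 ≤ 4 * ‖ft bumpC (τ / S)‖ ^ 2 := by nlinarith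
            rw [← mul_assoc]
            exact le_mul_of_one_le_left (by positivity) h3
      _ ≤ _ := setIntegral_le_integral (hint.const_mul 4)
          (Eventually.of_forall fun τ => by positivity)
  refine h1.trans ?_
  rw [heq]
  have hexp : ∀ u, ‖∑ i ∈ s, (S : ℂ) * bumpC (S * (u - l i))‖ ^ 2 =
      ∑ p ∈ s ×ˢ s, S ^ 2 * (bump (S * (u - l p.1)) * bump (S * (u - l p.2))) := fun u => by
    have : ∑ i ∈ s, (S : ℂ) * bumpC (S * (u - l i)) =
        ((∑ i ∈ s, S * bump (S * (u - l i)) : ℝ) : ℂ) := by simp [bumpC]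
    rw [this, Complex.norm_real, Real.norm_eq_abs, sq_abs, sq, Finset.sum_mul_sum,
      ← Finset.sum_product']
    exact Finset.sum_congr rfl fun p _ => by ring
  simp_rw [hexp]
  have hbi : ∀ a : ℝ, Integrable (fun u => bump (S * (u - a))) := fun a =>
    ((bump.integrable (μ := volume)).comp_mul_left' hS0.ne').comp_sub_right a
  have hbv : ∀ a : ℝ, ∫ u, bump (S * (u - a)) ≤ 2 / S := fun a => by
    rw [integral_sub_right_eq_self (fun u => bump (S * u)) a, Measure.integral_comp_mul_left,
      abs_of_pos (inv_pos.mpr hS0), smul_eq_mul]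
    calc _ ≤ S⁻¹ * 2 := by gcongr; exact integral_bump_le
      _ = _ := by ring
  have hpi : ∀ p : ι × ι, Integrable
      (fun u => bump (S * (u - l p.1)) * bump (S * (u - l p.2))) := fun p =>
    (hbi _).mul_bdd (c := 1)
      (Continuous.aestronglyMeasurable (bump.continuous.comp (by fun_prop)))
      (Eventually.of_forall fun u => by
        rw [Real.norm_eq_abs, abs_of_nonneg bump.nonneg]; exact bump.le_one)
  rw [integral_finsetSum _ (fun p _ => (hpi p).const_mul _)]
  have hterm : ∀ p ∈ s ×ˢ s, ∫ u, S ^ 2 * (bump (S * (u - l p.1)) * bump (S * (u - l p.2))) ≤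
      if |l p.1 - l p.2| ≤ 1 / T then 2 * S else 0 := by
    intro p _
    rw [integral_const_mul]
    split_ifs with h
    · have : ∫ u, bump (S * (u - l p.1)) * bump (S * (u - l p.2)) ≤ 2 / S := by
        refine le_trans (integral_mono (hpi p) (hbi (l p.1)) (fun u => ?_)) (hbv (l p.1))
        exact mul_le_of_le_one_right bump.nonneg bump.le_one
      calc _ ≤ S ^ 2 * (2 / S) := by gcongr
        _ = _ := by field_simp
    · have : ∀ u, bump (S * (u - l p.1)) * bump (S * (u - l p.2)) = 0 := fun u => by
        by_contra hc
        have h1 : bump (S * (u - l p.1)) ≠ 0 := left_ne_zero_of_mul hc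
        have h2 : bump (S * (u - l p.2)) ≠ 0 := right_ne_zero_of_mul hc
        have h3 : |S * (u - l p.1)| < 1 := by by_contra h'; exact h1 (bump_zero (not_lt.mp h'))
        have h4 : |S * (u - l p.2)| < 1 := by by_contra h'; exact h2 (bump_zero (not_lt.mp h'))
        have h5 : S * |l p.1 - l p.2| ≤ 2 := by
          have e : S * |l p.1 - l p.2| = |S * (l p.1 - l p.2)| := by
            rw [abs_mul, abs_of_pos hS0]
          rw [e, show S * (l p.1 - l p.2) = S * (u - l p.2) - S * (u - l p.1) by ring]
          refine (abs_sub _ _).trans ?_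
          linarith
        apply h
        rw [le_div_iff₀ hT]
        rw [hS] at h5
        nlinarith [abs_nonneg (l p.1 - l p.2)]
      simp_rw [this]; simp
  calc _ ≤ 4 * ∑ p ∈ s ×ˢ s, (if |l p.1 - l p.2| ≤ 1 / T then 2 * S else 0) := by
        gcongr with p hp; exact hterm p hp
    _ = _ := by
        rw [← Finset.sum_filter, Finset.sum_const, nsmul_eq_mul, hS]; ring

/-! ### Close values of the binary form and the mean square of its exponential sum -/

/-- The box `(M, 2M] × [1, M / h]` of lattice points. -/
def box (M h : ℕ) : Finset (ℕ × ℕ) := Finset.Ioc M (2 * M) ×ˢ Finset.Icc 1 (M / h)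

/-- The positive definite binary form `x₁² + α₂ x₂²`. -/
def qf (α₂ : ℝ) (p : ℕ × ℕ) : ℝ := (p.1 : ℝ) ^ 2 + α₂ * (p.2 : ℝ) ^ 2

/-- The sum `x₁ + y₁` of the first coordinates divides `a = (x₁ + y₁)(x₁ - y₁)`, and since `a ≠ 0`
it determines the difference, hence the pair. -/
theorem card_sq_sub_sq_eq_le (s : Finset ((ℕ × ℕ) × (ℕ × ℕ))) (a : ℤ) (ha : a ≠ 0) (x₂ y₂ : ℕ)
    (hs : ∀ p ∈ s, (p.1.1 : ℤ) ^ 2 - (p.2.1 : ℤ) ^ 2 = a ∧ p.1.2 = x₂ ∧ p.2.2 = y₂) :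
    s.card ≤ a.natAbs.divisors.card := by
  refine Finset.card_le_card_of_injOn (fun p => p.1.1 + p.2.1) (fun p hp => ?_)
    (fun p hp p' hp' h => ?_)
  · rw [Finset.mem_coe, Nat.mem_divisors]
    refine ⟨?_, Int.natAbs_ne_zero.mpr ha⟩
    have h1 := (hs p hp).1
    rw [← Int.natCast_dvd]
    refine ⟨(p.1.1 : ℤ) - p.2.1, ?_⟩
    rw [← h1]; push_cast; ring
  · obtain ⟨h1, h2, h3⟩ := hs p hp
    obtain ⟨h1', h2', h3'⟩ := hs p' hp'
    simp only at h
    have hz : (p.1.1 : ℤ) + p.2.1 = p'.1.1 + p'.2.1 := by exact_mod_cast h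
    have hne : (p.1.1 : ℤ) + p.2.1 ≠ 0 := by
      intro h0; apply ha; rw [← h1]
      have : (p.1.1 : ℤ) ^ 2 - (p.2.1 : ℤ) ^ 2 = (p.1.1 + p.2.1) * (p.1.1 - p.2.1) := by ring
      rw [this, h0, zero_mul]
    have hm : ((p.1.1 : ℤ) + p.2.1) * ((p.1.1 : ℤ) - p.2.1) =
        ((p.1.1 : ℤ) + p.2.1) * ((p'.1.1 : ℤ) - p'.2.1) := by
      nth_rw 2 [hz]
      linear_combination h1 - h1'
    have hd := mul_left_cancel₀ hne hm
    ext <;> lia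

/-- No Diophantine property of `α₂` is needed. Given the `M²` choices of the second coordinates,
`x₁² - y₁²` is one of `O(1)` integers, and a nonzero value is attained `O(M^ε)` times by the divisor
bound. If `x₁ = y₁`, then `x₂² - y₂²` is bounded, so `x₂ = y₂` or both are bounded. -/
theorem exists_card_close_pairs_le {α₂ : ℝ} (hα : 0 < α₂) (C₀ : ℕ) {ε : ℝ} (hε : 0 < ε) :
    ∃ C : ℝ, 0 < C ∧ ∀ M h : ℕ, 0 < M →
      ((((box M h) ×ˢ (box M h)).filter
        (fun p => |qf α₂ p.1 - qf α₂ p.2| ≤ C₀)).card : ℝ) ≤ C * (M : ℝ) ^ (2 + ε) := by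
  classical
  obtain ⟨D, hD0, hD⟩ := card_divisors_le_rpow (half_pos hε)
  obtain ⟨C₁, hC₁⟩ := exists_nat_ge (C₀ / α₂)
  refine ⟨D * 4 ^ (ε / 2) * (2 * C₀ + 2) + (1 + (C₁ + 1) ^ 2), by positivity, fun M h hM => ?_⟩
  have hM1 : (1 : ℝ) ≤ M := by exact_mod_cast hM
  set S := ((box M h) ×ˢ (box M h)).filter (fun p => |qf α₂ p.1 - qf α₂ p.2| ≤ C₀) with hS
  have hmem : ∀ p ∈ S, (M < p.1.1 ∧ p.1.1 ≤ 2 * M ∧ 1 ≤ p.1.2 ∧ p.1.2 ≤ M) ∧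
      (M < p.2.1 ∧ p.2.1 ≤ 2 * M ∧ 1 ≤ p.2.2 ∧ p.2.2 ≤ M) ∧
      |qf α₂ p.1 - qf α₂ p.2| ≤ C₀ := fun p hp => by
    have hMh : M / h ≤ M := Nat.div_le_self _ _
    simp only [hS, box, Finset.mem_filter, Finset.mem_product, Finset.mem_Ioc,
      Finset.mem_Icc] at hp
    obtain ⟨⟨⟨⟨h1, h2⟩, h3, h4⟩, ⟨h5, h6⟩, h7, h8⟩, h9⟩ := hp
    exact ⟨⟨h1, h2, h3, by lia⟩, ⟨h5, h6, h7, by lia⟩, h9⟩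
  have hsplit : S.card = (S.filter (fun p => p.1.1 ≠ p.2.1)).card +
      (S.filter (fun p => ¬ p.1.1 ≠ p.2.1)).card :=
    (Finset.card_filter_add_card_filter_not _).symm
  -- off-diagonal first coordinates
  have b1 : ((S.filter (fun p => p.1.1 ≠ p.2.1)).card : ℝ) ≤
      D * 4 ^ (ε / 2) * (2 * C₀ + 2) * (M : ℝ) ^ (2 + ε) := by
    -- The left end of the window of `2C₀ + 2` consecutive integers in which `x₁² - y₁²` must lie
    -- once `x₂` and `y₂` are fixed.
    set lo : ℕ × ℕ → ℤ := fun q => ⌊α₂ * ((q.2 : ℝ) ^ 2 - (q.1 : ℝ) ^ 2) - C₀⌋ with hlo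
    set t := (Finset.Icc 1 M ×ˢ Finset.Icc 1 M) ×ˢ Finset.range (2 * C₀ + 2) with ht
    have hin : ∀ p ∈ S, lo (p.1.2, p.2.2) ≤ (p.1.1 : ℤ) ^ 2 - (p.2.1 : ℤ) ^ 2 ∧
        (p.1.1 : ℤ) ^ 2 - (p.2.1 : ℤ) ^ 2 < lo (p.1.2, p.2.2) + (2 * C₀ + 2) := fun p hp => by
      have h9 := abs_le.mp (hmem p hp).2.2
      simp only [qf] at h9
      set c := α₂ * ((p.2.2 : ℝ) ^ 2 - (p.1.2 : ℝ) ^ 2) - C₀ with hc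
      have f1 := Int.floor_le c
      have f2 := Int.lt_floor_add_one c
      have g1 : ((⌊c⌋ : ℤ) : ℝ) ≤ (((p.1.1 : ℤ) ^ 2 - (p.2.1 : ℤ) ^ 2 : ℤ) : ℝ) := by
        push_cast; linarith [h9.1]
      have g2 : (((p.1.1 : ℤ) ^ 2 - (p.2.1 : ℤ) ^ 2 : ℤ) : ℝ) <
          ((⌊c⌋ + (2 * C₀ + 2) : ℤ) : ℝ) := by
        push_cast; linarith [h9.2]
      exact ⟨by exact_mod_cast g1, by exact_mod_cast g2⟩
    have hcard := Finset.card_le_mul_card_image_of_maps_to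
      (s := S.filter (fun p => p.1.1 ≠ p.2.1)) (t := t)
      (f := fun p => ((p.1.2, p.2.2),
        ((p.1.1 : ℤ) ^ 2 - (p.2.1 : ℤ) ^ 2 - lo (p.1.2, p.2.2)).toNat))
      (fun p hp => by
        have hp' := (Finset.mem_filter.mp hp).1
        obtain ⟨h1, h2, -⟩ := hmem p hp'
        have h3 := hin p hp'
        rw [ht, Finset.mem_product, Finset.mem_product, Finset.mem_Icc, Finset.mem_Icc,
          Finset.mem_range]
        refine ⟨⟨⟨h1.2.2.1, h1.2.2.2⟩, h2.2.2.1, h2.2.2.2⟩, ?_⟩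
        lia)
      ⌊D * ((4 * (M : ℝ) ^ 2)) ^ (ε / 2)⌋₊ (fun q _ => by
        apply Nat.le_floor
        rcases Finset.eq_empty_or_nonempty ((S.filter (fun p => p.1.1 ≠ p.2.1)).filter
          (fun p => ((p.1.2, p.2.2),
            ((p.1.1 : ℤ) ^ 2 - (p.2.1 : ℤ) ^ 2 - lo (p.1.2, p.2.2)).toNat) = q)) with he | ⟨r, hr⟩
        · rw [he]; simp; positivity
        · obtain ⟨hr1, hr2⟩ := Finset.mem_filter.mp hr
          obtain ⟨hr3, hr4⟩ := Finset.mem_filter.mp hr1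
          set a := (r.1.1 : ℤ) ^ 2 - (r.2.1 : ℤ) ^ 2 with ha
          have ha0 : a ≠ 0 := by
            intro h0
            have : (r.1.1 : ℤ) ^ 2 = (r.2.1 : ℤ) ^ 2 := by linarith
            have h' := (sq_eq_sq₀ (by positivity) (by positivity)).mp this
            exact hr4 (by exact_mod_cast h')
          have hle := card_sq_sub_sq_eq_le (a := a) (ha := ha0) (x₂ := q.1.1) (y₂ := q.1.2) (s := (S.filter
            (fun p => p.1.1 ≠ p.2.1)).filter (fun p => ((p.1.2, p.2.2),
            ((p.1.1 : ℤ) ^ 2 - (p.2.1 : ℤ) ^ 2 - lo (p.1.2, p.2.2)).toNat) = q)) (fun p hp => by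
              obtain ⟨hp1, hp2⟩ := Finset.mem_filter.mp hp
              have hp3 := (Finset.mem_filter.mp hp1).1
              have i1 := hin p hp3
              have i2 := hin r hr3
              have e1 : p.1.2 = q.1.1 := by rw [← hp2]
              have e2 : p.2.2 = q.1.2 := by rw [← hp2]
              have e3 : r.1.2 = q.1.1 := by rw [← hr2]
              have e4 : r.2.2 = q.1.2 := by rw [← hr2]
              have e5 : ((p.1.1 : ℤ) ^ 2 - (p.2.1 : ℤ) ^ 2 - lo (p.1.2, p.2.2)).toNat =
                ((r.1.1 : ℤ) ^ 2 - (r.2.1 : ℤ) ^ 2 - lo (r.1.2, r.2.2)).toNat := 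
                  (congrArg Prod.snd hp2).trans (congrArg Prod.snd hr2).symm
              rw [e1, e2] at i1 e5
              rw [e3, e4] at i2 e5
              exact ⟨by lia, e1, e2⟩)
          have hna : a.natAbs ≠ 0 := Int.natAbs_ne_zero.mpr ha0
          have h4 : ((a.natAbs : ℕ) : ℝ) ≤ 4 * (M : ℝ) ^ 2 := by
            have m1 := (hmem r hr3).1.2.1
            have m2 := (hmem r hr3).2.1.2.1
            have k1 : (r.1.1 : ℤ) ^ 2 ≤ (2 * M : ℤ) ^ 2 := by
              apply pow_le_pow_left₀ (by positivity); exact_mod_cast m1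
            have k2 : (r.2.1 : ℤ) ^ 2 ≤ (2 * M : ℤ) ^ 2 := by
              apply pow_le_pow_left₀ (by positivity); exact_mod_cast m2
            have k3 : 0 ≤ (r.1.1 : ℤ) ^ 2 := by positivity
            have k4 : 0 ≤ (r.2.1 : ℤ) ^ 2 := by positivity
            have : ((a.natAbs : ℕ) : ℤ) ≤ (4 * M ^ 2 : ℤ) := by
              rw [Int.natCast_natAbs, abs_le]
              constructor <;> nlinarith
            exact_mod_cast this
          calc _ ≤ ((a.natAbs.divisors.card : ℕ) : ℝ) := by exact_mod_cast hle
            _ ≤ D * (a.natAbs : ℝ) ^ (ε / 2) := hD _ hna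
            _ ≤ _ := by gcongr)
    have hcard' : ((S.filter (fun p => p.1.1 ≠ p.2.1)).card : ℝ) ≤
        (⌊D * ((4 * (M : ℝ) ^ 2)) ^ (ε / 2)⌋₊ : ℝ) * (t.card : ℝ) := by exact_mod_cast hcard
    have htc : (t.card : ℝ) = M ^ 2 * (2 * C₀ + 2) := by
      rw [ht, Finset.card_product, Finset.card_product, Nat.card_Icc, Finset.card_range]
      rw [Nat.add_sub_cancel]; push_cast; ring
    have e1 : (4 * (M : ℝ) ^ 2) ^ (ε / 2) = 4 ^ (ε / 2) * (M : ℝ) ^ ε := by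
      rw [Real.mul_rpow (by norm_num) (by positivity), ← Real.rpow_natCast, ← Real.rpow_mul
        (by positivity)]
      congr 2; push_cast; ring
    have e2 : (M : ℝ) ^ (2 + ε) = (M : ℝ) ^ 2 * (M : ℝ) ^ ε := by
      rw [Real.rpow_add (by positivity)]; norm_num
    calc _ ≤ _ := hcard'
      _ ≤ (D * ((4 * (M : ℝ) ^ 2)) ^ (ε / 2)) * (M ^ 2 * (2 * C₀ + 2)) := by
          rw [htc]; gcongr; exact Nat.floor_le (by positivity)
      _ = _ := by rw [e1, e2]; ring
  -- diagonal first coordinates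
  have b2 : ((S.filter (fun p => ¬ p.1.1 ≠ p.2.1)).card : ℝ) ≤
      (1 + (C₁ + 1) ^ 2) * (M : ℝ) ^ (2 + ε) := by
    set t := Finset.Ioc M (2 * M) ×ˢ ((Finset.Icc 1 M).image (fun x => (x, x)) ∪
      Finset.range (C₁ + 1) ×ˢ Finset.range (C₁ + 1)) with ht
    have hle : (S.filter (fun p => ¬ p.1.1 ≠ p.2.1)).card ≤ t.card := by
      refine Finset.card_le_card_of_injOn (fun p => (p.1.1, (p.1.2, p.2.2))) (fun p hp => ?_)
        (fun p hp p' hp' h => ?_)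
      · obtain ⟨hp1, hp2⟩ := Finset.mem_filter.mp hp
        rw [not_not] at hp2
        obtain ⟨h1, h2, h3⟩ := hmem p hp1
        rw [Finset.mem_coe, ht, Finset.mem_product, Finset.mem_union, Finset.mem_product]
        refine ⟨Finset.mem_Ioc.mpr ⟨h1.1, h1.2.1⟩, ?_⟩
        -- With equal first coordinates closeness reads `|x₂ - y₂|(x₂ + y₂) ≤ C₁`, so distinct `x₂`,
        -- `y₂` have sum at most `C₁`.
        by_cases hxy : p.1.2 = p.2.2
        · left
          exact Finset.mem_image.mpr ⟨p.1.2, Finset.mem_Icc.mpr h1.2.2, Prod.ext rfl hxy⟩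
        · right
          simp only [qf, hp2] at h3
          rw [show ((p.2.1 : ℝ) ^ 2 + α₂ * (p.1.2 : ℝ) ^ 2 - ((p.2.1 : ℝ) ^ 2 +
            α₂ * (p.2.2 : ℝ) ^ 2)) = α₂ * ((p.1.2 : ℝ) ^ 2 - (p.2.2 : ℝ) ^ 2) by ring, abs_mul,
            abs_of_pos hα, mul_comm, ← le_div_iff₀ hα] at h3
          have h4 := h3.trans hC₁
          have h5 : |(p.1.2 : ℤ) ^ 2 - (p.2.2 : ℤ) ^ 2| ≤ (C₁ : ℤ) := by exact_mod_cast h4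
          have h6 : (p.1.2 : ℤ) ^ 2 - (p.2.2 : ℤ) ^ 2 =
            ((p.1.2 : ℤ) - p.2.2) * ((p.1.2 : ℤ) + p.2.2) := by ring
          have h7 : 1 ≤ |(p.1.2 : ℤ) - p.2.2| := by
            apply Int.one_le_abs; intro h0; apply hxy; lia
          rw [h6, abs_mul, abs_of_nonneg (by positivity : (0 : ℤ) ≤ (p.1.2 : ℤ) + p.2.2)] at h5
          have h8 : (p.1.2 : ℤ) + p.2.2 ≤ C₁ := by nlinarith
          simp only [Finset.mem_range]
          constructor <;> lia
      · obtain ⟨hp1, hp2⟩ := Finset.mem_filter.mp hp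
        obtain ⟨hp1', hp2'⟩ := Finset.mem_filter.mp hp'
        simp only [Prod.mk.injEq] at h
        ext <;> lia
    have htc : t.card ≤ M * (M + (C₁ + 1) * (C₁ + 1)) := by
      rw [ht, Finset.card_product, Nat.card_Ioc]
      refine Nat.mul_le_mul (by lia) ((Finset.card_union_le _ _).trans (add_le_add ?_ ?_))
      · exact Finset.card_image_le.trans (by simp)
      · simp
    have h3 : ((S.filter (fun p => ¬ p.1.1 ≠ p.2.1)).card : ℝ) ≤
        M * (M + (C₁ + 1) * (C₁ + 1)) := by exact_mod_cast hle.trans htc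
    have h4 : (M : ℝ) ^ 2 ≤ (M : ℝ) ^ (2 + ε) := by
      rw [← Real.rpow_natCast]
      exact Real.rpow_le_rpow_of_exponent_le hM1 (by push_cast; linarith)
    calc _ ≤ _ := h3
      _ ≤ (1 + (C₁ + 1) ^ 2) * (M : ℝ) ^ 2 := by
          have := mul_nonneg (sq_nonneg ((C₁ : ℝ) + 1))
            (mul_nonneg (by linarith : (0 : ℝ) ≤ M) (sub_nonneg.mpr hM1))
          linarith
      _ ≤ _ := by gcongr
  rw [hsplit]; push_cast
  linarith

/-- The exponential sum `∑ (x₁² + α₂ x₂² - ξ)^{-2πiτ}` over the box. -/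
noncomputable def bsum (α₂ ξ : ℝ) (M h : ℕ) (τ : ℝ) : ℂ :=
  ∑ p ∈ box M h, ex (-(τ * Real.log (qf α₂ p - ξ)))

theorem continuous_bsum (α₂ ξ : ℝ) (M h : ℕ) : Continuous (bsum α₂ ξ M h) :=
  continuous_finsetSum _ fun _ _ => continuous_ex.comp (by fun_prop)

theorem card_box_le (M h : ℕ) : ((box M h).card : ℝ) ≤ (M : ℝ) ^ 2 := by
  have : (box M h).card ≤ M ^ 2 := by
    rw [box, Finset.card_product, Nat.card_Ioc, Nat.card_Icc, sq]
    have := Nat.div_le_self M h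
    exact Nat.mul_le_mul (by lia) (by lia)
  exact_mod_cast this

theorem norm_bsum_le (α₂ ξ : ℝ) (M h : ℕ) (τ : ℝ) : ‖bsum α₂ ξ M h τ‖ ≤ (M : ℝ) ^ 2 := by
  refine (norm_sum_le _ _).trans ?_
  simpa using card_box_le M h

/-- The size conditions on the box: `qf` takes values in `[M², 5M²]` on it. -/
theorem qf_bounds {α₂ : ℝ} (hα : 0 < α₂) {h : ℕ} (hh : 0 < h) (hαh : 10 * α₂ ≤ (h : ℝ) ^ 2)
    {M : ℕ} {p : ℕ × ℕ} (hp : p ∈ box M h) :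
    (M : ℝ) ^ 2 ≤ qf α₂ p ∧ qf α₂ p ≤ 5 * (M : ℝ) ^ 2 := by
  simp only [box, Finset.mem_product, Finset.mem_Ioc, Finset.mem_Icc] at hp
  obtain ⟨⟨h1, h2⟩, h3, h4⟩ := hp
  have g1 : (M : ℝ) ≤ p.1 := by exact_mod_cast h1.le
  have g2 : (p.1 : ℝ) ≤ 2 * M := by exact_mod_cast h2
  have g4 : (p.2 : ℝ) * h ≤ M := by exact_mod_cast (Nat.le_div_iff_mul_le hh).mp h4
  have g5 : ((p.2 : ℝ) * h) ^ 2 ≤ (M : ℝ) ^ 2 := pow_le_pow_left₀ (by positivity) g4 2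
  have g6 : 10 * (α₂ * (p.2 : ℝ) ^ 2) ≤ (M : ℝ) ^ 2 := by nlinarith [sq_nonneg (p.2 : ℝ)]
  have g7 : 0 ≤ α₂ * (p.2 : ℝ) ^ 2 := by positivity
  have g8 : 0 ≤ (M : ℝ) := by positivity
  simp only [qf]
  constructor <;> nlinarith

/-- Mean square bound for `bsum`. -/
theorem exists_integral_norm_sq_bsum_le {α₂ : ℝ} (hα : 0 < α₂) {h : ℕ} (hh : 0 < h)
    (hαh : 10 * α₂ ≤ (h : ℝ) ^ 2) {ε : ℝ} (hε : 0 < ε) :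
    ∃ C : ℝ, 0 < C ∧ ∀ M : ℕ, 0 < M → ∀ ξ T : ℝ, |ξ| ≤ (M : ℝ) ^ 2 / 2 → (M : ℝ) ^ 2 ≤ T →
      ∫ τ in Set.Icc (-T) T, ‖bsum α₂ ξ M h τ‖ ^ 2 ≤ C * (T * (M : ℝ) ^ (2 + ε)) := by
  -- On the box `qf - ξ` is at most `6M²`. Logarithms that differ by at most `1/T ≤ 1/M²` therefore
  -- belong to values that differ by at most `6`.
  obtain ⟨C, hC0, hC⟩ := exists_card_close_pairs_le hα 6 hε
  refine ⟨256 * C, by positivity, fun M hM ξ T hξ hT => ?_⟩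
  have hM0 : (0 : ℝ) < M := by exact_mod_cast hM
  have hT0 : 0 < T := lt_of_lt_of_le (by positivity) hT
  have h1 := integral_norm_sq_le_card (box M h) (fun p => Real.log (qf α₂ p - ξ)) hT0
  refine h1.trans ?_
  have h2 : ((((box M h) ×ˢ (box M h)).filter (fun p =>
      |Real.log (qf α₂ p.1 - ξ) - Real.log (qf α₂ p.2 - ξ)| ≤ 1 / T)).card : ℝ) ≤
      C * (M : ℝ) ^ (2 + ε) := by
    refine le_trans ?_ (hC M h hM)
    norm_cast
    refine Finset.card_le_card (fun p hp => ?_)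
    obtain ⟨hp1, hp2⟩ := Finset.mem_filter.mp hp
    refine Finset.mem_filter.mpr ⟨hp1, ?_⟩
    obtain ⟨m1, m2⟩ := Finset.mem_product.mp hp1
    obtain ⟨a1, a2⟩ := qf_bounds hα hh hαh m1
    obtain ⟨b1, b2⟩ := qf_bounds hα hh hαh m2
    obtain ⟨c1, c2⟩ := abs_le.mp hξ
    set A := qf α₂ p.1 - ξ with hA
    set B := qf α₂ p.2 - ξ with hB
    have hMsq : 0 < (M : ℝ) ^ 2 := by positivity
    have hA0 : 0 < A := by rw [hA]; linarith
    have hB0 : 0 < B := by rw [hB]; linarith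
    have hA6 : A ≤ 6 * (M : ℝ) ^ 2 := by rw [hA]; linarith
    have hB6 : B ≤ 6 * (M : ℝ) ^ 2 := by rw [hB]; linarith
    have key : ∀ x y : ℝ, 0 < x → 0 < y → x ≤ 6 * (M : ℝ) ^ 2 →
        Real.log x - Real.log y ≤ 1 / T → x - y ≤ 6 := fun x y hx hy hx6 hlog => by
      have := Real.one_sub_inv_le_log_of_pos (x := x / y) (by positivity)
      rw [Real.log_div hx.ne' hy.ne', inv_div] at this
      have h3 : 1 - y / x ≤ 1 / (M : ℝ) ^ 2 := by
        calc _ ≤ 1 / T := by linarith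
          _ ≤ _ := by gcongr
      have h4 : x - y = x * (1 - y / x) := by field_simp
      rw [h4]
      calc x * (1 - y / x) ≤ x * (1 / (M : ℝ) ^ 2) := by gcongr
        _ ≤ (6 * (M : ℝ) ^ 2) * (1 / (M : ℝ) ^ 2) := by gcongr
        _ = 6 := by field_simp
    obtain ⟨l1, l2⟩ := abs_le.mp hp2
    have k1 := key A B hA0 hB0 hA6 l2
    have k2 := key B A hB0 hA0 hB6 (by linarith)
    rw [hA, hB] at k1 k2
    rw [abs_le]; constructor <;> linarith
  calc _ ≤ 256 * T * (C * (M : ℝ) ^ (2 + ε)) := by gcongr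
    _ = _ := by ring

/-! ### Removing the cubic remainder of the phase on a block -/

/-- Two-dimensional Abel inequality. -/
theorem norm_sum_mul_le_of_rect_sums (a b : ℕ → ℕ → ℂ) {K n₁ n₂ : ℕ} (hK : 0 < K) (h₁ : n₁ ≤ K)
    (h₂ : n₂ ≤ K) {c B : ℝ} (hc : 0 ≤ c)
    (hB : ∀ m₁ ≤ n₁, ∀ m₂ ≤ n₂, ‖∑ i ∈ Finset.range m₁, ∑ j ∈ Finset.range m₂, b i j‖ ≤ B)
    (ha : ∀ i < K, ∀ j < K, ‖a i j‖ ≤ 1)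
    (ha₁ : ∀ i, i + 1 < K → ∀ j < K, ‖a (i + 1) j - a i j‖ ≤ c / K)
    (ha₂ : ∀ i < K, ∀ j, j + 1 < K → ‖a i (j + 1) - a i j‖ ≤ c / K)
    (ha₁₂ : ∀ i, i + 1 < K → ∀ j, j + 1 < K →
      ‖(a (i + 1) (j + 1) - a i (j + 1)) - (a (i + 1) j - a i j)‖ ≤ c / K ^ 2) :
    ‖∑ i ∈ Finset.range n₁, ∑ j ∈ Finset.range n₂, a i j * b i j‖ ≤ (1 + 3 * c) * B := by
  have hB0 : 0 ≤ B := (norm_nonneg _).trans (hB 0 (Nat.zero_le _) 0 (Nat.zero_le _))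
  have hKr : (0 : ℝ) < K := by exact_mod_cast hK
  rcases Nat.eq_zero_or_pos n₁ with h0 | h0
  · subst h0; simp; positivity
  rcases Nat.eq_zero_or_pos n₂ with h0' | h0'
  · subst h0'; simp; positivity
  set P : ℕ → ℕ → ℂ := fun i j => ∑ i' ∈ Finset.range i, b i' j with hP
  have hPs : ∀ i ≤ n₁, ∀ m ≤ n₂, ‖∑ j ∈ Finset.range m, P i j‖ ≤ B := fun i hi m hm => by
    simp only [hP]; rw [Finset.sum_comm]; exact hB i hi m hm
  -- Summation by parts in the first variable for each `j`; Abel's inequality in the second variable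
  -- is then applied to each of the resulting sums.
  have key : ∑ i ∈ Finset.range n₁, ∑ j ∈ Finset.range n₂, a i j * b i j =
      ∑ j ∈ Finset.range n₂, a (n₁ - 1) j * P n₁ j - ∑ i ∈ Finset.range (n₁ - 1),
        ∑ j ∈ Finset.range n₂, (a (i + 1) j - a i j) * P (i + 1) j := by
    rw [Finset.sum_comm, Finset.sum_comm (s := Finset.range (n₁ - 1)), ← Finset.sum_sub_distrib]
    refine Finset.sum_congr rfl fun j _ => ?_
    have := Finset.sum_range_by_parts (fun i => a i j) (fun i => b i j) n₁
    simp only [smul_eq_mul] at this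
    rw [this]
  have e1 : ∀ n, n ≤ K → (n : ℝ) * (c / K) ≤ c := fun n hn => by
    have : (n : ℝ) ≤ K := by exact_mod_cast hn
    rw [← mul_div_assoc, div_le_iff₀ hKr]; nlinarith
  have b1 : ‖∑ j ∈ Finset.range n₂, a (n₁ - 1) j * P n₁ j‖ ≤ (1 + c) * B := by
    refine (norm_sum_mul_le_of_partial_sums _ _ n₂ (B := B) (fun m hm => hPs n₁ le_rfl m hm)).trans ?_
    gcongr
    · exact ha _ (by lia) _ (by lia)
    · refine (Finset.sum_le_sum (fun j hj => ha₂ (n₁ - 1) (by lia) j (by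
        have := Finset.mem_range.mp hj; lia))).trans ?_
      rw [Finset.sum_const, Finset.card_range, nsmul_eq_mul]
      exact e1 _ (by lia)
  have b2 : ∀ i ∈ Finset.range (n₁ - 1),
      ‖∑ j ∈ Finset.range n₂, (a (i + 1) j - a i j) * P (i + 1) j‖ ≤ 2 * (c / K) * B := by
    intro i hi
    have hi' := Finset.mem_range.mp hi
    refine (norm_sum_mul_le_of_partial_sums (fun j => a (i + 1) j - a i j) _ n₂ (B := B)
      (fun m hm => hPs (i + 1) (by lia) m hm)).trans ?_
    gcongr
    have s1 := ha₁ i (by lia) (n₂ - 1) (by lia)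
    have s2 : ∑ j ∈ Finset.range (n₂ - 1),
        ‖(a (i + 1) (j + 1) - a i (j + 1)) - (a (i + 1) j - a i j)‖ ≤ c / K := by
      refine (Finset.sum_le_sum (fun j hj => ha₁₂ i (by lia) j (by
        have := Finset.mem_range.mp hj; lia))).trans ?_
      rw [Finset.sum_const, Finset.card_range, nsmul_eq_mul]
      have h3 := e1 (n₂ - 1) (by lia)
      calc ((n₂ - 1 : ℕ) : ℝ) * (c / K ^ 2) = ((n₂ - 1 : ℕ) : ℝ) * (c / K) / K := by
            field_simp
        _ ≤ _ := by gcongr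
    linarith
  rw [key]
  refine (norm_sub_le _ _).trans ?_
  have b3 : ‖∑ i ∈ Finset.range (n₁ - 1),
        ∑ j ∈ Finset.range n₂, (a (i + 1) j - a i j) * P (i + 1) j‖ ≤ 2 * c * B := by
    refine (norm_sum_le _ _).trans ((Finset.sum_le_sum b2).trans ?_)
    rw [Finset.sum_const, Finset.card_range, nsmul_eq_mul]
    have h3 := e1 (n₁ - 1) (by lia)
    calc _ = 2 * (((n₁ - 1 : ℕ) : ℝ) * (c / K)) * B := by ring
      _ ≤ _ := by gcongr
  linarith

theorem norm_ex_mixed_difference_le {r₀₀ r₁₀ r₀₁ r₁₁ A D : ℝ} (h1 : |r₁₀ - r₀₀| ≤ A)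
    (h2 : |r₁₁ - r₁₀| ≤ A) (h3 : |(r₁₁ - r₁₀) - (r₀₁ - r₀₀)| ≤ D) :
    ‖(ex r₁₁ - ex r₀₁) - (ex r₁₀ - ex r₀₀)‖ ≤ (2 * Real.pi * A) ^ 2 + 2 * Real.pi * D := by
  -- Discrete product rule: the first product consists of two first differences, the second contains
  -- the mixed difference of the phases.
  have e : (ex r₁₁ - ex r₀₁) - (ex r₁₀ - ex r₀₀) = (ex r₁₀ - ex r₀₀) * (ex (r₁₁ - r₁₀) - ex 0) +
      ex r₀₀ * (ex (r₁₁ - r₁₀) - ex (r₀₁ - r₀₀)) := by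
    have e1 : ex r₁₁ = ex r₁₀ * ex (r₁₁ - r₁₀) := by rw [← ex_add]; ring_nf
    have e2 : ex r₀₁ = ex r₀₀ * ex (r₀₁ - r₀₀) := by rw [← ex_add]; ring_nf
    rw [e1, e2, ex_zero]; ring
  rw [e]
  have hp := Real.pi_pos
  refine (norm_add_le _ _).trans (add_le_add ?_ ?_)
  · rw [norm_mul, sq]
    refine mul_le_mul ((norm_ex_sub_ex_le _ _).trans (by gcongr))
      ((norm_ex_sub_ex_le _ _).trans ?_) (norm_nonneg _) ?_
    · rw [sub_zero]; gcongr
    · have : 0 ≤ A := (abs_nonneg _).trans h1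
      positivity
  · rw [norm_mul, norm_ex, one_mul]
    exact (norm_ex_sub_ex_le _ _).trans (by gcongr)

/-- The remainder of the phase `log |z + ω|² - ξ` after removing its quadratic Taylor polynomial;
here `z = b₁ + i β b₂` and `ω = s + i β t`. -/
noncomputable def phaseRem (β ξ b₁ b₂ s t : ℝ) : ℝ :=
  Real.log ((b₁ + s) ^ 2 + β ^ 2 * (b₂ + t) ^ 2 - ξ) -
    (2 * (s * (1 / ((b₁ : ℂ) + β * b₂ * Complex.I)).re
        - β * t * (1 / ((b₁ : ℂ) + β * b₂ * Complex.I)).im)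
      - ((s ^ 2 - β ^ 2 * t ^ 2) * (1 / ((b₁ : ℂ) + β * b₂ * Complex.I) ^ 2).re
        - 2 * β * s * t * (1 / ((b₁ : ℂ) + β * b₂ * Complex.I) ^ 2).im))

/-- The geometric data of a block of size `K` at scale `M`. -/
structure BlockData (β ξ M K b₁ b₂ : ℝ) : Prop where
  hβ : 0 < β
  hK : 1 ≤ K
  hKM : K ≤ M
  hb₁ : M ≤ b₁
  hb₁' : b₁ ≤ 3 * M
  hb₂ : 0 ≤ b₂
  hb₂' : b₂ ≤ 3 * M
  hξ : |ξ| ≤ K ^ 2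
  hξ' : |ξ| ≤ M ^ 2 / 2

section
variable {β ξ M K b₁ b₂ : ℝ}

/-- `1/(z+ω)` minus its linear Taylor polynomial. -/
noncomputable def invRem (z ω : ℂ) : ℂ := ω ^ 2 / (z ^ 2 * (z + ω))

theorem invRem_eq {z ω : ℂ} (hz : z ≠ 0) (hzω : z + ω ≠ 0) :
    1 / (z + ω) - 1 / z + ω / z ^ 2 = invRem z ω := by
  rw [invRem]; field_simp; ring

/-- The explicit factor `ω' - ω`, which is `O(1)` for neighbouring lattice points, is what makes
mixed differences of the remainder smaller than first differences by a factor `K`. -/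
theorem invRem_sub {z ω ω' : ℂ} (hz : z ≠ 0) (h : z + ω ≠ 0) (h' : z + ω' ≠ 0) :
    invRem z ω' - invRem z ω =
      (ω' - ω) * (ω' / (z ^ 2 * (z + ω')) + ω / (z * (z + ω) * (z + ω'))) := by
  simp only [invRem]; field_simp; ring

theorem norm_lower (hM : 0 < M) {x y : ℝ} (hx : M ≤ x) : M ≤ ‖(x : ℂ) + y * Complex.I‖ ∧
    (x : ℂ) + y * Complex.I ≠ 0 := by
  have h : M ≤ ‖(x : ℂ) + y * Complex.I‖ := by
    have := Complex.re_le_norm ((x : ℂ) + y * Complex.I)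
    simp at this; linarith
  exact ⟨h, fun h0 => by rw [h0, norm_zero] at h; linarith⟩

theorem norm_offset_le (hβ : 0 < β) {s t : ℝ} (hs : 0 ≤ s) (hs' : s ≤ K) (ht : 0 ≤ t)
    (ht' : t ≤ K) : ‖(s : ℂ) + β * t * Complex.I‖ ≤ (1 + β) * K := by
  refine (norm_add_le _ _).trans ?_
  simp only [norm_mul, Complex.norm_real, Complex.norm_I, mul_one, Real.norm_eq_abs,
    abs_of_nonneg hs, abs_of_nonneg ht, abs_of_pos hβ]
  nlinarith

theorem norm_invRem_le (hM : 0 < M) {z ω : ℂ} (hz : M ≤ ‖z‖) (hzω : M ≤ ‖z + ω‖) {c : ℝ}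
    (hω : ‖ω‖ ≤ c) : ‖invRem z ω‖ ≤ c ^ 2 / M ^ 3 := by
  rw [invRem, norm_div, norm_mul, norm_pow, norm_pow, show M ^ 3 = M ^ 2 * M by ring]
  gcongr

theorem norm_invRem_sub_le (hM : 0 < M) {z ω ω' : ℂ} (hz : M ≤ ‖z‖) (hzω : M ≤ ‖z + ω‖)
    (hzω' : M ≤ ‖z + ω'‖) {c : ℝ} (hω : ‖ω‖ ≤ c) (hω' : ‖ω'‖ ≤ c) :
    ‖invRem z ω' - invRem z ω‖ ≤ ‖ω' - ω‖ * (2 * c / M ^ 3) := by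
  have hc : 0 ≤ c := (norm_nonneg _).trans hω
  have n0 : ∀ {x : ℂ}, M ≤ ‖x‖ → x ≠ 0 := fun h h0 => by rw [h0, norm_zero] at h; linarith
  rw [invRem_sub (n0 hz) (n0 hzω) (n0 hzω'), norm_mul]
  gcongr
  refine (norm_add_le _ _).trans ?_
  rw [norm_div, norm_div, norm_mul, norm_mul, norm_mul, norm_pow]
  have e : 2 * c / M ^ 3 = c / (M ^ 2 * M) + c / (M * M * M) := by field_simp; ring
  rw [e]
  gcongr

/-- The error made in `1/q` by the shift `ξ`. -/
noncomputable def shiftErr (ξ q : ℝ) : ℝ := 1 / (q - ξ) - 1 / q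

theorem abs_shiftErr_le (hM : 0 < M) (hξ : |ξ| ≤ M ^ 2 / 2) {q : ℝ} (hq : M ^ 2 ≤ q) :
    |shiftErr ξ q| ≤ 2 * |ξ| / M ^ 4 := by
  have hM2 : 0 < M ^ 2 := by positivity
  have h1 := (abs_le.mp hξ).2
  have hq0 : 0 < q := by linarith
  have hq1 : M ^ 2 / 2 ≤ q - ξ := by linarith
  have hq2 : 0 < q - ξ := by linarith
  have e : shiftErr ξ q = ξ / ((q - ξ) * q) := by rw [shiftErr]; field_simp; ring
  rw [e, abs_div, abs_of_pos (by positivity : 0 < (q - ξ) * q)]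
  calc _ ≤ |ξ| / ((M ^ 2 / 2) * M ^ 2) := by gcongr
    _ = _ := by field_simp

theorem abs_shiftErr_sub_le (hM : 0 < M) (hξ : |ξ| ≤ M ^ 2 / 2) {q q' : ℝ} (hq : M ^ 2 ≤ q)
    (hq' : M ^ 2 ≤ q') : |shiftErr ξ q' - shiftErr ξ q| ≤ |q' - q| * (6 * |ξ| / M ^ 6) := by
  have hM2 : 0 < M ^ 2 := by positivity
  have h1 := (abs_le.mp hξ).2
  have hq0 : 0 < q := by linarith
  have hq1 : M ^ 2 / 2 ≤ q - ξ := by linarith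
  have hq2 : 0 < q - ξ := by linarith
  have hq0' : 0 < q' := by linarith
  have hq1' : M ^ 2 / 2 ≤ q' - ξ := by linarith
  have hq2' : 0 < q' - ξ := by linarith
  have e : shiftErr ξ q' - shiftErr ξ q =
      -((q' - q) * (ξ / (q * (q - ξ) * (q' - ξ)) + ξ / (q * q' * (q' - ξ)))) := by
    simp only [shiftErr]; field_simp; ring
  rw [e, abs_neg, abs_mul]
  gcongr
  refine (abs_add_le _ _).trans ?_
  rw [abs_div, abs_div, abs_of_pos (by positivity : 0 < q * (q - ξ) * (q' - ξ)),
    abs_of_pos (by positivity : 0 < q * q' * (q' - ξ))]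
  have e2 : 6 * |ξ| / M ^ 6 = |ξ| / (M ^ 2 * (M ^ 2 / 2) * (M ^ 2 / 2)) +
      |ξ| / (M ^ 2 * M ^ 2 * (M ^ 2 / 2)) := by field_simp; ring
  rw [e2]
  gcongr

end

section
variable {β ξ M K b₁ b₂ : ℝ}

theorem re_one_div_add_mul_I (x y : ℝ) :
    (1 / ((x : ℂ) + y * Complex.I)).re = x / (x ^ 2 + y ^ 2) ∧
      (1 / ((x : ℂ) + y * Complex.I)).im = -(y / (x ^ 2 + y ^ 2)) := by
  rw [one_div, Complex.inv_re, Complex.inv_im]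
  simp [Complex.normSq_apply]
  constructor <;> ring_nf

/-- The base point of a block. -/
noncomputable def blockPt (β b₁ b₂ : ℝ) : ℂ := (b₁ : ℂ) + ((β * b₂ : ℝ) : ℂ) * Complex.I

/-- The partial derivatives of `phaseRem`. -/
noncomputable def phaseRem₁ (β ξ b₁ b₂ s t : ℝ) : ℝ :=
  2 * (b₁ + s) * shiftErr ξ ((b₁ + s) ^ 2 + β ^ 2 * (b₂ + t) ^ 2)
    + 2 * (invRem (blockPt β b₁ b₂) (blockPt β s t)).re

noncomputable def phaseRem₂ (β ξ b₁ b₂ s t : ℝ) : ℝ :=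
  2 * β ^ 2 * (b₂ + t) * shiftErr ξ ((b₁ + s) ^ 2 + β ^ 2 * (b₂ + t) ^ 2)
    - 2 * β * (invRem (blockPt β b₁ b₂) (blockPt β s t)).im

theorem blockPt_add (s t : ℝ) :
    blockPt β b₁ b₂ + blockPt β s t = blockPt β (b₁ + s) (b₂ + t) := by
  simp only [blockPt]; push_cast; ring

theorem blockPt_mul_re (s t : ℝ) (v : ℂ) : (blockPt β s t * v).re = s * v.re - β * t * v.im := by
  simp [blockPt]

theorem blockPt_mul_im (s t : ℝ) (v : ℂ) : (blockPt β s t * v).im = s * v.im + β * t * v.re := by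
  simp [blockPt]

theorem BlockData.M_pos (h : BlockData β ξ M K b₁ b₂) : 0 < M := by
  linarith [h.hK, h.hKM]

theorem BlockData.le_q (h : BlockData β ξ M K b₁ b₂) {s t : ℝ} (hs : 0 ≤ s) :
    M ^ 2 ≤ (b₁ + s) ^ 2 + β ^ 2 * (b₂ + t) ^ 2 := by
  have h1 := h.M_pos
  have h2 := h.hb₁
  have h3 : 0 ≤ β ^ 2 * (b₂ + t) ^ 2 := by positivity
  nlinarith

theorem BlockData.le_norm (h : BlockData β ξ M K b₁ b₂) {s t : ℝ} (hs : 0 ≤ s) :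
    M ≤ ‖blockPt β b₁ b₂‖ ∧ M ≤ ‖blockPt β b₁ b₂ + blockPt β s t‖ ∧ blockPt β b₁ b₂ ≠ 0 ∧
      blockPt β b₁ b₂ + blockPt β s t ≠ 0 := by
  rw [blockPt_add]
  have a := norm_lower h.M_pos (y := β * b₂) h.hb₁
  have b := norm_lower h.M_pos (y := β * (b₂ + t)) (h.hb₁.trans (le_add_of_nonneg_right hs))
  exact ⟨a.1, b.1, a.2, b.2⟩

/-- The gradient of `log |z + ω|²` is given by the real and imaginary parts of `2/(z + ω)`, so the
real partial derivatives of the Taylor remainder of the logarithm are read off from the complex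
remainder of `1/(z + ω)`. -/
theorem invRem_re_im (h : BlockData β ξ M K b₁ b₂) {s t : ℝ} (hs : 0 ≤ s) :
    (invRem (blockPt β b₁ b₂) (blockPt β s t)).re =
      (b₁ + s) / ((b₁ + s) ^ 2 + β ^ 2 * (b₂ + t) ^ 2) - (1 / blockPt β b₁ b₂).re
        + (s * (1 / blockPt β b₁ b₂ ^ 2).re - β * t * (1 / blockPt β b₁ b₂ ^ 2).im) ∧
    (invRem (blockPt β b₁ b₂) (blockPt β s t)).im =
      -(β * (b₂ + t) / ((b₁ + s) ^ 2 + β ^ 2 * (b₂ + t) ^ 2)) - (1 / blockPt β b₁ b₂).im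
        + (s * (1 / blockPt β b₁ b₂ ^ 2).im + β * t * (1 / blockPt β b₁ b₂ ^ 2).re) := by
  obtain ⟨-, -, h1, h2⟩ := h.le_norm (t := t) hs
  have e := re_one_div_add_mul_I (b₁ + s) (β * (b₂ + t))
  rw [mul_pow] at e
  rw [← invRem_eq h1 h2, blockPt_add, ← blockPt_mul_re s t, ← blockPt_mul_im s t,
    div_eq_mul_one_div (blockPt β s t), Complex.add_re, Complex.add_im, Complex.sub_re,
    Complex.sub_im]
  have e1 : 1 / blockPt β (b₁ + s) (b₂ + t) =
    1 / (((b₁ + s : ℝ) : ℂ) + ((β * (b₂ + t) : ℝ) : ℂ) * Complex.I) := rfl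
  rw [e1, e.1, e.2]
  exact ⟨rfl, rfl⟩

theorem phaseRem_eq (s t : ℝ) : phaseRem β ξ b₁ b₂ s t =
    Real.log ((b₁ + s) ^ 2 + β ^ 2 * (b₂ + t) ^ 2 - ξ) -
    (2 * (s * (1 / blockPt β b₁ b₂).re - β * t * (1 / blockPt β b₁ b₂).im)
      - ((s ^ 2 - β ^ 2 * t ^ 2) * (1 / blockPt β b₁ b₂ ^ 2).re
        - 2 * β * s * t * (1 / blockPt β b₁ b₂ ^ 2).im)) := by
  simp only [phaseRem, blockPt]; push_cast; rfl

theorem hasDerivAt_phaseRem₁ (h : BlockData β ξ M K b₁ b₂) {s t : ℝ} (hs : 0 ≤ s) :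
    HasDerivAt (fun s => phaseRem β ξ b₁ b₂ s t) (phaseRem₁ β ξ b₁ b₂ s t) s := by
  have hq := h.le_q (t := t) hs
  have hM2 : 0 < M ^ 2 := by have := h.M_pos; positivity
  have hξ := (abs_le.mp h.hξ').2
  have hq2 : 0 < (b₁ + s) ^ 2 + β ^ 2 * (b₂ + t) ^ 2 - ξ := by linarith
  have hq1 : 0 < (b₁ + s) ^ 2 + β ^ 2 * (b₂ + t) ^ 2 := by linarith
  simp only [phaseRem_eq]
  have d0 : HasDerivAt (fun s : ℝ => (b₁ + s)) 1 s := (hasDerivAt_id s).const_add b₁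
  have d1 := (((d0.pow 2).add_const (β ^ 2 * (b₂ + t) ^ 2)).sub_const ξ).log hq2.ne'
  have d2 := (((hasDerivAt_id s).mul_const (1 / blockPt β b₁ b₂).re).sub_const
    (β * t * (1 / blockPt β b₁ b₂).im)).const_mul 2
  have d3 := (((hasDerivAt_id s).pow 2).sub_const (β ^ 2 * t ^ 2)).mul_const
    (1 / blockPt β b₁ b₂ ^ 2).re
  have d4 := (((hasDerivAt_id s).const_mul (2 * β)).mul_const t).mul_const
    (1 / blockPt β b₁ b₂ ^ 2).im
  refine (d1.sub (d2.sub (d3.sub d4))).congr_deriv ?_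
  rw [phaseRem₁, shiftErr, (invRem_re_im h hs).1]
  simp only [id, Pi.pow_apply]
  generalize (1 / blockPt β b₁ b₂).re = A₁
  generalize (1 / blockPt β b₁ b₂).im = A₂
  generalize (1 / blockPt β b₁ b₂ ^ 2).re = A₃
  generalize (1 / blockPt β b₁ b₂ ^ 2).im = A₄
  field_simp
  ring

theorem hasDerivAt_phaseRem₂ (h : BlockData β ξ M K b₁ b₂) {s t : ℝ} (hs : 0 ≤ s) :
    HasDerivAt (fun t => phaseRem β ξ b₁ b₂ s t) (phaseRem₂ β ξ b₁ b₂ s t) t := by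
  have hq := h.le_q (t := t) hs
  have hM2 : 0 < M ^ 2 := by have := h.M_pos; positivity
  have hξ := (abs_le.mp h.hξ').2
  have hq2 : 0 < (b₁ + s) ^ 2 + β ^ 2 * (b₂ + t) ^ 2 - ξ := by linarith
  have hq1 : 0 < (b₁ + s) ^ 2 + β ^ 2 * (b₂ + t) ^ 2 := by linarith
  simp only [phaseRem_eq]
  have d0 : HasDerivAt (fun t : ℝ => (b₂ + t)) 1 t := (hasDerivAt_id t).const_add b₂
  have d1 := ((((d0.pow 2).const_mul (β ^ 2)).const_add ((b₁ + s) ^ 2)).sub_const ξ).log hq2.ne'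
  have d2 := ((((hasDerivAt_id t).const_mul β).mul_const (1 / blockPt β b₁ b₂).im).const_sub
    (s * (1 / blockPt β b₁ b₂).re)).const_mul 2
  have d3 := ((((hasDerivAt_id t).pow 2).const_mul (β ^ 2)).const_sub (s ^ 2)).mul_const
    (1 / blockPt β b₁ b₂ ^ 2).re
  have d4 := ((hasDerivAt_id t).const_mul (2 * β * s)).mul_const
    (1 / blockPt β b₁ b₂ ^ 2).im
  refine (d1.sub (d2.sub (d3.sub d4))).congr_deriv ?_
  rw [phaseRem₂, shiftErr, (invRem_re_im h hs).2]
  simp only [id, Pi.pow_apply]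
  generalize (1 / blockPt β b₁ b₂).re = A₁
  generalize (1 / blockPt β b₁ b₂).im = A₂
  generalize (1 / blockPt β b₁ b₂ ^ 2).re = A₃
  generalize (1 / blockPt β b₁ b₂ ^ 2).im = A₄
  field_simp
  ring

theorem norm_blockPt_le (h : BlockData β ξ M K b₁ b₂) {s t : ℝ} (hs : 0 ≤ s) (hs' : s ≤ K)
    (ht : 0 ≤ t) (ht' : t ≤ K) : ‖blockPt β s t‖ ≤ (1 + β) * K := by
  have := norm_offset_le h.hβ hs hs' ht ht'
  rw [blockPt]; push_cast; exact this

/-- `K²/M³` is the derivative of a cubic remainder with `ω` of size `K` and `z` of size `M`. The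
shift contributes `M · |ξ|/M⁴`, which fits because `|ξ| ≤ K²`. -/
theorem abs_phaseRem_deriv_le (h : BlockData β ξ M K b₁ b₂) {s t : ℝ} (hs : 0 ≤ s) (hs' : s ≤ K)
    (ht : 0 ≤ t) (ht' : t ≤ K) :
    |phaseRem₁ β ξ b₁ b₂ s t| ≤ 440 * (1 + β) ^ 3 * (K ^ 2 / M ^ 3) ∧
    |phaseRem₂ β ξ b₁ b₂ s t| ≤ 440 * (1 + β) ^ 3 * (K ^ 2 / M ^ 3) := by
  have hM := h.M_pos
  have hβ := h.hβ
  have hK := h.hK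
  obtain ⟨n1, n2, -, -⟩ := h.le_norm (t := t) hs
  have i1 := norm_invRem_le hM n1 n2 (norm_blockPt_le h hs hs' ht ht')
  have i2 := (Complex.abs_re_le_norm _).trans i1
  have i3 := (Complex.abs_im_le_norm _).trans i1
  have s1 := abs_shiftErr_le hM h.hξ' (h.le_q (t := t) hs)
  have s2 : 2 * |ξ| / M ^ 4 ≤ 2 * K ^ 2 / M ^ 4 := by have := h.hξ; gcongr
  have s3 := s1.trans s2
  have c1 : |b₁ + s| ≤ 4 * M := by
    rw [abs_of_nonneg (by linarith [h.hb₁])]; linarith [h.hb₁', h.hKM]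
  have c2 : |b₂ + t| ≤ 4 * M := by
    rw [abs_of_nonneg (by linarith [h.hb₂])]; linarith [h.hb₂', h.hKM]
  have hX : 0 ≤ K ^ 2 / M ^ 3 := by positivity
  have f1 : ((1 + β) * K) ^ 2 / M ^ 3 = (1 + β) ^ 2 * (K ^ 2 / M ^ 3) := by ring
  have f2 : 4 * M * (2 * K ^ 2 / M ^ 4) = 8 * (K ^ 2 / M ^ 3) := by field_simp; norm_num
  rw [f1] at i2 i3
  have p1 : |b₁ + s| * |shiftErr ξ ((b₁ + s) ^ 2 + β ^ 2 * (b₂ + t) ^ 2)| ≤ 8 * (K ^ 2 / M ^ 3) :=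
    (mul_le_mul c1 s3 (abs_nonneg _) (by positivity)).trans_eq f2
  have p2 : |b₂ + t| * |shiftErr ξ ((b₁ + s) ^ 2 + β ^ 2 * (b₂ + t) ^ 2)| ≤ 8 * (K ^ 2 / M ^ 3) :=
    (mul_le_mul c2 s3 (abs_nonneg _) (by positivity)).trans_eq f2
  constructor
  · rw [phaseRem₁]
    refine (abs_add_le _ _).trans ?_
    rw [abs_mul, abs_mul, abs_mul, abs_two]
    have : 2 * |b₁ + s| * |shiftErr ξ ((b₁ + s) ^ 2 + β ^ 2 * (b₂ + t) ^ 2)| +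
      2 * |(invRem (blockPt β b₁ b₂) (blockPt β s t)).re| ≤
        (16 + 2 * (1 + β) ^ 2) * (K ^ 2 / M ^ 3) := by linarith
    refine this.trans (mul_le_mul_of_nonneg_right ?_ hX)
    nlinarith [sq_nonneg β, mul_pos hβ hβ, mul_pos (mul_pos hβ hβ) hβ]
  · rw [phaseRem₂]
    refine (abs_sub _ _).trans ?_
    rw [abs_mul, abs_mul, abs_mul, abs_mul, abs_mul, abs_two, abs_pow, abs_of_pos hβ]
    have : 2 * β ^ 2 * |b₂ + t| * |shiftErr ξ ((b₁ + s) ^ 2 + β ^ 2 * (b₂ + t) ^ 2)| +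
      2 * β * |(invRem (blockPt β b₁ b₂) (blockPt β s t)).im| ≤
        (16 * β ^ 2 + 2 * β * (1 + β) ^ 2) * (K ^ 2 / M ^ 3) := by
      have q1 := mul_le_mul_of_nonneg_left p2 (by positivity : 0 ≤ 2 * β ^ 2)
      have q2 := mul_le_mul_of_nonneg_left i3 (by positivity : 0 ≤ 2 * β)
      linarith
    refine this.trans (mul_le_mul_of_nonneg_right ?_ hX)
    nlinarith [sq_nonneg β, mul_pos hβ hβ, mul_pos (mul_pos hβ hβ) hβ]

/-- One power of `K` is gained over the derivative bound. For the shift one gets `K²/M⁴`, and `K ≤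
M` reduces it to `K/M³`. -/
theorem abs_phaseRem₁_sub_le (h : BlockData β ξ M K b₁ b₂) {s t : ℝ} (hs : 0 ≤ s) (hs' : s ≤ K)
    (ht : 0 ≤ t) (ht' : t + 1 ≤ K) :
    |phaseRem₁ β ξ b₁ b₂ s (t + 1) - phaseRem₁ β ξ b₁ b₂ s t| ≤
      440 * (1 + β) ^ 3 * (K / M ^ 3) := by
  have hM := h.M_pos
  have hβ := h.hβ
  have hK := h.hK
  have hKM := h.hKM
  obtain ⟨n1, n2, -, -⟩ := h.le_norm (t := t) hs
  obtain ⟨-, n3, -, -⟩ := h.le_norm (t := t + 1) hs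
  have i1 := norm_invRem_sub_le hM n1 n2 n3 (norm_blockPt_le h hs hs' ht (by linarith))
    (norm_blockPt_le h hs hs' (by linarith) ht')
  have e1 : blockPt β s (t + 1) - blockPt β s t = (β : ℂ) * Complex.I := by
    simp only [blockPt]; push_cast; ring
  rw [e1, norm_mul, Complex.norm_I, Complex.norm_real, Real.norm_eq_abs, abs_of_pos hβ,
    mul_one] at i1
  have i2 := (Complex.abs_re_le_norm _).trans i1
  rw [Complex.sub_re] at i2
  have s1 := abs_shiftErr_sub_le hM h.hξ' (h.le_q (t := t) hs) (h.le_q (t := t + 1) hs)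
  have eq : (b₁ + s) ^ 2 + β ^ 2 * (b₂ + (t + 1)) ^ 2 - ((b₁ + s) ^ 2 + β ^ 2 * (b₂ + t) ^ 2) =
    β ^ 2 * (2 * (b₂ + t) + 1) := by ring
  rw [eq, abs_of_nonneg (mul_nonneg (sq_nonneg β) (by linarith [h.hb₂]))] at s1
  have s2 : β ^ 2 * (2 * (b₂ + t) + 1) * (6 * |ξ| / M ^ 6) ≤
      β ^ 2 * (9 * M) * (6 * K ^ 2 / M ^ 6) := by
    have := h.hξ
    gcongr
    linarith [h.hb₂']
  have c1 : |b₁ + s| ≤ 4 * M := by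
    rw [abs_of_nonneg (by linarith [h.hb₁])]; linarith [h.hb₁', h.hKM]
  have hX : 0 ≤ K / M ^ 3 := by positivity
  have p1 := mul_le_mul c1 (s1.trans s2) (abs_nonneg _) (by positivity)
  have p2 : 4 * M * (β ^ 2 * (9 * M) * (6 * K ^ 2 / M ^ 6)) ≤ 216 * β ^ 2 * (K / M ^ 3) := by
    have : 4 * M * (β ^ 2 * (9 * M) * (6 * K ^ 2 / M ^ 6)) =
      216 * β ^ 2 * (K / M ^ 3 * (K / M)) := by field_simp; ring
    rw [this]
    have : K / M ≤ 1 := (div_le_one hM).mpr hKM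
    have := mul_le_mul_of_nonneg_left this hX
    gcongr
    linarith
  have e3 : phaseRem₁ β ξ b₁ b₂ s (t + 1) - phaseRem₁ β ξ b₁ b₂ s t =
      2 * ((b₁ + s) * (shiftErr ξ ((b₁ + s) ^ 2 + β ^ 2 * (b₂ + (t + 1)) ^ 2)
        - shiftErr ξ ((b₁ + s) ^ 2 + β ^ 2 * (b₂ + t) ^ 2)))
      + 2 * ((invRem (blockPt β b₁ b₂) (blockPt β s (t + 1))).re
        - (invRem (blockPt β b₁ b₂) (blockPt β s t)).re) := by
    simp only [phaseRem₁]; ring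
  rw [e3]
  refine (abs_add_le _ _).trans ?_
  rw [abs_mul, abs_mul, abs_mul, abs_two]
  have e4 : β * (2 * ((1 + β) * K) / M ^ 3) = 2 * β * (1 + β) * (K / M ^ 3) := by ring
  rw [e4] at i2
  have : 2 * (|b₁ + s| * |shiftErr ξ ((b₁ + s) ^ 2 + β ^ 2 * (b₂ + (t + 1)) ^ 2)
        - shiftErr ξ ((b₁ + s) ^ 2 + β ^ 2 * (b₂ + t) ^ 2)|)
      + 2 * |(invRem (blockPt β b₁ b₂) (blockPt β s (t + 1))).re
        - (invRem (blockPt β b₁ b₂) (blockPt β s t)).re| ≤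
      (432 * β ^ 2 + 4 * β * (1 + β)) * (K / M ^ 3) := by linarith
  refine this.trans (mul_le_mul_of_nonneg_right ?_ hX)
  nlinarith [sq_nonneg β, mul_pos hβ hβ, mul_pos (mul_pos hβ hβ) hβ]

theorem abs_sub_le_of_hasDerivAt_le {f f' : ℝ → ℝ} {a c : ℝ}
    (hf : ∀ x, a ≤ x → x ≤ a + 1 → HasDerivAt f (f' x) x)
    (hc : ∀ x, a ≤ x → x ≤ a + 1 → |f' x| ≤ c) : |f (a + 1) - f a| ≤ c := by
  have := (convex_Icc a (a + 1)).norm_image_sub_le_of_norm_hasDerivWithin_le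
    (f := f) (f' := f') (C := c) (fun x hx => (hf x hx.1 hx.2).hasDerivWithinAt)
    (fun x hx => hc x hx.1 hx.2) (x := a) (y := a + 1) ⟨le_rfl, by linarith⟩ ⟨by linarith, le_rfl⟩
  simpa using this

theorem abs_phaseRem_differences_le (h : BlockData β ξ M K b₁ b₂) :
    (∀ s t, 0 ≤ s → s + 1 ≤ K → 0 ≤ t → t ≤ K →
      |phaseRem β ξ b₁ b₂ (s + 1) t - phaseRem β ξ b₁ b₂ s t| ≤
        440 * (1 + β) ^ 3 * (K ^ 2 / M ^ 3)) ∧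
    (∀ s t, 0 ≤ s → s ≤ K → 0 ≤ t → t + 1 ≤ K →
      |phaseRem β ξ b₁ b₂ s (t + 1) - phaseRem β ξ b₁ b₂ s t| ≤
        440 * (1 + β) ^ 3 * (K ^ 2 / M ^ 3)) ∧
    (∀ s t, 0 ≤ s → s + 1 ≤ K → 0 ≤ t → t + 1 ≤ K →
      |(phaseRem β ξ b₁ b₂ (s + 1) (t + 1) - phaseRem β ξ b₁ b₂ (s + 1) t) -
        (phaseRem β ξ b₁ b₂ s (t + 1) - phaseRem β ξ b₁ b₂ s t)| ≤
        440 * (1 + β) ^ 3 * (K / M ^ 3)) := by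
  refine ⟨fun s t hs hs' ht ht' => ?_, fun s t hs hs' ht ht' => ?_, fun s t hs hs' ht ht' => ?_⟩
  · exact abs_sub_le_of_hasDerivAt_le (f := fun s => phaseRem β ξ b₁ b₂ s t)
      (fun x hx _ => hasDerivAt_phaseRem₁ h (by linarith))
      (fun x hx hx' => (abs_phaseRem_deriv_le h (by linarith) (by linarith) ht ht').1)
  · exact abs_sub_le_of_hasDerivAt_le (f := fun t => phaseRem β ξ b₁ b₂ s t)
      (fun x hx _ => hasDerivAt_phaseRem₂ h (by linarith))
      (fun x hx hx' => (abs_phaseRem_deriv_le h hs hs' (by linarith) (by linarith)).2)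
  · exact abs_sub_le_of_hasDerivAt_le
      (f := fun s => phaseRem β ξ b₁ b₂ s (t + 1) - phaseRem β ξ b₁ b₂ s t)
      (fun x hx _ => (hasDerivAt_phaseRem₁ h (by linarith)).sub
        (hasDerivAt_phaseRem₁ h (by linarith)))
      (fun x hx hx' => abs_phaseRem₁_sub_le h (by linarith) (by linarith) ht ht')

end

/-- The block length is tied to the frequency by `|τ| K³ ≤ M³`: then `|τ| K²/M³ ≤ 1/K` and `|τ| K/M³
≤ 1/K²`, which are exactly the variations allowed by the two-dimensional Abel inequality. -/
theorem blockAmplitude_bounds {β ξ M K b₁ b₂ : ℝ} (h : BlockData β ξ M K b₁ b₂) {τ C : ℝ}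
    (hτ : |τ| * K ^ 3 ≤ M ^ 3) (hC : C = 2 * Real.pi * (440 * (1 + β) ^ 3)) :
    (∀ s t, 0 ≤ s → s + 1 ≤ K → 0 ≤ t → t ≤ K →
      ‖ex (-(τ * phaseRem β ξ b₁ b₂ (s + 1) t)) - ex (-(τ * phaseRem β ξ b₁ b₂ s t))‖ ≤
        (C ^ 2 + C) / K) ∧
    (∀ s t, 0 ≤ s → s ≤ K → 0 ≤ t → t + 1 ≤ K →
      ‖ex (-(τ * phaseRem β ξ b₁ b₂ s (t + 1))) - ex (-(τ * phaseRem β ξ b₁ b₂ s t))‖ ≤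
        (C ^ 2 + C) / K) ∧
    (∀ s t, 0 ≤ s → s + 1 ≤ K → 0 ≤ t → t + 1 ≤ K →
      ‖(ex (-(τ * phaseRem β ξ b₁ b₂ (s + 1) (t + 1))) - ex (-(τ * phaseRem β ξ b₁ b₂ s (t + 1))))
        - (ex (-(τ * phaseRem β ξ b₁ b₂ (s + 1) t)) - ex (-(τ * phaseRem β ξ b₁ b₂ s t)))‖ ≤
        (C ^ 2 + C) / K ^ 2) := by
  have hM := h.M_pos
  have hK := h.hK
  have hβ := h.hβ
  obtain ⟨d1, d2, d3⟩ := abs_phaseRem_differences_le h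
  set G := 440 * (1 + β) ^ 3 with hG
  have hG0 : 0 < G := by positivity
  have hπ := Real.pi_pos
  have hC0 : 0 < C := by rw [hC]; positivity
  have g1 : |τ| * (G * (K ^ 2 / M ^ 3)) ≤ G / K := by
    rw [le_div_iff₀ (by positivity)]
    calc _ = G * (|τ| * K ^ 3 / M ^ 3) := by ring
      _ ≤ G * 1 := by gcongr; rw [div_le_one (by positivity)]; exact hτ
      _ = G := mul_one _
  have g2 : |τ| * (G * (K / M ^ 3)) ≤ G / K ^ 2 := by
    rw [le_div_iff₀ (by positivity)]
    calc _ = G * (|τ| * K ^ 3 / M ^ 3) := by ring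
      _ ≤ G * 1 := by gcongr; rw [div_le_one (by positivity)]; exact hτ
      _ = G := mul_one _
  have e : ∀ x y, |-(τ * x) - -(τ * y)| = |τ| * |x - y| := fun x y => by
    rw [← abs_mul, ← abs_neg]; ring_nf
  have k1 : ∀ x y, |x - y| ≤ G * (K ^ 2 / M ^ 3) → |-(τ * x) - -(τ * y)| ≤ G / K := fun x y hxy => by
    rw [e]; exact (mul_le_mul_of_nonneg_left hxy (abs_nonneg _)).trans g1
  have k2 : ∀ x y, |x - y| ≤ G * (K ^ 2 / M ^ 3) →
      ‖ex (-(τ * x)) - ex (-(τ * y))‖ ≤ (C ^ 2 + C) / K := fun x y hxy => by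
    refine (norm_ex_sub_ex_le _ _).trans ?_
    calc _ ≤ 2 * Real.pi * (G / K) := by gcongr; exact k1 x y hxy
      _ = C / K := by rw [hC]; ring
      _ ≤ _ := by gcongr; nlinarith
  refine ⟨fun s t hs hs' ht ht' => k2 _ _ (d1 s t hs hs' ht ht'),
    fun s t hs hs' ht ht' => k2 _ _ (d2 s t hs hs' ht ht'), fun s t hs hs' ht ht' => ?_⟩
  have m := norm_ex_mixed_difference_le
    (r₀₀ := -(τ * phaseRem β ξ b₁ b₂ s t)) (r₁₀ := -(τ * phaseRem β ξ b₁ b₂ (s + 1) t))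
    (r₀₁ := -(τ * phaseRem β ξ b₁ b₂ s (t + 1)))
    (r₁₁ := -(τ * phaseRem β ξ b₁ b₂ (s + 1) (t + 1))) (A := G / K) (D := G / K ^ 2)
    (k1 _ _ (d1 s t hs hs' ht (by linarith))) (k1 _ _ (d2 (s + 1) t (by linarith) hs' ht ht')) (by
      rw [show -(τ * phaseRem β ξ b₁ b₂ (s + 1) (t + 1)) - -(τ * phaseRem β ξ b₁ b₂ (s + 1) t)
        - (-(τ * phaseRem β ξ b₁ b₂ s (t + 1)) - -(τ * phaseRem β ξ b₁ b₂ s t)) =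
        -(τ * (phaseRem β ξ b₁ b₂ (s + 1) (t + 1) - phaseRem β ξ b₁ b₂ (s + 1) t)) -
        -(τ * (phaseRem β ξ b₁ b₂ s (t + 1) - phaseRem β ξ b₁ b₂ s t)) by ring, e]
      exact (mul_le_mul_of_nonneg_left (d3 s t hs hs' ht ht') (abs_nonneg _)).trans g2)
  refine m.trans (le_of_eq ?_)
  rw [hC]; field_simp

/-! ### Geometric sums, Weyl differencing and sums over blocks -/

/-- Weight of a cell of length `1/K` of the circle in the bound for geometric sums. -/
noncomputable def cellW (K : ℕ) (c : ℤ) : ℝ :=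
  2 * K / (((c % K : ℤ) : ℝ) + 1) + 2 * K / (K - ((c % K : ℤ) : ℝ))

theorem cell_mod_bounds {K : ℕ} (hK : 0 < K) (c : ℤ) :
    0 ≤ ((c % K : ℤ) : ℝ) ∧ ((c % K : ℤ) : ℝ) + 1 ≤ K := by
  have h1 := Int.emod_nonneg c (by lia : (K : ℤ) ≠ 0)
  have h2 := Int.emod_lt_of_pos c (by lia : (0 : ℤ) < K)
  exact ⟨by exact_mod_cast h1, by exact_mod_cast h2⟩

theorem cellW_nonneg {K : ℕ} (hK : 0 < K) (c : ℤ) : 0 ≤ cellW K c := by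
  obtain ⟨h1, h2⟩ := cell_mod_bounds hK c
  rw [cellW]
  have : (0 : ℝ) ≤ K - ((c % K : ℤ) : ℝ) := by linarith
  positivity

/-- The frequency lies in the cell `[r/K, (r+1)/K]` modulo `1`. For the two cells adjacent to an
integer the trivial bound is used, for the others Kuzmin–Landau with constant differences. The bound
depends on the cell only, so frequencies can later be counted cell by cell. -/
theorem norm_geom_sum_le {K : ℕ} (hK : 0 < K) (β : ℝ) {n : ℕ} (hn : n ≤ K) (a : ℝ) :
    ‖∑ i ∈ Finset.range n, ex ((a + i) * β)‖ ≤ cellW K ⌊K * β⌋ := by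
  obtain ⟨h1, h2⟩ := cell_mod_bounds hK ⌊K * β⌋
  set c := ⌊K * β⌋ with hc
  set r : ℝ := ((c % K : ℤ) : ℝ) with hr
  have hKr : (0 : ℝ) < K := by exact_mod_cast hK
  have hnK : (n : ℝ) ≤ K := by exact_mod_cast hn
  have triv : ‖∑ i ∈ Finset.range n, ex ((a + i) * β)‖ ≤ K := by
    refine (norm_sum_le _ _).trans ?_
    simp only [norm_ex, Finset.sum_const, Finset.card_range, nsmul_eq_mul, mul_one]
    exact hnK
  have hdiv : (c : ℝ) = K * ((c / K : ℤ) : ℝ) + r := by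
    rw [hr]; exact_mod_cast (Int.mul_ediv_add_emod c K).symm
  have hf1 : (c : ℝ) ≤ K * β := Int.floor_le _
  have hf2 : K * β < c + 1 := Int.lt_floor_add_one _
  have p1 : 0 ≤ 2 * K / (r + 1) := by positivity
  have p2 : 0 ≤ 2 * K / (K - r) := div_nonneg (by positivity) (by linarith)
  change _ ≤ 2 * K / (r + 1) + 2 * K / (K - r)
  rcases lt_or_ge r 1 with hr1 | hr1
  · have : (K : ℝ) ≤ 2 * K / (r + 1) := by
      rw [le_div_iff₀ (by linarith)]; nlinarith
    linarith
  rcases lt_or_ge (K : ℝ) (r + 2) with hr2 | hr2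
  · have : (K : ℝ) ≤ 2 * K / (K - r) := by
      rw [le_div_iff₀ (by linarith)]; nlinarith
    linarith
  set Δ := min (r / K) (1 - (r + 1) / K) with hΔ
  have hΔ1 : 0 < r / K := by positivity
  have hΔ2 : 0 < 1 - (r + 1) / K := by
    rw [sub_pos, div_lt_one hKr]; linarith
  have hΔ0 : 0 < Δ := lt_min hΔ1 hΔ2
  have hβ1 : ((c / K : ℤ) : ℝ) + r / K ≤ β := by
    have : ((c / K : ℤ) : ℝ) + r / K = c / K := by rw [hdiv]; field_simp
    rw [this, div_le_iff₀ hKr]; linarith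
  have hβ2 : β ≤ ((c / K : ℤ) : ℝ) + (r + 1) / K := by
    have : ((c / K : ℤ) : ℝ) + (r + 1) / K = (c + 1) / K := by rw [hdiv]; field_simp; ring
    rw [this, le_div_iff₀ hKr]; linarith
  have kl := kuzmin_landau (fun i : ℕ => (a + i) * β) n (c / K : ℤ) hΔ0 (fun i _ => by
    have : (a + ((i + 1 : ℕ) : ℝ)) * β - (a + i) * β = β := by push_cast; ring
    simp only [this]
    exact ⟨by linarith [min_le_left (r / K) (1 - (r + 1) / K)],
      by linarith [min_le_right (r / K) (1 - (r + 1) / K)]⟩) (by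
        intro i _; apply le_of_eq; push_cast; ring)
  refine kl.trans ?_
  rcases min_choice (r / K) (1 - (r + 1) / K) with hm | hm
  · rw [hΔ, hm]
    have : 1 / (r / K) ≤ 2 * K / (r + 1) := by
      rw [one_div_div, div_le_div_iff₀ (by linarith) (by linarith)]; nlinarith
    linarith
  · rw [hΔ, hm]
    have : 1 / (1 - (r + 1) / K) ≤ 2 * K / (K - r) := by
      rw [div_le_div_iff₀ hΔ2 (by linarith), one_mul]
      have : 2 * K * (1 - (r + 1) / K) = 2 * (K - (r + 1)) := by field_simp
      rw [this]; linarith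
    linarith

theorem norm_geom_sum_Ico_le {K : ℕ} (hK : 0 < K) (β : ℝ) {a b : ℤ} (hn : b - a ≤ K) :
    ‖∑ i ∈ Finset.Ico a b, ex (i * β)‖ ≤ cellW K ⌊K * β⌋ := by
  have e : ∑ i ∈ Finset.Ico a b, ex (i * β) =
      ∑ i ∈ Finset.range (b - a).toNat, ex (((a : ℝ) + i) * β) := by
    symm
    refine Finset.sum_bij (fun (r : ℕ) _ => a + (r : ℤ)) ?_ ?_ ?_ ?_
    · intro x hx; simp at hx ⊢; lia
    · intro x _ y _ h; simpa using h
    · intro x hx; simp at hx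
      exact ⟨(x - a).toNat, by simp; lia, by lia⟩
    · intro x _; push_cast; rfl
  rw [e]
  exact norm_geom_sum_le hK β (by lia) a

theorem sum_inv_succ_le (K : ℕ) : ∑ r ∈ Finset.range K, 1 / ((r : ℝ) + 1) ≤ 1 + Real.log K := by
  have := harmonic_le_one_add_log K
  refine le_trans (le_of_eq ?_) this
  rw [harmonic]; push_cast
  exact Finset.sum_congr rfl fun i _ => by rw [one_div]

theorem sum_cellW_period (K : ℕ) : ∑ r ∈ Finset.Ico (0 : ℤ) K, cellW K r ≤
    4 * K * (1 + Real.log K) := by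
  have e : ∑ r ∈ Finset.Ico (0 : ℤ) K, cellW K r =
      ∑ r ∈ Finset.range K, (2 * K * (1 / ((r : ℝ) + 1)) + 2 * K * (1 / (K - r))) := by
    rw [Finset.range_eq_Ico]
    symm
    refine Finset.sum_bij (fun (r : ℕ) _ => (r : ℤ)) ?_ ?_ ?_ ?_
    · intro a ha; simp at ha ⊢; exact ha
    · intro a _ b _ h; exact_mod_cast h
    · intro b hb; simp at hb
      exact ⟨b.toNat, by simp; lia, by lia⟩
    · intro a ha
      simp at ha
      rw [cellW, Int.emod_eq_of_lt (by lia) (by lia)]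
      push_cast; ring
  rw [e, Finset.sum_add_distrib, ← Finset.mul_sum, ← Finset.mul_sum]
  have r2 : ∑ i ∈ Finset.range K, 1 / ((K : ℝ) - i) = ∑ r ∈ Finset.range K, 1 / ((r : ℝ) + 1) := by
    rw [← Finset.sum_range_reflect (fun r : ℕ => 1 / ((r : ℝ) + 1))]
    refine Finset.sum_congr rfl fun i hi => ?_
    have := Finset.mem_range.mp hi
    rw [show K - 1 - i = K - (i + 1) by lia, Nat.cast_sub (by lia)]; push_cast; ring_nf
  rw [r2]
  have := sum_inv_succ_le K
  have hK : (0 : ℝ) ≤ K := by positivity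
  nlinarith

/-- Division by `K` places `s` in at most `2⌊L/K⌋ + 2` complete residue systems, and over one such
system the weights form two harmonic sums. -/
theorem sum_cellW_le {K : ℕ} (hK : 0 < K) {L : ℕ} (s : Finset ℤ) (hs : ∀ c ∈ s, |c| ≤ L) :
    ∑ c ∈ s, cellW K c ≤ (2 * (L / K : ℝ) + 3) * (4 * K * (1 + Real.log K)) := by
  have hKz : (0 : ℤ) < K := by exact_mod_cast hK
  have inj : Set.InjOn (fun c : ℤ => (c / K, c % K)) s := fun a _ b _ hab => by
    simp only [Prod.mk.injEq] at hab
    rw [← Int.mul_ediv_add_emod a K, ← Int.mul_ediv_add_emod b K, hab.1, hab.2]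
  have e : ∑ c ∈ s, cellW K c = ∑ p ∈ s.image (fun c : ℤ => (c / K, c % K)), cellW K p.2 := by
    rw [Finset.sum_image inj]
    refine Finset.sum_congr rfl fun c _ => ?_
    simp only [cellW, Int.emod_emod_of_dvd _ (dvd_refl _)]
  have sub : s.image (fun c : ℤ => (c / K, c % K)) ⊆
      Finset.Icc (-((L / K : ℕ) : ℤ) - 1) (L / K : ℕ) ×ˢ Finset.Ico (0 : ℤ) K := by
    intro p hp
    obtain ⟨c, hc, rfl⟩ := Finset.mem_image.mp hp
    have h := abs_le.mp (hs c hc)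
    simp only [Finset.mem_product, Finset.mem_Icc, Finset.mem_Ico]
    have hL : (L : ℤ) < K * ((L / K : ℕ) + 1) := by
      have := Nat.lt_mul_div_succ L hK
      exact_mod_cast this
    refine ⟨⟨?_, ?_⟩, Int.emod_nonneg _ hKz.ne', Int.emod_lt_of_pos _ hKz⟩
    · rw [Int.le_ediv_iff_mul_le hKz]; nlinarith [h.1]
    · rw [Int.natCast_ediv]; exact Int.ediv_le_ediv hKz h.2
  rw [e]
  refine (Finset.sum_le_sum_of_subset_of_nonneg sub fun p _ _ => cellW_nonneg hK _).trans ?_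
  rw [Finset.sum_product]
  dsimp only
  rw [Finset.sum_const, nsmul_eq_mul, Int.card_Icc]
  refine mul_le_mul ?_ (sum_cellW_period K) (Finset.sum_nonneg fun r _ => cellW_nonneg hK r)
    (by positivity)
  have h1 : (((L / K : ℕ) : ℤ) + 1 - (-((L / K : ℕ) : ℤ) - 1)).toNat = 2 * (L / K) + 2 := by lia
  rw [h1]; push_cast
  have := @Nat.cast_div_le ℝ _ _ _ L K
  linarith

theorem sum_sum_Ico_eq_sum_diff {m K : ℤ} (hm : m ≤ K) (H : ℤ → ℤ → ℂ) :
    ∑ i' ∈ Finset.Ico 0 m, ∑ i ∈ Finset.Ico 0 m, H i i' =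
      ∑ k ∈ Finset.Ioo (-K) K, ∑ i' ∈ Finset.Ico (max 0 (-k)) (min m (m - k)), H (i' + k) i' := by
  have e : ∀ i' : ℤ, ∑ i ∈ Finset.Ico 0 m, H i i' = ∑ k ∈ Finset.Ico (-i') (m - i'), H (i' + k) i' :=
    fun i' => by
    symm
    refine Finset.sum_bij (fun k _ => i' + k) ?_ ?_ ?_ ?_
    · intro x hx; simp at hx ⊢; lia
    · intro x _ y _ h; simpa using h
    · intro x hx; simp at hx
      exact ⟨x - i', by simp; lia, by lia⟩
    · intro x _; rfl
  simp only [e]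
  refine Finset.sum_comm' fun i k => ?_
  simp only [Finset.mem_Ico, Finset.mem_Ioo, max_le_iff, lt_min_iff]
  lia

/-- Weyl differencing: for a fixed difference `k` of two lattice points, the difference of the
quadratic phases is linear in each coordinate without a mixed term, so the inner double sum factors
into two geometric sums over intervals of length at most `K`. -/
theorem norm_sq_sum_quadratic_le {K : ℕ} (hK : 0 < K) {m₁ m₂ : ℕ} (h₁ : m₁ ≤ K) (h₂ : m₂ ≤ K)
    (p r A B C : ℝ) :
    ‖∑ i ∈ Finset.range m₁, ∑ j ∈ Finset.range m₂,
      ex (p * i + r * j + A * i ^ 2 + B * i * j + C * j ^ 2)‖ ^ 2 ≤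
    ∑ k ∈ Finset.Ioo (-(K : ℤ)) K ×ˢ Finset.Ioo (-(K : ℤ)) K,
      cellW K ⌊K * (2 * A * k.1 + B * k.2)⌋ * cellW K ⌊K * (B * k.1 + 2 * C * k.2)⌋ := by
  set Q : ℤ → ℤ → ℝ := fun i j => p * i + r * j + A * i ^ 2 + B * i * j + C * j ^ 2 with hQ
  have cast : ∀ (m : ℕ) (f : ℤ → ℂ), ∑ i ∈ Finset.range m, f i = ∑ i ∈ Finset.Ico (0 : ℤ) m, f i :=
    fun m f => by
    refine Finset.sum_bij (fun (r : ℕ) _ => (r : ℤ)) ?_ ?_ ?_ ?_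
    · intro x hx; simp at hx ⊢; lia
    · intro x _ y _ h; simpa using h
    · intro x hx; simp at hx
      exact ⟨x.toNat, by simp; lia, by lia⟩
    · intro x _; rfl
  have e1 : ∑ i ∈ Finset.range m₁, ∑ j ∈ Finset.range m₂,
      ex (p * i + r * j + A * i ^ 2 + B * i * j + C * j ^ 2) =
      ∑ i ∈ Finset.Ico (0 : ℤ) m₁, ∑ j ∈ Finset.Ico (0 : ℤ) m₂, ex (Q i j) := by
    rw [← cast m₁ (fun i => ∑ j ∈ Finset.Ico (0 : ℤ) m₂, ex (Q i j))]
    refine Finset.sum_congr rfl fun i _ => ?_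
    rw [← cast m₂ (fun j => ex (Q i j))]
    rfl
  set S := ∑ i ∈ Finset.Ico (0 : ℤ) m₁, ∑ j ∈ Finset.Ico (0 : ℤ) m₂, ex (Q i j) with hS
  have e2 : ((‖S‖ ^ 2 : ℝ) : ℂ) = ∑ k₁ ∈ Finset.Ioo (-(K : ℤ)) K, ∑ k₂ ∈ Finset.Ioo (-(K : ℤ)) K,
      ex (p * k₁ + r * k₂ + A * k₁ ^ 2 + B * k₁ * k₂ + C * k₂ ^ 2) *
      (∑ i ∈ Finset.Ico (max 0 (-k₁)) (min (m₁ : ℤ) (m₁ - k₁)), ex (i * (2 * A * k₁ + B * k₂))) *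
      ∑ j ∈ Finset.Ico (max 0 (-k₂)) (min (m₂ : ℤ) (m₂ - k₂)), ex (j * (B * k₁ + 2 * C * k₂)) := by
    push_cast
    rw [← Complex.conj_mul', hS, map_sum, Finset.sum_mul]
    simp only [Finset.mul_sum]
    rw [sum_sum_Ico_eq_sum_diff (K := K) (by exact_mod_cast h₁)
      (fun i i' => ∑ j ∈ Finset.Ico (0 : ℤ) m₂,
        (starRingEnd ℂ) (∑ j ∈ Finset.Ico (0 : ℤ) m₂, ex (Q i' j)) * ex (Q i j))]
    refine Finset.sum_congr rfl fun k₁ _ => ?_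
    have : ∀ i' : ℤ, ∑ j ∈ Finset.Ico (0 : ℤ) m₂,
        (starRingEnd ℂ) (∑ j ∈ Finset.Ico (0 : ℤ) m₂, ex (Q i' j)) * ex (Q (i' + k₁) j) =
        ∑ k₂ ∈ Finset.Ioo (-(K : ℤ)) K,
          ∑ j' ∈ Finset.Ico (max 0 (-k₂)) (min (m₂ : ℤ) (m₂ - k₂)),
            ex (-(Q i' j')) * ex (Q (i' + k₁) (j' + k₂)) := fun i' => by
      rw [← sum_sum_Ico_eq_sum_diff (K := K) (by exact_mod_cast h₂)
        (fun j j' => ex (-(Q i' j')) * ex (Q (i' + k₁) j)), Finset.sum_comm]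
      refine Finset.sum_congr rfl fun j _ => ?_
      rw [map_sum, Finset.sum_mul]
      simp only [ex_neg]
    simp only [this]
    rw [Finset.sum_comm]
    refine Finset.sum_congr rfl fun k₂ _ => ?_
    rw [Finset.sum_comm]
    refine Finset.sum_congr rfl fun j _ => ?_
    rw [Finset.sum_mul]
    refine Finset.sum_congr rfl fun i _ => ?_
    rw [← ex_add, ← ex_add, ← ex_add]
    congr 1
    simp only [hQ]; push_cast; ring
  rw [e1]
  have e3 : ‖S‖ ^ 2 = ‖((‖S‖ ^ 2 : ℝ) : ℂ)‖ := by
    rw [Complex.norm_real, Real.norm_of_nonneg (by positivity)]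
  rw [e3, e2, Finset.sum_product]
  refine (norm_sum_le _ _).trans (Finset.sum_le_sum fun k₁ _ => (norm_sum_le _ _).trans
    (Finset.sum_le_sum fun k₂ _ => ?_))
  rw [norm_mul, norm_mul, norm_ex, one_mul]
  refine mul_le_mul (norm_geom_sum_Ico_le hK _ ?_) (norm_geom_sum_Ico_le hK _ ?_) (norm_nonneg _)
    (cellW_nonneg hK _)
  · lia
  · lia

/-- Splitting a sum over an initial segment into blocks of length `K`. -/
theorem sum_range_eq_sum_blocks (g : ℕ → ℂ) (K n R : ℕ) (h : n ≤ R * K) :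
    ∑ i ∈ Finset.range n, g i =
      ∑ J ∈ Finset.range R, ∑ y ∈ Finset.range (min K (n - K * J)), g (K * J + y) := by
  have key : ∀ R, ∑ i ∈ Finset.range (min n (R * K)), g i =
      ∑ J ∈ Finset.range R, ∑ y ∈ Finset.range (min K (n - K * J)), g (K * J + y) := by
    intro R
    induction R with
    | zero => simp
    | succ R ih =>
      rw [Finset.sum_range_succ, ← ih]
      rcases le_total n (R * K) with hn | hn
      · have h1 : n - K * R = 0 := by rw [mul_comm]; lia
        have h2 : n ≤ (R + 1) * K := hn.trans (Nat.mul_le_mul_right _ (by lia))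
        simp [h1, min_eq_left hn, min_eq_left h2]
      · have h1 : min n ((R + 1) * K) = K * R + min K (n - K * R) := by
          have : (R + 1) * K = K * R + K := by ring
          rw [mul_comm] at hn
          lia
        rw [h1, Finset.sum_range_add, min_eq_right hn, mul_comm R K]
  rw [← key R, min_eq_left h]

section
variable {β ξ : ℝ}

/-- Upper bound for the square of a sum over one block. -/
theorem norm_sq_block_le {M : ℝ} {K : ℕ} {b₁ b₂ : ℝ} (h : BlockData β ξ M K b₁ b₂) {τ C : ℝ}
    (hτ : |τ| * K ^ 3 ≤ M ^ 3) (hC : C = 2 * Real.pi * (440 * (1 + β) ^ 3)) {m₁ m₂ : ℕ}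
    (h₁ : m₁ ≤ K) (h₂ : m₂ ≤ K) :
    ‖∑ i ∈ Finset.range m₁, ∑ j ∈ Finset.range m₂,
      ex (-(τ * Real.log ((b₁ + i) ^ 2 + β ^ 2 * (b₂ + j) ^ 2 - ξ)))‖ ^ 2 ≤
    (1 + 3 * (C ^ 2 + C)) ^ 2 *
      ∑ k ∈ Finset.Ioo (-(K : ℤ)) K ×ˢ Finset.Ioo (-(K : ℤ)) K,
        cellW K ⌊K * (2 * τ * (blockPt β k.1 k.2 * (1 / blockPt β b₁ b₂ ^ 2)).re)⌋ *
        cellW K ⌊K * (-(2 * τ * β) * (blockPt β k.1 k.2 * (1 / blockPt β b₁ b₂ ^ 2)).im)⌋ := by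
  have hK : 0 < K := by have := h.hK; exact_mod_cast (by linarith : (0 : ℝ) < K)
  have hC0 : 0 < C := by rw [hC]; have := h.hβ; have := Real.pi_pos; positivity
  obtain ⟨d1, d2, d3⟩ := blockAmplitude_bounds h hτ hC
  set v := 1 / blockPt β b₁ b₂ ^ 2 with hv
  set w := 1 / blockPt β b₁ b₂ with hw
  set T := ∑ k ∈ Finset.Ioo (-(K : ℤ)) K ×ˢ Finset.Ioo (-(K : ℤ)) K,
        cellW K ⌊K * (2 * τ * (blockPt β k.1 k.2 * v).re)⌋ *
        cellW K ⌊K * (-(2 * τ * β) * (blockPt β k.1 k.2 * v).im)⌋ with hT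
  set bq : ℕ → ℕ → ℂ := fun i j => ex ((-(2 * τ * w.re)) * i + (2 * τ * β * w.im) * j +
    (τ * v.re) * i ^ 2 + (-(2 * τ * β * v.im)) * i * j + (-(τ * β ^ 2 * v.re)) * j ^ 2) with hbq
  have hB : ∀ n₁ ≤ m₁, ∀ n₂ ≤ m₂, ‖∑ i ∈ Finset.range n₁, ∑ j ∈ Finset.range n₂, bq i j‖ ≤
      √T := by
    intro n₁ hn₁ n₂ hn₂
    apply Real.le_sqrt_of_sq_le
    refine (norm_sq_sum_quadratic_le hK (hn₁.trans h₁) (hn₂.trans h₂) _ _ _ _ _).trans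
      (le_of_eq ?_)
    refine Finset.sum_congr rfl fun k _ => ?_
    rw [blockPt_mul_re, blockPt_mul_im]
    congr 3 <;> ring_nf
  have hab : ∀ i j : ℕ, ex (-(τ * Real.log ((b₁ + i) ^ 2 + β ^ 2 * (b₂ + j) ^ 2 - ξ))) =
      ex (-(τ * phaseRem β ξ b₁ b₂ i j)) * bq i j := fun i j => by
    rw [hbq, ← ex_add]
    congr 1
    rw [phaseRem_eq]; ring
  have key := norm_sum_mul_le_of_rect_sums (fun i j => ex (-(τ * phaseRem β ξ b₁ b₂ i j))) bq hK
    h₁ h₂ (c := C ^ 2 + C) (B := √T) (by positivity) hB (fun i _ j _ => (norm_ex _).le)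
    (fun i hi j hj => by
      have := d1 i j (by positivity) (by exact_mod_cast hi.le) (by positivity)
        (by exact_mod_cast hj.le)
      push_cast; exact this)
    (fun i hi j hj => by
      have := d2 i j (by positivity) (by exact_mod_cast hi.le) (by positivity)
        (by exact_mod_cast hj.le)
      push_cast; exact this)
    (fun i hi j hj => by
      have := d3 i j (by positivity) (by exact_mod_cast hi.le) (by positivity)
        (by exact_mod_cast hj.le)
      push_cast; exact this)
  simp only [hab]
  have hT0 : 0 ≤ T := Finset.sum_nonneg fun k _ =>
    mul_nonneg (cellW_nonneg hK _) (cellW_nonneg hK _)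
  calc _ ≤ ((1 + 3 * (C ^ 2 + C)) * √T) ^ 2 := by gcongr
    _ = _ := by rw [mul_pow, Real.sq_sqrt hT0]

/-- If no pair of cells is hit more than `F` times, the sum is at most `F` times the sum over all
pairs of cells, and that factors. -/
theorem sum_cellW_mul_le {ι : Type*} {K : ℕ} (hK : 0 < K) (s : Finset ι) (g₁ g₂ : ι → ℤ) {L : ℕ}
    {F : ℝ} (hF : ∀ c₁ c₂, ((s.filter fun x => g₁ x = c₁ ∧ g₂ x = c₂).card : ℝ) ≤ F)
    (hL₁ : ∀ x ∈ s, |g₁ x| ≤ L) (hL₂ : ∀ x ∈ s, |g₂ x| ≤ L) :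
    ∑ x ∈ s, cellW K (g₁ x) * cellW K (g₂ x) ≤
      F * ((2 * (L / K : ℝ) + 3) * (4 * K * (1 + Real.log K))) ^ 2 := by
  set I := Finset.Icc (-(L : ℤ)) L
  have hI : ∀ c ∈ I, |c| ≤ L := fun c hc => abs_le.mpr (by simpa [I] using hc)
  have hF0 : 0 ≤ F := (Nat.cast_nonneg _).trans (hF 0 0)
  rw [← Finset.sum_fiberwise_of_maps_to (s := s) (t := I ×ˢ I) (g := fun x => (g₁ x, g₂ x))
    (fun x hx => by
      have a := abs_le.mp (hL₁ x hx)
      have b := abs_le.mp (hL₂ x hx)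
      simp [I, a.1, a.2, b.1, b.2])]
  calc _ ≤ ∑ c ∈ I ×ˢ I, F * (cellW K c.1 * cellW K c.2) := by
        refine Finset.sum_le_sum fun c _ => ?_
        have : ∀ x ∈ s.filter (fun x => (g₁ x, g₂ x) = c),
            cellW K (g₁ x) * cellW K (g₂ x) = cellW K c.1 * cellW K c.2 := fun x hx => by
          rw [← (Finset.mem_filter.mp hx).2]
        rw [Finset.sum_congr rfl this, Finset.sum_const, nsmul_eq_mul]
        refine mul_le_mul_of_nonneg_right ?_ (mul_nonneg (cellW_nonneg hK _) (cellW_nonneg hK _))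
        refine le_trans (le_of_eq ?_) (hF c.1 c.2)
        congr 2
        ext x; simp [Prod.ext_iff]
    _ = F * (∑ c ∈ I, cellW K c) ^ 2 := by
        rw [← Finset.mul_sum, sq, Finset.sum_mul_sum, Finset.sum_product]
    _ ≤ _ := by
        have h0 : 0 ≤ ∑ c ∈ I, cellW K c := Finset.sum_nonneg fun c _ => cellW_nonneg hK c
        gcongr
        exact sum_cellW_le hK I hI

theorem card_le_of_pairwise_close (s : Finset (ℕ × ℕ)) {D : ℝ} (hD : 0 ≤ D)
    (h : ∀ p ∈ s, ∀ q ∈ s, |(p.1 : ℝ) - q.1| ≤ D ∧ |(p.2 : ℝ) - q.2| ≤ D) :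
    (s.card : ℝ) ≤ (2 * D + 1) ^ 2 := by
  rcases s.eq_empty_or_nonempty with rfl | ⟨q, hq⟩
  · simp; positivity
  set d := ⌊D⌋₊
  have hc : ∀ a b : ℕ, |(a : ℝ) - b| ≤ D → a ∈ Finset.Icc (b - d) (b + d) := fun a b hab => by
    have h1 := abs_le.mp hab
    have h2 := Nat.lt_floor_add_one D
    have h3 : (a : ℝ) < b + d + 1 := by simp only [d]; linarith
    have h4 : (b : ℝ) < a + d + 1 := by simp only [d]; linarith
    have h5 : a < b + d + 1 := by exact_mod_cast h3
    have h6 : b < a + d + 1 := by exact_mod_cast h4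
    simp; lia
  have sub : s ⊆ Finset.Icc (q.1 - d) (q.1 + d) ×ˢ Finset.Icc (q.2 - d) (q.2 + d) := fun p hp =>
    Finset.mem_product.mpr ⟨hc _ _ (h p hp q hq).1, hc _ _ (h p hp q hq).2⟩
  have h1 := Finset.card_le_card sub
  rw [Finset.card_product, Nat.card_Icc, Nat.card_Icc] at h1
  have h2 : s.card ≤ (2 * d + 1) * (2 * d + 1) := h1.trans (Nat.mul_le_mul (by lia) (by lia))
  have h3 : (s.card : ℝ) ≤ (2 * d + 1) * (2 * d + 1) := by exact_mod_cast h2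
  have h4 : (d : ℝ) ≤ D := Nat.floor_le hD
  have h5 : (0 : ℝ) ≤ d := by positivity
  nlinarith

/-- Separation of the points `1 / z²`. -/
theorem norm_sub_le_of_inv_sq_sub {M B : ℝ} (hM : 0 < M) {z z' : ℂ} (hz : M ≤ z.re)
    (hz' : M ≤ z'.re) (hB : ‖z‖ ≤ B * M) (hB' : ‖z'‖ ≤ B * M) :
    ‖z - z'‖ ≤ B ^ 4 * M ^ 3 / 2 * ‖1 / z ^ 2 - 1 / z' ^ 2‖ := by
  have h0 : z ≠ 0 := fun h => by rw [h] at hz; simp at hz; linarith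
  have h0' : z' ≠ 0 := fun h => by rw [h] at hz'; simp at hz'; linarith
  have hn : 0 < ‖z‖ := norm_pos_iff.mpr h0
  have hn' : 0 < ‖z'‖ := norm_pos_iff.mpr h0'
  have hs : 2 * M ≤ ‖z + z'‖ := by
    have := Complex.re_le_norm (z + z'); rw [Complex.add_re] at this; linarith
  have e : 1 / z ^ 2 - 1 / z' ^ 2 = -((z - z') * (z + z')) / (z ^ 2 * z' ^ 2) := by
    field_simp; ring
  rw [e, norm_div, norm_neg, norm_mul, norm_mul, norm_pow, norm_pow, mul_div_assoc']
  rw [le_div_iff₀ (by positivity)]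
  have h1 : ‖z‖ ^ 2 * ‖z'‖ ^ 2 ≤ (B * M) ^ 2 * (B * M) ^ 2 := by gcongr
  have h2 : ‖z - z'‖ * (‖z‖ ^ 2 * ‖z'‖ ^ 2) ≤ ‖z - z'‖ * ((B * M) ^ 2 * (B * M) ^ 2) := by gcongr
  have h3 : 0 ≤ B ^ 4 * M ^ 3 / 2 * ‖z - z'‖ := by positivity
  nlinarith [mul_le_mul_of_nonneg_left hs h3]

end

/-! ### Spacing of the block frequencies and the pointwise bound -/

/-- The base points of the blocks of size `K` at scale `M`. -/
noncomputable def gridPt (β : ℝ) (M K : ℕ) (J : ℕ × ℕ) : ℂ :=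
  blockPt β (M + 1 + K * J.1) (1 + K * J.2)

/-- The number of blocks per coordinate, as an index set. -/
def gridIdx (M K : ℕ) : Finset (ℕ × ℕ) := Finset.range (M / K + 1) ×ˢ Finset.range (M / K + 1)

theorem gridIdx_le {M K : ℕ} {J : ℕ × ℕ} (hJ : J ∈ gridIdx M K) :
    K * J.1 ≤ M ∧ K * J.2 ≤ M := by
  simp only [gridIdx, Finset.mem_product, Finset.mem_range, Nat.lt_succ_iff] at hJ
  exact ⟨(Nat.mul_le_mul_left K hJ.1).trans (Nat.mul_div_le M K),
    (Nat.mul_le_mul_left K hJ.2).trans (Nat.mul_div_le M K)⟩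

theorem gridPt_bounds {β : ℝ} (hβ : 0 < β) {M K : ℕ} (hM : 0 < M) {J : ℕ × ℕ}
    (hJ : J ∈ gridIdx M K) :
    (M : ℝ) ≤ (gridPt β M K J).re ∧ ‖gridPt β M K J‖ ≤ (3 + 3 * β) * M := by
  obtain ⟨h1, h2⟩ := gridIdx_le hJ
  have h1' : (K : ℝ) * J.1 ≤ M := by exact_mod_cast h1
  have h2' : (K : ℝ) * J.2 ≤ M := by exact_mod_cast h2
  have hM' : (1 : ℝ) ≤ M := by exact_mod_cast hM
  have p1 : (0 : ℝ) ≤ K * J.1 := by positivity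
  have p2 : (0 : ℝ) ≤ K * J.2 := by positivity
  constructor
  · simp [gridPt, blockPt]; linarith
  · rw [gridPt, blockPt]
    refine (norm_add_le _ _).trans ?_
    rw [norm_mul, Complex.norm_I, mul_one, Complex.norm_real, Complex.norm_real,
      Real.norm_of_nonneg (by linarith), Real.norm_of_nonneg (by positivity)]
    nlinarith

theorem abs_sub_lt_one_of_floor_eq {x y : ℝ} {c : ℤ} (hx : ⌊x⌋ = c) (hy : ⌊y⌋ = c) :
    |x - y| < 1 := Int.abs_sub_lt_one_of_floor_eq_floor (hx.trans hy.symm)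

section
variable {β : ℝ} {M K : ℕ} {τ : ℝ} {k : ℤ × ℤ}

/-- The first frequency attached to a difference `k` and a block. -/
noncomputable def freq₁ (β τ : ℝ) (M K : ℕ) (k : ℤ × ℤ) (J : ℕ × ℕ) : ℝ :=
  2 * τ * (blockPt β k.1 k.2 * (1 / gridPt β M K J ^ 2)).re

/-- The second frequency attached to a difference `k` and a block. -/
noncomputable def freq₂ (β τ : ℝ) (M K : ℕ) (k : ℤ × ℤ) (J : ℕ × ℕ) : ℝ :=
  -(2 * τ * β) * (blockPt β k.1 k.2 * (1 / gridPt β M K J ^ 2)).im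

theorem norm_blockPt_int_le (hβ : 0 < β) (h1 : |k.1| ≤ K) (h2 : |k.2| ≤ K) :
    ‖blockPt β k.1 k.2‖ ≤ (1 + β) * K := by
  rw [blockPt]
  refine (norm_add_le _ _).trans ?_
  rw [norm_mul, Complex.norm_I, mul_one, Complex.norm_real, Complex.norm_real, norm_mul,
    Real.norm_of_nonneg hβ.le, Real.norm_eq_abs, Real.norm_eq_abs]
  have a : |(k.1 : ℝ)| ≤ K := by exact_mod_cast h1
  have b : |(k.2 : ℝ)| ≤ K := by exact_mod_cast h2
  nlinarith

theorem blockPt_int_ne_zero (hβ : 0 < β) (hk : k ≠ 0) : blockPt β k.1 k.2 ≠ 0 := fun h => hk (by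
  have a := congrArg Complex.re h
  have b := congrArg Complex.im h
  simp [blockPt, hβ.ne'] at a b
  exact Prod.ext a b)

/-- Let `κ = k₁ + iβk₂`. Two blocks `z`, `z'` in the same pair of cells satisfy `|κ| |1/z² - 1/z'²|
≪ 1/(τK)`. Inverting `z ↦ 1/z²` costs `M³ ≪ τK³`, hence `|z - z'| ≪ K²/|κ|`, and the base points
form a grid of mesh `K`, so the indices differ by `O(K/|κ|)`. -/
theorem card_fiber_le (hβ : 0 < β) (hM : 0 < M) (hK : 0 < K) (hτ : 0 < τ)
    (hMK : (M : ℝ) ^ 3 ≤ 8 * τ * K ^ 3) (hk : k ≠ 0) (h1 : |k.1| ≤ K) (h2 : |k.2| ≤ K)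
    (c₁ c₂ : ℤ) :
    (((gridIdx M K).filter fun J => ⌊K * freq₁ β τ M K k J⌋ = c₁ ∧
      ⌊K * freq₂ β τ M K k J⌋ = c₂).card : ℝ) ≤
    ((4 * (3 + 3 * β) ^ 4 * (1 + 1 / β) ^ 2 + (1 + β)) * (K / ‖blockPt β k.1 k.2‖)) ^ 2 := by
  have hκ : 0 < ‖blockPt β k.1 k.2‖ := norm_pos_iff.mpr (blockPt_int_ne_zero hβ hk)
  have hκ' := norm_blockPt_int_le hβ h1 h2
  set κ := blockPt β k.1 k.2
  have hKr : (0 : ℝ) < K := by exact_mod_cast hK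
  have hMr : (0 : ℝ) < M := by exact_mod_cast hM
  set B := 3 + 3 * β with hB
  have hB0 : 0 < B := by positivity
  set E := 1 + 1 / β with hE
  have hE1 : 1 ≤ E := by rw [hE]; have : 0 < 1 / β := by positivity
                         linarith
  have hE2 : 1 ≤ E * β := by rw [hE, add_mul, one_div_mul_cancel hβ.ne']; linarith
  set D := 2 * B ^ 4 * E ^ 2 * (K / ‖κ‖) with hD
  have hD0 : 0 ≤ D := by positivity
  refine (card_le_of_pairwise_close _ hD0 ?_).trans ?_
  · intro J hJ J' hJ'
    rw [Finset.mem_filter] at hJ hJ'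
    obtain ⟨hJ0, ha, hb⟩ := hJ
    obtain ⟨hJ0', ha', hb'⟩ := hJ'
    obtain ⟨r1, n1⟩ := gridPt_bounds hβ hM hJ0
    obtain ⟨r2, n2⟩ := gridPt_bounds hβ hM hJ0'
    have sep := norm_sub_le_of_inv_sq_sub hMr r1 r2 n1 n2
    have fa := abs_sub_lt_one_of_floor_eq ha ha'
    have fb := abs_sub_lt_one_of_floor_eq hb hb'
    set z := gridPt β M K J with hz
    set z' := gridPt β M K J' with hz'
    have e1 : K * freq₁ β τ M K k J - K * freq₁ β τ M K k J' =
        (2 * τ * K) * (κ * (1 / z ^ 2 - 1 / z' ^ 2)).re := by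
      simp only [freq₁]; rw [mul_sub κ, Complex.sub_re]; ring
    have e2 : K * freq₂ β τ M K k J - K * freq₂ β τ M K k J' =
        -(2 * τ * K * β) * (κ * (1 / z ^ 2 - 1 / z' ^ 2)).im := by
      simp only [freq₂]; rw [mul_sub κ, Complex.sub_im]; ring
    set Δ := 1 / z ^ 2 - 1 / z' ^ 2
    rw [e1, abs_mul, abs_of_pos (by positivity)] at fa
    rw [e2, abs_mul, abs_neg, abs_of_pos (by positivity)] at fb
    have g1 : 2 * τ * K * ‖κ * Δ‖ ≤ E := by
      have n := Complex.norm_le_abs_re_add_abs_im (κ * Δ)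
      have fb' : 2 * τ * K * |(κ * Δ).im| ≤ 1 / β := by
        rw [le_div_iff₀ hβ]; linarith
      have hp : 0 < 2 * τ * K := by positivity
      rw [hE]
      nlinarith
    have g2 : ‖z - z'‖ ≤ 2 * B ^ 4 * E * (K / ‖κ‖) * K := by
      have e3 : ‖Δ‖ = ‖κ * Δ‖ / ‖κ‖ := by rw [norm_mul]; field_simp
      have g3 : ‖κ * Δ‖ ≤ E / (2 * τ * K) := by
        rw [le_div_iff₀ (by positivity)]; linarith
      calc ‖z - z'‖ ≤ B ^ 4 * M ^ 3 / 2 * ‖Δ‖ := sep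
        _ ≤ B ^ 4 * (8 * τ * K ^ 3) / 2 * ((E / (2 * τ * K)) / ‖κ‖) := by
            rw [e3]; gcongr
        _ = _ := by field_simp; ring
    have re : (z - z').re = K * ((J.1 : ℝ) - J'.1) := by
      simp [hz, hz', gridPt, blockPt]; ring
    have im : (z - z').im = β * K * ((J.2 : ℝ) - J'.2) := by
      simp [hz, hz', gridPt, blockPt]; ring
    have a1 := (Complex.abs_re_le_norm _).trans g2
    have a2 := (Complex.abs_im_le_norm _).trans g2
    rw [re, abs_mul, abs_of_pos hKr] at a1
    rw [im, abs_mul, abs_of_pos (by positivity)] at a2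
    have hX : 0 ≤ 2 * B ^ 4 * (K / ‖κ‖) := by positivity
    constructor
    · have : |(J.1 : ℝ) - J'.1| ≤ 2 * B ^ 4 * E * (K / ‖κ‖) := by
        refine le_of_mul_le_mul_left ?_ hKr; linarith
      refine this.trans ?_
      rw [hD]
      gcongr
      exact le_self_pow₀ hE1 two_ne_zero
    · have a3 : β * |(J.2 : ℝ) - J'.2| ≤ 2 * B ^ 4 * E * (K / ‖κ‖) := by
        refine le_of_mul_le_mul_left ?_ hKr; linarith
      have a4 : E * (β * |(J.2 : ℝ) - J'.2|) ≤ E * (2 * B ^ 4 * E * (K / ‖κ‖)) := by gcongr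
      have a5 := mul_le_mul_of_nonneg_right hE2 (abs_nonneg ((J.2 : ℝ) - J'.2))
      rw [one_mul, mul_assoc] at a5
      exact a5.trans (a4.trans_eq (by rw [hD]; ring))
  -- Absorbs the `1` in the count `(2D + 1)²`, since `|κ| ≤ (1 + β)K`.
  · have : 1 ≤ (1 + β) * (K / ‖κ‖) := by
      rw [mul_div_assoc', le_div_iff₀ hκ]; linarith
    gcongr
    rw [hD]
    refine (add_le_add_right this _).trans (le_of_eq ?_)
    ring

theorem abs_floor_freq_le (hβ : 0 < β) (hM : 0 < M) (hτ : 0 < τ) {J : ℕ × ℕ}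
    (hJ : J ∈ gridIdx M K) :
    |⌊K * freq₁ β τ M K k J⌋| ≤ ⌈2 * τ * (1 + β) * (‖blockPt β k.1 k.2‖ / M ^ 2) * K⌉₊ + 1 ∧
    |⌊K * freq₂ β τ M K k J⌋| ≤ ⌈2 * τ * (1 + β) * (‖blockPt β k.1 k.2‖ / M ^ 2) * K⌉₊ + 1 := by
  have hMr : (0 : ℝ) < M := by exact_mod_cast hM
  have aux : ∀ x : ℝ, |x| ≤ 2 * τ * (1 + β) * (‖blockPt β k.1 k.2‖ / M ^ 2) * K →
      |⌊x⌋| ≤ ⌈2 * τ * (1 + β) * (‖blockPt β k.1 k.2‖ / M ^ 2) * K⌉₊ + 1 := fun x hx => by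
    have h1 := Nat.le_ceil (2 * τ * (1 + β) * (‖blockPt β k.1 k.2‖ / M ^ 2) * K)
    have h2 := abs_le.mp (hx.trans h1)
    have h3 : (⌊x⌋ : ℝ) ≤ ⌈2 * τ * (1 + β) * (‖blockPt β k.1 k.2‖ / M ^ 2) * K⌉₊ :=
      (Int.floor_le x).trans h2.2
    have h4 : -(⌈2 * τ * (1 + β) * (‖blockPt β k.1 k.2‖ / M ^ 2) * K⌉₊ : ℤ) ≤ ⌊x⌋ :=
      Int.le_floor.mpr (by push_cast; exact h2.1)
    have h3' : ⌊x⌋ ≤ (⌈2 * τ * (1 + β) * (‖blockPt β k.1 k.2‖ / M ^ 2) * K⌉₊ : ℤ) := by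
      exact_mod_cast h3
    rw [abs_le]; constructor <;> linarith
  obtain ⟨r1, -⟩ := gridPt_bounds hβ hM hJ
  have hz : (M : ℝ) ≤ ‖gridPt β M K J‖ := r1.trans (Complex.re_le_norm _)
  have hn : ‖blockPt β k.1 k.2 * (1 / gridPt β M K J ^ 2)‖ ≤ ‖blockPt β k.1 k.2‖ / M ^ 2 := by
    rw [norm_mul, norm_div, norm_one, norm_pow, mul_one_div]; gcongr
  have hre := (Complex.abs_re_le_norm _).trans hn
  have him := (Complex.abs_im_le_norm _).trans hn
  have hX : 0 ≤ ‖blockPt β k.1 k.2‖ / (M : ℝ) ^ 2 := by positivity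
  have hY : 0 ≤ K * (2 * τ) * (‖blockPt β k.1 k.2‖ / (M : ℝ) ^ 2) := by positivity
  constructor
  · apply aux
    rw [freq₁, abs_mul, abs_mul, abs_of_nonneg (by positivity : 0 ≤ 2 * τ), Nat.abs_cast]
    calc _ ≤ K * (2 * τ * (‖blockPt β k.1 k.2‖ / (M : ℝ) ^ 2)) := by gcongr
      _ ≤ _ := by nlinarith
  · apply aux
    rw [freq₂, abs_mul, abs_mul, abs_neg, abs_of_nonneg (by positivity : 0 ≤ 2 * τ * β),
      Nat.abs_cast]
    calc _ ≤ K * (2 * τ * β * (‖blockPt β k.1 k.2‖ / (M : ℝ) ^ 2)) := by gcongr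
      _ ≤ _ := by nlinarith

theorem sq_add_le_weighted (β x y : ℝ) :
    (4 * (1 + β) * x + 7 * y) ^ 2 ≤ 2 * (16 * (1 + β) ^ 2 + 49) * (x ^ 2 + y ^ 2) := by
  have i1 := sq_nonneg (4 * (1 + β) * x - 7 * y)
  have i2 := sq_nonneg ((1 + β) * y)
  have i3 := sq_nonneg x
  linarith

/-- Each pair of cells is hit `O((K/|κ|)²)` times, and the frequencies run through `O(1 + τ|κ|/M²)`
periods per coordinate, each of weight `O(K log K)`. The product of these is `K⁴ (τ/M² + 1/|κ|)²` up
to logarithms. -/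
theorem sum_grid_cellW_le (hβ : 0 < β) : ∃ C > 0, ∀ (M K : ℕ) (τ : ℝ) (k : ℤ × ℤ), 0 < M → 0 < K →
    0 < τ → (M : ℝ) ^ 3 ≤ 8 * τ * K ^ 3 → k ≠ 0 → |k.1| ≤ K → |k.2| ≤ K →
    ∑ J ∈ gridIdx M K, cellW K ⌊K * freq₁ β τ M K k J⌋ * cellW K ⌊K * freq₂ β τ M K k J⌋ ≤
      C * (K ^ 4 * (1 + Real.log K) ^ 2 * (τ ^ 2 / M ^ 4 + 1 / ‖blockPt β k.1 k.2‖ ^ 2)) := by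
  set C₃ := 4 * (3 + 3 * β) ^ 4 * (1 + 1 / β) ^ 2 + (1 + β) with hC₃
  have hC₃0 : 0 < C₃ := by positivity
  refine ⟨C₃ ^ 2 * (32 * (16 * (1 + β) ^ 2 + 49)), by positivity, ?_⟩
  intro M K τ k hM hK hτ hMK hk h1 h2
  have hκ : 0 < ‖blockPt β k.1 k.2‖ := norm_pos_iff.mpr (blockPt_int_ne_zero hβ hk)
  have hKr : (1 : ℝ) ≤ K := by exact_mod_cast hK
  have hMr : (0 : ℝ) < M := by exact_mod_cast hM
  have s := sum_cellW_mul_le hK (gridIdx M K) (fun J => ⌊K * freq₁ β τ M K k J⌋)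
    (fun J => ⌊K * freq₂ β τ M K k J⌋)
    (L := ⌈2 * τ * (1 + β) * (‖blockPt β k.1 k.2‖ / M ^ 2) * K⌉₊ + 1)
    (card_fiber_le hβ hM hK hτ hMK hk h1 h2)
    (fun J hJ => by push_cast; exact (abs_floor_freq_le hβ hM hτ hJ).1)
    (fun J hJ => by push_cast; exact (abs_floor_freq_le hβ hM hτ hJ).2)
  refine s.trans ?_
  set n := ‖blockPt β k.1 k.2‖
  have hL := Nat.ceil_lt_add_one (by positivity : 0 ≤ 2 * τ * (1 + β) * (n / (M : ℝ) ^ 2) * K)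
  set L := ⌈2 * τ * (1 + β) * (n / (M : ℝ) ^ 2) * K⌉₊
  have hlog : 0 ≤ Real.log K := Real.log_nonneg hKr
  have hq : 2 * (((L + 1 : ℕ) : ℝ) / K) + 3 ≤ 4 * (1 + β) * (τ * n / M ^ 2) + 7 := by
    have : ((L + 1 : ℕ) : ℝ) / K ≤ 2 * (1 + β) * (τ * n / M ^ 2) + 2 := by
      rw [div_le_iff₀ (by linarith)]; push_cast
      have : 2 * τ * (1 + β) * (n / (M : ℝ) ^ 2) * K = 2 * (1 + β) * (τ * n / M ^ 2) * K := by ring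
      rw [this] at hL
      rw [add_mul]
      linarith
    linarith
  have hq0 : 0 ≤ 2 * (((L + 1 : ℕ) : ℝ) / K) + 3 := by positivity
  calc _ ≤ (C₃ * (K / n)) ^ 2 * ((4 * (1 + β) * (τ * n / M ^ 2) + 7)
        * (4 * K * (1 + Real.log K))) ^ 2 := by gcongr
    _ = C₃ ^ 2 * 16 * (K ^ 4 * (1 + Real.log K) ^ 2) *
        ((4 * (1 + β) * (τ / M ^ 2) + 7 * (1 / n)) ^ 2) := by field_simp; norm_num
    _ ≤ C₃ ^ 2 * 16 * (K ^ 4 * (1 + Real.log K) ^ 2) *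
        (2 * (16 * (1 + β) ^ 2 + 49) * ((τ / M ^ 2) ^ 2 + (1 / n) ^ 2)) := by
        gcongr
        exact sq_add_le_weighted β _ _
    _ = _ := by rw [div_pow, div_pow, one_pow, ← pow_mul]; ring

theorem sum_inv_abs_succ_le {K : ℕ} (hK : 0 < K) :
    ∑ k ∈ Finset.Ioo (-(K : ℤ)) K, 1 / (|(k : ℝ)| + 1) ≤ 2 * (1 + Real.log K) := by
  have sub : Finset.Ioo (-(K : ℤ)) K ⊆ (Finset.range K).image (fun r : ℕ => (r : ℤ)) ∪
      (Finset.range K).image (fun r : ℕ => -(r : ℤ)) := by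
    intro k hk
    simp only [Finset.mem_Ioo, Finset.mem_union, Finset.mem_image, Finset.mem_range] at hk ⊢
    rcases le_total 0 k with h | h
    · exact Or.inl ⟨k.toNat, by lia, by lia⟩
    · exact Or.inr ⟨(-k).toNat, by lia, by lia⟩
  refine (Finset.sum_le_sum_of_subset_of_nonneg sub fun k _ _ => by positivity).trans ?_
  have hnn : ∀ s : Finset ℤ, 0 ≤ ∑ k ∈ s, 1 / (|(k : ℝ)| + 1) := fun s =>
    Finset.sum_nonneg fun k _ => by positivity
  have h1 := Finset.sum_union_inter (f := fun k : ℤ => 1 / (|(k : ℝ)| + 1))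
    (s₁ := (Finset.range K).image (fun r : ℕ => (r : ℤ)))
    (s₂ := (Finset.range K).image (fun r : ℕ => -(r : ℤ)))
  have h2 := hnn ((Finset.range K).image (fun r : ℕ => (r : ℤ)) ∩
    (Finset.range K).image (fun r : ℕ => -(r : ℤ)))
  rw [Finset.sum_image (by intro a _ b _ h; simpa using h),
    Finset.sum_image (by intro a _ b _ h; simpa using h)] at h1
  simp only [Int.cast_neg, Int.cast_natCast, abs_neg, Nat.abs_cast] at h1
  have := sum_inv_succ_le K
  linarith

theorem sum_inv_norm_sq_le (hβ : 0 < β) : ∃ C > 0, ∀ K : ℕ, 0 < K →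
    ∑ k ∈ (Finset.Ioo (-(K : ℤ)) K ×ˢ Finset.Ioo (-(K : ℤ)) K).erase 0,
      1 / ‖blockPt β k.1 k.2‖ ^ 2 ≤ C * (1 + Real.log K) ^ 2 := by
  set m := min 1 (β ^ 2) with hm
  have hm0 : 0 < m := lt_min one_pos (by positivity)
  refine ⟨18 / m, by positivity, fun K hK => ?_⟩
  have key : ∀ k ∈ (Finset.Ioo (-(K : ℤ)) K ×ˢ Finset.Ioo (-(K : ℤ)) K).erase 0,
      1 / ‖blockPt β k.1 k.2‖ ^ 2 ≤
        (9 / 2 / m) * (1 / (|(k.1 : ℝ)| + 1) * (1 / (|(k.2 : ℝ)| + 1))) := by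
    intro k hk
    have hk0 := Finset.ne_of_mem_erase hk
    have hκ : 0 < ‖blockPt β k.1 k.2‖ := norm_pos_iff.mpr (blockPt_int_ne_zero hβ hk0)
    have e : ‖blockPt β k.1 k.2‖ ^ 2 = (k.1 : ℝ) ^ 2 + β ^ 2 * (k.2 : ℝ) ^ 2 := by
      rw [Complex.sq_norm, Complex.normSq_apply]; simp [blockPt]; ring
    have ab : 1 ≤ |(k.1 : ℝ)| + |(k.2 : ℝ)| := by
      have : 1 ≤ |k.1| + |k.2| := by
        by_contra hc
        push Not at hc
        have a := abs_nonneg k.1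
        have b := abs_nonneg k.2
        exact hk0 (Prod.ext (abs_eq_zero.mp (by lia)) (abs_eq_zero.mp (by lia)))
      exact_mod_cast this
    have low : m * ((k.1 : ℝ) ^ 2 + (k.2 : ℝ) ^ 2) ≤ (k.1 : ℝ) ^ 2 + β ^ 2 * (k.2 : ℝ) ^ 2 := by
      have := min_le_left 1 (β ^ 2)
      have := min_le_right 1 (β ^ 2)
      nlinarith [sq_nonneg (k.1 : ℝ), sq_nonneg (k.2 : ℝ)]
    -- With `a + b ≥ 1`, one has `(a+1)(b+1) ≤ (3(a+b)/2)² ≤ 9(a²+b²)/2`. This replaces the planar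
    -- lattice sum by a product of two harmonic sums.
    have up : (|(k.1 : ℝ)| + 1) * (|(k.2 : ℝ)| + 1) ≤ 9 / 2 * ((k.1 : ℝ) ^ 2 + (k.2 : ℝ) ^ 2) := by
      rw [← sq_abs (k.1 : ℝ), ← sq_abs (k.2 : ℝ)]
      nlinarith [abs_nonneg (k.1 : ℝ), abs_nonneg (k.2 : ℝ), sq_nonneg (|(k.1 : ℝ)| - |(k.2 : ℝ)|)]
    rw [e, div_mul_div_comm, one_mul, div_mul_div_comm, mul_one,
      div_le_div_iff₀ (by rw [← e]; positivity) (by positivity), one_mul]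
    nlinarith
  refine (Finset.sum_le_sum key).trans ?_
  rw [← Finset.mul_sum]
  have h2 := sum_inv_abs_succ_le hK
  have h3 : ∑ k ∈ (Finset.Ioo (-(K : ℤ)) K ×ˢ Finset.Ioo (-(K : ℤ)) K).erase 0,
      (1 / (|(k.1 : ℝ)| + 1) * (1 / (|(k.2 : ℝ)| + 1))) ≤ (2 * (1 + Real.log K)) ^ 2 := by
    refine (Finset.sum_le_sum_of_subset_of_nonneg (Finset.erase_subset _ _)
      fun k _ _ => by positivity).trans ?_
    rw [Finset.sum_product, sq]
    dsimp only
    rw [← Finset.sum_mul_sum]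
    have h0 : 0 ≤ ∑ k ∈ Finset.Ioo (-(K : ℤ)) K, 1 / (|(k : ℝ)| + 1) :=
      Finset.sum_nonneg fun k _ => by positivity
    exact mul_le_mul h2 h2 h0 (h0.trans h2)
  calc _ ≤ 9 / 2 / m * (2 * (1 + Real.log K)) ^ 2 := by gcongr
    _ = _ := by ring

end

section
variable {β ξ : ℝ} {M K : ℕ} {τ : ℝ}

theorem blockData_grid (hβ : 0 < β) (hK : 0 < K) (hKM : K ≤ M) (hξ : |ξ| ≤ K ^ 2)
    (hξ' : |ξ| ≤ M ^ 2 / 2) {J : ℕ × ℕ} (hJ : J ∈ gridIdx M K) :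
    BlockData β ξ M K (M + 1 + K * J.1) (1 + K * J.2) := by
  obtain ⟨h1, h2⟩ := gridIdx_le hJ
  have h1' : (K : ℝ) * J.1 ≤ M := by exact_mod_cast h1
  have h2' : (K : ℝ) * J.2 ≤ M := by exact_mod_cast h2
  have hK' : (1 : ℝ) ≤ K := by exact_mod_cast hK
  have hKM' : (K : ℝ) ≤ M := by exact_mod_cast hKM
  have p1 : (0 : ℝ) ≤ K * J.1 := by positivity
  have p2 : (0 : ℝ) ≤ K * J.2 := by positivity
  exact ⟨hβ, hK', hKM', by linarith, by linarith, by linarith, by linarith, hξ, hξ'⟩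

theorem card_gridIdx_le (hK : 0 < K) (hKM : K ≤ M) :
    ((gridIdx M K).card : ℝ) ≤ 4 * (M ^ 2 / K ^ 2) := by
  have hK' : (0 : ℝ) < K := by exact_mod_cast hK
  have hKM' : (1 : ℝ) ≤ M / K := by rw [le_div_iff₀ hK', one_mul]; exact_mod_cast hKM
  rw [gridIdx, Finset.card_product, Finset.card_range]
  push_cast
  have h := @Nat.cast_div_le ℝ _ _ _ M K
  have h0 : (0 : ℝ) ≤ ((M / K : ℕ) : ℝ) := by positivity
  calc _ ≤ ((M : ℝ) / K + M / K) * (M / K + M / K) := by gcongr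
    _ = _ := by ring

theorem cellW_zero_le (hK : 0 < K) : cellW K 0 ≤ 4 * K := by
  have hK' : (1 : ℝ) ≤ K := by exact_mod_cast hK
  simp only [cellW, Int.zero_emod, Int.cast_zero, zero_add, div_one, sub_zero]
  rw [mul_div_assoc, div_self (by linarith)]
  linarith

/-- The difference `k = 0` costs `(4K)²` for each of the `O(M²/K²)` blocks. For the others, the term
`τ²/M⁴` summed over `O(K²)` differences gives `(τK³)²/M⁴ ≤ M²`, while the lattice sum of `1/|κ|²` is
logarithmic and leaves `K⁴`. -/
theorem sum_grid_sum_cellW_le (hβ : 0 < β) : ∃ C > 0, ∀ (M K : ℕ) (τ : ℝ), 0 < K → K ≤ M →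
    0 < τ → τ * (K : ℝ) ^ 3 ≤ M ^ 3 → (M : ℝ) ^ 3 ≤ 8 * τ * K ^ 3 →
    ∑ J ∈ gridIdx M K, ∑ k ∈ Finset.Ioo (-(K : ℤ)) K ×ˢ Finset.Ioo (-(K : ℤ)) K,
      cellW K ⌊K * freq₁ β τ M K k J⌋ * cellW K ⌊K * freq₂ β τ M K k J⌋ ≤
      C * ((1 + Real.log K) ^ 4 * (M ^ 2 + K ^ 4)) := by
  obtain ⟨C₄, hC₄, h₄⟩ := sum_grid_cellW_le hβ
  obtain ⟨C₅, hC₅, h₅⟩ := sum_inv_norm_sq_le hβ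
  refine ⟨64 + C₄ * (4 + C₅), by positivity, ?_⟩
  intro M K τ hK hKM hτ hKτ hMτ
  have hM : 0 < M := hK.trans_le hKM
  have hK' : (1 : ℝ) ≤ K := by exact_mod_cast hK
  have hM' : (0 : ℝ) < M := by exact_mod_cast hM
  have hlog : 1 ≤ 1 + Real.log K := by linarith [Real.log_nonneg hK']
  set ℓ := 1 + Real.log K with hℓ
  rw [Finset.sum_comm]
  have h0 : (0 : ℤ × ℤ) ∈ Finset.Ioo (-(K : ℤ)) K ×ˢ Finset.Ioo (-(K : ℤ)) K := by
    simp; lia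
  rw [← Finset.add_sum_erase _ _ h0]
  set E := (Finset.Ioo (-(K : ℤ)) K ×ˢ Finset.Ioo (-(K : ℤ)) K).erase 0 with hE
  have t0 : ∑ J ∈ gridIdx M K, cellW K ⌊K * freq₁ β τ M K 0 J⌋ * cellW K ⌊K * freq₂ β τ M K 0 J⌋
      ≤ 64 * M ^ 2 := by
    have : ∀ J, freq₁ β τ M K 0 J = 0 ∧ freq₂ β τ M K 0 J = 0 := fun J => by
      simp [freq₁, freq₂, blockPt]
    simp only [(this _).1, (this _).2, mul_zero, Int.floor_zero]
    rw [Finset.sum_const, nsmul_eq_mul]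
    have a := cellW_zero_le hK
    have b := cellW_nonneg hK 0
    calc _ ≤ 4 * ((M : ℝ) ^ 2 / K ^ 2) * (4 * K * (4 * K)) := by
          gcongr
          exact card_gridIdx_le hK hKM
      _ = _ := by field_simp; norm_num
  have t1 : ∑ k ∈ E, ∑ J ∈ gridIdx M K,
      cellW K ⌊K * freq₁ β τ M K k J⌋ * cellW K ⌊K * freq₂ β τ M K k J⌋ ≤
      C₄ * (K ^ 4 * ℓ ^ 2 * (4 * K ^ 2 * (τ ^ 2 / M ^ 4) + C₅ * ℓ ^ 2)) := by
    have : ∀ k ∈ E, ∑ J ∈ gridIdx M K,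
        cellW K ⌊K * freq₁ β τ M K k J⌋ * cellW K ⌊K * freq₂ β τ M K k J⌋ ≤
        C₄ * (K ^ 4 * ℓ ^ 2 * (τ ^ 2 / M ^ 4 + 1 / ‖blockPt β k.1 k.2‖ ^ 2)) := by
      intro k hk
      rw [hE, Finset.mem_erase, Finset.mem_product, Finset.mem_Ioo, Finset.mem_Ioo] at hk
      exact h₄ M K τ k hM hK hτ hMτ hk.1 (abs_le.mpr ⟨by lia, by lia⟩)
        (abs_le.mpr ⟨by lia, by lia⟩)
    refine (Finset.sum_le_sum this).trans ?_
    rw [← Finset.mul_sum, ← Finset.mul_sum, Finset.sum_add_distrib, Finset.sum_const,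
      nsmul_eq_mul]
    have hc : (E.card : ℝ) ≤ 4 * K ^ 2 := by
      have : E.card ≤ (2 * K) * (2 * K) := by
        refine (Finset.card_le_card (Finset.erase_subset _ _)).trans ?_
        rw [Finset.card_product, Int.card_Ioo]
        exact Nat.mul_le_mul (by lia) (by lia)
      have h2 : (E.card : ℝ) ≤ (2 * K) * (2 * K) := by exact_mod_cast this
      linarith
    gcongr
    exact h₅ K hK
  have t2 : (K : ℝ) ^ 4 * (K ^ 2 * (τ ^ 2 / M ^ 4)) ≤ M ^ 2 := by
    have : (τ * (K : ℝ) ^ 3) ^ 2 ≤ ((M : ℝ) ^ 3) ^ 2 := by gcongr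
    calc _ = (τ * (K : ℝ) ^ 3) ^ 2 / M ^ 4 := by ring
      _ ≤ ((M : ℝ) ^ 3) ^ 2 / M ^ 4 := by gcongr
      _ = _ := by field_simp
  have l1 : 1 ≤ ℓ ^ 4 := one_le_pow₀ hlog
  have l2 : ℓ ^ 2 ≤ ℓ ^ 4 := pow_le_pow_right₀ hlog (by norm_num)
  calc _ ≤ 64 * (M : ℝ) ^ 2 +
        C₄ * (K ^ 4 * ℓ ^ 2 * (4 * K ^ 2 * (τ ^ 2 / M ^ 4) + C₅ * ℓ ^ 2)) := add_le_add t0 t1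
    _ = 64 * (M : ℝ) ^ 2 + C₄ * (4 * (ℓ ^ 2 * (K ^ 4 * (K ^ 2 * (τ ^ 2 / M ^ 4)))) +
        C₅ * (ℓ ^ 4 * K ^ 4)) := by ring
    _ ≤ 64 * (ℓ ^ 4 * (M ^ 2 + K ^ 4)) + C₄ * (4 * (ℓ ^ 4 * (M ^ 2 + K ^ 4)) +
        C₅ * (ℓ ^ 4 * (M ^ 2 + K ^ 4))) := by
        have : (M : ℝ) ^ 2 ≤ M ^ 2 + K ^ 4 := le_add_of_nonneg_right (by positivity)
        have hM2 : (0 : ℝ) ≤ M ^ 2 + K ^ 4 := by positivity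
        gcongr
        · nlinarith
        · exact t2.trans this
        · exact le_add_of_nonneg_left (by positivity)
    _ = _ := by ring

theorem sum_box_eq_sum_blocks (f : ℕ → ℕ → ℂ) (M h K : ℕ) (hK : 0 < K) :
    ∑ p ∈ box M h, f p.1 p.2 = ∑ J ∈ gridIdx M K,
      ∑ i ∈ Finset.range (min K (M - K * J.1)), ∑ j ∈ Finset.range (min K (M / h - K * J.2)),
        f (M + 1 + (K * J.1 + i)) (1 + (K * J.2 + j)) := by
  have hR : ∀ n ≤ M, n ≤ (M / K + 1) * K := fun n hn => by
    have := Nat.lt_mul_div_succ M hK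
    rw [mul_comm] at this
    exact hn.trans this.le
  rw [box, Finset.sum_product]
  have e1 : ∀ g : ℕ → ℂ, ∑ x ∈ Finset.Ioc M (2 * M), g x = ∑ i ∈ Finset.range M, g (M + 1 + i) :=
    fun g => by
    symm
    refine Finset.sum_bij (fun i _ => M + 1 + i) ?_ ?_ ?_ ?_
    · intro x hx; simp at hx ⊢; lia
    · intro x _ y _ h; simpa using h
    · intro x hx; simp at hx; exact ⟨x - (M + 1), by simp; lia, by lia⟩
    · intro x _; rfl
  have e2 : ∀ g : ℕ → ℂ, ∑ x ∈ Finset.Icc 1 (M / h), g x =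
      ∑ i ∈ Finset.range (M / h), g (1 + i) := fun g => by
    symm
    refine Finset.sum_bij (fun i _ => 1 + i) ?_ ?_ ?_ ?_
    · intro x hx; simp at hx ⊢; lia
    · intro x _ y _ h; simpa using h
    · intro x hx; simp at hx; exact ⟨x - 1, by simp; lia, by lia⟩
    · intro x _; rfl
  rw [e1, sum_range_eq_sum_blocks _ K M (M / K + 1) (hR M le_rfl), gridIdx, Finset.sum_product]
  refine Finset.sum_congr rfl fun J₁ _ => ?_
  dsimp only
  refine Eq.trans ?_ Finset.sum_comm
  refine Finset.sum_congr rfl fun i _ => ?_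
  rw [e2, sum_range_eq_sum_blocks _ K (M / h) (M / K + 1) (hR _ (Nat.div_le_self _ _))]

end

/-- Pointwise bound for the binary exponential sum. -/
theorem exists_norm_sq_bsum_le {α₂ : ℝ} (hα : 0 < α₂) : ∃ C > 0, ∀ (M h K : ℕ) (τ ξ : ℝ), 0 < K →
    K ≤ M → |τ| * (K : ℝ) ^ 3 ≤ M ^ 3 → (M : ℝ) ^ 3 ≤ 8 * |τ| * K ^ 3 → |ξ| ≤ K ^ 2 →
    |ξ| ≤ M ^ 2 / 2 →
    ‖bsum α₂ ξ M h τ‖ ^ 2 ≤ C * ((1 + Real.log K) ^ 4 * (M ^ 4 / K ^ 2 + M ^ 2 * K ^ 2)) := by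
  set β := √α₂ with hβ'
  have hβ : 0 < β := Real.sqrt_pos.mpr hα
  have hβ2 : β ^ 2 = α₂ := Real.sq_sqrt hα.le
  obtain ⟨C₁, hC₁, h₁⟩ := sum_grid_sum_cellW_le hβ
  set C := 2 * Real.pi * (440 * (1 + β) ^ 3) with hC
  have hC0 : 0 < C := by have := Real.pi_pos; positivity
  refine ⟨4 * (1 + 3 * (C ^ 2 + C)) ^ 2 * C₁, by positivity, ?_⟩
  intro M h K τ ξ hK hKM hKτ hMτ hξ hξ'
  have hM : 0 < M := hK.trans_le hKM
  have hK' : (0 : ℝ) < K := by exact_mod_cast hK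
  have hM' : (0 : ℝ) < M := by exact_mod_cast hM
  have hτ : 0 < |τ| := by
    by_contra h0
    have h0' : |τ| = 0 := le_antisymm (not_lt.mp h0) (abs_nonneg _)
    rw [h0'] at hMτ
    have : (0 : ℝ) < M ^ 3 := by positivity
    linarith
  have e0 : ‖bsum α₂ ξ M h τ‖ = ‖bsum α₂ ξ M h |τ|‖ := by
    simp only [bsum]
    rw [norm_sum_ex_neg, norm_sum_ex_neg, norm_sum_ex_abs_mul]
  set f : ℕ → ℕ → ℂ := fun x y => ex (-(|τ| * Real.log ((x : ℝ) ^ 2 + β ^ 2 * (y : ℝ) ^ 2 - ξ)))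
    with hf
  have e1 : bsum α₂ ξ M h |τ| = ∑ p ∈ box M h, f p.1 p.2 := by
    simp only [bsum, qf, hf, hβ2]
  set S : ℕ × ℕ → ℂ := fun J => ∑ i ∈ Finset.range (min K (M - K * J.1)),
    ∑ j ∈ Finset.range (min K (M / h - K * J.2)),
        f (M + 1 + (K * J.1 + i)) (1 + (K * J.2 + j)) with hS
  have hSJ : ∀ J ∈ gridIdx M K, ‖S J‖ ^ 2 ≤ (1 + 3 * (C ^ 2 + C)) ^ 2 *
      ∑ k ∈ Finset.Ioo (-(K : ℤ)) K ×ˢ Finset.Ioo (-(K : ℤ)) K,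
        cellW K ⌊K * freq₁ β |τ| M K k J⌋ * cellW K ⌊K * freq₂ β |τ| M K k J⌋ := by
    intro J hJ
    have := norm_sq_block_le (blockData_grid hβ hK hKM hξ hξ' hJ) (τ := |τ|) (C := C)
      (by rw [abs_abs]; exact hKτ) hC (m₁ := min K (M - K * J.1)) (m₂ := min K (M / h - K * J.2))
      (min_le_left _ _) (min_le_left _ _)
    refine le_trans (le_of_eq ?_) this
    simp only [hS, hf]
    congr 2
    refine Finset.sum_congr rfl fun i _ => Finset.sum_congr rfl fun j _ => ?_
    push_cast
    ring_nf
  rw [e0, e1, sum_box_eq_sum_blocks f M h K hK]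
  -- Cauchy–Schwarz over the blocks: only the average of the squared block sums is controlled,
  -- through the spacing of the block frequencies.
  calc ‖∑ J ∈ gridIdx M K, S J‖ ^ 2 ≤ (∑ J ∈ gridIdx M K, ‖S J‖) ^ 2 := by
        gcongr; exact norm_sum_le _ _
    _ ≤ (gridIdx M K).card * ∑ J ∈ gridIdx M K, ‖S J‖ ^ 2 := sq_sum_le_card_mul_sum_sq
    _ ≤ 4 * (M ^ 2 / K ^ 2) * ((1 + 3 * (C ^ 2 + C)) ^ 2 *
        (C₁ * ((1 + Real.log K) ^ 4 * (M ^ 2 + K ^ 4)))) := by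
        have s1 := Finset.sum_le_sum hSJ
        rw [← Finset.mul_sum] at s1
        have s2 := h₁ M K |τ| hK hKM hτ hKτ hMτ
        have s3 : ∑ J ∈ gridIdx M K, ‖S J‖ ^ 2 ≤ (1 + 3 * (C ^ 2 + C)) ^ 2 *
          (C₁ * ((1 + Real.log K) ^ 4 * (M ^ 2 + K ^ 4))) := s1.trans (by gcongr)
        exact mul_le_mul (card_gridIdx_le hK hKM) s3 (Finset.sum_nonneg fun _ _ => by positivity)
          (by positivity)
    _ = _ := by field_simp

/-! ### Large values of the smooth zeta sum -/

/-- A dual large sieve inequality in continuous form. -/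
theorem norm_sq_integral_sum_mul_le {ι : Type*} (s : Finset ι) (μ : Measure ℝ) [IsFiniteMeasure μ]
    (a : ι → ℂ) (e : ι → ℝ → ℂ) (f : ℝ → ℂ) (he : ∀ i, Continuous (e i)) (hf : Continuous f)
    {B : ℝ} (hB : ∀ x, ‖f x‖ ≤ B) (he1 : ∀ i x, ‖e i x‖ ≤ 1) :
    ‖∫ x, f x * ∑ i ∈ s, a i * e i x ∂μ‖ ^ 2 ≤ (∑ i ∈ s, ‖a i‖ ^ 2) *
      ∫ p, ‖f p.1‖ * ‖f p.2‖ * ‖∑ i ∈ s, e i p.1 * (starRingEnd ℂ) (e i p.2)‖ ∂(μ.prod μ) := by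
  have hint : ∀ i, Integrable (fun x => f x * e i x) μ := fun i =>
    Integrable.of_bound (hf.mul (he i)).aestronglyMeasurable (B * 1) (Eventually.of_forall fun x => by
      rw [norm_mul]
      exact mul_le_mul (hB x) (he1 i x) (norm_nonneg _) ((norm_nonneg _).trans (hB x)))
  set c : ι → ℂ := fun i => ∫ x, f x * e i x ∂μ with hc
  have e1 : ∫ x, f x * ∑ i ∈ s, a i * e i x ∂μ = ∑ i ∈ s, a i * c i := by
    simp only [Finset.mul_sum]
    rw [integral_finsetSum _ fun i _ => by
      have := (hint i).const_mul (a i)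
      exact this.congr (Eventually.of_forall fun x => by ring)]
    refine Finset.sum_congr rfl fun i _ => ?_
    rw [hc, ← integral_const_mul]
    congr 1; ext x; ring
  -- Duality: after Cauchy–Schwarz has removed the coefficients, the squares are expanded into a
  -- double integral, so that the sum over `i` is performed first and yields a coefficient-free
  -- kernel.
  have e2 : ((∑ i ∈ s, ‖c i‖ ^ 2 : ℝ) : ℂ) = ∫ p, f p.1 * (starRingEnd ℂ) (f p.2) *
      ∑ i ∈ s, e i p.1 * (starRingEnd ℂ) (e i p.2) ∂(μ.prod μ) := by
    simp only [Finset.mul_sum]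
    have hp : ∀ i, Integrable (fun p : ℝ × ℝ => (f p.1 * e i p.1) *
        (starRingEnd ℂ) (f p.2 * e i p.2)) (μ.prod μ) := fun i =>
      (hint i).mul_prod (Complex.conjCLE.integrable_comp_iff.mpr (hint i))
    rw [integral_finsetSum _ fun i _ => (hp i).congr (Eventually.of_forall fun p => by
      simp only [map_mul]; ring)]
    push_cast
    refine Finset.sum_congr rfl fun i _ => ?_
    have h1 : ∫ p, f p.1 * (starRingEnd ℂ) (f p.2) * (e i p.1 * (starRingEnd ℂ) (e i p.2))
        ∂(μ.prod μ) = ∫ p : ℝ × ℝ, (f p.1 * e i p.1) *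
          (fun y => (starRingEnd ℂ) (f y * e i y)) p.2 ∂(μ.prod μ) := by
      congr 1; ext p; simp only [map_mul]; ring
    rw [h1, integral_prod_mul (fun x => f x * e i x) (fun y => (starRingEnd ℂ) (f y * e i y)),
      integral_conj, Complex.mul_conj']
  have e3 : ∑ i ∈ s, ‖c i‖ ^ 2 ≤
      ∫ p, ‖f p.1‖ * ‖f p.2‖ * ‖∑ i ∈ s, e i p.1 * (starRingEnd ℂ) (e i p.2)‖ ∂(μ.prod μ) := by
    have h1 : ∑ i ∈ s, ‖c i‖ ^ 2 = ‖((∑ i ∈ s, ‖c i‖ ^ 2 : ℝ) : ℂ)‖ := by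
      rw [Complex.norm_real, Real.norm_of_nonneg (Finset.sum_nonneg fun i _ => by positivity)]
    rw [h1, e2]
    refine (norm_integral_le_integral_norm _).trans (le_of_eq ?_)
    congr 1; ext p
    rw [norm_mul, norm_mul, RCLike.norm_conj]
  rw [e1]
  calc _ ≤ (∑ i ∈ s, ‖a i‖ * ‖c i‖) ^ 2 := by
        gcongr
        exact (norm_sum_le _ _).trans (le_of_eq (Finset.sum_congr rfl fun i _ => norm_mul _ _))
    _ ≤ (∑ i ∈ s, ‖a i‖ ^ 2) * ∑ i ∈ s, ‖c i‖ ^ 2 := Finset.sum_mul_sq_le_sq_mul_sq _ _ _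
    _ ≤ _ := by gcongr

/-- The coefficients of the square of `zsum`. -/
noncomputable def zcoef (M m : ℕ) : ℝ :=
  ∑ p ∈ (Finset.Icc M (3 * M) ×ˢ Finset.Icc M (3 * M)).filter (fun p => p.1 * p.2 = m),
    wt (p.1 / M) * wt (p.2 / M)

theorem zsum_sq_eq {M : ℕ} (hM : 0 < M) (θ : ℝ) : zsum M θ ^ 2 =
    ∑ m ∈ Finset.Icc (M ^ 2) (9 * M ^ 2), (zcoef M m : ℂ) * ex (θ * Real.log m) := by
  rw [sq, zsum, Finset.sum_mul_sum, ← Finset.sum_product',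
    ← Finset.sum_fiberwise_of_maps_to (t := Finset.Icc (M ^ 2) (9 * M ^ 2))
      (g := fun p : ℕ × ℕ => p.1 * p.2)]
  · refine Finset.sum_congr rfl fun m _ => ?_
    rw [zcoef]; push_cast
    rw [Finset.sum_mul]
    refine Finset.sum_congr rfl fun p hp => ?_
    simp only [Finset.mem_filter, Finset.mem_product, Finset.mem_Icc] at hp
    have h1 : (p.1 : ℝ) ≠ 0 := by have : 0 < p.1 := by lia
                                  positivity
    have h2 : (p.2 : ℝ) ≠ 0 := by have : 0 < p.2 := by lia
                                  positivity
    rw [← hp.2]; push_cast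
    rw [Real.log_mul h1 h2, mul_add, ex_add]; ring
  · intro p hp
    simp only [Finset.mem_product, Finset.mem_Icc] at hp ⊢
    constructor
    · nlinarith [hp.1.1, hp.2.1]
    · nlinarith [hp.1.2, hp.2.2]

/-- The coefficients count factorizations with weights at most `1`, so they are bounded by the
divisor function, and there are `O(M²)` of them. -/
theorem exists_sum_zcoef_sq_le {ε : ℝ} (hε : 0 < ε) : ∃ C > 0, ∀ M : ℕ, 0 < M →
    ∑ m ∈ Finset.Icc (M ^ 2) (9 * M ^ 2), ‖(zcoef M m : ℂ)‖ ^ 2 ≤ C * (M : ℝ) ^ (2 + ε) := by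
  obtain ⟨C, hC, h⟩ := card_divisors_le_rpow (ε := ε / 4) (by positivity)
  refine ⟨9 * (C * 9 ^ (ε / 4)) ^ 2, by positivity, fun M hM => ?_⟩
  have hM' : (1 : ℝ) ≤ M := by exact_mod_cast hM
  have key : ∀ m ∈ Finset.Icc (M ^ 2) (9 * M ^ 2), ‖(zcoef M m : ℂ)‖ ^ 2 ≤
      (C * 9 ^ (ε / 4)) ^ 2 * (M : ℝ) ^ ε := by
    intro m hm
    rw [Finset.mem_Icc] at hm
    have hm0 : m ≠ 0 := by have := Nat.pow_pos (n := 2) hM; lia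
    have h0 : 0 ≤ zcoef M m := Finset.sum_nonneg fun p _ => mul_nonneg wt.nonneg wt.nonneg
    rw [Complex.norm_real, Real.norm_of_nonneg h0]
    have h1 : zcoef M m ≤ (m.divisors.card : ℝ) := by
      have : zcoef M m ≤ ∑ p ∈ m.divisorsAntidiagonal, (1 : ℝ) := by
        refine (Finset.sum_le_sum (g := fun _ => (1 : ℝ)) fun p _ =>
          mul_le_one₀ wt.le_one wt.nonneg wt.le_one).trans
          (Finset.sum_le_sum_of_subset_of_nonneg (fun p hp => ?_) fun _ _ _ => zero_le_one)
        rw [Nat.mem_divisorsAntidiagonal]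
        exact ⟨(Finset.mem_filter.mp hp).2, hm0⟩
      refine this.trans (le_of_eq ?_)
      rw [Finset.sum_const, nsmul_eq_mul, mul_one, ← Nat.map_div_right_divisors, Finset.card_map]
    have h2 : (m : ℝ) ≤ 9 * M ^ 2 := by exact_mod_cast hm.2
    calc zcoef M m ^ 2 ≤ (C * (9 * (M : ℝ) ^ 2) ^ (ε / 4)) ^ 2 := by
          gcongr
          exact h1.trans ((h m hm0).trans (by gcongr))
      _ = _ := by
          rw [Real.mul_rpow (by norm_num) (by positivity), ← mul_assoc, mul_pow, ← Real.rpow_natCast,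
            ← Real.rpow_natCast ((((M : ℝ)) ^ 2) ^ (ε / 4)), ← Real.rpow_natCast (M : ℝ),
            ← Real.rpow_mul (by positivity), ← Real.rpow_mul (by positivity)]
          congr 2; push_cast; ring
  refine (Finset.sum_le_sum key).trans ?_
  rw [Finset.sum_const, nsmul_eq_mul, Nat.card_Icc, Real.rpow_add (by positivity), Real.rpow_two]
  have hc : ((9 * M ^ 2 + 1 - M ^ 2 : ℕ) : ℝ) ≤ 9 * M ^ 2 := by
    have : 9 * M ^ 2 + 1 - M ^ 2 ≤ 9 * M ^ 2 := by have := Nat.pow_pos (n := 2) hM; lia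
    exact_mod_cast this
  calc _ ≤ 9 * (M : ℝ) ^ 2 * ((C * 9 ^ (ε / 4)) ^ 2 * (M : ℝ) ^ ε) := by gcongr
    _ = _ := by ring

/-- Bound for the kernel `∑ m ^ (it)` over `m ∈ [L, 9L]`. -/
theorem norm_sum_Icc_log_le {L : ℕ} (hL : 0 < L) {t : ℝ} (ht : |t| ≤ L ^ 2) :
    ‖∑ m ∈ Finset.Icc L (9 * L), ex (t * Real.log m)‖ ≤ 20 * L / (1 + |t|) + 250 * √|t| := by
  have hLr : (1 : ℝ) ≤ L := by exact_mod_cast hL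
  have e : ∑ m ∈ Finset.Icc L (9 * L), ex (t * Real.log m) =
      ∑ n ∈ Finset.range (8 * L + 1), ex (t * Real.log ((L + n : ℕ) : ℝ)) := by
    symm
    refine Finset.sum_bij (fun n _ => L + n) ?_ ?_ ?_ ?_
    · intro x hx; simp at hx ⊢; lia
    · intro x _ y _ h; simpa using h
    · intro x hx; simp at hx; exact ⟨x - L, by simp; lia, by lia⟩
    · intro x _; rfl
  rw [e]
  have hs := Real.sqrt_nonneg |t|
  have ht0 := abs_nonneg t
  have hq : 0 ≤ 20 * L / (1 + |t|) := by positivity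
  rcases le_total |t| 1 with h1 | h1
  · have triv : ‖∑ n ∈ Finset.range (8 * L + 1), ex (t * Real.log ((L + n : ℕ) : ℝ))‖ ≤ 9 * L := by
      refine (norm_sum_le _ _).trans ?_
      simp only [norm_ex, Finset.sum_const, Finset.card_range, nsmul_eq_mul, mul_one]
      push_cast; linarith
    have : (9 : ℝ) * L ≤ 20 * L / (1 + |t|) := by
      rw [le_div_iff₀ (by linarith)]; nlinarith
    linarith
  have htn : t ≠ 0 := fun h => by rw [h, abs_zero] at h1; linarith
  rcases le_total |t| (L / 2) with h2 | h2
  · have := norm_sum_log_le_of_small hL le_rfl (by lia : L + (8 * L + 1) ≤ 9 * L + 1) htn h2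
    have h3 : 10 * L / |t| ≤ 20 * L / (1 + |t|) := by
      rw [div_le_div_iff₀ (by linarith) (by linarith)]; nlinarith
    linarith
  · have := norm_sum_log_le_of_large hL le_rfl (by lia : L + (8 * L + 1) ≤ 9 * L + 1) h2 ht
    linarith

theorem norm_zsum_le (M : ℕ) (hM : 0 < M) (θ : ℝ) : ‖zsum M θ‖ ≤ 3 * M := by
  rw [zsum]
  refine (norm_sum_le _ _).trans ?_
  have : ∀ n ∈ Finset.Icc M (3 * M), ‖(wt (n / M) : ℂ) * ex (θ * Real.log n)‖ ≤ 1 := fun n _ => by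
    rw [norm_mul, norm_ex, mul_one, Complex.norm_real, Real.norm_of_nonneg wt.nonneg]
    exact wt.le_one
  refine (Finset.sum_le_sum this).trans ?_
  rw [Finset.sum_const, Nat.card_Icc, nsmul_eq_mul, mul_one]
  have : 3 * M + 1 - M ≤ 3 * M := by lia
  exact_mod_cast this

theorem continuous_zsum (M : ℕ) : Continuous (zsum M) :=
  continuous_finsetSum _ fun _ _ => continuous_const.mul (continuous_ex.comp (by fun_prop))

/-- Schur's test: `g(x)g(y) ≤ (g(x)² + g(y)²)/2`, the two halves agree because the kernel is even,
and integrating out the free variable costs the integral of the kernel. -/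
theorem integral_prod_mul_kernel_le (μ : Measure ℝ) [IsFiniteMeasure μ] (hμ : μ ≤ volume)
    {g k : ℝ → ℝ} {B D : ℝ} (hg : Continuous g) (hk : Continuous k) (hg0 : ∀ x, 0 ≤ g x)
    (hk0 : ∀ x, 0 ≤ k x) (hgB : ∀ x, g x ≤ B) (hkD : ∀ x, k x ≤ D) (hki : Integrable k)
    (heven : ∀ x, k (-x) = k x) :
    ∫ p, g p.1 * g p.2 * k (p.1 - p.2) ∂(μ.prod μ) ≤ (∫ x, g x ^ 2 ∂μ) * ∫ x, k x := by
  have hB : ∀ x, ‖g x‖ ≤ B := fun x => by rw [Real.norm_of_nonneg (hg0 x)]; exact hgB x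
  have hD : ∀ x, ‖k x‖ ≤ D := fun x => by rw [Real.norm_of_nonneg (hk0 x)]; exact hkD x
  have hB0 : 0 ≤ B := (hg0 0).trans (hgB 0)
  have i1 : Integrable (fun p : ℝ × ℝ => g p.1 * g p.2 * k (p.1 - p.2)) (μ.prod μ) :=
    Integrable.of_bound (Continuous.aestronglyMeasurable (by fun_prop)) (B * B * D)
      (Eventually.of_forall fun p => by
        rw [norm_mul, norm_mul]
        have := hB p.1
        have := hB p.2
        have := hD (p.1 - p.2)
        gcongr)
  have i2 : Integrable (fun p : ℝ × ℝ => g p.1 ^ 2 * k (p.1 - p.2)) (μ.prod μ) :=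
    Integrable.of_bound (Continuous.aestronglyMeasurable (by fun_prop)) (B ^ 2 * D)
      (Eventually.of_forall fun p => by
        rw [norm_mul, norm_pow]
        have := hB p.1
        have := hD (p.1 - p.2)
        gcongr)
  have i3 : Integrable (fun p : ℝ × ℝ => g p.2 ^ 2 * k (p.1 - p.2)) (μ.prod μ) := by
    refine i2.swap.congr (Eventually.of_forall fun p => ?_)
    simp only [Function.comp, Prod.fst_swap, Prod.snd_swap]
    rw [← heven (p.1 - p.2), neg_sub]
  have e3 : ∫ p, g p.2 ^ 2 * k (p.1 - p.2) ∂(μ.prod μ) =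
      ∫ p, g p.1 ^ 2 * k (p.1 - p.2) ∂(μ.prod μ) := by
    rw [← integral_prod_swap]
    refine integral_congr_ae (Eventually.of_forall fun p => ?_)
    simp only [Prod.fst_swap, Prod.snd_swap]
    rw [← heven (p.1 - p.2), neg_sub]
  have e2 : ∫ p, g p.1 ^ 2 * k (p.1 - p.2) ∂(μ.prod μ) ≤ (∫ x, g x ^ 2 ∂μ) * ∫ x, k x := by
    rw [integral_prod _ i2, ← integral_mul_const]
    refine integral_mono i2.integral_prod_left ?_ fun x => ?_
    · exact (Integrable.of_bound (hg.pow 2).aestronglyMeasurable (B ^ 2)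
        (Eventually.of_forall fun x => by
          rw [Pi.pow_apply, norm_pow]; have := hB x; gcongr)).mul_const _
    · dsimp only
      rw [integral_const_mul]
      refine mul_le_mul_of_nonneg_left ?_ (sq_nonneg _)
      have hi : Integrable (fun y => k (x - y)) := hki.comp_sub_left x
      calc ∫ y, k (x - y) ∂μ ≤ ∫ y, k (x - y) :=
            integral_mono_measure hμ (Eventually.of_forall fun y => hk0 _) hi
        _ = ∫ y, k y := integral_sub_left_eq_self k volume x
  calc ∫ p, g p.1 * g p.2 * k (p.1 - p.2) ∂(μ.prod μ) ≤
        ∫ p, (1 / 2 : ℝ) * (g p.1 ^ 2 * k (p.1 - p.2) + g p.2 ^ 2 * k (p.1 - p.2)) ∂(μ.prod μ) := by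
        refine integral_mono i1 ((i2.add i3).const_mul _) fun p => ?_
        have := hk0 (p.1 - p.2)
        have h2 := sq_nonneg (g p.1 - g p.2)
        dsimp only
        nlinarith
    _ = ∫ p, g p.1 ^ 2 * k (p.1 - p.2) ∂(μ.prod μ) := by
        rw [integral_const_mul, integral_add i2 i3, e3]; ring
    _ ≤ _ := e2

/-- The fourth power of `zsum` on a bounded set, estimated by a dual large sieve. -/
theorem integral_norm_zsum_pow_four_sq_le {M : ℕ} (hM : 0 < M) {T : ℝ} (hT : 1 ≤ T)
    (hTM : 4 * T ≤ (M : ℝ) ^ 4) {S : Set ℝ} (hS : MeasurableSet S) (hST : S ⊆ Set.Icc (-T) T)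
    {η : ℝ} (hη : 0 < η) :
    (∫ τ in S, ‖zsum M (2 * τ)‖ ^ 4) ^ 2 ≤
      (∑ m ∈ Finset.Icc (M ^ 2) (9 * M ^ 2), ‖(zcoef M m : ℂ)‖ ^ 2) *
      ((∫ τ in S, ‖zsum M (2 * τ)‖ ^ 4) *
        (20 * (M : ℝ) ^ 2 * (1 + 4 * T) ^ η * ∫ x : ℝ, (1 + |x|) ^ (-(1 + η)))
        + 500 * √T * (∫ τ in S, ‖zsum M (2 * τ)‖ ^ 2) ^ 2) := by
  set F : ℝ → ℂ := fun τ => zsum M (2 * τ) with hF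
  have hFc : Continuous F := (continuous_zsum M).comp (by fun_prop)
  have hFB : ∀ τ, ‖F τ‖ ≤ 3 * M := fun τ => norm_zsum_le M hM _
  have hvol : volume S < ⊤ := (measure_mono hST).trans_lt (by simp)
  set μ := volume.restrict S with hμ
  have : IsFiniteMeasure μ := ⟨by simpa [hμ] using hvol⟩
  -- The square of the sum is a Dirichlet polynomial of length about `M²`. Testing it against its
  -- own conjugate turns the dual inequality into one for the fourth moment.
  have hf := norm_sq_integral_sum_mul_le (Finset.Icc (M ^ 2) (9 * M ^ 2)) μ
    (fun m => (zcoef M m : ℂ)) (fun m τ => ex (2 * τ * Real.log m))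
    (fun τ => (starRingEnd ℂ) (F τ ^ 2)) (fun m => continuous_ex.comp (by fun_prop))
    (Complex.continuous_conj.comp (hFc.pow 2)) (B := (3 * M) ^ 2) (fun τ => by
      rw [RCLike.norm_conj, norm_pow]; have := hFB τ; gcongr) (fun m τ => (norm_ex _).le)
  have e1 : ∫ τ, (starRingEnd ℂ) (F τ ^ 2) * ∑ m ∈ Finset.Icc (M ^ 2) (9 * M ^ 2),
      (zcoef M m : ℂ) * ex (2 * τ * Real.log m) ∂μ = ((∫ τ, ‖F τ‖ ^ 4 ∂μ : ℝ) : ℂ) := by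
    rw [← integral_complex_ofReal]
    congr 1; ext τ
    rw [← zsum_sq_eq hM]
    push_cast
    rw [show zsum M (2 * τ) = F τ from rfl, Complex.conj_mul', norm_pow]
    push_cast; ring
  rw [e1, Complex.norm_real, Real.norm_eq_abs, sq_abs] at hf
  refine hf.trans (mul_le_mul_of_nonneg_left ?_ (Finset.sum_nonneg fun _ _ => by positivity))
  set g : ℝ → ℝ := fun τ => ‖F τ‖ ^ 2 with hg
  have hgc : Continuous g := by fun_prop
  have hg0 : ∀ x, 0 ≤ g x := fun x => by positivity
  have hgB : ∀ x, g x ≤ (3 * M) ^ 2 := fun x => by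
    have := hFB x; simp only [hg]; gcongr
  -- Frequencies in `S` differ by at most `2T`, so the factor `(1 + 4T)^η` pays for replacing `1/(1
  -- + |x|)` by a kernel integrable on the whole line.
  set c := 20 * (M : ℝ) ^ 2 * (1 + 4 * T) ^ η with hc
  have hc0 : 0 ≤ c := by positivity
  set k : ℝ → ℝ := fun x => c * (1 + |x|) ^ (-(1 + η)) with hk
  have hkc : Continuous k := by
    refine continuous_const.mul (Continuous.rpow_const (by fun_prop) fun x => Or.inl ?_)
    have := abs_nonneg x; positivity
  have hk0 : ∀ x, 0 ≤ k x := fun x => by positivity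
  have hkD : ∀ x, k x ≤ c := fun x => by
    refine mul_le_of_le_one_right hc0 (Real.rpow_le_one_of_one_le_of_nonpos ?_ (by linarith))
    have := abs_nonneg x; linarith
  have hki : Integrable k := by
    have := integrable_one_add_norm (E := ℝ) (μ := volume) (r := 1 + η) (by simp; exact hη)
    exact this.const_mul c
  have hint : ∫ x, k x = c * ∫ x : ℝ, (1 + |x|) ^ (-(1 + η)) := integral_const_mul _ _
  have m1 := integral_prod_mul_kernel_le μ Measure.restrict_le_self hgc hkc hg0 hk0 hgB hkD hki
    (fun x => by simp [hk])
  have e4 : ∫ x, g x ^ 2 ∂μ = ∫ τ, ‖F τ‖ ^ 4 ∂μ := by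
    congr 1; ext x; simp only [hg]; ring
  rw [e4, hint] at m1
  have hgi : Integrable g μ := Integrable.of_bound hgc.aestronglyMeasurable ((3 * M) ^ 2)
    (Eventually.of_forall fun x => by rw [Real.norm_of_nonneg (hg0 x)]; exact hgB x)
  have i1 : Integrable (fun p : ℝ × ℝ => g p.1 * g p.2 * k (p.1 - p.2)) (μ.prod μ) :=
    Integrable.of_bound (Continuous.aestronglyMeasurable (by fun_prop))
      ((3 * M) ^ 2 * (3 * M) ^ 2 * c)
      (Eventually.of_forall fun p => by
        rw [Real.norm_of_nonneg (mul_nonneg (mul_nonneg (hg0 _) (hg0 _)) (hk0 _))]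
        have := hgB p.1
        have := hgB p.2
        have := hkD (p.1 - p.2)
        have := hg0 p.1
        have := hg0 p.2
        have := hk0 (p.1 - p.2)
        gcongr)
  have i2 : Integrable (fun p : ℝ × ℝ => g p.1 * g p.2) (μ.prod μ) := hgi.mul_prod hgi
  have e5 : ∫ p : ℝ × ℝ, g p.1 * g p.2 ∂(μ.prod μ) = (∫ τ, ‖F τ‖ ^ 2 ∂μ) ^ 2 := by
    rw [integral_prod_mul, sq]
  have hae : ∀ᵐ p ∂(μ.prod μ), p ∈ S ×ˢ S := by
    rw [hμ, Measure.prod_restrict]; exact ae_restrict_mem (hS.prod hS)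
  calc _ ≤ ∫ p, (g p.1 * g p.2 * k (p.1 - p.2) + 500 * √T * (g p.1 * g p.2)) ∂(μ.prod μ) := by
        refine integral_mono_of_nonneg (Eventually.of_forall fun p => by positivity)
          (i1.add (i2.const_mul _)) ?_
        filter_upwards [hae] with p hp
        have hx := hST hp.1
        have hy := hST hp.2
        have hd : |p.1 - p.2| ≤ 2 * T := by
          rw [abs_le]; constructor <;> linarith [hx.1, hx.2, hy.1, hy.2]
        have e6 : ∑ m ∈ Finset.Icc (M ^ 2) (9 * M ^ 2), ex (2 * p.1 * Real.log m) *
            (starRingEnd ℂ) (ex (2 * p.2 * Real.log m)) =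
            ∑ m ∈ Finset.Icc (M ^ 2) (9 * M ^ 2), ex (2 * (p.1 - p.2) * Real.log m) := by
          refine Finset.sum_congr rfl fun m _ => ?_
          rw [← ex_neg, ← ex_add]; ring_nf
        have h2d : |2 * (p.1 - p.2)| = 2 * |p.1 - p.2| := by rw [abs_mul, abs_two]
        have hK := norm_sum_Icc_log_le (L := M ^ 2) (by positivity) (t := 2 * (p.1 - p.2)) (by
          rw [h2d]; push_cast; nlinarith)
        rw [← e6] at hK
        have hnn := abs_nonneg (p.1 - p.2)
        have hK1 : 20 * ((M ^ 2 : ℕ) : ℝ) / (1 + |2 * (p.1 - p.2)|) ≤ k (p.1 - p.2) := by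
          rw [h2d]; push_cast
          simp only [hk, hc]
          rw [Real.rpow_neg (by positivity), Real.rpow_add (by positivity), Real.rpow_one,
            div_eq_mul_inv, mul_assoc (20 * (M : ℝ) ^ 2)]
          gcongr
          rw [mul_inv, mul_left_comm, ← div_eq_mul_inv ((1 + 4 * T) ^ η)]
          have h8 : 1 ≤ (1 + 4 * T) ^ η / (1 + |p.1 - p.2|) ^ η := by
            rw [one_le_div (by positivity)]
            gcongr
            linarith
          calc (1 + 2 * |p.1 - p.2|)⁻¹ ≤ (1 + |p.1 - p.2|)⁻¹ * 1 := by
                rw [mul_one]; gcongr; linarith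
            _ ≤ _ := by gcongr
        have hK2 : 250 * √|2 * (p.1 - p.2)| ≤ 500 * √T := by
          have : √|2 * (p.1 - p.2)| ≤ √(2 ^ 2 * T) := Real.sqrt_le_sqrt (by rw [h2d]; linarith)
          rw [Real.sqrt_mul (by norm_num), Real.sqrt_sq (by norm_num)] at this
          linarith
        have e7 : ∀ τ, ‖(starRingEnd ℂ) (F τ ^ 2)‖ = g τ := fun τ => by
          rw [RCLike.norm_conj, norm_pow]
        simp only [e7]
        have hgg := mul_nonneg (hg0 p.1) (hg0 p.2)
        have := mul_le_mul_of_nonneg_left (hK.trans (add_le_add hK1 hK2)) hgg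
        linarith
    _ ≤ _ := by
        rw [integral_add i1 (i2.const_mul _), integral_const_mul, e5]
        exact add_le_add_left m1 _

/-- Large values of `zsum`: a bound for its mean square over a set where it exceeds `V`. -/
theorem exists_integral_norm_zsum_sq_large_le {ε : ℝ} (hε : 0 < ε) : ∃ C > 0, ∀ (M : ℕ) (T V : ℝ)
    (S : Set ℝ), 0 < M → 1 ≤ T → 4 * T ≤ (M : ℝ) ^ 4 → 0 < V → MeasurableSet S →
    S ⊆ Set.Icc (-T) T → (∀ τ ∈ S, V ≤ ‖zsum M (2 * τ)‖) → C * (M : ℝ) ^ (2 + ε) * √T ≤ V ^ 4 →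
    ∫ τ in S, ‖zsum M (2 * τ)‖ ^ 2 ≤ C * (M : ℝ) ^ (4 + ε) / V ^ 2 := by
  obtain ⟨C₀, hC₀, h₀⟩ := exists_sum_zcoef_sq_le (ε := ε / 2) (by positivity)
  set J := ∫ x : ℝ, (1 + |x|) ^ (-(1 + ε / 8)) with hJ
  have hJ0 : 0 ≤ J := integral_nonneg fun x => by positivity
  refine ⟨1000 * C₀ + 40 * C₀ * 2 ^ (ε / 8) * J, by positivity, ?_⟩
  intro M T V S hM hT hTM hV hS hST hVS hcond
  have hM' : (1 : ℝ) ≤ M := by exact_mod_cast hM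
  have main := integral_norm_zsum_pow_four_sq_le hM hT hTM hS hST (η := ε / 8) (by positivity)
  rw [← hJ] at main
  set A := ∑ m ∈ Finset.Icc (M ^ 2) (9 * M ^ 2), ‖(zcoef M m : ℂ)‖ ^ 2 with hA
  have hA0 : 0 ≤ A := Finset.sum_nonneg fun _ _ => by positivity
  have hAle : A ≤ C₀ * (M : ℝ) ^ (2 + ε / 2) := h₀ M hM
  have hvol : volume S < ⊤ := (measure_mono hST).trans_lt (by simp)
  have : IsFiniteMeasure (volume.restrict S) := ⟨by simpa using hvol⟩
  have hFc : Continuous fun τ : ℝ => zsum M (2 * τ) := (continuous_zsum M).comp (by fun_prop)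
  have hpow : ∀ n, Integrable (fun τ => ‖zsum M (2 * τ)‖ ^ n) (volume.restrict S) := fun n =>
    Integrable.of_bound (hFc.norm.pow n).aestronglyMeasurable ((3 * M) ^ n)
      (Eventually.of_forall fun x => by
        rw [Real.norm_of_nonneg (by positivity)]; have := norm_zsum_le M hM (2 * x); gcongr)
  set Y := ∫ τ in S, ‖zsum M (2 * τ)‖ ^ 4 with hY
  set X := ∫ τ in S, ‖zsum M (2 * τ)‖ ^ 2 with hX
  have hX0 : 0 ≤ X := integral_nonneg fun x => by positivity
  have hY0 : 0 ≤ Y := integral_nonneg fun x => by positivity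
  have hXY : V ^ 2 * X ≤ Y := by
    rw [hX, hY, ← integral_const_mul]
    refine setIntegral_mono_on ((hpow 2).const_mul _) (hpow 4) hS fun τ hτ => ?_
    have := hVS τ hτ
    calc V ^ 2 * ‖zsum M (2 * τ)‖ ^ 2 ≤ ‖zsum M (2 * τ)‖ ^ 2 * ‖zsum M (2 * τ)‖ ^ 2 := by gcongr
      _ = _ := by ring
  -- Here the lower bound on `V` enters. The `√T`-term carries `X²`, and `V²X ≤ Y`, so it is at most
  -- `Y²/2` and is absorbed on the left; what remains is `Y ≪ M^(4+ε)`.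
  have hsmall : A * (500 * √T) ≤ V ^ 4 / 2 := by
    have h1 : 1000 * C₀ * (M : ℝ) ^ (2 + ε / 2) * √T ≤ V ^ 4 := by
      refine le_trans ?_ hcond
      gcongr
      · exact le_add_of_nonneg_right (by positivity)
      · linarith
    have h2 : A * (500 * √T) ≤ C₀ * (M : ℝ) ^ (2 + ε / 2) * (500 * √T) := by gcongr
    linarith
  have hsq : (V ^ 2 * X) ^ 2 ≤ Y ^ 2 := by gcongr
  set c₁ := 20 * (M : ℝ) ^ 2 * (1 + 4 * T) ^ (ε / 8) * J with hc₁
  have hYle : Y ≤ 2 * (A * c₁) := by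
    rcases hY0.eq_or_lt with h | h
    · rw [← h]; positivity
    · have h3 : A * (500 * √T) * X ^ 2 ≤ V ^ 4 / 2 * X ^ 2 := by gcongr
      have h4 : Y * Y ≤ 2 * (A * c₁) * Y := by nlinarith
      exact le_of_mul_le_mul_right h4 h
  have hc₁le : c₁ ≤ 20 * 2 ^ (ε / 8) * J * (M : ℝ) ^ (2 + ε / 2) := by
    have h5 : (1 + 4 * T) ^ (ε / 8) ≤ 2 ^ (ε / 8) * (M : ℝ) ^ (ε / 2) := by
      calc (1 + 4 * T) ^ (ε / 8) ≤ (2 * (M : ℝ) ^ 4) ^ (ε / 8) := by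
            gcongr
            have : (1 : ℝ) ≤ M ^ 4 := one_le_pow₀ hM'
            linarith
        _ = _ := by
            rw [Real.mul_rpow (by norm_num) (by positivity), ← Real.rpow_natCast (M : ℝ) 4,
              ← Real.rpow_mul (by positivity)]
            congr 2; push_cast; ring
    rw [Real.rpow_add (by positivity), Real.rpow_two]
    calc c₁ ≤ 20 * (M : ℝ) ^ 2 * (2 ^ (ε / 8) * (M : ℝ) ^ (ε / 2)) * J := by rw [hc₁]; gcongr
      _ = _ := by ring
  rw [le_div_iff₀ (by positivity), mul_comm]
  refine hXY.trans (hYle.trans ?_)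
  have h6 : (M : ℝ) ^ (4 + ε) = (M : ℝ) ^ (2 + ε / 2) * (M : ℝ) ^ (2 + ε / 2) := by
    rw [← Real.rpow_add (by positivity)]; ring_nf
  rw [h6]
  calc 2 * (A * c₁) ≤ 2 * (C₀ * (M : ℝ) ^ (2 + ε / 2) *
        (20 * 2 ^ (ε / 8) * J * (M : ℝ) ^ (2 + ε / 2))) := by gcongr
    _ = (40 * C₀ * 2 ^ (ε / 8) * J) * ((M : ℝ) ^ (2 + ε / 2) * (M : ℝ) ^ (2 + ε / 2)) := by ring
    _ ≤ _ := by gcongr; exact le_add_of_nonneg_left (by positivity)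

/-! ### The smooth counting function and its coarse lower bound -/

/-- The logarithm of the value of `α₃` for which the form takes the value `ξ` at the point. -/
noncomputable def lam (α₂ ξ : ℝ) (i : (ℕ × ℕ) × ℕ) : ℝ :=
  Real.log (qf α₂ i.1 - ξ) - 2 * Real.log i.2

/-- The index set of the points at scale `M`. -/
def pts (M h : ℕ) : Finset ((ℕ × ℕ) × ℕ) := box M h ×ˢ Finset.Icc M (3 * M)

/-- A smooth count of the points at scale `M` at which the form is within `M² / T` of `ξ`. -/
noncomputable def gsum (α₂ ξ : ℝ) (M h : ℕ) (T u : ℝ) : ℝ :=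
  ∑ i ∈ pts M h, wt (i.2 / M) * bump (T * (u - lam α₂ ξ i))

theorem continuous_gsum (α₂ ξ : ℝ) (M h : ℕ) (T : ℝ) : Continuous (gsum α₂ ξ M h T) :=
  continuous_finsetSum _ fun _ _ => continuous_const.mul
    ((bump.contDiff (n := 0)).continuous.comp (by fun_prop))

theorem abs_exp_sub_exp_le {u v : ℝ} (hu : u ≤ 0) (huv : |u - v| ≤ 1) :
    |Real.exp u - Real.exp v| ≤ 3 * |u - v| := by
  have he : Real.exp 1 ≤ 3 := by linarith [Real.exp_one_lt_d9]
  have hv : v ≤ 1 := by have := (abs_le.mp huv).1; linarith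
  have key : ∀ x y : ℝ, y ≤ x → x ≤ 1 → Real.exp x - Real.exp y ≤ 3 * (x - y) := fun x y hxy hx => by
    have h1 : Real.exp y = Real.exp x * Real.exp (y - x) := by rw [← Real.exp_add]; ring_nf
    have h2 := Real.add_one_le_exp (y - x)
    have h3 : Real.exp x ≤ 3 := (Real.exp_le_exp.mpr hx).trans he
    have h4 := Real.exp_pos x
    rw [h1]
    nlinarith
  rcases le_total u v with h | h
  · rw [abs_sub_comm, abs_sub_comm u, abs_of_nonneg (by linarith [Real.exp_le_exp.mpr h]),
      abs_of_nonneg (by linarith)]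
    exact key v u h hv
  · rw [abs_of_nonneg (by linarith [Real.exp_le_exp.mpr h]), abs_of_nonneg (by linarith)]
    exact key u v h (by linarith)

/-- A nonzero term gives `|u - λ| < 1/T`, and `Q(x) - ξ = -(e^u - e^λ) x₃²`. Here `27 = 3 · 3²`,
from the Lipschitz constant of `exp` and `x₃ ≤ 3M`; the radius `4M` exceeds `√(4 + 1 + 9) M`. -/
theorem exists_mem_puncturedBall_of_gsum_ne_zero {α₂ ξ : ℝ} (hα : 0 < α₂) {M h : ℕ} (hM : 0 < M)
    (hξ : |ξ| ≤ (M : ℝ) ^ 2 / 2) {T u : ℝ} (hT : 1 ≤ T) (hu : u ≤ 0)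
    (hg : gsum α₂ ξ M h T u ≠ 0) :
    ∃ x ∈ puncturedBall (4 * M), |diagForm α₂ (Real.exp u) x - ξ| ≤ 27 * (M : ℝ) ^ 2 / T := by
  obtain ⟨i, hi, hne⟩ := Finset.exists_ne_zero_of_sum_ne_zero hg
  have hb : bump (T * (u - lam α₂ ξ i)) ≠ 0 := fun h0 => hne (by rw [h0, mul_zero])
  have hlt : |T * (u - lam α₂ ξ i)| < 1 := by
    by_contra hc; exact hb (bump_zero (not_lt.mp hc))
  simp only [pts, box, Finset.mem_product, Finset.mem_Ioc, Finset.mem_Icc] at hi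
  obtain ⟨⟨⟨h1, h2⟩, h3, h4⟩, h5, h6⟩ := hi
  have hM' : (1 : ℝ) ≤ M := by exact_mod_cast hM
  have a1 : (M : ℝ) ≤ i.1.1 := by exact_mod_cast h1.le
  have a2 : (i.1.1 : ℝ) ≤ 2 * M := by exact_mod_cast h2
  have a4 : (i.1.2 : ℝ) ≤ M := by exact_mod_cast h4.trans (Nat.div_le_self M h)
  have a5 : (M : ℝ) ≤ i.2 := by exact_mod_cast h5
  have a6 : (i.2 : ℝ) ≤ 3 * M := by exact_mod_cast h6
  have hn : (0 : ℝ) < i.2 := by linarith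
  have hq : 0 < qf α₂ i.1 - ξ := by
    have := (abs_le.mp hξ).2
    have : 0 ≤ α₂ * (i.1.2 : ℝ) ^ 2 := by positivity
    rw [qf]; nlinarith
  refine ⟨![(i.1.1 : ℤ), (i.1.2 : ℤ), (i.2 : ℤ)], ⟨fun h0 => ?_, ?_⟩, ?_⟩
  · have := congrFun h0 0
    simp at this
    rw [this] at a1; norm_num at a1; linarith
  · rw [EuclideanSpace.norm_eq]
    simp only [Fin.sum_univ_three, Matrix.cons_val, Int.cast_natCast, Real.norm_eq_abs, sq_abs]
    rw [Real.sqrt_lt' (by linarith)]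
    have : (0 : ℝ) ≤ i.1.2 := by positivity
    nlinarith
  · have hT0 : 0 < T := by linarith
    have hd : |u - lam α₂ ξ i| ≤ 1 / T := by
      rw [abs_mul, abs_of_pos hT0] at hlt
      rw [le_div_iff₀ hT0]; linarith
    have hd1 : |u - lam α₂ ξ i| ≤ 1 := hd.trans (by rw [div_le_one hT0]; exact hT)
    have he := abs_exp_sub_exp_le hu hd1
    have hel : Real.exp (lam α₂ ξ i) * (i.2 : ℝ) ^ 2 = qf α₂ i.1 - ξ := by
      rw [lam, Real.exp_sub, Real.exp_log hq, two_mul, Real.exp_add, Real.exp_log hn]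
      field_simp
    have e : diagForm α₂ (Real.exp u) ![(i.1.1 : ℤ), (i.1.2 : ℤ), (i.2 : ℤ)] - ξ =
        -((Real.exp u - Real.exp (lam α₂ ξ i)) * (i.2 : ℝ) ^ 2) := by
      rw [sub_mul, hel, qf, diagForm]; simp; ring
    rw [e, abs_neg, abs_mul, abs_of_pos (by positivity : (0 : ℝ) < (i.2 : ℝ) ^ 2)]
    calc _ ≤ 3 * (1 / T) * (3 * M) ^ 2 := by
          refine mul_le_mul (he.trans (by gcongr)) (by gcongr) (by positivity) (by positivity)
      _ = _ := by ring

theorem card_Icc_ceil_floor_ge {a b : ℝ} (ha : 0 ≤ a) :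
    b - a - 1 ≤ ((Finset.Icc ⌈a⌉₊ ⌊b⌋₊).card : ℝ) := by
  rw [Nat.card_Icc]
  have h1 := Nat.lt_floor_add_one b
  have h2 := Nat.ceil_lt_add_one ha
  have h3 : ((⌊b⌋₊ + 1 : ℕ) : ℝ) - ⌈a⌉₊ ≤ ((⌊b⌋₊ + 1 - ⌈a⌉₊ : ℕ) : ℝ) := by
    rw [sub_le_iff_le_add]
    exact_mod_cast (by lia : ⌊b⌋₊ + 1 ≤ ⌊b⌋₊ + 1 - ⌈a⌉₊ + ⌈a⌉₊)
  push_cast at h3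
  linarith

/-- The number of `n` close to a given real point, weighted. -/
theorem sum_wt_bump_ge {M : ℕ} (hM : 0 < M) {T : ℝ} (hT : 4 ≤ T) (hTM : 8 * T ≤ M) {y v : ℝ}
    (h1 : 33 / 25 * M ≤ y) (h2 : y ≤ 61 / 25 * M) (hv : v = 2 * Real.log y) :
    M / (8 * T) ≤ ∑ n ∈ Finset.Icc M (3 * M), wt (n / M) * bump (T * (v - 2 * Real.log n)) := by
  have hM' : (0 : ℝ) < M := by exact_mod_cast hM
  have hT0 : 0 < T := by linarith
  have hy : 0 < y := by nlinarith
  -- For `|n - y| ≤ r` the argument of the bump is at most `1/2` in absolute value, so the bump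
  -- equals `1`. Since `8T ≤ M` gives `r ≥ 1`, the interval contains at least `2r - 1 ≥ r` integers.
  set r := y / (8 * T) with hr
  have hr32 : r ≤ y / 32 := by rw [hr]; gcongr; linarith
  have hrM : M / (8 * T) ≤ r := by rw [hr]; gcongr; linarith
  have hr1 : 1 ≤ r := by
    refine le_trans ?_ hrM
    rw [le_div_iff₀ (by positivity)]; linarith
  set I := Finset.Icc ⌈y - r⌉₊ ⌊y + r⌋₊ with hI
  have hmem : ∀ n ∈ I, y - r ≤ n ∧ (n : ℝ) ≤ y + r := fun n hn => by
    rw [hI, Finset.mem_Icc] at hn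
    exact ⟨Nat.ceil_le.mp hn.1, (Nat.le_floor_iff (by linarith)).mp hn.2⟩
  have hsub : I ⊆ Finset.Icc M (3 * M) := fun n hn => by
    obtain ⟨g1, g2⟩ := hmem n hn
    rw [Finset.mem_Icc]
    constructor
    · exact_mod_cast (by linarith : (M : ℝ) ≤ n)
    · exact_mod_cast (by linarith : (n : ℝ) ≤ 3 * M)
  have hone : ∀ n ∈ I, wt ((n : ℝ) / M) * bump (T * (v - 2 * Real.log n)) = 1 := fun n hn => by
    obtain ⟨g1, g2⟩ := hmem n hn
    have hn0 : (0 : ℝ) < n := by linarith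
    rw [wt_one, bump_one, one_mul]
    · have e : v - 2 * Real.log n = 2 * (Real.log y - Real.log n) := by rw [hv]; ring
      have hl : |Real.log y - Real.log n| ≤ r / (y - r) := by
        have hyr : 0 < y - r := by linarith
        have l1 : ∀ a b : ℝ, y - r ≤ a → y - r ≤ b → |b - a| ≤ r →
            Real.log b - Real.log a ≤ r / (y - r) := fun a b ha hb hab => by
          have ha0 : 0 < a := by linarith
          have hb0 : 0 < b := by linarith
          rw [← Real.log_div hb0.ne' ha0.ne']
          have := Real.log_le_sub_one_of_pos (div_pos hb0 ha0)
          have h7 : b / a - 1 = (b - a) / a := by field_simp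
          rw [h7] at this
          refine this.trans ?_
          have h8 := (abs_le.mp hab).2
          gcongr
        rw [abs_le]
        constructor
        · have := l1 y n (by linarith) g1 (abs_le.mpr ⟨by linarith, by linarith⟩)
          linarith
        · exact l1 n y g1 (by linarith) (abs_le.mpr ⟨by linarith, by linarith⟩)
      rw [e, abs_mul, abs_mul, abs_two, abs_of_pos hT0]
      have h9 : r / (y - r) ≤ 1 / (4 * T) := by
        rw [div_le_div_iff₀ (by linarith) (by positivity), one_mul]
        have : r * (8 * T) = y := by rw [hr]; field_simp
        linarith
      calc T * (2 * |Real.log y - Real.log n|) ≤ T * (2 * (1 / (4 * T))) := by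
            gcongr; exact hl.trans h9
        _ = 1 / 2 := by field_simp; norm_num
    · rw [le_div_iff₀ hM']; linarith
    · rw [div_le_iff₀ hM']; linarith
  calc M / (8 * T) ≤ r := hrM
    _ ≤ (y + r) - (y - r) - 1 := by linarith
    _ ≤ (I.card : ℝ) := card_Icc_ceil_floor_ge (by linarith)
    _ = ∑ n ∈ I, wt ((n : ℝ) / M) * bump (T * (v - 2 * Real.log n)) := by
        rw [Finset.sum_congr rfl hone, Finset.sum_const, nsmul_eq_mul, mul_one]
    _ ≤ _ := Finset.sum_le_sum_of_subset_of_nonneg hsub fun _ _ _ =>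
        mul_nonneg wt.nonneg bump.nonneg

/-- At resolution `T ≤ M/8` no equidistribution is needed: for each `(x₁, x₂)` the admissible `x₃`
fill an interval of length at least about `M/T`, so every `u` is reached with the expected order of
multiplicity. -/
theorem gsum_ge {α₂ ξ : ℝ} (hα : 0 < α₂) {M h : ℕ} (hh : 0 < h) (hαh : 10 * α₂ ≤ (h : ℝ) ^ 2)
    (hM : 12 ≤ M) (hMh : 2 * h ≤ M) (hξ : |ξ| ≤ (M : ℝ) ^ 2 / 100) {T u : ℝ} (hT : 4 ≤ T)
    (hTM : 8 * T ≤ M) (hu : -Real.log 2 ≤ u) (hu0 : u ≤ 0) :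
    (M : ℝ) ^ 3 / (96 * h) ≤ T * gsum α₂ ξ M h T u := by
  have hM' : (12 : ℝ) ≤ M := by exact_mod_cast hM
  have hh' : (1 : ℝ) ≤ h := by exact_mod_cast hh
  have hT0 : 0 < T := by linarith
  -- On this sub-box `4M/3 ≤ x₁ ≤ 5M/3`, so for all `e^u` in `[1/2, 1]` the real solution for `x₃`
  -- lies in `[33M/25, 61M/25]`, safely inside the region where the weight is `1`.
  set P := Finset.Icc (M + 2 * (M / 6) + 2) (M + 4 * (M / 6)) ×ˢ Finset.Icc 1 (M / h) with hP
  have hPsub : P ⊆ box M h := by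
    intro p hp
    simp only [hP, box, Finset.mem_product, Finset.mem_Icc, Finset.mem_Ioc] at hp ⊢
    exact ⟨⟨by lia, by lia⟩, hp.2⟩
  have hcard : (M : ℝ) ^ 2 / (12 * h) ≤ P.card := by
    rw [hP, Finset.card_product, Nat.card_Icc, Nat.card_Icc]
    have c1 : (M : ℝ) / 6 ≤ ((M + 4 * (M / 6) + 1 - (M + 2 * (M / 6) + 2) : ℕ) : ℝ) := by
      rw [div_le_iff₀ (by norm_num)]
      exact_mod_cast (by lia : M ≤ (M + 4 * (M / 6) + 1 - (M + 2 * (M / 6) + 2)) * 6)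
    have c2 : (M : ℝ) / (2 * h) ≤ ((M / h + 1 - 1 : ℕ) : ℝ) := by
      rw [Nat.add_sub_cancel, div_le_iff₀ (by positivity)]
      have a1 := Nat.lt_mul_div_succ M hh
      have a2 : 1 ≤ M / h := (Nat.one_le_div_iff hh).mpr (by lia)
      have a3 : M ≤ M / h * (2 * h) := by nlinarith
      exact_mod_cast a3
    rw [Nat.cast_mul]
    calc _ = (M : ℝ) / 6 * (M / (2 * h)) := by field_simp; norm_num
      _ ≤ _ := by gcongr
  have hinner : ∀ p ∈ P, (M : ℝ) / (8 * T) ≤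
      ∑ n ∈ Finset.Icc M (3 * M), wt (n / M) * bump (T * (u - lam α₂ ξ (p, n))) := by
    intro p hp
    simp only [hP, Finset.mem_product, Finset.mem_Icc] at hp
    obtain ⟨⟨p1, p2⟩, p3, p4⟩ := hp
    have b1 : 4 * (M : ℝ) / 3 ≤ p.1 := by
      rw [div_le_iff₀ (by norm_num)]; exact_mod_cast (by lia : 4 * M ≤ p.1 * 3)
    have b2 : (p.1 : ℝ) ≤ 5 * M / 3 := by
      rw [le_div_iff₀ (by norm_num)]; exact_mod_cast (by lia : p.1 * 3 ≤ 5 * M)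
    have b3 : α₂ * (p.2 : ℝ) ^ 2 ≤ (M : ℝ) ^ 2 / 10 := by
      have : (p.2 : ℝ) * h ≤ M := by
        exact_mod_cast (Nat.mul_le_mul_right h p4).trans (Nat.div_mul_le_self M h)
      have h5 : ((p.2 : ℝ) * h) ^ 2 ≤ (M : ℝ) ^ 2 := by gcongr
      have h6 : 10 * α₂ * (p.2 : ℝ) ^ 2 ≤ (h : ℝ) ^ 2 * (p.2 : ℝ) ^ 2 := by gcongr
      nlinarith
    have b4 : 0 ≤ α₂ * (p.2 : ℝ) ^ 2 := by positivity
    have hx := abs_le.mp hξ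
    have q1 : 1759 / 1000 * (M : ℝ) ^ 2 ≤ qf α₂ p - ξ := by rw [qf]; nlinarith
    have q2 : qf α₂ p - ξ ≤ 29 / 10 * (M : ℝ) ^ 2 := by rw [qf]; nlinarith
    have hq : 0 < qf α₂ p - ξ := by nlinarith
    set w := (qf α₂ p - ξ) * Real.exp (-u) with hw
    have e1 : 1 ≤ Real.exp (-u) := Real.one_le_exp (by linarith)
    have e2 : Real.exp (-u) ≤ 2 := by
      rw [← Real.exp_log (by norm_num : (0 : ℝ) < 2)]; exact Real.exp_le_exp.mpr (by linarith)
    have w1 : (33 / 25 * (M : ℝ)) ^ 2 ≤ w := by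
      rw [hw]; nlinarith
    have w2 : w ≤ (61 / 25 * (M : ℝ)) ^ 2 := by
      rw [hw]; nlinarith
    have hw0 : 0 < w := by positivity
    have := sum_wt_bump_ge (M := M) (by lia) hT hTM (y := √w) (v := Real.log w)
      (Real.le_sqrt_of_sq_le w1) ((Real.sqrt_le_left (by positivity)).mpr w2) (by
        rw [Real.log_sqrt hw0.le]; ring)
    refine this.trans (le_of_eq (Finset.sum_congr rfl fun n _ => ?_))
    rw [← bump.neg, lam, hw, Real.log_mul hq.ne' (Real.exp_pos _).ne', Real.log_exp]
    congr 2; ring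
  have hg : (P.card : ℝ) * (M / (8 * T)) ≤ gsum α₂ ξ M h T u := by
    rw [gsum, pts, Finset.sum_product, ← nsmul_eq_mul, ← Finset.sum_const]
    exact (Finset.sum_le_sum hinner).trans (Finset.sum_le_sum_of_subset_of_nonneg hPsub
      fun _ _ _ => Finset.sum_nonneg fun _ _ => mul_nonneg wt.nonneg bump.nonneg)
  calc (M : ℝ) ^ 3 / (96 * h) = T * ((M : ℝ) ^ 2 / (12 * h) * (M / (8 * T))) := by
        field_simp; norm_num
    _ ≤ _ := by gcongr; exact le_trans (by gcongr) hg

theorem hasCompactSupport_sum_translates {ι : Type*} (s : Finset ι) (c : ι → ℂ) (l : ι → ℝ)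
    {ψ : ℝ → ℂ} (hψ : HasCompactSupport ψ) :
    HasCompactSupport (fun u => ∑ i ∈ s, c i * ψ (u - l i)) := by
  classical
  induction s using Finset.induction_on with
  | empty => simp only [Finset.sum_empty]; exact HasCompactSupport.zero
  | insert a s ha ih =>
    simp_rw [Finset.sum_insert ha]
    exact ((hψ.comp_homeomorph (Homeomorph.subRight (l a))).mul_left (f := fun _ => c a)).add ih

theorem integrable_norm_sq_sum_translates {ι : Type*} (s : Finset ι) (c : ι → ℂ) (l : ι → ℝ)
    {ψ : ℝ → ℂ} (hψ : HasCompactSupport ψ) (hψ' : Continuous ψ) :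
    Integrable (fun u => ‖∑ i ∈ s, c i * ψ (u - l i)‖ ^ 2) := by
  have hc : Continuous (fun u => ∑ i ∈ s, c i * ψ (u - l i)) := by fun_prop
  have hcs := (hasCompactSupport_sum_translates s c l hψ).norm
  simp only [sq]
  exact (hc.norm.mul hc.norm).integrable_of_hasCompactSupport hcs.mul_left

/-! ### The variance bound for the exceptional set -/

/-- The spectral weight of the difference of two smoothings. -/
noncomputable def dker (T T₀ τ : ℝ) : ℝ := ‖ft bumpC (τ / T) - ft bumpC (τ / T₀)‖ ^ 2

/-- The values of `u = log α₃` for which no point at scale `M` is counted. -/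
def badSet (α₂ ξ : ℝ) (M h : ℕ) (T : ℝ) : Set ℝ :=
  {u | u ∈ Set.Icc (-Real.log 2) 0 ∧ gsum α₂ ξ M h T u = 0}

theorem measurableSet_badSet (α₂ ξ : ℝ) (M h : ℕ) (T : ℝ) :
    MeasurableSet (badSet α₂ ξ M h T) :=
  measurableSet_Icc.inter ((isClosed_singleton.preimage (continuous_gsum α₂ ξ M h T)).measurableSet)

theorem ft_scale_sub {T T₀ : ℝ} (hT : 0 < T) (hT₀ : 0 < T₀) (τ : ℝ) :
    ft (fun u => (T : ℂ) * bumpC (T * u) - (T₀ : ℂ) * bumpC (T₀ * u)) τ =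
      ft bumpC (τ / T) - ft bumpC (τ / T₀) := by
  rw [← ft_scale bumpC hT, ← ft_scale bumpC hT₀]
  have hi : ∀ T : ℝ, 0 < T → Integrable (fun u : ℝ => ex (-(u * τ)) * ((T : ℂ) * bumpC (T * u))) :=
    fun T hT => Continuous.integrable_of_hasCompactSupport
      ((continuous_ex.comp (by fun_prop)).mul (contDiff_scale T).continuous)
      (hasCompactSupport_scale T hT).mul_left
  simp only [ft]
  rw [← integral_sub (hi T hT) (hi T₀ hT₀)]
  congr 1; ext u; ring

theorem sum_pts_ex_eq {α₂ ξ : ℝ} (M h : ℕ) (τ : ℝ) :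
    ∑ i ∈ pts M h, (wt (i.2 / M) : ℂ) * ex (-(τ * lam α₂ ξ i)) =
      bsum α₂ ξ M h τ * zsum M (2 * τ) := by
  rw [pts, bsum, zsum, Finset.sum_mul_sum, Finset.sum_product]
  refine Finset.sum_congr rfl fun p _ => Finset.sum_congr rfl fun n _ => ?_
  rw [lam, show -(τ * (Real.log (qf α₂ p - ξ) - 2 * Real.log n)) =
    -(τ * Real.log (qf α₂ p - ξ)) + 2 * τ * Real.log n by ring, ex_add]
  ring

/-- Chebyshev in mean square: on the bad set the fine count is zero and the coarse count is at least
`M³/(96h)`, so their difference is large. Plancherel expresses its mean square through the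
transform, which is a product because the frequencies `lam` split as a function of `(x₁, x₂)` plus a
function of `x₃`. -/
theorem volume_badSet_mul_le {α₂ ξ : ℝ} (hα : 0 < α₂) {M h : ℕ} (hh : 0 < h)
    (hαh : 10 * α₂ ≤ (h : ℝ) ^ 2) (hM : 12 ≤ M) (hMh : 2 * h ≤ M) (hξ : |ξ| ≤ (M : ℝ) ^ 2 / 100)
    {T T₀ : ℝ} (hT : 0 < T) (hT₀ : 4 ≤ T₀) (hTM : 8 * T₀ ≤ M) :
    Integrable (fun τ => dker T T₀ τ * (‖bsum α₂ ξ M h τ‖ ^ 2 * ‖zsum M (2 * τ)‖ ^ 2)) ∧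
    volume.real (badSet α₂ ξ M h T) * ((M : ℝ) ^ 3 / (96 * h)) ^ 2 ≤
      ∫ τ, dker T T₀ τ * (‖bsum α₂ ξ M h τ‖ ^ 2 * ‖zsum M (2 * τ)‖ ^ 2) := by
  have hT₀' : 0 < T₀ := by linarith
  set ψ : ℝ → ℂ := fun u => (T : ℂ) * bumpC (T * u) - (T₀ : ℂ) * bumpC (T₀ * u) with hψ
  have hψc : HasCompactSupport ψ := by
    have e : ψ = (fun u : ℝ => (T : ℂ) * bumpC (T * u)) +
        (-fun u : ℝ => (T₀ : ℂ) * bumpC (T₀ * u)) := by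
      ext u; simp [hψ, sub_eq_add_neg]
    rw [e]
    exact (hasCompactSupport_scale T hT).add ((hasCompactSupport_scale T₀ hT₀').neg)
  have hψs : ContDiff ℝ (⊤ : ℕ∞) ψ := (contDiff_scale T).sub (contDiff_scale T₀)
  obtain ⟨p1, p2⟩ := plancherel_translates (pts M h) (fun i => (wt (i.2 / M) : ℂ))
    (lam α₂ ξ) hψc hψs
  have e1 : (fun τ => ‖ft ψ τ‖ ^ 2 *
      ‖∑ i ∈ pts M h, (wt (i.2 / M) : ℂ) * ex (-(τ * lam α₂ ξ i))‖ ^ 2) =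
      fun τ => dker T T₀ τ * (‖bsum α₂ ξ M h τ‖ ^ 2 * ‖zsum M (2 * τ)‖ ^ 2) := by
    ext τ
    rw [sum_pts_ex_eq, hψ, ft_scale_sub hT hT₀', norm_mul, mul_pow, dker]
  rw [e1] at p1 p2
  refine ⟨p1, ?_⟩
  rw [p2]
  have hint := integrable_norm_sq_sum_translates (pts M h) (fun i => (wt (i.2 / M) : ℂ))
    (lam α₂ ξ) hψc hψs.continuous
  have e2 : ∀ u, ∑ i ∈ pts M h, (wt (i.2 / M) : ℂ) * ψ (u - lam α₂ ξ i) =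
      ((T * gsum α₂ ξ M h T u - T₀ * gsum α₂ ξ M h T₀ u : ℝ) : ℂ) := fun u => by
    simp only [gsum, hψ, bumpC]
    push_cast
    rw [Finset.mul_sum, Finset.mul_sum, ← Finset.sum_sub_distrib]
    refine Finset.sum_congr rfl fun i _ => ?_
    ring
  have hB := measurableSet_badSet α₂ ξ M h T
  have hvol : volume (badSet α₂ ξ M h T) < ⊤ :=
    (measure_mono (fun u hu => hu.1 : _ ⊆ Set.Icc (-Real.log 2) 0)).trans_lt (by simp)
  calc _ = ∫ u in badSet α₂ ξ M h T, ((M : ℝ) ^ 3 / (96 * h)) ^ 2 := by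
        rw [setIntegral_const, smul_eq_mul]
    _ ≤ ∫ u in badSet α₂ ξ M h T,
        ‖∑ i ∈ pts M h, (wt (i.2 / M) : ℂ) * ψ (u - lam α₂ ξ i)‖ ^ 2 := by
        refine setIntegral_mono_on (integrableOn_const hvol.ne) hint.integrableOn hB fun u hu => ?_
        rw [e2, Complex.norm_real, hu.2, mul_zero, zero_sub, norm_neg]
        have hg := gsum_ge hα hh hαh hM hMh hξ hT₀ hTM hu.1.1 hu.1.2
        have h0 : (0 : ℝ) ≤ (M : ℝ) ^ 3 / (96 * h) := by positivity
        rw [Real.norm_of_nonneg (h0.trans hg)]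
        gcongr
    _ ≤ _ := setIntegral_le_integral hint (Eventually.of_forall fun u => by positivity)

theorem dker_le_sixteen (T T₀ τ : ℝ) : dker T T₀ τ ≤ 16 := by
  have : ‖ft bumpC (τ / T) - ft bumpC (τ / T₀)‖ ≤ 4 :=
    (norm_sub_le _ _).trans (by linarith [norm_ft_bumpC_le (τ / T), norm_ft_bumpC_le (τ / T₀)])
  calc dker T T₀ τ ≤ 4 ^ 2 := by rw [dker]; gcongr
    _ = 16 := by norm_num

/-- The two smoothings have the same mass, so their transforms agree at `0`; the Lipschitz bound
measures the departure. -/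
theorem dker_le_sq {T T₀ : ℝ} (hT₀ : 0 < T₀) (hT : T₀ ≤ T) (τ : ℝ) :
    dker T T₀ τ ≤ (4 * Real.pi * (|τ| / T₀)) ^ 2 := by
  have hT' : 0 < T := hT₀.trans_le hT
  have hpi := Real.pi_pos
  rw [dker]
  gcongr
  refine (norm_ft_bumpC_sub_le _ _).trans ?_
  gcongr
  have e : τ / T - τ / T₀ = τ * (1 / T - 1 / T₀) := by ring
  have h1 : 1 / T ≤ 1 / T₀ := by gcongr
  have h2 : 0 < 1 / T := by positivity
  rw [e, abs_mul, div_eq_mul_one_div |τ|]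
  gcongr
  rw [abs_le]; constructor <;> linarith

theorem exists_dker_decay (k : ℕ) : ∃ C > 0, ∀ T T₀ τ : ℝ, 0 < T₀ → T₀ ≤ T →
    dker T T₀ τ * (|τ| / T) ^ (2 * k) ≤ C := by
  obtain ⟨C, hC, h⟩ := exists_norm_ft_bumpC_decay k
  refine ⟨(2 * C) ^ 2, by positivity, fun T T₀ τ hT₀ hT => ?_⟩
  have hT' : 0 < T := hT₀.trans_le hT
  have h1 := h (τ / T)
  have h2 := h (τ / T₀)
  rw [abs_div, abs_of_pos hT'] at h1
  rw [abs_div, abs_of_pos hT₀] at h2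
  have h3 : (|τ| / T) ^ k ≤ (|τ| / T₀) ^ k := by gcongr
  have h4 : (|τ| / T) ^ k * ‖ft bumpC (τ / T₀)‖ ≤ C := le_trans (by gcongr) h2
  have h5 : (|τ| / T) ^ k * ‖ft bumpC (τ / T) - ft bumpC (τ / T₀)‖ ≤ 2 * C := by
    have := norm_sub_le (ft bumpC (τ / T)) (ft bumpC (τ / T₀))
    have h0 : 0 ≤ (|τ| / T) ^ k := by positivity
    nlinarith
  calc _ = ((|τ| / T) ^ k * ‖ft bumpC (τ / T) - ft bumpC (τ / T₀)‖) ^ 2 := by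
        rw [dker]; ring
    _ ≤ _ := by gcongr

/-- The range of frequencies between `T₀` and `T₁`. -/
def midRange (T₀ T₁ : ℝ) : Set ℝ := {τ | T₀ < |τ| ∧ |τ| ≤ T₁}

theorem measurableSet_midRange (T₀ T₁ : ℝ) : MeasurableSet (midRange T₀ T₁) :=
  (measurableSet_lt measurable_const continuous_abs.measurable).inter
    (measurableSet_le continuous_abs.measurable measurable_const)

theorem midRange_subset (T₀ T₁ : ℝ) : midRange T₀ T₁ ⊆ Set.Icc (-T₁) T₁ := fun _ h =>
  abs_le.mp h.2

/-- Below `T₀` the quadratic vanishing of the kernel at `0` cancels the decay bound `M/|τ|` for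
`zsum`; above `T₁` the decay of the kernel beats the trivial bounds. Only the middle range needs
arithmetic. -/
theorem exists_energy_le (k : ℕ) : ∃ C > 0, ∀ (α₂ ξ : ℝ) (M h : ℕ) (T T₀ T₁ : ℝ), 0 < M → 0 < T₀ →
    4 * T₀ ≤ M → T₀ ≤ T → T ≤ T₁ →
    Integrable (fun τ => dker T T₀ τ * (‖bsum α₂ ξ M h τ‖ ^ 2 * ‖zsum M (2 * τ)‖ ^ 2)) →
    ∫ τ, dker T T₀ τ * (‖bsum α₂ ξ M h τ‖ ^ 2 * ‖zsum M (2 * τ)‖ ^ 2) ≤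
      C * ((M : ℝ) ^ 6 / T₀ + ∫ τ in midRange T₀ T₁, ‖bsum α₂ ξ M h τ‖ ^ 2 * ‖zsum M (2 * τ)‖ ^ 2)
      + C * ((M : ℝ) ^ 6 * T * (T / T₁) ^ (2 * k)) := by
  obtain ⟨C₁, hC₁, h₁⟩ := exists_norm_zsum_le_div
  obtain ⟨C₂, hC₂, h₂⟩ := exists_dker_decay (k + 1)
  have hpi := Real.pi_pos
  refine ⟨8 * Real.pi ^ 2 * C₁ ^ 2 + 16 + 18 * Real.pi * C₂, by positivity, ?_⟩
  intro α₂ ξ M h T T₀ T₁ hM hT₀ hTM hTT hT₁ hint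
  have hT : 0 < T := hT₀.trans_le hTT
  have hT₁' : 0 < T₁ := hT.trans_le hT₁
  have hM' : (0 : ℝ) < M := by exact_mod_cast hM
  set g : ℝ → ℝ := fun τ => ‖bsum α₂ ξ M h τ‖ ^ 2 * ‖zsum M (2 * τ)‖ ^ 2 with hg
  have hgc : Continuous g := by
    have := continuous_bsum α₂ ξ M h
    have := (continuous_zsum M).comp (continuous_const_mul (2 : ℝ))
    simp only [hg]
    exact ((continuous_bsum α₂ ξ M h).norm.pow 2).mul (this.norm.pow 2)
  have hg0 : ∀ τ, 0 ≤ g τ := fun τ => by positivity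
  have hgM : ∀ τ, g τ ≤ 9 * (M : ℝ) ^ 6 := fun τ => by
    have a := norm_bsum_le α₂ ξ M h τ
    have b := norm_zsum_le M hM (2 * τ)
    calc g τ ≤ ((M : ℝ) ^ 2) ^ 2 * (3 * M) ^ 2 := by simp only [hg]; gcongr
      _ = _ := by ring
  have hgmid : IntegrableOn g (midRange T₀ T₁) :=
    (hgc.continuousOn.integrableOn_compact isCompact_Icc).mono_set (midRange_subset T₀ T₁)
  -- The product of `(4π|τ|/T₀)²`, of `M⁴` for the binary sum and of `(C₁M/(2|τ|))²`; the variable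
  -- `τ` cancels, and integration over length `2T₀` gives `M⁶/T₀`.
  set lo : ℝ → ℝ := (Set.Icc (-T₀) T₀).indicator fun _ =>
    4 * Real.pi ^ 2 * C₁ ^ 2 * (M : ℝ) ^ 6 / T₀ ^ 2 with hlo
  set mi : ℝ → ℝ := (midRange T₀ T₁).indicator fun τ => 16 * g τ with hmi
  -- One of the `k + 1` available powers of `(T/τ)²` is kept as `(1 + (τ/T)²)⁻¹` for integrability;
  -- the remaining `k` become the saving.
  set hi : ℝ → ℝ := fun τ => (18 * C₂ * (M : ℝ) ^ 6 * (T / T₁) ^ (2 * k)) *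
    (1 + (τ / T) ^ 2)⁻¹ with hhi
  have hlo0 : ∀ τ, 0 ≤ lo τ := fun τ => Set.indicator_nonneg (fun _ _ => by positivity) τ
  have hmi0 : ∀ τ, 0 ≤ mi τ := fun τ => Set.indicator_nonneg (fun x _ => by
    have := hg0 x; positivity) τ
  have hhi0 : ∀ τ, 0 ≤ hi τ := fun τ => by positivity
  have ilo : Integrable lo := (integrable_indicator_iff measurableSet_Icc).mpr (by simp)
  have imi : Integrable mi :=
    (integrable_indicator_iff (measurableSet_midRange T₀ T₁)).mpr (hgmid.const_mul 16)
  have ihi : Integrable hi := by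
    exact (integrable_inv_one_add_sq.comp_div hT.ne').const_mul _
  have vlo : ∫ τ, lo τ = 8 * Real.pi ^ 2 * C₁ ^ 2 * ((M : ℝ) ^ 6 / T₀) := by
    rw [hlo, integral_indicator measurableSet_Icc, setIntegral_const, smul_eq_mul, Real.volume_real_Icc_of_le
      (by linarith)]
    field_simp; ring
  have vmi : ∫ τ, mi τ = 16 * ∫ τ in midRange T₀ T₁, g τ := by
    rw [hmi, integral_indicator (measurableSet_midRange T₀ T₁), integral_const_mul]
  have vhi : ∫ τ, hi τ = 18 * Real.pi * C₂ * ((M : ℝ) ^ 6 * T * (T / T₁) ^ (2 * k)) := by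
    rw [hhi, integral_const_mul, Measure.integral_comp_div (fun x : ℝ => (1 + x ^ 2)⁻¹),
      integral_univ_inv_one_add_sq, abs_of_pos hT, smul_eq_mul]
    ring
  have hpt : ∀ τ, dker T T₀ τ * g τ ≤ lo τ + mi τ + hi τ := by
    intro τ
    rcases le_or_gt |τ| T₀ with h1 | h1
    · have e : lo τ = 4 * Real.pi ^ 2 * C₁ ^ 2 * (M : ℝ) ^ 6 / T₀ ^ 2 :=
        Set.indicator_of_mem (show τ ∈ Set.Icc (-T₀) T₀ from abs_le.mp h1) _
      have : dker T T₀ τ * g τ ≤ lo τ := by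
        rw [e]
        rcases eq_or_ne τ 0 with rfl | h0
        · simp only [dker, zero_div, sub_self, norm_zero]
          rw [zero_pow two_ne_zero, zero_mul]; positivity
        have hτ : 0 < |τ| := abs_pos.mpr h0
        have z := h₁ M hM (2 * τ) (mul_ne_zero two_ne_zero h0) (by
          rw [abs_mul, abs_two]; linarith)
        rw [abs_mul, abs_two] at z
        have a := norm_bsum_le α₂ ξ M h τ
        have d := dker_le_sq hT₀ hTT τ
        calc dker T T₀ τ * g τ ≤ (4 * Real.pi * (|τ| / T₀)) ^ 2 *
              (((M : ℝ) ^ 2) ^ 2 * (C₁ * (M / (2 * |τ|))) ^ 2) := by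
              simp only [hg]; gcongr
          _ = _ := by field_simp; norm_num
      linarith [hmi0 τ, hhi0 τ]
    rcases le_or_gt |τ| T₁ with h3 | h3
    · have e : mi τ = 16 * g τ := Set.indicator_of_mem (show τ ∈ midRange T₀ T₁ from ⟨h1, h3⟩) _
      have := mul_le_mul_of_nonneg_right (dker_le_sixteen T T₀ τ) (hg0 τ)
      linarith [hlo0 τ, hhi0 τ]
    · have hτ : 0 < |τ| := hT₁'.trans h3
      have d := h₂ T T₀ τ hT₀ hTT
      have : dker T T₀ τ * g τ ≤ hi τ := by
        have d1 : dker T T₀ τ ≤ C₂ * ((T / |τ|) ^ (2 * k) * (T / |τ|) ^ 2) := by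
          have : dker T T₀ τ = dker T T₀ τ * (|τ| / T) ^ (2 * (k + 1)) * (T / |τ|) ^ (2 * (k + 1)) := by
            rw [mul_assoc, ← mul_pow]; field_simp; simp
          rw [this, ← pow_add]
          have : 0 ≤ (T / |τ|) ^ (2 * (k + 1)) := by positivity
          exact mul_le_mul_of_nonneg_right d this
        have d2 : (T / |τ|) ^ (2 * k) ≤ (T / T₁) ^ (2 * k) := by gcongr
        have d3 : (T / |τ|) ^ 2 ≤ 2 * (1 + (τ / T) ^ 2)⁻¹ := by
          rw [div_pow, div_pow, sq_abs]
          have : T ^ 2 ≤ τ ^ 2 := by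
            rw [← sq_abs τ]; gcongr; linarith
          have hτ2 : 0 < τ ^ 2 := by rw [← sq_abs]; positivity
          rw [← div_eq_mul_inv, div_le_div_iff₀ hτ2 (by positivity)]
          have : T ^ 2 * (1 + τ ^ 2 / T ^ 2) = T ^ 2 + τ ^ 2 := by field_simp
          linarith
        calc dker T T₀ τ * g τ ≤ C₂ * ((T / T₁) ^ (2 * k) * (2 * (1 + (τ / T) ^ 2)⁻¹)) *
              (9 * (M : ℝ) ^ 6) := by
              refine mul_le_mul (d1.trans ?_) (hgM τ) (hg0 τ) (by positivity)
              gcongr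
          _ = hi τ := by simp only [hhi]; ring
      linarith [hlo0 τ, hmi0 τ]
  have hmid0 : 0 ≤ ∫ τ in midRange T₀ T₁, g τ := integral_nonneg hg0
  calc _ ≤ ∫ τ, (lo τ + mi τ + hi τ) := integral_mono hint ((ilo.add imi).add ihi) hpt
    _ = 8 * Real.pi ^ 2 * C₁ ^ 2 * ((M : ℝ) ^ 6 / T₀) + 16 * (∫ τ in midRange T₀ T₁, g τ)
        + 18 * Real.pi * C₂ * ((M : ℝ) ^ 6 * T * (T / T₁) ^ (2 * k)) := by
        have e1 := integral_add (f := fun τ => lo τ + mi τ) (ilo.add imi) ihi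
        rw [e1, integral_add ilo imi, vlo, vmi, vhi]
    _ ≤ _ := by
        have a1 : 0 ≤ (M : ℝ) ^ 6 / T₀ := by positivity
        have a2 : 0 ≤ (M : ℝ) ^ 6 * T * (T / T₁) ^ (2 * k) := by positivity
        have c1 : 0 ≤ 8 * Real.pi ^ 2 * C₁ ^ 2 := by positivity
        have c2 : 0 ≤ 18 * Real.pi * C₂ := by positivity
        set D := 8 * Real.pi ^ 2 * C₁ ^ 2 + 16 + 18 * Real.pi * C₂
        have b1 := mul_le_mul_of_nonneg_right (by simp only [D]; linarith :
          8 * Real.pi ^ 2 * C₁ ^ 2 ≤ D) a1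
        have b2 := mul_le_mul_of_nonneg_right (by simp only [D]; linarith :
          18 * Real.pi * C₂ ≤ D) a2
        have b3 := mul_le_mul_of_nonneg_right (by simp only [D]; linarith : 16 ≤ D) hmid0
        linarith

theorem eventually_le_natCast_rpow {a : ℝ} (ha : 0 < a) (c : ℝ) :
    ∀ᶠ M : ℕ in atTop, c ≤ (M : ℝ) ^ a :=
  ((tendsto_rpow_atTop ha).comp tendsto_natCast_atTop_atTop).eventually_ge_atTop c

/-- The exceptional set at scale `M`, in terms of the intermediate range of frequencies. -/
theorem exists_volume_badSet_le {α₂ : ℝ} (hα : 0 < α₂) {h : ℕ} (hh : 0 < h)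
    (hαh : 10 * α₂ ≤ (h : ℝ) ^ 2) {η : ℝ} (hη : 0 < η) (hη1 : η ≤ 1 / 2) :
    ∃ C > 0, ∀ᶠ M : ℕ in atTop, ∀ ξ T : ℝ, |ξ| ≤ (M : ℝ) ^ 2 / 100 → (M : ℝ) ^ 2 ≤ T →
      volume.real (badSet α₂ ξ M h T) ≤ C * (M : ℝ) ^ (-6 : ℝ) * ((M : ℝ) ^ (5 + η) + (M : ℝ) ^ 2 * T +
        ∫ τ in midRange ((M : ℝ) ^ (1 - η)) (T * (M : ℝ) ^ η),
          ‖bsum α₂ ξ M h τ‖ ^ 2 * ‖zsum M (2 * τ)‖ ^ 2) := by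
  -- With `T₁ = T M^η` the saving `(T/T₁)^(2k)` is at most `M^(-4)`.
  set k := ⌈2 / η⌉₊ with hk
  obtain ⟨C, hC, hE⟩ := exists_energy_le k
  refine ⟨(96 * h) ^ 2 * C, by positivity, ?_⟩
  filter_upwards [eventually_ge_atTop 12, eventually_ge_atTop (2 * h),
    eventually_le_natCast_rpow hη 8, eventually_le_natCast_rpow (by linarith : 0 < 1 - η) 4]
    with M hM12 hMh hM8 hM4 ξ T hξ hT
  have hM : (12 : ℝ) ≤ M := by exact_mod_cast hM12
  have hM0 : (0 : ℝ) < M := by linarith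
  have hM1 : (1 : ℝ) ≤ M := by linarith
  set T₀ := (M : ℝ) ^ (1 - η) with hT₀
  have hsplit : T₀ * (M : ℝ) ^ η = M := by
    rw [hT₀, ← Real.rpow_add hM0, sub_add_cancel, Real.rpow_one]
  have hT₀0 : 0 < T₀ := by positivity
  have h8 : 8 * T₀ ≤ M := by nlinarith
  have hT0 : 0 < T := by nlinarith
  have hT₀T : T₀ ≤ T := by nlinarith
  have hTT₁ : T ≤ T * (M : ℝ) ^ η := le_mul_of_one_le_right hT0.le (by linarith)
  obtain ⟨p1, p2⟩ := volume_badSet_mul_le hα hh hαh hM12 hMh hξ hT0 hM4 h8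
  have e := hE α₂ ξ M h T T₀ (T * (M : ℝ) ^ η) (by lia) hT₀0 (by linarith) hT₀T hTT₁ p1
  set I := ∫ τ in midRange T₀ (T * (M : ℝ) ^ η), ‖bsum α₂ ξ M h τ‖ ^ 2 * ‖zsum M (2 * τ)‖ ^ 2
    with hI
  have f1 : (M : ℝ) ^ 6 / T₀ = (M : ℝ) ^ (5 + η) := by
    rw [hT₀, ← Real.rpow_natCast, ← Real.rpow_sub hM0]; congr 1; push_cast; ring
  have f2 : (M : ℝ) ^ 6 * T * (T / (T * (M : ℝ) ^ η)) ^ (2 * k) ≤ (M : ℝ) ^ 2 * T := by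
    have g1 : T / (T * (M : ℝ) ^ η) = (M : ℝ) ^ (-η) := by
      rw [Real.rpow_neg hM0.le]; field_simp
    have g2 : ((M : ℝ) ^ (-η)) ^ (2 * k) ≤ (M : ℝ) ^ (-4 : ℝ) := by
      rw [← Real.rpow_natCast, ← Real.rpow_mul hM0.le]
      apply Real.rpow_le_rpow_of_exponent_le hM1
      have := Nat.le_ceil (2 / η)
      rw [div_le_iff₀ hη] at this
      push_cast; rw [hk]; linarith
    have g3 : (M : ℝ) ^ (-4 : ℝ) * (M : ℝ) ^ 6 = (M : ℝ) ^ 2 := by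
      rw [← Real.rpow_natCast, ← Real.rpow_natCast, ← Real.rpow_add hM0]; norm_num
    rw [g1]
    calc _ ≤ (M : ℝ) ^ 6 * T * (M : ℝ) ^ (-4 : ℝ) := by gcongr
      _ = (M : ℝ) ^ (-4 : ℝ) * (M : ℝ) ^ 6 * T := by ring
      _ = _ := by rw [g3]
  rw [f1] at e
  have e2 := p2.trans e
  have hh' : (0 : ℝ) < h := by exact_mod_cast hh
  have f3 : ((M : ℝ) ^ 3 / (96 * h)) ^ 2 * ((96 * h) ^ 2 * (M : ℝ) ^ (-6 : ℝ)) = 1 := by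
    rw [Real.rpow_neg hM0.le, show (6 : ℝ) = ((6 : ℕ) : ℝ) by norm_num, Real.rpow_natCast]
    field_simp
  have f4 : 0 ≤ (96 * (h : ℝ)) ^ 2 * (M : ℝ) ^ (-6 : ℝ) := by positivity
  calc volume.real (badSet α₂ ξ M h T) = volume.real (badSet α₂ ξ M h T) *
        ((M : ℝ) ^ 3 / (96 * h)) ^ 2 * ((96 * h) ^ 2 * (M : ℝ) ^ (-6 : ℝ)) := by
        rw [mul_assoc, f3, mul_one]
    _ ≤ (C * ((M : ℝ) ^ (5 + η) + I) + C * ((M : ℝ) ^ 2 * T)) *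
        ((96 * h) ^ 2 * (M : ℝ) ^ (-6 : ℝ)) := by
        refine mul_le_mul_of_nonneg_right (e2.trans ?_) f4
        gcongr
    _ = _ := by ring

/-! ### The intermediate range of frequencies -/

/-- The intermediate range under the Lindelöf hypothesis. -/
theorem LindelofHypothesis.exists_integral_midRange_le (hLH : LindelofHypothesis) {α₂ : ℝ}
    (hα : 0 < α₂) {h : ℕ} (hh : 0 < h) (hαh : 10 * α₂ ≤ (h : ℝ) ^ 2) {η : ℝ} (hη : 0 < η)
    (hη1 : η ≤ 1 / 2) :
    ∃ C > 0, ∀ᶠ M : ℕ in atTop, ∀ ξ T : ℝ, |ξ| ≤ (M : ℝ) ^ 2 / 2 → (M : ℝ) ^ 2 ≤ T →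
      T ≤ (M : ℝ) ^ 4 →
      ∫ τ in midRange ((M : ℝ) ^ (1 - η)) (T * (M : ℝ) ^ η),
          ‖bsum α₂ ξ M h τ‖ ^ 2 * ‖zsum M (2 * τ)‖ ^ 2 ≤ C * ((M : ℝ) ^ (3 + 14 * η) * T) := by
  obtain ⟨C₁, hC₁, h₁⟩ := hLH.exists_norm_zsum_le hη (by linarith)
  obtain ⟨C₂, hC₂, h₂⟩ := exists_integral_norm_sq_bsum_le hα hh hαh hη
  refine ⟨4 * C₁ ^ 2 * C₂, by positivity, ?_⟩
  filter_upwards [eventually_ge_atTop 3] with M hM3 ξ T hξ hT hT4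
  have hM : (3 : ℝ) ≤ M := by exact_mod_cast hM3
  have hM0 : (0 : ℝ) < M := by linarith
  have hM1 : (1 : ℝ) ≤ M := by linarith
  set T₁ := T * (M : ℝ) ^ η with hT₁
  have hT0 : 0 < T := by nlinarith
  have hTT₁ : T ≤ T₁ := le_mul_of_one_le_right hT0.le (Real.one_le_rpow hM1 hη.le)
  have hT₁M : T₁ ≤ (M : ℝ) ^ 5 := by
    have : (M : ℝ) ^ η ≤ (M : ℝ) ^ (1 : ℝ) := Real.rpow_le_rpow_of_exponent_le hM1 (by linarith)
    rw [Real.rpow_one] at this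
    calc T₁ ≤ (M : ℝ) ^ 4 * M := by rw [hT₁]; gcongr
      _ = _ := by ring
  have hz : ∀ τ ∈ midRange ((M : ℝ) ^ (1 - η)) T₁,
      ‖zsum M (2 * τ)‖ ≤ 2 * C₁ * (M : ℝ) ^ (1 / 2 + 6 * η) := by
    intro τ hτ
    have hτ0 : 0 < |τ| := lt_trans (by positivity) hτ.1
    have hz := h₁ M (by lia) (2 * τ) (mul_ne_zero two_ne_zero (abs_pos.mp hτ0))
    rw [abs_mul, abs_two] at hz
    have a1 : (1 + 2 * |τ|) ^ η ≤ (M : ℝ) ^ (6 * η) := by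
      have : (1 + 2 * |τ|) ≤ (M : ℝ) ^ 6 := by
        have h5 : (1 : ℝ) ≤ (M : ℝ) ^ 5 := one_le_pow₀ hM1
        have := hτ.2.trans hT₁M
        calc 1 + 2 * |τ| ≤ 3 * (M : ℝ) ^ 5 := by linarith
          _ ≤ M * (M : ℝ) ^ 5 := by gcongr
          _ = _ := by ring
      calc (1 + 2 * |τ|) ^ η ≤ ((M : ℝ) ^ 6) ^ η := by gcongr
        _ = _ := by rw [← Real.rpow_natCast, ← Real.rpow_mul hM0.le]; norm_num
    -- Above `M^(1-η)` the pole contribution is at most `M^η`, hence dominated by the square root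
    -- term.
    have a2 : (M : ℝ) / (2 * |τ|) ≤ (M : ℝ) ^ (1 / 2 + 6 * η) := by
      have : (M : ℝ) / (2 * |τ|) ≤ M / (M : ℝ) ^ (1 - η) := by
        have := hτ.1
        gcongr
        linarith
      refine this.trans ?_
      rw [div_eq_mul_inv, ← Real.rpow_neg hM0.le]
      nth_rewrite 1 [← Real.rpow_one (M : ℝ)]
      rw [← Real.rpow_add hM0]
      exact Real.rpow_le_rpow_of_exponent_le hM1 (by linarith)
    have a3 : √(M : ℝ) * (M : ℝ) ^ (6 * η) = (M : ℝ) ^ (1 / 2 + 6 * η) := by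
      rw [Real.sqrt_eq_rpow, ← Real.rpow_add hM0]
    calc _ ≤ C₁ * (√(M : ℝ) * (M : ℝ) ^ (6 * η) + (M : ℝ) ^ (1 / 2 + 6 * η)) :=
          hz.trans (by gcongr)
      _ = _ := by rw [a3]; ring
  have hbc : Continuous fun τ => ‖bsum α₂ ξ M h τ‖ ^ 2 := (continuous_bsum α₂ ξ M h).norm.pow 2
  have hzc : Continuous fun τ : ℝ => ‖zsum M (2 * τ)‖ ^ 2 :=
    (((continuous_zsum M).comp (continuous_const_mul (2 : ℝ))).norm.pow 2)
  have hi : ∀ f : ℝ → ℝ, Continuous f → IntegrableOn f (midRange ((M : ℝ) ^ (1 - η)) T₁) :=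
    fun f hf => (hf.continuousOn.integrableOn_compact isCompact_Icc).mono_set (midRange_subset _ T₁)
  calc _ ≤ ∫ τ in midRange ((M : ℝ) ^ (1 - η)) T₁,
        (2 * C₁ * (M : ℝ) ^ (1 / 2 + 6 * η)) ^ 2 * ‖bsum α₂ ξ M h τ‖ ^ 2 := by
        refine setIntegral_mono_on (hi _ (hbc.mul hzc)) ((hi _ hbc).const_mul _)
          (measurableSet_midRange _ _) fun τ hτ => ?_
        rw [mul_comm]
        have := hz τ hτ
        gcongr
    _ = (2 * C₁ * (M : ℝ) ^ (1 / 2 + 6 * η)) ^ 2 *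
        ∫ τ in midRange ((M : ℝ) ^ (1 - η)) T₁, ‖bsum α₂ ξ M h τ‖ ^ 2 := integral_const_mul _ _
    _ ≤ (2 * C₁ * (M : ℝ) ^ (1 / 2 + 6 * η)) ^ 2 * (C₂ * (T₁ * (M : ℝ) ^ (2 + η))) := by
        gcongr
        refine le_trans (setIntegral_mono_set (hbc.continuousOn.integrableOn_compact isCompact_Icc)
          (Eventually.of_forall fun τ => by positivity) (midRange_subset _ T₁).eventuallyLE)
          (h₂ M (by lia) ξ T₁ hξ (hT.trans hTT₁))
    _ = 4 * C₁ ^ 2 * C₂ * ((((M : ℝ) ^ (1 / 2 + 6 * η)) ^ 2 * (M : ℝ) ^ η *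
          (M : ℝ) ^ (2 + η)) * T) := by rw [hT₁]; ring
    _ = _ := by
        rw [← Real.rpow_natCast ((M : ℝ) ^ (1 / 2 + 6 * η)) 2, ← Real.rpow_mul hM0.le,
          ← Real.rpow_add hM0, ← Real.rpow_add hM0]
        congr 3; push_cast; ring

/-- Pointwise bound for `bsum` in the intermediate range, in terms of powers of the scale. -/
theorem exists_norm_sq_bsum_midRange_le {α₂ : ℝ} (hα : 0 < α₂) {η : ℝ} (hη : 0 < η)
    (hη1 : η ≤ 1 / 2) :
    ∃ C > 0, ∀ᶠ M : ℕ in atTop, ∀ (h : ℕ) (ξ T τ : ℝ), |ξ| ≤ (M : ℝ) ^ (1 / 3 : ℝ) →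
      (M : ℝ) ^ 2 ≤ T → T ≤ (M : ℝ) ^ (12 / 5 - η) →
      τ ∈ midRange ((M : ℝ) ^ (1 - η)) (T * (M : ℝ) ^ η) →
      ‖bsum α₂ ξ M h τ‖ ^ 2 ≤ C * ((M : ℝ) ^ (2 + 2 * η) * T ^ (2 / 3 : ℝ)) := by
  obtain ⟨C, hC, hb⟩ := exists_norm_sq_bsum_le hα
  refine ⟨C * (5 * (1 + 4 / η) ^ 4), by positivity, ?_⟩
  filter_upwards [eventually_ge_atTop 2, eventually_le_natCast_rpow (by norm_num : (0 : ℝ) < 1 / 15) 4]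
    with M hM2 hM4 h ξ T τ hξ hT hT5 hτ
  have hM : (2 : ℝ) ≤ M := by exact_mod_cast hM2
  have hM0 : (0 : ℝ) < M := by linarith
  have hM1 : (1 : ℝ) ≤ M := by linarith
  have hT0 : 0 < T := by nlinarith
  obtain ⟨hτ0, hτ1⟩ := hτ
  have hT₀1 : 1 ≤ (M : ℝ) ^ (1 - η) := Real.one_le_rpow hM1 (by linarith)
  have ht1 : 1 ≤ |τ| := hT₀1.trans hτ0.le
  have ht0 : 0 < |τ| := by linarith
  have hT₁ : T * (M : ℝ) ^ η ≤ (M : ℝ) ^ (12 / 5 : ℝ) := by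
    calc _ ≤ (M : ℝ) ^ (12 / 5 - η) * (M : ℝ) ^ η := by gcongr
      _ = _ := by rw [← Real.rpow_add hM0]; ring_nf
  -- The ideal block length, solving `|τ| y³ = M³`. Rounding down to the integer `K` loses at most a
  -- factor `2`, which accounts for the `8` in the pointwise bound.
  set y := (M : ℝ) * |τ| ^ (-(1 / 3) : ℝ) with hy
  have hy3 : |τ| * y ^ 3 = M ^ 3 := by
    have : (|τ| ^ (-(1 / 3) : ℝ)) ^ 3 = |τ|⁻¹ := by
      rw [← Real.rpow_natCast, ← Real.rpow_mul ht0.le, ← Real.rpow_neg_one]; norm_num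
    rw [hy, mul_pow, this]; field_simp
  have hyM : y ≤ M := mul_le_of_le_one_right hM0.le
    (Real.rpow_le_one_of_one_le_of_nonpos ht1 (by norm_num))
  have hy0 : 0 < y := by positivity
  -- Since `|τ| ≤ M^(12/5)`. So `K²` is at least `M^(2/5)/4`, which exceeds `M^(1/3) ≥ |ξ|`, the
  -- size allowed for the shift.
  have hylow : (M : ℝ) ^ (1 / 5 : ℝ) ≤ y := by
    have : (M : ℝ) ^ (1 / 5 : ℝ) = M * ((M : ℝ) ^ (12 / 5 : ℝ)) ^ (-(1 / 3) : ℝ) := by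
      rw [← Real.rpow_mul hM0.le]
      nth_rewrite 2 [← Real.rpow_one (M : ℝ)]
      rw [← Real.rpow_add hM0]; norm_num
    rw [this, hy]
    gcongr 1
    exact Real.rpow_le_rpow_of_nonpos ht0 (hτ1.trans hT₁) (by norm_num)
  have hy1 : 1 ≤ y := (Real.one_le_rpow hM1 (by norm_num)).trans hylow
  set K := ⌊y⌋₊ with hK
  have hKpos : 0 < K := Nat.floor_pos.mpr hy1
  have hKy : (K : ℝ) ≤ y := Nat.floor_le hy0.le
  have hyK : y ≤ 2 * K := by
    have := Nat.lt_floor_add_one y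
    have : (1 : ℝ) ≤ K := by exact_mod_cast hKpos
    linarith
  have hK0 : (0 : ℝ) < K := by exact_mod_cast hKpos
  have hK1 : (1 : ℝ) ≤ K := by exact_mod_cast hKpos
  have hξK : |ξ| ≤ (K : ℝ) ^ 2 := by
    have h1 : ((M : ℝ) ^ (1 / 5 : ℝ)) ^ 2 ≤ (2 * (K : ℝ)) ^ 2 := by
      have := hylow.trans hyK; gcongr
    have h2 : ((M : ℝ) ^ (1 / 5 : ℝ)) ^ 2 = (M : ℝ) ^ (1 / 3 : ℝ) * (M : ℝ) ^ (1 / 15 : ℝ) := by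
      rw [← Real.rpow_natCast, ← Real.rpow_mul hM0.le, ← Real.rpow_add hM0]; norm_num
    rw [h2] at h1
    have h3 : 0 ≤ (M : ℝ) ^ (1 / 3 : ℝ) := by positivity
    nlinarith
  have hξM : |ξ| ≤ (M : ℝ) ^ 2 / 2 := by
    refine hξ.trans ?_
    have : (M : ℝ) ^ (1 / 3 : ℝ) ≤ (M : ℝ) ^ (1 : ℝ) :=
      Real.rpow_le_rpow_of_exponent_le hM1 (by norm_num)
    rw [Real.rpow_one] at this
    nlinarith
  have main := hb M h K τ ξ hKpos (by exact_mod_cast hKy.trans hyM)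
    (by rw [← hy3]; gcongr)
    (by
      rw [← hy3]
      calc |τ| * y ^ 3 ≤ |τ| * (2 * K) ^ 3 := by gcongr
        _ = _ := by ring) hξK hξM
  refine main.trans ?_
  have hlog : (1 + Real.log K) ^ 4 ≤ (1 + 4 / η) ^ 4 * (M : ℝ) ^ η := by
    have h1 : Real.log K ≤ (M : ℝ) ^ (η / 4) / (η / 4) := by
      refine (Real.log_le_rpow_div hK0.le (by positivity : 0 < η / 4)).trans ?_
      have := hKy.trans hyM
      gcongr
    have h2 : 1 ≤ (M : ℝ) ^ (η / 4) := Real.one_le_rpow hM1 (by positivity)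
    have h3 : 1 + Real.log K ≤ (1 + 4 / η) * (M : ℝ) ^ (η / 4) := by
      have : (M : ℝ) ^ (η / 4) / (η / 4) = 4 / η * (M : ℝ) ^ (η / 4) := by field_simp
      linarith
    have h0 : 0 ≤ Real.log K := Real.log_nonneg hK1
    calc (1 + Real.log K) ^ 4 ≤ ((1 + 4 / η) * (M : ℝ) ^ (η / 4)) ^ 4 := by gcongr
      _ = _ := by
        rw [mul_pow, ← Real.rpow_natCast ((M : ℝ) ^ (η / 4)), ← Real.rpow_mul hM0.le]
        congr 2; push_cast; ring
  have hY : 1 ≤ (M : ℝ) ^ η := Real.one_le_rpow hM1 hη.le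
  have e1 : (M : ℝ) ^ 4 / K ^ 2 ≤ 4 * ((M : ℝ) ^ (2 + η) * T ^ (2 / 3 : ℝ)) := by
    have h1 : (M : ℝ) ^ 4 / K ^ 2 ≤ 4 * (M ^ 4 / y ^ 2) := by
      rw [div_le_iff₀ (by positivity), mul_div_assoc', div_mul_eq_mul_div, le_div_iff₀ (by positivity)]
      have : y ^ 2 ≤ (2 * K) ^ 2 := by gcongr
      have h4 : (0 : ℝ) ≤ (M : ℝ) ^ 4 := by positivity
      nlinarith
    have h2 : (M : ℝ) ^ 4 / y ^ 2 = M ^ 2 * |τ| ^ (2 / 3 : ℝ) := by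
      have : (|τ| ^ (-(1 / 3) : ℝ)) ^ 2 = (|τ| ^ (2 / 3 : ℝ))⁻¹ := by
        rw [← Real.rpow_natCast, ← Real.rpow_mul ht0.le, ← Real.rpow_neg ht0.le]; norm_num
      rw [hy, mul_pow, this]; field_simp
    have h3 : |τ| ^ (2 / 3 : ℝ) ≤ T ^ (2 / 3 : ℝ) * (M : ℝ) ^ η := by
      calc |τ| ^ (2 / 3 : ℝ) ≤ (T * (M : ℝ) ^ η) ^ (2 / 3 : ℝ) := by gcongr
        _ = T ^ (2 / 3 : ℝ) * (M : ℝ) ^ (η * (2 / 3)) := by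
            rw [Real.mul_rpow hT0.le (by positivity), ← Real.rpow_mul hM0.le]
        _ ≤ _ := by gcongr 1; exact Real.rpow_le_rpow_of_exponent_le hM1 (by linarith)
    rw [h2] at h1
    refine h1.trans ?_
    rw [Real.rpow_add hM0, Real.rpow_two]
    calc _ ≤ 4 * ((M : ℝ) ^ 2 * (T ^ (2 / 3 : ℝ) * (M : ℝ) ^ η)) := by gcongr
      _ = _ := by ring
  -- The lower end `|τ| > M^(1-η)` makes `K ≤ M^(2/3+η/3)`, so `K²` is about `M^(4/3)` at most, and
  -- this is `≤ T^(2/3)` because `T ≥ M²`.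
  have e2 : (M : ℝ) ^ 2 * K ^ 2 ≤ (M : ℝ) ^ (2 + η) * T ^ (2 / 3 : ℝ) := by
    have h1 : (M : ℝ) ^ 2 * K ^ 2 ≤ M ^ 2 * y ^ 2 := by gcongr
    have h2 : y ≤ (M : ℝ) ^ (2 / 3 + η / 3) := by
      have : (M : ℝ) ^ (2 / 3 + η / 3) = M * ((M : ℝ) ^ (1 - η)) ^ (-(1 / 3) : ℝ) := by
        rw [← Real.rpow_mul hM0.le]
        nth_rewrite 2 [← Real.rpow_one (M : ℝ)]
        rw [← Real.rpow_add hM0]; ring_nf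
      rw [this, hy]
      gcongr 1
      exact Real.rpow_le_rpow_of_nonpos (by positivity) hτ0.le (by norm_num)
    have h3 : (M : ℝ) ^ (4 / 3 : ℝ) ≤ T ^ (2 / 3 : ℝ) := by
      calc (M : ℝ) ^ (4 / 3 : ℝ) = ((M : ℝ) ^ 2) ^ (2 / 3 : ℝ) := by
            rw [← Real.rpow_natCast, ← Real.rpow_mul hM0.le]; norm_num
        _ ≤ _ := by gcongr
    calc _ ≤ (M : ℝ) ^ 2 * ((M : ℝ) ^ (2 / 3 + η / 3)) ^ 2 := h1.trans (by gcongr)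
      _ = (M : ℝ) ^ (2 + 2 / 3 * η + 4 / 3) := by
          rw [← Real.rpow_natCast ((M : ℝ) ^ (2 / 3 + η / 3)), ← Real.rpow_mul hM0.le,
            ← Real.rpow_two, ← Real.rpow_add hM0]
          congr 1; push_cast; ring
      _ ≤ (M : ℝ) ^ (2 + η + 4 / 3) := Real.rpow_le_rpow_of_exponent_le hM1 (by linarith)
      _ = (M : ℝ) ^ (2 + η) * (M : ℝ) ^ (4 / 3 : ℝ) := by rw [← Real.rpow_add hM0]
      _ ≤ _ := by gcongr
  have e3 : (M : ℝ) ^ (2 + 2 * η) = (M : ℝ) ^ η * (M : ℝ) ^ (2 + η) := by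
    rw [← Real.rpow_add hM0]; ring_nf
  rw [e3]
  have hl0 : 0 ≤ 1 + Real.log K := by linarith [Real.log_nonneg hK1]
  calc _ ≤ C * ((1 + 4 / η) ^ 4 * (M : ℝ) ^ η *
        (4 * ((M : ℝ) ^ (2 + η) * T ^ (2 / 3 : ℝ)) + (M : ℝ) ^ (2 + η) * T ^ (2 / 3 : ℝ))) := by
        gcongr
    _ = _ := by ring

/-- The intermediate range, unconditionally. -/
theorem exists_integral_midRange_le {α₂ : ℝ} (hα : 0 < α₂) {h : ℕ} (hh : 0 < h)
    (hαh : 10 * α₂ ≤ (h : ℝ) ^ 2) {η : ℝ} (hη : 0 < η) (hη1 : η ≤ 1 / 10) :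
    ∃ C > 0, ∀ᶠ M : ℕ in atTop, ∀ ξ T : ℝ, |ξ| ≤ (M : ℝ) ^ (1 / 3 : ℝ) → (M : ℝ) ^ 2 ≤ T →
      T ≤ (M : ℝ) ^ (12 / 5 - 3 * η) →
      ∫ τ in midRange ((M : ℝ) ^ (1 - η)) (T * (M : ℝ) ^ η),
          ‖bsum α₂ ξ M h τ‖ ^ 2 * ‖zsum M (2 * τ)‖ ^ 2 ≤
        C * ((M : ℝ) ^ (4 + 3 * η) * T ^ (5 / 6 : ℝ)) := by
  obtain ⟨C₁, hC₁, h₁⟩ := exists_norm_sq_bsum_midRange_le hα hη (by linarith)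
  obtain ⟨C₂, hC₂, h₂⟩ := exists_integral_norm_sq_bsum_le hα hh hαh hη
  obtain ⟨C₃, hC₃, h₃⟩ := exists_integral_norm_zsum_sq_large_le hη
  refine ⟨C₂ + C₁ * C₃, by positivity, ?_⟩
  filter_upwards [h₁, eventually_ge_atTop 4, eventually_le_natCast_rpow hη C₃]
    with M hb hM4 hMC ξ T hξ hT hT5
  have hM : (4 : ℝ) ≤ M := by exact_mod_cast hM4
  have hM0 : (0 : ℝ) < M := by linarith
  have hM1 : (1 : ℝ) ≤ M := by linarith
  have hT0 : 0 < T := by nlinarith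
  have hT1 : 1 ≤ T := by nlinarith
  have hY : 1 ≤ (M : ℝ) ^ η := Real.one_le_rpow hM1 hη.le
  set T₁ := T * (M : ℝ) ^ η with hT₁
  have hTT₁ : T ≤ T₁ := le_mul_of_one_le_right hT0.le hY
  set R := midRange ((M : ℝ) ^ (1 - η)) T₁ with hR
  -- The threshold equalizes the two contributions: `V² · T M²` from small values and `M² T^(2/3) ·
  -- M⁴/V²` from large values are both `M⁴ T^(5/6)`.
  set V := (M : ℝ) * T ^ (-(1 / 12) : ℝ) with hV
  have hV0 : 0 < V := by positivity
  have hV2 : V ^ 2 = M ^ 2 * T ^ (-(1 / 6) : ℝ) := by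
    rw [hV, mul_pow, ← Real.rpow_natCast (T ^ (-(1 / 12) : ℝ)), ← Real.rpow_mul hT0.le]
    norm_num
  have hV4 : V ^ 4 = M ^ 4 * T ^ (-(1 / 3) : ℝ) := by
    rw [hV, mul_pow, ← Real.rpow_natCast (T ^ (-(1 / 12) : ℝ)), ← Real.rpow_mul hT0.le]
    norm_num
  have hξ' : |ξ| ≤ (M : ℝ) ^ 2 / 2 := by
    refine hξ.trans ?_
    have : (M : ℝ) ^ (1 / 3 : ℝ) ≤ (M : ℝ) ^ (1 : ℝ) :=
      Real.rpow_le_rpow_of_exponent_le hM1 (by norm_num)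
    rw [Real.rpow_one] at this
    nlinarith
  have hbc : Continuous fun τ => ‖bsum α₂ ξ M h τ‖ ^ 2 := (continuous_bsum α₂ ξ M h).norm.pow 2
  have hzn : Continuous fun τ : ℝ => ‖zsum M (2 * τ)‖ :=
    ((continuous_zsum M).comp (continuous_const_mul (2 : ℝ))).norm
  have hzc : Continuous fun τ : ℝ => ‖zsum M (2 * τ)‖ ^ 2 := hzn.pow 2
  have hi : ∀ f : ℝ → ℝ, Continuous f → IntegrableOn f R :=
    fun f hf => (hf.continuousOn.integrableOn_compact isCompact_Icc).mono_set (midRange_subset _ T₁)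
  set S := {τ : ℝ | V ≤ ‖zsum M (2 * τ)‖} with hS
  have hSm : MeasurableSet S := measurableSet_le measurable_const hzn.measurable
  have hRm : MeasurableSet R := measurableSet_midRange _ _
  have hsmall : ∫ τ in R \ S, ‖bsum α₂ ξ M h τ‖ ^ 2 * ‖zsum M (2 * τ)‖ ^ 2 ≤
      C₂ * ((M : ℝ) ^ (4 + 3 * η) * T ^ (5 / 6 : ℝ)) := by
    calc _ ≤ ∫ τ in R \ S, V ^ 2 * ‖bsum α₂ ξ M h τ‖ ^ 2 := by
          refine setIntegral_mono_on ((hi _ (hbc.mul hzc)).mono_set Set.sdiff_subset)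
            (((hi _ hbc).mono_set Set.sdiff_subset).const_mul _) (hRm.diff hSm) fun τ hτ => ?_
          rw [mul_comm]
          have : ‖zsum M (2 * τ)‖ ≤ V := (not_le.mp hτ.2).le
          gcongr
      _ = V ^ 2 * ∫ τ in R \ S, ‖bsum α₂ ξ M h τ‖ ^ 2 := integral_const_mul _ _
      _ ≤ V ^ 2 * (C₂ * (T₁ * (M : ℝ) ^ (2 + η))) := by
          gcongr
          refine le_trans (setIntegral_mono_set (hbc.continuousOn.integrableOn_compact isCompact_Icc)
            (Eventually.of_forall fun τ => by positivity)
            (Set.sdiff_subset.trans (midRange_subset _ T₁)).eventuallyLE)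
            (h₂ M (by lia) ξ T₁ hξ' (hT.trans hTT₁))
      _ = C₂ * (((M : ℝ) ^ 2 * (M : ℝ) ^ η * (M : ℝ) ^ (2 + η)) * (T ^ (-(1 / 6) : ℝ) * T)) := by
          rw [hV2, hT₁]; ring
      _ = C₂ * ((M : ℝ) ^ (4 + 2 * η) * T ^ (5 / 6 : ℝ)) := by
          congr 2
          · rw [← Real.rpow_two, ← Real.rpow_add hM0, ← Real.rpow_add hM0]; ring_nf
          · nth_rewrite 2 [← Real.rpow_one T]
            rw [← Real.rpow_add hT0]; norm_num
      _ ≤ _ := by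
          gcongr 3
          linarith
  have hlarge : ∫ τ in R ∩ S, ‖bsum α₂ ξ M h τ‖ ^ 2 * ‖zsum M (2 * τ)‖ ^ 2 ≤
      C₁ * C₃ * ((M : ℝ) ^ (4 + 3 * η) * T ^ (5 / 6 : ℝ)) := by
    -- The requirement `M² √T ≤ V⁴ = M⁴ T^(-1/3)` of the large values estimate means `T ≤ M^(12/5)`
    -- up to `η`, that is `δ ≥ M^(-2/5)`.
    have hX := h₃ M T₁ V (R ∩ S) (by lia) (hT1.trans hTT₁) (by
        have : T₁ ≤ (M : ℝ) ^ (3 : ℝ) := by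
          calc T₁ ≤ (M : ℝ) ^ (12 / 5 - 3 * η) * (M : ℝ) ^ η := by rw [hT₁]; gcongr
            _ = (M : ℝ) ^ (12 / 5 - 2 * η) := by rw [← Real.rpow_add hM0]; ring_nf
            _ ≤ _ := Real.rpow_le_rpow_of_exponent_le hM1 (by linarith)
        rw [show (3 : ℝ) = ((3 : ℕ) : ℝ) by norm_num, Real.rpow_natCast] at this
        calc 4 * T₁ ≤ M * (M : ℝ) ^ 3 := by gcongr
          _ = _ := by ring) hV0 (hRm.inter hSm)
      (Set.inter_subset_left.trans (midRange_subset _ T₁)) (fun τ hτ => hτ.2) (by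
        rw [hV4]
        have h1 : √T₁ ≤ T ^ (1 / 2 : ℝ) * (M : ℝ) ^ (η / 2) := by
          rw [hT₁, Real.sqrt_eq_rpow, Real.mul_rpow hT0.le (by positivity), ← Real.rpow_mul hM0.le]
          apply le_of_eq; ring_nf
        have h2 : T ^ (5 / 6 : ℝ) ≤ (M : ℝ) ^ (2 - 5 / 2 * η) := by
          calc T ^ (5 / 6 : ℝ) ≤ ((M : ℝ) ^ (12 / 5 - 3 * η)) ^ (5 / 6 : ℝ) := by gcongr
            _ = _ := by rw [← Real.rpow_mul hM0.le]; ring_nf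
        have h3 : T ^ (1 / 2 : ℝ) = T ^ (5 / 6 : ℝ) * T ^ (-(1 / 3) : ℝ) := by
          rw [← Real.rpow_add hT0]; norm_num
        calc C₃ * (M : ℝ) ^ (2 + η) * √T₁ ≤ (M : ℝ) ^ η * (M : ℝ) ^ (2 + η) *
              ((M : ℝ) ^ (2 - 5 / 2 * η) * T ^ (-(1 / 3) : ℝ) * (M : ℝ) ^ (η / 2)) := by
              rw [h3] at h1
              gcongr
              exact h1.trans (by gcongr)
          _ = ((M : ℝ) ^ η * (M : ℝ) ^ (2 + η) * (M : ℝ) ^ (2 - 5 / 2 * η) * (M : ℝ) ^ (η / 2)) *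
              T ^ (-(1 / 3) : ℝ) := by ring
          _ = (M : ℝ) ^ 4 * T ^ (-(1 / 3) : ℝ) := by
              congr 1
              rw [← Real.rpow_add hM0, ← Real.rpow_add hM0, ← Real.rpow_add hM0, ← Real.rpow_natCast]
              congr 1; push_cast; ring)
    calc _ ≤ ∫ τ in R ∩ S, C₁ * ((M : ℝ) ^ (2 + 2 * η) * T ^ (2 / 3 : ℝ)) * ‖zsum M (2 * τ)‖ ^ 2 := by
          refine setIntegral_mono_on ((hi _ (hbc.mul hzc)).mono_set Set.inter_subset_left)
            (((hi _ hzc).mono_set Set.inter_subset_left).const_mul _) (hRm.inter hSm) fun τ hτ => ?_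
          have := hb h ξ T τ hξ hT (hT5.trans
            (Real.rpow_le_rpow_of_exponent_le hM1 (by linarith))) hτ.1
          gcongr
      _ = C₁ * ((M : ℝ) ^ (2 + 2 * η) * T ^ (2 / 3 : ℝ)) * ∫ τ in R ∩ S, ‖zsum M (2 * τ)‖ ^ 2 :=
          integral_const_mul _ _
      _ ≤ C₁ * ((M : ℝ) ^ (2 + 2 * η) * T ^ (2 / 3 : ℝ)) * (C₃ * (M : ℝ) ^ (4 + η) / V ^ 2) := by
          gcongr
      _ = C₁ * C₃ * (((M : ℝ) ^ (2 + 2 * η) * (M : ℝ) ^ (4 + η) * ((M : ℝ) ^ 2)⁻¹) *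
          (T ^ (2 / 3 : ℝ) * (T ^ (-(1 / 6) : ℝ))⁻¹)) := by rw [hV2]; field_simp
      _ = _ := by
          congr 2
          · rw [← Real.rpow_two, ← Real.rpow_neg hM0.le, ← Real.rpow_add hM0, ← Real.rpow_add hM0]
            ring_nf
          · rw [← Real.rpow_neg hT0.le, ← Real.rpow_add hT0]; norm_num
  have e := integral_inter_add_sdiff (f := fun τ => ‖bsum α₂ ξ M h τ‖ ^ 2 * ‖zsum M (2 * τ)‖ ^ 2) hSm
    (hi _ (hbc.mul hzc))
  rw [← e]
  linarith

/-! ### Measure of the exceptional sets -/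

/-- The exceptional set for `ξ` and `δ` at scale `M` has measure `≪ M ^ (-e + ε) δ ^ (-r)`. -/
def BadSetBound (α₂ : ℝ) (h : ℕ) (e r : ℝ) : Prop :=
  ∀ ε : ℝ, 0 < ε → ∃ C : ℝ, ∀ᶠ M : ℕ in atTop, ∀ ξ δ : ℝ, |ξ| ≤ (M : ℝ) ^ e →
    (M : ℝ) ^ (-(e / r) + ε) ≤ δ → δ ≤ 1 →
    volume.real (badSet α₂ ξ M h ((M : ℝ) ^ 2 / δ)) ≤ C * ((M : ℝ) ^ (-e + ε) * δ ^ (-r))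

/-- A smaller `ε` admits more `δ` and gives a better bound. -/
theorem BadSetBound.of_small {α₂ : ℝ} {h : ℕ} {e r ε₀ : ℝ} (hε₀ : 0 < ε₀)
    (H : ∀ ε : ℝ, 0 < ε → ε ≤ ε₀ → ∃ C ≥ 0, ∀ᶠ M : ℕ in atTop, ∀ ξ δ : ℝ, |ξ| ≤ (M : ℝ) ^ e →
      (M : ℝ) ^ (-(e / r) + ε) ≤ δ → δ ≤ 1 →
      volume.real (badSet α₂ ξ M h ((M : ℝ) ^ 2 / δ)) ≤ C * ((M : ℝ) ^ (-e + ε) * δ ^ (-r))) :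
    BadSetBound α₂ h e r := by
  intro ε hε
  obtain ⟨C, hC0, hC⟩ := H (min ε ε₀) (lt_min hε hε₀) (min_le_right _ _)
  refine ⟨C, ?_⟩
  filter_upwards [hC, eventually_ge_atTop 1] with M hM hM1 ξ δ hξ hδ hδ1
  have hM1' : (1 : ℝ) ≤ M := by exact_mod_cast hM1
  have hδ0 : 0 < δ := lt_of_lt_of_le (by positivity) hδ
  refine (hM ξ δ hξ (le_trans (Real.rpow_le_rpow_of_exponent_le hM1' ?_) hδ) hδ1).trans ?_
  · have := min_le_left ε ε₀; linarith
  · have := min_le_left ε ε₀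
    gcongr

/-- The middle range contributes `M^(3+ε) T` with `T = M²/δ`; division by `M⁶` leaves `M^(-1+ε)
δ^(-1)`. The low and high frequencies are smaller since `T ≥ M²`. -/
theorem LindelofHypothesis.badSetBound (hLH : LindelofHypothesis) {α₂ : ℝ} (hα : 0 < α₂) {h : ℕ}
    (hh : 0 < h) (hαh : 10 * α₂ ≤ (h : ℝ) ^ 2) : BadSetBound α₂ h 1 1 := by
  refine BadSetBound.of_small (ε₀ := 1) one_pos fun ε hε hε1 => ?_
  set η := ε / 20 with hη
  have hη0 : 0 < η := by positivity
  obtain ⟨C₁, hC₁, h₁⟩ := exists_volume_badSet_le hα hh hαh hη0 (by linarith)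
  obtain ⟨C₂, hC₂, h₂⟩ := hLH.exists_integral_midRange_le hα hh hαh hη0 (by linarith)
  refine ⟨C₁ * (2 + C₂), by positivity, ?_⟩
  filter_upwards [h₁, h₂, eventually_ge_atTop 100] with M hb hm hM100 ξ δ hξ hδ hδ1
  have hM : (100 : ℝ) ≤ M := by exact_mod_cast hM100
  have hM0 : (0 : ℝ) < M := by linarith
  have hM1 : (1 : ℝ) ≤ M := by linarith
  have hδ0 : 0 < δ := lt_of_lt_of_le (by positivity) hδ
  rw [Real.rpow_one] at hξ
  set T := (M : ℝ) ^ 2 / δ with hT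
  have hT2 : (M : ℝ) ^ 2 ≤ T := by rw [hT, le_div_iff₀ hδ0]; nlinarith
  have hT4 : T ≤ (M : ℝ) ^ 4 := by
    have : (M : ℝ) ^ (-1 : ℝ) ≤ δ :=
      le_trans (Real.rpow_le_rpow_of_exponent_le hM1 (by norm_num; linarith)) hδ
    rw [Real.rpow_neg_one] at this
    have h1 : 1 ≤ δ * M := by rw [← inv_mul_cancel₀ hM0.ne']; gcongr
    rw [hT, div_le_iff₀ hδ0]
    have h2 : 1 * 1 ≤ (δ * M) * (M * 1) := by gcongr; linarith
    nlinarith [sq_nonneg (M : ℝ)]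
  have b := hb ξ T (by nlinarith) hT2
  have m := hm ξ T (by nlinarith) hT2 hT4
  have hT0 : 0 < T := by positivity
  refine b.trans ?_
  have e1 : (M : ℝ) ^ (5 + η) ≤ (M : ℝ) ^ (3 + 14 * η) * T := by
    calc (M : ℝ) ^ (5 + η) ≤ (M : ℝ) ^ (3 + 14 * η + 2) :=
          Real.rpow_le_rpow_of_exponent_le hM1 (by linarith)
      _ = (M : ℝ) ^ (3 + 14 * η) * (M : ℝ) ^ 2 := by rw [Real.rpow_add hM0, Real.rpow_two]
      _ ≤ _ := by gcongr
  have e2 : (M : ℝ) ^ 2 * T ≤ (M : ℝ) ^ (3 + 14 * η) * T := by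
    rw [← Real.rpow_two]
    gcongr 1
    exact Real.rpow_le_rpow_of_exponent_le hM1 (by linarith)
  calc _ ≤ C₁ * (M : ℝ) ^ (-6 : ℝ) * ((M : ℝ) ^ (3 + 14 * η) * T + (M : ℝ) ^ (3 + 14 * η) * T +
        C₂ * ((M : ℝ) ^ (3 + 14 * η) * T)) := by gcongr
    _ = C₁ * (2 + C₂) * ((M : ℝ) ^ (-6 : ℝ) * (M : ℝ) ^ (3 + 14 * η) * (M : ℝ) ^ (2 : ℝ) * δ⁻¹) := by
        rw [hT, Real.rpow_two]; field_simp; ring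
    _ ≤ _ := by
        rw [Real.rpow_neg_one, ← Real.rpow_add hM0, ← Real.rpow_add hM0]
        gcongr 3
        linarith

/-- The middle range contributes `M^(4+ε) T^(5/6)`, and `M^(-6) M⁴ (M²/δ)^(5/6) = M^(-1/3)
δ^(-5/6)`. The bound on `δ` from below, with `e/r = 2/5`, is the range `T ≤ M^(12/5)` up to the loss
in `ε`. -/
theorem badSetBound {α₂ : ℝ} (hα : 0 < α₂) {h : ℕ} (hh : 0 < h) (hαh : 10 * α₂ ≤ (h : ℝ) ^ 2) :
    BadSetBound α₂ h (1 / 3) (5 / 6) := by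
  refine BadSetBound.of_small (ε₀ := 1) one_pos fun ε hε hε1 => ?_
  set η := ε / 20 with hη
  have hη0 : 0 < η := by positivity
  obtain ⟨C₁, hC₁, h₁⟩ := exists_volume_badSet_le hα hh hαh hη0 (by linarith)
  obtain ⟨C₂, hC₂, h₂⟩ := exists_integral_midRange_le hα hh hαh hη0 (by linarith)
  refine ⟨C₁ * (2 + C₂), by positivity, ?_⟩
  filter_upwards [h₁, h₂, eventually_ge_atTop 100] with M hb hm hM100 ξ δ hξ hδ hδ1
  have hM : (100 : ℝ) ≤ M := by exact_mod_cast hM100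
  have hM0 : (0 : ℝ) < M := by linarith
  have hM1 : (1 : ℝ) ≤ M := by linarith
  have hδ0 : 0 < δ := lt_of_lt_of_le (by positivity) hδ
  set T := (M : ℝ) ^ 2 / δ with hT
  have hT2 : (M : ℝ) ^ 2 ≤ T := by rw [hT, le_div_iff₀ hδ0]; nlinarith
  have hT0 : 0 < T := by positivity
  have hT5 : T ≤ (M : ℝ) ^ (12 / 5 - 3 * η) := by
    have h1 : T ≤ (M : ℝ) ^ 2 / (M : ℝ) ^ (-(1 / 3 / (5 / 6)) + ε) := by rw [hT]; gcongr
    refine h1.trans ?_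
    rw [← Real.rpow_two, ← Real.rpow_sub hM0]
    exact Real.rpow_le_rpow_of_exponent_le hM1 (by linarith)
  have hξ' : |ξ| ≤ (M : ℝ) ^ 2 / 100 := by
    refine hξ.trans ?_
    have : (M : ℝ) ^ (1 / 3 : ℝ) ≤ (M : ℝ) ^ (1 : ℝ) :=
      Real.rpow_le_rpow_of_exponent_le hM1 (by norm_num)
    rw [Real.rpow_one] at this
    nlinarith
  have b := hb ξ T hξ' hT2
  have m := hm ξ T hξ hT2 hT5
  refine b.trans ?_
  have hT56 : (M : ℝ) ^ (5 / 3 : ℝ) ≤ T ^ (5 / 6 : ℝ) := by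
    calc (M : ℝ) ^ (5 / 3 : ℝ) = ((M : ℝ) ^ 2) ^ (5 / 6 : ℝ) := by
          rw [← Real.rpow_natCast, ← Real.rpow_mul hM0.le]; norm_num
      _ ≤ _ := by gcongr
  have e1 : (M : ℝ) ^ (5 + η) ≤ (M : ℝ) ^ (4 + 3 * η) * T ^ (5 / 6 : ℝ) := by
    calc (M : ℝ) ^ (5 + η) ≤ (M : ℝ) ^ (4 + 3 * η + 5 / 3) :=
          Real.rpow_le_rpow_of_exponent_le hM1 (by linarith)
      _ = (M : ℝ) ^ (4 + 3 * η) * (M : ℝ) ^ (5 / 3 : ℝ) := by rw [Real.rpow_add hM0]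
      _ ≤ _ := by gcongr
  have e2 : (M : ℝ) ^ 2 * T ≤ (M : ℝ) ^ (4 + 3 * η) * T ^ (5 / 6 : ℝ) := by
    have h1 : T = T ^ (1 / 6 : ℝ) * T ^ (5 / 6 : ℝ) := by
      rw [← Real.rpow_add hT0]; norm_num
    have h2 : T ^ (1 / 6 : ℝ) ≤ (M : ℝ) ^ (2 / 5 : ℝ) := by
      calc T ^ (1 / 6 : ℝ) ≤ ((M : ℝ) ^ (12 / 5 - 3 * η)) ^ (1 / 6 : ℝ) := by gcongr
        _ = (M : ℝ) ^ ((12 / 5 - 3 * η) * (1 / 6)) := by rw [← Real.rpow_mul hM0.le]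
        _ ≤ _ := Real.rpow_le_rpow_of_exponent_le hM1 (by linarith)
    calc (M : ℝ) ^ 2 * T = (M : ℝ) ^ 2 * (T ^ (1 / 6 : ℝ) * T ^ (5 / 6 : ℝ)) := by rw [← h1]
      _ ≤ (M : ℝ) ^ (2 : ℝ) * ((M : ℝ) ^ (2 / 5 : ℝ) * T ^ (5 / 6 : ℝ)) := by
          rw [Real.rpow_two]; gcongr
      _ = (M : ℝ) ^ (2 + 2 / 5 : ℝ) * T ^ (5 / 6 : ℝ) := by rw [Real.rpow_add hM0]; ring
      _ ≤ _ := by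
          gcongr 1
          exact Real.rpow_le_rpow_of_exponent_le hM1 (by linarith)
  have e3 : T ^ (5 / 6 : ℝ) = (M : ℝ) ^ (5 / 3 : ℝ) * δ ^ (-(5 / 6) : ℝ) := by
    rw [hT, Real.div_rpow (by positivity) hδ0.le, ← Real.rpow_natCast, ← Real.rpow_mul hM0.le,
      Real.rpow_neg hδ0.le, div_eq_mul_inv]
    norm_num
  calc _ ≤ C₁ * (M : ℝ) ^ (-6 : ℝ) * ((M : ℝ) ^ (4 + 3 * η) * T ^ (5 / 6 : ℝ) +
        (M : ℝ) ^ (4 + 3 * η) * T ^ (5 / 6 : ℝ) +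
        C₂ * ((M : ℝ) ^ (4 + 3 * η) * T ^ (5 / 6 : ℝ))) := by gcongr
    _ = C₁ * (2 + C₂) * ((M : ℝ) ^ (-6 : ℝ) * (M : ℝ) ^ (4 + 3 * η) * (M : ℝ) ^ (5 / 3 : ℝ) *
          δ ^ (-(5 / 6) : ℝ)) := by rw [e3]; ring
    _ ≤ _ := by
        rw [← Real.rpow_add hM0, ← Real.rpow_add hM0]
        gcongr 3
        linarith

/-! ### Borel–Cantelli and passage to all scales -/

theorem exists_dyadic {k₀ : ℕ} {N : ℝ} (hN : 4 * 2 ^ k₀ ≤ N) :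
    ∃ k ≥ k₀, 4 * (2 : ℝ) ^ k ≤ N ∧ N ≤ 8 * 2 ^ k := by
  have h1 : (1 : ℝ) ≤ 2 ^ k₀ := one_le_pow₀ (by norm_num)
  obtain ⟨k, hk, hk'⟩ := exists_nat_pow_near (x := N / 4) (y := 2) (by linarith) (by norm_num)
  refine ⟨k, ?_, by linarith, by rw [pow_succ] at hk'; linarith⟩
  have : (2 : ℝ) ^ k₀ < 2 ^ (k + 1) := by linarith
  have := (pow_lt_pow_iff_right₀ (by norm_num : (1 : ℝ) < 2)).mp this
  lia

theorem puncturedBall_mono {N N' : ℝ} (h : N ≤ N') : puncturedBall N ⊆ puncturedBall N' :=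
  fun _ hx => ⟨hx.1, hx.2.trans_le h⟩

theorem rpow_le_mul_rpow_of_le {M N c : ℝ} (hM : 0 < M) (h1 : M ≤ N) (h2 : N ≤ 8 * M) :
    N ^ c ≤ 8 ^ |c| * M ^ c := by
  have h3 : 1 ≤ N / M := by rwa [le_div_iff₀ hM, one_mul]
  calc N ^ c = (N / M) ^ c * M ^ c := by
        rw [← Real.mul_rpow (by positivity) hM.le, div_mul_cancel₀ _ hM.ne']
    _ ≤ (N / M) ^ |c| * M ^ c := by
        gcongr
        exact le_abs_self c
    _ ≤ _ := by
        gcongr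
        rwa [div_le_iff₀ hM]

theorem volume_real_biUnion_badSet_le {α₂ δ B : ℝ} {M h : ℕ} {K : ℝ} (hK : 0 ≤ K)
    (hB : ∀ m : ℤ, |(m : ℝ)| ≤ K → volume.real (badSet α₂ (m * δ) M h ((M : ℝ) ^ 2 / δ)) ≤ B) :
    volume.real (⋃ m ∈ Finset.Icc (-⌊K⌋) ⌊K⌋, badSet α₂ (m * δ) M h ((M : ℝ) ^ 2 / δ)) ≤
      (2 * K + 1) * B := by
  have hB0 : 0 ≤ B := measureReal_nonneg.trans (hB 0 (by simpa using hK))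
  have hf : (0 : ℤ) ≤ ⌊K⌋ := Int.floor_nonneg.mpr hK
  refine (measureReal_biUnion_finset_le _ _).trans ?_
  refine (Finset.sum_le_card_nsmul _ _ B fun m hm => hB m ?_).trans ?_
  · rw [Finset.mem_Icc, ← abs_le, Int.le_floor] at hm
    exact_mod_cast hm
  · rw [nsmul_eq_mul]
    gcongr
    have : ((Finset.Icc (-⌊K⌋) ⌊K⌋).card : ℤ) = 2 * ⌊K⌋ + 1 := by
      rw [Int.card_Icc, Int.toNat_of_nonneg (by lia)]; ring
    have h2 : ((Finset.Icc (-⌊K⌋) ⌊K⌋).card : ℝ) = 2 * (⌊K⌋ : ℝ) + 1 := by exact_mod_cast this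
    rw [h2]
    linarith [Int.floor_le K]

/-- Borel–Cantelli along `M = 2^k` with `δ = M^(-s)`. There are `O(M^(e-ε-rs) + 1)` targets `ξ =
mδ`, each with a bad set of measure `O(M^(-e+ε'+rs))`; the union is `O(M^(-ε'))`, a geometric series
in `k`. -/
theorem BadSetBound.ae_eventually_gsum_ne_zero {α₂ : ℝ} {h : ℕ} {e r : ℝ} (hr : 0 < r)
    (H : BadSetBound α₂ h e r) {s ε : ℝ} (hs : 0 ≤ s) (hε : 0 < ε) (hsε : s ≤ e / r - ε) :
    ∀ᵐ u ∂(volume.restrict (Set.Icc (-Real.log 2) 0)), ∀ᶠ k : ℕ in atTop, ∀ m : ℤ,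
      |(m : ℝ)| ≤ ((2 : ℝ) ^ k) ^ (e - ε - r * s) →
      gsum α₂ (m * ((2 : ℝ) ^ k) ^ (-s)) (2 ^ k) h
        (((2 : ℝ) ^ k) ^ 2 / ((2 : ℝ) ^ k) ^ (-s)) u ≠ 0 := by
  -- The bound `2ε' ≤ ε` serves the union over many targets, and `2ε' ≤ rε` serves the single target
  -- `m = 0`, where only `rs ≤ e - rε` is available.
  set ε' := min ε (r * ε) / 2 with hε'
  have hε'0 : 0 < ε' := by positivity
  have hle1 : 2 * ε' ≤ ε := by rw [hε']; linarith [min_le_left ε (r * ε)]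
  have hle2 : 2 * ε' ≤ r * ε := by rw [hε']; linarith [min_le_right ε (r * ε)]
  have hrs : r * s ≤ e - r * ε := by
    calc r * s ≤ r * (e / r - ε) := by gcongr
      _ = _ := by field_simp
  obtain ⟨C, hC⟩ := H ε' hε'0
  set E : ℕ → Set ℝ := fun k => ⋃ m ∈ Finset.Icc (-⌊((2 : ℝ) ^ k) ^ (e - ε - r * s)⌋)
      ⌊((2 : ℝ) ^ k) ^ (e - ε - r * s)⌋,
    badSet α₂ (m * ((2 : ℝ) ^ k) ^ (-s)) (2 ^ k) h (((2 ^ k : ℕ) : ℝ) ^ 2 / ((2 : ℝ) ^ k) ^ (-s))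
    with hE
  have hEsub : ∀ k, E k ⊆ Set.Icc (-Real.log 2) 0 := fun k =>
    Set.iUnion₂_subset fun m _ u hu => hu.1
  have hEfin : ∀ k, volume (E k) ≠ ⊤ := fun k =>
    ((measure_mono (hEsub k)).trans_lt measure_Icc_lt_top).ne
  have hbound : ∀ᶠ k : ℕ in atTop, ‖volume.real (E k)‖ ≤ 3 * C * ((2 : ℝ) ^ (-ε')) ^ k := by
    filter_upwards [(tendsto_pow_atTop_atTop_of_one_lt (by norm_num : 1 < 2)).eventually hC]
      with k hk
    push_cast at hk
    have hM1 : (1 : ℝ) ≤ (2 : ℝ) ^ k := one_le_pow₀ (by norm_num)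
    have hM0 : (0 : ℝ) < (2 : ℝ) ^ k := by positivity
    rw [Real.norm_of_nonneg measureReal_nonneg]
    set M := (2 : ℝ) ^ k with hM
    have key := volume_real_biUnion_badSet_le (α₂ := α₂) (δ := M ^ (-s)) (M := 2 ^ k) (h := h)
      (K := M ^ (e - ε - r * s)) (B := C * (M ^ (-e + ε') * (M ^ (-s)) ^ (-r))) (by positivity)
      (fun m hm => by
        have := hk (m * M ^ (-s)) (M ^ (-s)) (by
          rw [abs_mul, abs_of_pos (Real.rpow_pos_of_pos hM0 (-s))]
          calc _ ≤ M ^ (e - ε - r * s) * M ^ (-s) := by gcongr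
            _ = M ^ (e - ε - r * s - s) := by rw [← Real.rpow_add hM0]; ring_nf
            _ ≤ _ := Real.rpow_le_rpow_of_exponent_le hM1 (by nlinarith))
          (Real.rpow_le_rpow_of_exponent_le hM1 (by linarith))
          (Real.rpow_le_one_of_one_le_of_nonpos hM1 (by linarith))
        push_cast
        exact this)
    have hC0 : 0 ≤ C := by
      have := measureReal_nonneg.trans (hk 0 1 (by simp; positivity)
        (Real.rpow_le_one_of_one_le_of_nonpos hM1 (by linarith)) le_rfl)
      exact nonneg_of_mul_nonneg_left this (by positivity)
    refine key.trans ?_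
    rw [← Real.rpow_mul hM0.le]
    have e0 : ((2 : ℝ) ^ (-ε')) ^ k = M ^ (-ε') := by
      rw [hM, ← Real.rpow_natCast, ← Real.rpow_natCast, ← Real.rpow_mul (by norm_num),
        ← Real.rpow_mul (by norm_num), mul_comm]
    have e1 : M ^ (e - ε - r * s) * (M ^ (-e + ε') * M ^ (-s * -r)) ≤ M ^ (-ε') := by
      rw [← Real.rpow_add hM0, ← Real.rpow_add hM0]
      exact Real.rpow_le_rpow_of_exponent_le hM1 (by linarith)
    have e2 : M ^ (-e + ε') * M ^ (-s * -r) ≤ M ^ (-ε') := by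
      rw [← Real.rpow_add hM0]
      exact Real.rpow_le_rpow_of_exponent_le hM1 (by linarith)
    rw [e0]
    calc _ = C * (2 * (M ^ (e - ε - r * s) * (M ^ (-e + ε') * M ^ (-s * -r))) +
          M ^ (-e + ε') * M ^ (-s * -r)) := by ring
      _ ≤ C * (2 * M ^ (-ε') + M ^ (-ε')) := by gcongr
      _ = _ := by ring
  have hsum : Summable fun k => volume.real (E k) := by
    refine Summable.of_norm_bounded_eventually_nat
      ((summable_geometric_of_lt_one (by positivity)
        (Real.rpow_lt_one_of_one_lt_of_neg (by norm_num) (by linarith))).mul_left (3 * C)) hbound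
  have hfin : ∑' k, volume (E k) ≠ ⊤ := by
    have := hsum.tsum_ofReal_ne_top
    convert this using 3 with k
    exact (ofReal_measureReal (hEfin k)).symm
  have hae := ae_eventually_notMem hfin
  rw [ae_restrict_iff' measurableSet_Icc]
  filter_upwards [hae] with u hu hu'
  filter_upwards [hu] with k hk m hm h0
  refine hk (Set.mem_iUnion₂.mpr ⟨m, ?_, hu', ?_⟩)
  · rw [Finset.mem_Icc, ← abs_le, Int.le_floor]
    exact_mod_cast hm
  · push_cast
    exact h0

/-- At all scales `2 ^ k` and at the precisions `δ = (2 ^ k) ^ (-j / n)`, the form comes within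
`27 δ` of all points of `δ ℤ` in a suitable interval. -/
def GridSolvable (α₂ α₃ e r : ℝ) : Prop :=
  ∀ n j : ℕ, 0 < n → (j : ℝ) / n ≤ e / r - 1 / n → ∀ᶠ k : ℕ in atTop, ∀ m : ℤ,
    |(m : ℝ)| ≤ ((2 : ℝ) ^ k) ^ (e - 1 / n - r * (j / n)) →
    ∃ x ∈ puncturedBall (4 * 2 ^ k), |diagForm α₂ α₃ x - m * ((2 : ℝ) ^ k) ^ (-(j / n : ℝ))| ≤
      27 * ((2 : ℝ) ^ k) ^ (-(j / n : ℝ))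

/-- Rational exponents `j/n` with slack `1/n` suffice for the applications, and there are countably
many of them, so a single null set serves all functions `A`, `δ` and all `ε`. -/
theorem BadSetBound.ae_gridSolvable {α₂ : ℝ} (hα : 0 < α₂) {h : ℕ} {e r : ℝ} (he : e ≤ 1)
    (hr : 0 < r) (H : BadSetBound α₂ h e r) :
    ∀ᵐ u ∂(volume.restrict (Set.Icc (-Real.log 2) 0)), GridSolvable α₂ (Real.exp u) e r := by
  simp only [GridSolvable, ae_all_iff]
  intro n j hn hj
  have hn' : (0 : ℝ) < n := by exact_mod_cast hn
  have hu : ∀ᵐ u ∂(volume.restrict (Set.Icc (-Real.log 2) 0)), u ∈ Set.Icc (-Real.log 2) 0 :=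
    ae_restrict_mem measurableSet_Icc
  filter_upwards [H.ae_eventually_gsum_ne_zero hr (s := j / n) (ε := 1 / n) (by positivity)
    (by positivity) hj, hu] with u hu hu'
  filter_upwards [hu, eventually_ge_atTop 1] with k hk hk1 m hm
  have hM1 : (2 : ℝ) ≤ (2 : ℝ) ^ k := by
    calc (2 : ℝ) = 2 ^ 1 := by norm_num
      _ ≤ _ := pow_le_pow_right₀ (by norm_num) hk1
  have hM0 : (0 : ℝ) < (2 : ℝ) ^ k := by positivity
  have key := hk m hm
  set M := (2 : ℝ) ^ k with hM
  have hδ1 : M ^ (-(j / n : ℝ)) ≤ 1 :=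
    Real.rpow_le_one_of_one_le_of_nonpos (by linarith) (by simp; positivity)
  have hδ0 : 0 < M ^ (-(j / n : ℝ)) := by positivity
  set δ := M ^ (-(j / n : ℝ)) with hδ
  obtain ⟨x, hx, hx'⟩ := exists_mem_puncturedBall_of_gsum_ne_zero hα (M := 2 ^ k)
    (by positivity) (by
      push_cast
      rw [← hM, abs_mul, abs_of_pos hδ0]
      have : |(m : ℝ)| ≤ M ^ (1 : ℝ) := hm.trans (Real.rpow_le_rpow_of_exponent_le (by linarith) (by
        have : 0 ≤ 1 / (n : ℝ) := by positivity
        have : 0 ≤ r * (j / n : ℝ) := by positivity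
        linarith))
      rw [Real.rpow_one] at this
      calc |(m : ℝ)| * δ ≤ M * 1 := by gcongr
        _ ≤ _ := by nlinarith) (by
      rw [le_div_iff₀ hδ0]; nlinarith) hu'.2 key
  push_cast at hx hx'
  refine ⟨x, hx, hx'.trans (le_of_eq ?_)⟩
  rw [← hM]
  field_simp

theorem exists_abs_diagForm_eq_one (α₂ α₃ : ℝ) {N : ℝ} (hN : 1 < N) :
    ∃ x ∈ puncturedBall N, |diagForm α₂ α₃ x| = 1 := by
  refine ⟨![1, 0, 0], ⟨fun h => by simpa using congrFun h 0, ?_⟩, by simp [diagForm]⟩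
  simpa [EuclideanSpace.norm_eq, Fin.sum_univ_three] using hN

/-- On the remaining bounded range of `N` the vector `(1, 0, 0)`, where the form equals `1`, is good
enough after enlarging the constant. -/
theorem MinValueBound.of_eventually {α₂ α₃ c C : ℝ}
    (H : ∀ᶠ N : ℝ in atTop, ∃ x ∈ puncturedBall N, |diagForm α₂ α₃ x| ≤ C * N ^ c) :
    MinValueBound α₂ α₃ c := by
  obtain ⟨N₀, hN₀⟩ := eventually_atTop.mp (H.and (eventually_ge_atTop 1))
  have h1 : 1 ≤ N₀ := (hN₀ N₀ le_rfl).2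
  refine ⟨max C (N₀ ^ |c|), fun N hN => ?_⟩
  rcases le_total N₀ N with h | h
  · obtain ⟨x, hx, hx'⟩ := (hN₀ N h).1
    exact ⟨x, hx, hx'.trans (by gcongr; exact le_max_left _ _)⟩
  · obtain ⟨x, hx, hx'⟩ := exists_abs_diagForm_eq_one α₂ α₃ hN
    refine ⟨x, hx, ?_⟩
    have hN0 : 0 < N := by linarith
    calc |diagForm α₂ α₃ x| = N ^ (0 : ℝ) := by rw [hx', Real.rpow_zero]
      _ ≤ N ^ (|c| + c) := Real.rpow_le_rpow_of_exponent_le hN.le (by linarith [neg_abs_le c])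
      _ = N ^ |c| * N ^ c := Real.rpow_add hN0 _ _
      _ ≤ max C (N₀ ^ |c|) * N ^ c := by
          gcongr
          exact le_trans (by gcongr) (le_max_right _ _)

theorem GridSolvable.minValueBound {α₂ α₃ e r : ℝ} (he : 0 < e) (hr : 0 < r)
    (H : GridSolvable α₂ α₃ e r) {ε : ℝ} (hε : 0 < ε) : MinValueBound α₂ α₃ (-(e / r) + ε) := by
  have her : 0 < e / r := by positivity
  obtain ⟨n, hn⟩ := exists_nat_gt (2 / min ε (e / r))
  have hn0 : (0 : ℝ) < n := lt_trans (by positivity) hn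
  have hn1 : 2 / (n : ℝ) < min ε (e / r) := by
    rw [div_lt_iff₀ (by positivity), mul_comm] at hn
    rwa [div_lt_iff₀ hn0]
  have hnε : 2 / (n : ℝ) < ε := hn1.trans_le (min_le_left _ _)
  have hnr : 2 / (n : ℝ) < e / r := hn1.trans_le (min_le_right _ _)
  -- The largest admissible precision exponent with denominator `n`; it misses `e/r` by at most `2/n
  -- < ε`.
  set j := ⌊n * (e / r - 1 / n)⌋₊ with hj
  have hn2 : 2 / (n : ℝ) = 1 / n + 1 / n := by ring
  have hn3 : 0 < 1 / (n : ℝ) := by positivity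
  have hj1 : (j : ℝ) / n ≤ e / r - 1 / n := by
    rw [div_le_iff₀ hn0, mul_comm]
    exact Nat.floor_le (by apply mul_nonneg hn0.le; linarith)
  have hj2 : e / r - 2 / n ≤ (j : ℝ) / n := by
    rw [le_div_iff₀ hn0]
    have := (Nat.lt_floor_add_one (n * (e / r - 1 / n))).le
    rw [← hj] at this
    have h3 : (e / r - 2 / n) * n = n * (e / r - 1 / n) - 1 := by field_simp; ring
    linarith
  obtain ⟨k₀, hk₀⟩ := eventually_atTop.mp (H n j (by exact_mod_cast hn0) hj1)
  refine MinValueBound.of_eventually (C := 27 * 8 ^ (j / n : ℝ)) ?_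
  filter_upwards [eventually_ge_atTop (4 * (2 : ℝ) ^ k₀), eventually_ge_atTop 1] with N hN hN1
  obtain ⟨k, hk, hk1, hk2⟩ := exists_dyadic hN
  obtain ⟨x, hx, hx'⟩ := hk₀ k hk 0 (by simp; positivity)
  refine ⟨x, puncturedBall_mono hk1 hx, ?_⟩
  rw [Int.cast_zero, zero_mul, sub_zero] at hx'
  refine hx'.trans ?_
  have hM0 : (0 : ℝ) < 2 ^ k := by positivity
  have : ((2 : ℝ) ^ k) ^ (-(j / n : ℝ)) ≤ 8 ^ (j / n : ℝ) * N ^ (-(j / n : ℝ)) := by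
    rw [Real.rpow_neg hM0.le, Real.rpow_neg (by linarith), inv_le_iff_one_le_mul₀ (by positivity)]
    calc (1 : ℝ) = N ^ (j / n : ℝ) * (N ^ (j / n : ℝ))⁻¹ := by
          rw [mul_inv_cancel₀]; positivity
      _ ≤ (8 * 2 ^ k) ^ (j / n : ℝ) * (N ^ (j / n : ℝ))⁻¹ := by gcongr
      _ = _ := by rw [Real.mul_rpow (by norm_num) hM0.le]; ring
  calc _ ≤ 27 * (8 ^ (j / n : ℝ) * N ^ (-(j / n : ℝ))) := by gcongr
    _ ≤ 27 * (8 ^ (j / n : ℝ) * N ^ (-(e / r) + ε)) := by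
        gcongr
        linarith
    _ = _ := by ring

/-- The value `δ(N)` is replaced by the coarsest precision `M^(-j/n)` below `δ(N)/28`, and `ξ` by
the nearest multiple of it: the grid solution is within `27` units of the multiple, rounding costs
at most one more. The hypothesis on `A` and `δ` says that the multiples needed are among those
allowed. -/
theorem GridSolvable.eventually_oppenheimBound {α₂ α₃ e r : ℝ} (he : 0 < e) (hr : 0 < r)
    (H : GridSolvable α₂ α₃ e r) {ε : ℝ} (hε : 0 < ε) {A δ : ℝ → ℝ}
    (hA : Tendsto A atTop atTop) (hδ : Tendsto δ atTop (𝓝[>] 0)) {C : ℝ}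
    (hAδ : ∀ᶠ N in atTop, A N ≤ C * N ^ (e - ε) * δ N ^ (1 + r)) :
    ∀ᶠ N in atTop, OppenheimBound α₂ α₃ N (A N) (δ N) := by
  have hρ : 0 < e / r - e / (1 + r) := by
    rw [sub_pos]; gcongr; linarith
  -- With `σ = 1/n`, rounding the precision costs `(1 + r)σ`, absorbing constants `σ`, and the slack
  -- in the grid statement another `σ`; `(3 + r)σ` covers all. The gap `e/r - e/(1+r)` is there
  -- because the hypothesis forces `δ` to stay above roughly `M^(-e/(1+r))`.
  obtain ⟨n, hn⟩ := exists_nat_gt ((3 + r) / min ε (e / r - e / (1 + r)))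
  have hn0 : (0 : ℝ) < n := lt_trans (by positivity) hn
  have hn1 : (3 + r) / (n : ℝ) < min ε (e / r - e / (1 + r)) := by
    rw [div_lt_iff₀ (by positivity), mul_comm] at hn
    rwa [div_lt_iff₀ hn0]
  set σ := 1 / (n : ℝ) with hσ
  have hσ0 : 0 < σ := by positivity
  have hσ1 : (3 + r) / (n : ℝ) = (3 + r) * σ := by rw [hσ]; ring
  rw [hσ1] at hn1
  have hσε : (3 + r) * σ < ε := hn1.trans_le (min_le_left _ _)
  have hσr : (3 + r) * σ < e / r - e / (1 + r) := hn1.trans_le (min_le_right _ _)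
  have hσr0 : 0 < r * σ := by positivity
  have hJ : ∀ᶠ k : ℕ in atTop, ∀ j ∈ {j : ℕ | (j : ℝ) / n ≤ e / r - 1 / n}, ∀ m : ℤ,
      |(m : ℝ)| ≤ ((2 : ℝ) ^ k) ^ (e - 1 / n - r * (j / n)) →
      ∃ x ∈ puncturedBall (4 * 2 ^ k), |diagForm α₂ α₃ x - m * ((2 : ℝ) ^ k) ^ (-(j / n : ℝ))| ≤
        27 * ((2 : ℝ) ^ k) ^ (-(j / n : ℝ)) := by
    -- The exponent `j` will depend on `N`, so a threshold uniform in `j` is required; finiteness of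
    -- the admissible set provides it.
    have hfin : {j : ℕ | (j : ℝ) / n ≤ e / r - 1 / n}.Finite := by
      refine (Set.finite_Iic ⌊(e / r - 1 / n) * n⌋₊).subset fun j hj => ?_
      exact Nat.le_floor ((div_le_iff₀ hn0).mp hj)
    exact (eventually_all_finite hfin).mpr fun j hj => H n j (by exact_mod_cast hn0) hj
  set D := 2 * (|C| * 8 ^ |e - ε| * 28 ^ (1 + r)) + 1 with hD
  have hlarge : ∀ᶠ k : ℕ in atTop, D ≤ ((2 : ℝ) ^ k) ^ σ :=
    ((tendsto_rpow_atTop hσ0).comp (tendsto_pow_atTop_atTop_of_one_lt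
      (by norm_num : (1 : ℝ) < 2))).eventually_ge_atTop D
  obtain ⟨k₀, hk₀⟩ := eventually_atTop.mp (hJ.and (hlarge.and (eventually_ge_atTop 1)))
  have hδ' := tendsto_nhdsWithin_iff.mp hδ
  filter_upwards [eventually_ge_atTop (4 * (2 : ℝ) ^ k₀), hA.eventually_ge_atTop 1, hδ'.2,
    hδ'.1.eventually_lt_const (show (0 : ℝ) < 1 by norm_num), hAδ] with N hN hA1 hδ0 hδ1 hAN
  obtain ⟨k, hk, hk1, hk2⟩ := exists_dyadic hN
  obtain ⟨hgrid, hDk, hk1'⟩ := hk₀ k hk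
  rw [Set.mem_Ioi] at hδ0
  have hM2 : (2 : ℝ) ≤ (2 : ℝ) ^ k := by
    calc (2 : ℝ) = 2 ^ 1 := by norm_num
      _ ≤ _ := pow_le_pow_right₀ (by norm_num) hk1'
  set M := (2 : ℝ) ^ k with hM
  have hM0 : 0 < M := by linarith
  have hM1 : 1 ≤ M := by linarith
  generalize A N = a at *
  generalize δ N = d at *
  -- the upper bound for `a` in terms of `M`
  set C' := |C| * 8 ^ |e - ε| with hC'
  have hC'0 : 0 ≤ C' := by positivity
  have ha : a ≤ C' * M ^ (e - ε) * d ^ (1 + r) := by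
    calc a ≤ |C| * N ^ (e - ε) * d ^ (1 + r) := hAN.trans (by
          have : 0 ≤ N := by linarith
          gcongr; exact le_abs_self C)
      _ ≤ |C| * (8 ^ |e - ε| * M ^ (e - ε)) * d ^ (1 + r) := by
          gcongr
          exact rpow_le_mul_rpow_of_le hM0 (by linarith) hk2
      _ = _ := by ring
  -- the choice of the precision
  have hex : ∃ j : ℕ, 28 * M ^ (-(j / n : ℝ)) < d := by
    have hq : (M ^ (-σ)) < 1 := Real.rpow_lt_one_of_one_lt_of_neg (by linarith) (by linarith)
    obtain ⟨j, hj⟩ := exists_pow_lt_of_lt_one (show 0 < d / 28 by positivity) hq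
    refine ⟨j, ?_⟩
    rw [← Real.rpow_natCast, ← Real.rpow_mul hM0.le] at hj
    rw [show -(j / n : ℝ) = -σ * j by rw [hσ]; ring]
    linarith
  classical
  -- Minimality of `j` makes the precision comparable to `d` up to `M^σ`. The minimal `j` is not
  -- `0`, because `d < 1 < 28`.
  obtain ⟨j, hj, hjmin⟩ : ∃ j : ℕ, 28 * M ^ (-(j / n : ℝ)) < d ∧
      d ≤ 28 * M ^ σ * M ^ (-(j / n : ℝ)) := by
    refine ⟨Nat.find hex, Nat.find_spec hex, ?_⟩
    have h0 : Nat.find hex ≠ 0 := by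
      intro h0
      have := Nat.find_spec hex
      rw [h0] at this
      norm_num at this
      linarith
    have := not_lt.mp (Nat.find_min hex (Nat.sub_one_lt h0))
    refine this.trans (le_of_eq ?_)
    rw [mul_assoc, ← Real.rpow_add hM0, Nat.cast_sub (Nat.one_le_iff_ne_zero.mpr h0), hσ]
    congr 2
    push_cast
    ring
  set δj := M ^ (-(j / n : ℝ)) with hδj
  have hδj0 : 0 < δj := by positivity
  have hA' : a ≤ C' * 28 ^ (1 + r) * (M ^ (e - ε + (1 + r) * σ) * δj ^ (1 + r)) := by
    calc a ≤ C' * M ^ (e - ε) * (28 * M ^ σ * δj) ^ (1 + r) := ha.trans (by gcongr)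
      _ = C' * 28 ^ (1 + r) * ((M ^ (e - ε) * M ^ (σ * (1 + r))) * δj ^ (1 + r)) := by
          rw [Real.mul_rpow (by positivity) hδj0.le, Real.mul_rpow (by norm_num) (by positivity),
            ← Real.rpow_mul hM0.le]; ring
      _ = _ := by rw [← Real.rpow_add hM0, mul_comm σ]
  have hA'' : 2 * a ≤ M ^ (e - ε + (1 + r) * σ + σ) * δj ^ (1 + r) := by
    calc 2 * a ≤ (2 * (C' * 28 ^ (1 + r))) * (M ^ (e - ε + (1 + r) * σ) * δj ^ (1 + r)) := by
          linarith
      _ ≤ M ^ σ * (M ^ (e - ε + (1 + r) * σ) * δj ^ (1 + r)) := by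
          gcongr
          exact le_trans (by rw [hD]; linarith) hDk
      _ = _ := by rw [Real.rpow_add hM0 _ σ]; ring
  -- As `a ≥ 1`, the upper bound for `2a` cannot have a negative exponent of `M`; hence `j/n ≤
  -- e/(1+r)`, which is below `e/r` by more than `σ`.
  have hjmem : (j : ℝ) / n ≤ e / r - 1 / n := by
    have h1 : M ^ (0 : ℝ) ≤ M ^ (e - ε + (1 + r) * σ + σ + -(j / n) * (1 + r)) := by
      rw [Real.rpow_add hM0, Real.rpow_mul hM0.le, ← hδj, Real.rpow_zero]
      linarith
    have h2 := (Real.rpow_le_rpow_left_iff (by linarith : (1 : ℝ) < M)).mp h1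
    have h3 : (j / n : ℝ) ≤ e / (1 + r) := by
      rw [le_div_iff₀ (by linarith)]; linarith
    rw [← hσ]
    linarith
  refine ⟨28 * δj, hj, fun ξ hξ => ?_⟩
  have hround : |ξ / δj - round (ξ / δj)| ≤ 1 / 2 := abs_sub_round _
  set m := round (ξ / δj) with hm
  have hδj1 : δj ≤ 1 := by linarith
  have hmb : |(m : ℝ)| ≤ M ^ (e - 1 / n - r * (j / n)) := by
    have h1 : |(m : ℝ)| ≤ |ξ / δj| + 1 / 2 := by
      calc |(m : ℝ)| = |ξ / δj - (ξ / δj - m)| := by ring_nf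
        _ ≤ |ξ / δj| + |ξ / δj - m| := abs_sub _ _
        _ ≤ _ := by gcongr
    have h2 : |ξ / δj| ≤ a / δj := by
      rw [abs_div, abs_of_pos hδj0]; gcongr
    have h3 : 1 ≤ a / δj := by rw [le_div_iff₀ hδj0]; linarith
    calc |(m : ℝ)| ≤ 2 * a / δj := by rw [mul_div_assoc]; linarith
      _ ≤ M ^ (e - ε + (1 + r) * σ + σ) * δj ^ (1 + r) / δj := by gcongr
      _ = M ^ (e - ε + (1 + r) * σ + σ) * δj ^ r := by
          rw [Real.rpow_add hδj0, Real.rpow_one]; field_simp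
      _ = M ^ (e - ε + (1 + r) * σ + σ + -(j / n) * r) := by
          rw [Real.rpow_add hM0 _ (-(j / n : ℝ) * r), Real.rpow_mul hM0.le, ← hδj]
      _ ≤ _ := Real.rpow_le_rpow_of_exponent_le hM1 (by rw [← hσ]; linarith)
  obtain ⟨x, hx, hx'⟩ := hgrid j hjmem m hmb
  refine ⟨x, puncturedBall_mono hk1 hx, ?_⟩
  have h4 : |m * δj - ξ| ≤ δj := by
    have : m * δj - ξ = -(ξ / δj - m) * δj := by field_simp; ring
    rw [this, abs_mul, abs_neg, abs_of_pos hδj0]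
    nlinarith
  calc |diagForm α₂ α₃ x - ξ| = |(diagForm α₂ α₃ x - m * δj) + (m * δj - ξ)| := by ring_nf
    _ ≤ |diagForm α₂ α₃ x - m * δj| + |m * δj - ξ| := abs_add_le _ _
    _ ≤ 27 * δj + δj := by gcongr
    _ = _ := by ring

/-! ### Assembly of the theorem -/

/-- The exponential is differentiable, so it maps null sets to null sets, and it carries `[-log 2,
0]` onto `[1/2, 1]`. -/
theorem ae_restrict_Icc_of_ae_exp {p : ℝ → Prop}
    (H : ∀ᵐ u ∂(volume.restrict (Set.Icc (-Real.log 2) 0)), p (Real.exp u)) :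
    ∀ᵐ a ∂(volume.restrict (Set.Icc (1 / 2 : ℝ) 1)), p a := by
  rw [ae_restrict_iff' measurableSet_Icc, ae_iff] at H ⊢
  refine measure_mono_null (fun a ha => ?_)
    (addHaar_image_eq_zero_of_differentiableOn_of_addHaar_eq_zero volume
      Real.differentiable_exp.differentiableOn H)
  simp only [Set.mem_ofPred_eq, Classical.not_imp] at ha
  have ha0 : 0 < a := by linarith [ha.1.1]
  refine ⟨Real.log a, ?_, Real.exp_log ha0⟩
  simp only [Set.mem_ofPred_eq, Classical.not_imp, Real.exp_log ha0]
  refine ⟨⟨?_, Real.log_nonpos ha0.le ha.1.2⟩, ha.2⟩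
  rw [← Real.log_inv]
  exact Real.log_le_log (by norm_num) (by linarith [ha.1.1])

theorem eventually_le_of_isBigO {A δ : ℝ → ℝ} {ε : ℝ} (hδ : Tendsto δ atTop (𝓝[>] 0))
    (h : (fun N : ℝ => A N * δ N ^ (-2 : ℝ)) =O[atTop] (fun N : ℝ => N ^ (1 - ε))) :
    ∃ C : ℝ, ∀ᶠ N in atTop, A N ≤ C * N ^ (1 - ε) * δ N ^ (1 + 1 : ℝ) := by
  obtain ⟨C, hC⟩ := h.bound
  refine ⟨C, ?_⟩
  filter_upwards [hC, (tendsto_nhdsWithin_iff.mp hδ).2, eventually_gt_atTop 0] with N hN hδ0 hN0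
  rw [Set.mem_Ioi] at hδ0
  rw [Real.norm_of_nonneg (Real.rpow_nonneg hN0.le _), Real.norm_eq_abs] at hN
  calc A N = A N * δ N ^ (-2 : ℝ) * δ N ^ (1 + 1 : ℝ) := by
        rw [mul_assoc, ← Real.rpow_add hδ0]; norm_num
    _ ≤ C * N ^ (1 - ε) * δ N ^ (1 + 1 : ℝ) := by
        gcongr ?_ * _
        exact (le_abs_self _).trans hN

/-- A cube root puts the hypothesis in the form of `GridSolvable.eventually_oppenheimBound` with `e
= 1/3` and `r = 5/6`, as `11/6 = 1 + r`; the loss `ε` becomes `ε/3`. -/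
theorem eventually_le_of_cube_isBigO {A δ : ℝ → ℝ} {ε : ℝ} (hA : Tendsto A atTop atTop)
    (hδ : Tendsto δ atTop (𝓝[>] 0))
    (h : (fun N : ℝ => A N ^ 3 * δ N ^ (-(11 / 2) : ℝ)) =O[atTop] (fun N : ℝ => N ^ (1 - ε))) :
    ∃ C : ℝ, ∀ᶠ N in atTop, A N ≤ C * N ^ (1 / 3 - ε / 3) * δ N ^ (1 + 5 / 6 : ℝ) := by
  obtain ⟨C, hC0, hC⟩ := h.exists_pos
  refine ⟨C ^ (1 / 3 : ℝ), ?_⟩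
  filter_upwards [hC.bound, (tendsto_nhdsWithin_iff.mp hδ).2, eventually_gt_atTop 0,
    hA.eventually_ge_atTop 0] with N hN hδ0 hN0 hA0
  rw [Set.mem_Ioi] at hδ0
  rw [Real.norm_of_nonneg (Real.rpow_nonneg hN0.le _), Real.norm_eq_abs] at hN
  have h3 : A N ^ 3 ≤ C * N ^ (1 - ε) * δ N ^ (11 / 2 : ℝ) := by
    calc A N ^ 3 = A N ^ 3 * δ N ^ (-(11 / 2) : ℝ) * δ N ^ (11 / 2 : ℝ) := by
          rw [mul_assoc, ← Real.rpow_add hδ0]; norm_num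
      _ ≤ _ := by
          gcongr ?_ * _
          exact (le_abs_self _).trans hN
  calc A N = (A N ^ 3) ^ (1 / 3 : ℝ) := by
        rw [← Real.rpow_natCast, ← Real.rpow_mul hA0]; norm_num
    _ ≤ (C * N ^ (1 - ε) * δ N ^ (11 / 2 : ℝ)) ^ (1 / 3 : ℝ) := by gcongr
    _ = C ^ (1 / 3 : ℝ) * N ^ (1 / 3 - ε / 3) * δ N ^ (1 + 5 / 6 : ℝ) := by
        rw [Real.mul_rpow (by positivity) (by positivity), Real.mul_rpow hC0.le (by positivity),
          ← Real.rpow_mul hN0.le, ← Real.rpow_mul hδ0.le]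
        congr 3
        · ring
        · norm_num

theorem mainTheorem1 (α₂ : ℝ) (hα₂ : 0 < α₂) :
    ∀ᵐ α₃ : ℝ ∂(volume.restrict (Set.Icc (1 / 2 : ℝ) 1)),
      (LindelofHypothesis →
        (∀ ε : ℝ, 0 < ε → MinValueBound α₂ α₃ (-1 + ε)) ∧
        (∀ ε : ℝ, 0 < ε → ∀ A δ : ℝ → ℝ,
          Tendsto A atTop atTop → Tendsto δ atTop (𝓝[>] 0) →
          (fun N : ℝ => A N * δ N ^ (-2 : ℝ)) =O[atTop] (fun N : ℝ => N ^ (1 - ε)) →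
          ∀ᶠ N in atTop, OppenheimBound α₂ α₃ N (A N) (δ N))) ∧
      ((∀ ε : ℝ, 0 < ε → MinValueBound α₂ α₃ (-(2 / 5) + ε)) ∧
        (∀ ε : ℝ, 0 < ε → ∀ A δ : ℝ → ℝ,
          Tendsto A atTop atTop → Tendsto δ atTop (𝓝[>] 0) →
          (fun N : ℝ => A N ^ 3 * δ N ^ (-(11 / 2) : ℝ)) =O[atTop] (fun N : ℝ => N ^ (1 - ε)) →
          ∀ᶠ N in atTop, OppenheimBound α₂ α₃ N (A N) (δ N))) := by
  -- Restricting `x₂` to `[1, M/h]` keeps `α₂x₂² ≤ M²/10`, so that the values of the binary form are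
  -- comparable to `x₁²` whatever `α₂` is.
  obtain ⟨h, hh⟩ := exists_nat_gt (10 * α₂)
  have hh0 : 0 < h := by
    have : (0 : ℝ) < h := lt_trans (by positivity) hh
    exact_mod_cast this
  have hαh : 10 * α₂ ≤ (h : ℝ) ^ 2 := by
    have : (1 : ℝ) ≤ h := by exact_mod_cast hh0
    nlinarith
  -- The hypothesis stands inside the almost everywhere quantifier, so the null set must be fixed
  -- first; a case distinction on the hypothesis does this.
  have hLH : ∀ᵐ α₃ : ℝ ∂(volume.restrict (Set.Icc (1 / 2 : ℝ) 1)),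
      LindelofHypothesis → GridSolvable α₂ α₃ 1 1 := by
    by_cases hL : LindelofHypothesis
    · filter_upwards [ae_restrict_Icc_of_ae_exp
        (p := fun a => GridSolvable α₂ a 1 1) ((hL.badSetBound hα₂ hh0 hαh).ae_gridSolvable
        hα₂ le_rfl one_pos)] with α₃ H _ using H
    · exact Eventually.of_forall fun _ h => absurd h hL
  filter_upwards [hLH, ae_restrict_Icc_of_ae_exp
    (p := fun a => GridSolvable α₂ a (1 / 3) (5 / 6)) ((badSetBound hα₂ hh0 hαh).ae_gridSolvable
    hα₂ (by norm_num) (by norm_num))] with α₃ H₁ H₂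
  refine ⟨fun hL => ⟨fun ε hε => ?_, fun ε hε A δ hA hδ hO => ?_⟩,
    fun ε hε => ?_, fun ε hε A δ hA hδ hO => ?_⟩
  · simpa using (H₁ hL).minValueBound one_pos one_pos hε
  · obtain ⟨C, hC⟩ := eventually_le_of_isBigO hδ hO
    exact (H₁ hL).eventually_oppenheimBound one_pos one_pos hε hA hδ hC
  · have := H₂.minValueBound (by norm_num) (by norm_num) hε
    norm_num at this ⊢
    exact this
  · obtain ⟨C, hC⟩ := eventually_le_of_cube_isBigO hA hδ hO
    exact H₂.eventually_oppenheimBound (by norm_num) (by norm_num) (by positivity) hA hδ hC
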